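/- **Setting (double semion model).** Consider the hexagonal lattice in $\mathbb R^2$ with edges of length one, and let $\Gamma$ be the set of its edges, each located at its midpoint. Let $\mathcal A$ be the quasi-local $C^*$-algebra generated by Pauli matrices $\sigma^X_e,\sigma^Z_e$, one copy of $M_2(\mathbb C)$ for each $e\in\Gamma$; for $Y\subset\Gamma$ (or $Y\subset\mathbb R^2$, meaning the edges with midpoint in $Y$), $\mathcal A_{Y,\mathrm{loc}}$ is the $*$-algebra generated by the Pauli matrices at sites of $Y$ and $\mathcal A_Y$ is its norm closure. An edge is occupied by a string if $\sigma^Z_e=-1$. For a finite set $F$ of hexagons let $|\partial F\rangle$ be the product vector in which exactly the edges of $\partial F$ are occupied, and let $\sharp\partial F$ be the number of connected components (closed loops) of $\partial F$. Let $\Pi_n$ be the hexagonal patch consisting of a fixed hexagon and the $n-1$ rings of hexagons around it, and let $\omega_n$ be the vector state given by $$\Omega_n=2^{-|\Pi_n|/2}\sum_{F\subset\Pi_n}(-1)^{\sharp\partial F}\,|\partial F\rangle .$$ The double semion state $\omega$ is the weak-* limit of $(\omega_n)$; let $(\pi_1,\mathcal H,\Omega)$ be its GNS triple and $\mathcal R(Y)=\pi_1(\mathcal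 A_Y)''$. **String operators.** Let $P$ be a finite oriented path that uses no edge twice. At each vertex between consecutive edges of $P$ there is a third edge; if it lies to the right of $P$ it is called an R-leg, and if it lies to the left the vertex is called an L-vertex. Put $W_1[P]=1$, $W_B[P]=\prod_{\text{R-legs }j}\sigma^Z_j$ and $$W_S[P]=\prod_{j\in P}\sigma^X_j\prod_{\text{R-legs }j} i^{(1-\sigma^Z_j)/2}\prod_{\text{L-vertices }v}(-1)^{s_v},\qquad s_v=\tfrac14(1-\sigma^Z_j)(1+\sigma^Z_k),$$ where $j,k$ are the edges of $P$ going in and out of $v$; $W_{\bar S}[P]$ is the same with $-i$ in place of $i$. For $a\in\{1,S,\bar S,B\}$ and a half-infinite path $P$, $w_a[P]$ is the automorphism of $\mathcal A$ given by $w_a[P](O)=\lim_n W_a[P_n]\,O\,W_a[P_n]^*$ (norm limit), where $P_n$ consists of the $n$ edges of $P$ next to its endpoint. An automorphism is supported in $Y$ if it is the identity on $\mathcal A_{Y^c}$. **Cones.** A cone is a set $\Lambda=\{x\in\mathbb R^2: (x-p)\cdot\hat v>\|x-p\|\cos(\theta/2)\}$ with apex $p$, unit axis $\hat v$ and opening angle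 $\theta\in(0,2\pi)$. Let $\Lambda^{(R)}$ be its right half (with apex $p$, opening angle $\theta/2$, and left leg the axis of $\Lambda$) and let $\Pi$ be the set of open hexagons that meet $\Lambda^{(R)}$. Orient $\partial\Pi$ counterclockwise (with $\Pi$ on its left). For $r>2$ large enough, the edges of $\partial\Pi$ with midpoint at distance more than $r$ from $p$ form two half-infinite paths, one coming in from infinity along the left leg of $\Lambda^{(R)}$ and one going out to infinity along its right leg; call the incoming one $P_\Lambda$, and let $r$ also be so large that $w_a[P_\Lambda]$ is supported in $\Lambda$ for all $a$. Put $w_{a,\Lambda}=w_a[P_\Lambda]$. **Proposition.** Let $\Lambda_1,\Lambda_2$ be cones contained in a cone $\Lambda$, let $a\in\{1,S,\bar S,B\}$, and let $P_{\Lambda_1},P_{\Lambda_2}$ be obtained as above from any admissible choice of the radii. The limit state $\omega$ and the automorphisms $w_{a,\Lambda_1},w_{a,\Lambda_2}$ exist, and $\pi_1\circ w_{a,\Lambda_1}\simeq\pi_1\circ w_{a,\Lambda_2}$ (unitary equivalence). Moreover, every unitary $U$ on $\mathcal H$ with $U\,\pi_1(w_{a,\Lambda_1}(O))\,U^*=\pi_1(w_{a,\Lambda_2}(O))$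 for all $O\in\mathcal A$ belongs to the von Neumann algebra $\mathcal R(\Lambda)$, and it is a weak limit of products of local closed-string unitaries: there are finite closed paths $Q_n,Q_n'$ with $W_a[Q_n],W_a[Q'_n]\in\mathcal A_{\Lambda,\mathrm{loc}}$, unitaries $T,T'\in\mathcal A_{\Lambda,\mathrm{loc}}$ not depending on $n$, and phases $z_n$ such that $$z_n\,\pi_1\big(T'\,W_a[Q_n']\,W_a[Q_n]^*\,T\big)\longrightarrow U$$ in the weak operator topology. -/

import Mathlib

open Filter Topology
open scoped InnerProductSpace

noncomputable section

namespace DoubleSemion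

/-! ### The hexagonal lattice

Hexagons are labelled by `ℤ × ℤ`; each hexagon has six neighbours, at angles `0°, 60°, …, 300°`. -/

/-- Hexagons of the lattice. -/
abbrev Face : Type := ℤ × ℤ

/-- The displacement from a hexagon to its `k`-th neighbour, which lies at angle `60 k` degrees. -/
def dirVec : Fin 6 → ℤ × ℤ :=
  ![(1, 0), (0, 1), (-1, 1), (-1, 0), (0, -1), (1, -1)]

/-- Edges of the hexagonal lattice, i.e. the sites of the model: `(f, k)` is the edge shared by
the hexagons `f` and `f + dirVec k`, for `k = 0, 1, 2`. -/
abbrev Edge : Type := (ℤ × ℤ) × Fin 3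

/-- The first of the two hexagons which share an edge. -/
def Edge.face₁ (e : Edge) : Face := e.1

/-- The second of the two hexagons which share an edge. -/
def Edge.face₂ (e : Edge) : Face := e.1 + dirVec (Fin.castLE (by norm_num) e.2)

/-- An oriented edge, given by the hexagon on its left and the direction `dir` from that hexagon
to the hexagon on its right. It runs counterclockwise around the hexagon `left`. -/
@[ext]
structure Dart where
  left : Face
  dir : Fin 6
deriving DecidableEq

namespace Dart

/-- The hexagon on the right of an oriented edge. -/
def right (d : Dart) : Face := d.left + dirVec d.dir

/-- The underlying unoriented edge. -/
def edge (d : Dart) : Edge :=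
  (if d.dir.val < 3 then d.left else d.right, ⟨d.dir.val % 3, Nat.mod_lt _ (by norm_num)⟩)

/-- The oriented edge reached by turning left at the final vertex of `d`. -/
def turnLeft (d : Dart) : Dart := ⟨d.left, d.dir + 1⟩

/-- The oriented edge reached by turning right at the final vertex of `d`; the hexagon on its left
is the one straight ahead of `d`. -/
def turnRight (d : Dart) : Dart := ⟨d.left + dirVec (d.dir + 1), d.dir - 1⟩

/-- `d'` can follow `d` in an oriented path: `d'` starts at the final vertex of `d` and is not `d`
reversed. -/
def Follows (d d' : Dart) : Prop := d' = d.turnLeft ∨ d' = d.turnRight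

end Dart

/-- Two edges are adjacent when they are distinct and share a vertex. -/
def edgeGraph : SimpleGraph Edge :=
  SimpleGraph.fromRel fun e e' => ∃ d d' : Dart, d.edge = e ∧ d'.edge = e' ∧ d.Follows d'

/-! ### Geometry of the lattice in the plane `ℝ² = ℂ` (edges have length one) -/

/-- The centre of a hexagon. -/
def center (f : Face) : ℂ :=
  ⟨Real.sqrt 3 * ((f.1 : ℝ) + (f.2 : ℝ) / 2), 3 / 2 * (f.2 : ℝ)⟩

/-- The open hexagon: the points closer to its centre than to the centres of its neighbours. -/
def hexagon (f : Face) : Set ℂ :=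
  {x | ∀ k : Fin 6, dist x (center f) < dist x (center (f + dirVec k))}

/-- The midpoint of an edge. -/
def Edge.mid (e : Edge) : ℂ := midpoint ℝ (center e.face₁) (center e.face₂)

/-- The set of sites (edges) whose midpoint lies in a region of the plane. -/
def sites (S : Set ℂ) : Set Edge := {e | e.mid ∈ S}

/-- The hexagons which overlap a region of the plane. -/
def overlapping (S : Set ℂ) : Set Face := {f | (hexagon f ∩ S).Nonempty}

/-- The boundary of a set of hexagons, oriented counterclockwise: the set lies on the left. -/
def boundaryDarts (F : Set Face) : Set Dart := {d | d.left ∈ F ∧ d.right ∉ F}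

/-- A cone, given by its apex, its axis and its opening angle. -/
structure Cone where
  apex : ℂ
  axis : ℂ
  angle : ℝ
  norm_axis : ‖axis‖ = 1
  angle_pos : 0 < angle
  angle_lt : angle < 2 * Real.pi

namespace Cone

/-- The points of a cone. -/
def region (Λ : Cone) : Set ℂ :=
  {x | ‖x - Λ.apex‖ * Real.cos (Λ.angle / 2) < ⟪x - Λ.apex, Λ.axis⟫_ℝ}

/-- The right half of a cone, as seen when looking from the apex along the axis. Its left leg is
the axis of `Λ`. -/
def rightHalf (Λ : Cone) : Cone where
  apex := Λ.apex
  axis := Λ.axis * Complex.exp ((-(Λ.angle / 4) : ℝ) * Complex.I)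
  angle := Λ.angle / 2
  norm_axis := by rw [norm_mul, Λ.norm_axis, Complex.norm_exp_ofReal_mul_I, one_mul]
  angle_pos := by have := Λ.angle_pos; linarith
  angle_lt := by have := Λ.angle_lt; have := Λ.angle_pos; linarith

end Cone

/-! ### The algebra of quasi-local observables

A spin configuration with finitely many strings is the finite set of edges occupied by strings.
The Hilbert space `ℓ²` over these configurations is the incomplete infinite tensor product of the
`ℂ²`'s along the string-free product vector, and the quasi-local algebra acts faithfully on it: the
observables of a finite set of sites are generated by the Pauli matrices at these sites and form
a full matrix algebra, and the quasi-local algebra is the norm closure of all of them. -/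

/-- The Hilbert space spanned by the finite string configurations. -/
abbrev ConfigSpace : Type := lp (fun _ : Finset Edge => ℂ) 2

/-- The product vector in which exactly the edges in `α` are occupied by a string. -/
def ket (α : Finset Edge) : ConfigSpace := lp.single 2 α 1

/-- Flipping the occupation of the edge `e`. -/
def flip (e : Edge) : Finset Edge ≃ Finset Edge where
  toFun α := symmDiff α {e}
  invFun α := symmDiff α {e}
  left_inv α := symmDiff_symmDiff_cancel_right {e} α
  right_inv α := symmDiff_symmDiff_cancel_right {e} α

/-- The Pauli matrix `σ^X` at the site `e`, as an operator: it flips the occupation of `e`. -/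
def pauliXOp (e : Edge) : ConfigSpace →L[ℂ] ConfigSpace :=
  LinearMap.mkContinuous
    { toFun := fun ψ => ⟨fun α => ψ (flip e α), by
        have h2 : 0 < (2 : ENNReal).toReal := by norm_num
        exact (memℓp_gen_iff h2).2
          ((flip e).summable_iff.2 ((memℓp_gen_iff h2).1 (lp.memℓp ψ)))⟩
      map_add' := fun _ _ => rfl
      map_smul' := fun _ _ => rfl } 1 (by
    intro ψ
    have h2 : 0 < (2 : ENNReal).toReal := by norm_num
    rw [one_mul, lp.norm_eq_tsum_rpow h2, lp.norm_eq_tsum_rpow h2]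
    exact le_of_eq (congrArg (fun t : ℝ => t ^ (1 / (2 : ENNReal).toReal))
      ((flip e).tsum_eq fun α => ‖ψ α‖ ^ (2 : ENNReal).toReal)))

/-- The Pauli matrix `σ^Z` at the site `e`, as an operator: it is `-1` on configurations in which
`e` is occupied and `1` on the others. -/
def pauliZOp (e : Edge) : ConfigSpace →L[ℂ] ConfigSpace :=
  LinearMap.mkContinuous
    { toFun := fun ψ => ⟨fun α => (if e ∈ α then -1 else 1) * ψ α, by
        have h2 : 0 < (2 : ENNReal).toReal := by norm_num
        refine (memℓp_gen_iff h2).2 (((memℓp_gen_iff h2).1 (lp.memℓp ψ)).congr fun α => ?_)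
        split_ifs <;> simp⟩
      map_add' := fun φ ψ => by
        ext α
        exact mul_add _ (φ α) (ψ α)
      map_smul' := fun c ψ => by
        ext α
        exact mul_left_comm _ c (ψ α) } 1 (by
    intro ψ
    have h2 : 0 < (2 : ENNReal).toReal := by norm_num
    rw [one_mul, lp.norm_eq_tsum_rpow h2, lp.norm_eq_tsum_rpow h2]
    refine le_of_eq (congrArg (fun t : ℝ => t ^ (1 / (2 : ENNReal).toReal))
      (tsum_congr fun α => ?_))
    show ‖(if e ∈ α then (-1 : ℂ) else 1) * ψ α‖ ^ _ = _
    split_ifs <;> simp)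

/-- The algebra of quasi-local observables. -/
def quasiLocal : StarSubalgebra ℂ (ConfigSpace →L[ℂ] ConfigSpace) :=
  (StarAlgebra.adjoin ℂ (Set.range pauliXOp ∪ Set.range pauliZOp)).topologicalClosure

/-- The type of quasi-local observables. -/
abbrev Obs : Type := ↥quasiLocal

/-- The Pauli matrix `σ^X` at a site, as an observable. -/
def pauliX (e : Edge) : Obs :=
  ⟨pauliXOp e, StarSubalgebra.le_topologicalClosure _
    (StarAlgebra.subset_adjoin ℂ _ (Or.inl ⟨e, rfl⟩))⟩

/-- The Pauli matrix `σ^Z` at a site, as an observable. -/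
def pauliZ (e : Edge) : Obs :=
  ⟨pauliZOp e, StarSubalgebra.le_topologicalClosure _
    (StarAlgebra.subset_adjoin ℂ _ (Or.inr ⟨e, rfl⟩))⟩

/-- The algebra of strictly local observables supported in a set of sites. -/
def localObs (Y : Set Edge) : StarSubalgebra ℂ Obs :=
  StarAlgebra.adjoin ℂ (pauliX '' Y ∪ pauliZ '' Y)

/-- The algebra of quasi-local observables supported in a set of sites. -/
def obsOn (Y : Set Edge) : StarSubalgebra ℂ Obs := (localObs Y).topologicalClosure

/-! ### The double semion state -/

/-- The hexagonal patch made of a central hexagon and the `n - 1` rings of hexagons around it. -/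
def patch (n : ℕ) : Finset Face :=
  (Finset.Icc (-(n : ℤ)) n ×ˢ Finset.Icc (-(n : ℤ)) n).filter
    fun f => |f.1| < n ∧ |f.2| < n ∧ |f.1 + f.2| < n

/-- The edges in the boundary of a finite set of hexagons: a soup of closed strings. -/
def boundary (F : Finset Face) : Finset Edge :=
  ((F ×ˢ (Finset.univ : Finset (Fin 6))).filter fun p => p.1 + dirVec p.2 ∉ F).image
    fun p => (Dart.mk p.1 p.2).edge

/-- The number of connected components of a string configuration. -/
def numStrings (α : Finset Edge) : ℕ :=
  Nat.card (edgeGraph.induce (α : Set Edge)).ConnectedComponent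

/-- The superposition of all closed string configurations in the `n`-th patch, with a sign given by
the parity of the number of strings. -/
def approxVector (n : ℕ) : ConfigSpace :=
  ((Real.sqrt (1 / 2 ^ (patch n).card) : ℝ) : ℂ) •
    ∑ F ∈ (patch n).powerset, ((-1 : ℂ) ^ numStrings (boundary F)) • ket (boundary F)

/-- The approximating states `ω_n`. -/
def approxState (n : ℕ) (O : Obs) : ℂ :=
  ⟪approxVector n, (O : ConfigSpace →L[ℂ] ConfigSpace) (approxVector n)⟫_ℂ

/-- `ω` is the double semion state, the weak-* limit of the approximating states. -/
def IsDoubleSemionState (ω : Obs →L[ℂ] ℂ) : Prop :=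
  ∀ O : Obs, Tendsto (fun n => approxState n O) atTop (𝓝 (ω O))

/-- `(π, H, Ω)` is a GNS triple of `ω`. -/
structure IsGNSTriple {H : Type*} [NormedAddCommGroup H] [InnerProductSpace ℂ H] [CompleteSpace H]
    (ω : Obs →L[ℂ] ℂ) (π : Obs →⋆ₐ[ℂ] (H →L[ℂ] H)) (Ω : H) : Prop where
  expectation : ∀ O : Obs, ⟪Ω, π O Ω⟫_ℂ = ω O
  cyclic : DenseRange fun O : Obs => π O Ω

/-- The von Neumann algebra `π(𝒜_Y)''` associated to a set of sites. -/
def vonNeumann {H : Type*} [NormedAddCommGroup H] [InnerProductSpace ℂ H] [CompleteSpace H]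
    (π : Obs →⋆ₐ[ℂ] (H →L[ℂ] H)) (Y : Set Edge) : Set (H →L[ℂ] H) :=
  Set.centralizer (Set.centralizer (π '' (obsOn Y : Set Obs)))

/-! ### String operators -/

/-- The anyon types: vacuum, semion, anti-semion and bound state. -/
inductive Anyon where
  | vacuum
  | semion
  | antisemion
  | boundState

/-- The R-legs of an oriented path, listed along the path: at each vertex where the path turns left,
the third edge at this vertex lies on the right of the path. -/
def rLegs : List Dart → List Edge
  | d :: d' :: l =>
      (if d' = d.turnLeft then [d.turnRight.edge] else []) ++ rLegs (d' :: l)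
  | _ => []

/-- The L-vertices of an oriented path, listed along the path: the vertices where the path turns
right, so that the third edge lies on its left. Each is given by the pair of edges of the path
going in and out of it. -/
def lVertices : List Dart → List (Edge × Edge)
  | d :: d' :: l =>
      (if d' = d.turnRight then [(d.edge, d'.edge)] else []) ++ lVertices (d' :: l)
  | _ => []

/-- The operator `c ^ ((1 - σ^Z) / 2)` at a site: `c` if occupied and `1` otherwise. -/
def phaseAt (c : ℂ) (e : Edge) : Obs :=
  (1 / 2 : ℂ) • (1 + pauliZ e) + (c / 2) • (1 - pauliZ e)

/-- The operator `(-1) ^ s` where `s = (1 - σ^Z_j) (1 + σ^Z_k) / 4`. As `s` is a projection,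
this is `1 - 2 s`. -/
def signAt (v : Edge × Edge) : Obs :=
  1 - (2 : ℂ) • ((1 / 4 : ℂ) • ((1 - pauliZ v.1) * (1 + pauliZ v.2)))

/-- The string operator for a list `E` of edges together with the R-legs and L-vertices passed by
the oriented path `l`. -/
def stringOpAux (a : Anyon) (E : List Edge) (l : List Dart) : Obs :=
  match a with
  | .vacuum => 1
  | .semion =>
      (E.map pauliX).prod * ((rLegs l).map (phaseAt Complex.I)).prod *
        ((lVertices l).map signAt).prod
  | .antisemion =>
      (E.map pauliX).prod * ((rLegs l).map (phaseAt (-Complex.I))).prod *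
        ((lVertices l).map signAt).prod
  | .boundState => ((rLegs l).map pauliZ).prod

/-- The string operator `W_a[P]` of a finite open oriented path. -/
def openString (a : Anyon) (l : List Dart) : Obs := stringOpAux a (l.map Dart.edge) l

/-- The string operator `W_a[P]` of a finite closed oriented path `[d₁, …, dₖ]`, including the
vertex between `dₖ` and `d₁`. -/
def closedString (a : Anyon) (l : List Dart) : Obs :=
  stringOpAux a (l.map Dart.edge) (l ++ l.take 1)

/-- A finite closed oriented path which passes every edge at most once. -/
def IsClosedPath (l : List Dart) : Prop :=
  l ≠ [] ∧ (l.map Dart.edge).Nodup ∧ List.IsChain Dart.Follows (l ++ l.take 1)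

/-- The last `n` edges `P (n - 1), …, P 1, P 0` of a half-infinite path coming in from infinity and
ending at `P 0`. -/
def truncation (P : ℕ → Dart) (n : ℕ) : List Dart := ((List.range n).map P).reverse

/-- Conjugation with the string operator of the last `n` edges of a half-infinite path. -/
def conjTruncation (a : Anyon) (P : ℕ → Dart) (n : ℕ) (O : Obs) : Obs :=
  openString a (truncation P n) * O * star (openString a (truncation P n))

/-- `w` is the automorphism `w_a[P]` given by conjugation with the formal unitary `W_a[P]`, for
a half-infinite path `P` coming in from infinity and ending at `P 0`. -/
def IsStringAut (a : Anyon) (P : ℕ → Dart) (w : Obs ≃⋆ₐ[ℂ] Obs) : Prop :=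
  ∀ O : Obs, Tendsto (fun n => conjTruncation a P n O) atTop (𝓝 (w O))

/-- `P` is a path `P_Λ` along which the string automorphisms `w_{a,Λ} = w_a[P_Λ]` are defined.

Remove from the counterclockwise boundary of the set of hexagons overlapping the right half of `Λ`
all edges with midpoint at distance at most `r` from the apex, for some `r > 2`. What remains has to
consist of two disjoint half-infinite paths. The one which comes in from infinity follows the left
leg of the right half of `Λ`, that is, the axis of `Λ`: this is `P`. The other one, `Q`, goes out to
infinity along the right leg. The radius `r` is so large that all `w_a[P]` are supported in `Λ`,
i.e. act trivially on the observables supported outside of `Λ`. -/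
def IsConePath (Λ : Cone) (P : ℕ → Dart) : Prop :=
  ∃ r : ℝ, 2 < r ∧
    (∃ Q : ℕ → Dart,
      (∀ i, (P (i + 1)).Follows (P i)) ∧ (∀ i, (Q i).Follows (Q (i + 1))) ∧
      Function.Injective (fun i => (P i).edge) ∧ Function.Injective (fun i => (Q i).edge) ∧
      Disjoint (Set.range P) (Set.range Q) ∧
      Set.range P ∪ Set.range Q =
        {d ∈ boundaryDarts (overlapping Λ.rightHalf.region) | r < dist d.edge.mid Λ.apex}) ∧
    ∀ a : Anyon, ∀ O ∈ obsOn (sites Λ.region)ᶜ,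
      Tendsto (fun n => conjTruncation a P n O) atTop (𝓝 O)

/-- The unitary `U` implements an equivalence between the representations `π ∘ w₁` and
`π ∘ w₂`. -/
def Implements {H : Type*} [NormedAddCommGroup H] [InnerProductSpace ℂ H] [CompleteSpace H]
    (U : H →L[ℂ] H) (π : Obs →⋆ₐ[ℂ] (H →L[ℂ] H)) (w₁ w₂ : Obs ≃⋆ₐ[ℂ] Obs) : Prop :=
  U ∈ unitary (H →L[ℂ] H) ∧ ∀ O : Obs, U * π (w₁ O) * star U = π (w₂ O)

/-- `U` is a limit, in the weak operator topology, of products of local closed string operators of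
type `a` in the region with sites `Y`: up to phases, `U` is the weak limit of
`T' W_a[Q'_n] W_a[Q_n]^* T`, with closed paths `Q_n`, `Q'_n` whose string operators are supported
in `Y`, and with strictly local unitaries `T`, `T'` supported in `Y` which do not depend on `n`. -/
def IsWeakLimitOfClosedStrings {H : Type*} [NormedAddCommGroup H] [InnerProductSpace ℂ H]
    [CompleteSpace H] (π : Obs →⋆ₐ[ℂ] (H →L[ℂ] H)) (a : Anyon) (Y : Set Edge)
    (U : H →L[ℂ] H) : Prop :=
  ∃ (Q Q' : ℕ → List Dart) (T T' : Obs) (z : ℕ → ℂ),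
    (∀ n, IsClosedPath (Q n) ∧ closedString a (Q n) ∈ localObs Y) ∧
    (∀ n, IsClosedPath (Q' n) ∧ closedString a (Q' n) ∈ localObs Y) ∧
    (T ∈ unitary Obs ∧ T ∈ localObs Y) ∧ (T' ∈ unitary Obs ∧ T' ∈ localObs Y) ∧
    (∀ n, ‖z n‖ = 1) ∧
    ∀ ξ η : H, Tendsto
      (fun n => ⟪ξ, (z n • π (T' * closedString a (Q' n) * star (closedString a (Q n)) * T)) η⟫_ℂ)
      atTop (𝓝 ⟪ξ, U η⟫_ℂ)

end DoubleSemion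

end

noncomputable section

namespace DoubleSemion

/-! ### Combinatorics of oriented edges -/

/-! Closed strings fix the double semion vectors up to a phase, and growing closed strings in `Λ`
converge, as automorphisms, to the open strings of the cones. Everything else serves to make these
two facts usable.

The sign of a string configuration. All vertices are trivalent, so the boundary of a finite set of
hexagons is a disjoint union of loops, and the number of loops has the parity of the Euler
characteristic. Modulo two the latter is a cubic polynomial in the indicator function of the set
(hexagons, adjacent pairs, triples around a vertex). Twice this polynomial lives in `ZMod 4` as the
exponent `twiceEuler` of `i` (`two_mul_numStrings`), and its polarization is `twiceCoupling`
(`twiceEuler_symmDiff`). A semion string along the boundary of `G` collects on the configuration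
around `F` exactly the phase with exponent `twiceCoupling G F` (`finsum_turnExponent`,
`loopOp_ket`). Hence the substitution of `F` by its symmetric difference with `E` shows that closed
strings have the approximating vectors as eigenvectors (`loopOp_approxVector`).

Existence and purity of the state. Each Pauli monomial either anticommutes with a stabilizer (a
product of `σ^Z` around a vertex or a closed semion string) or is reduced to stabilizers, because
finite cycles of edges are boundaries (`exists_boundary_eq`). So any functional compatible with the
stabilizers is determined on local observables up to normalization. This gives the limit state
(`exists_isDoubleSemionState`) and the irreducibility of its GNS representation
(`commutant_trivial`).

Transport between the cones. Choose in `Λ` a direction `b` independent of both axes. For each `Λᵢ` a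
wedge deep inside `Λ` is bounded, up to finitely many edges, by `P_Λᵢ` coming in and by one common
ray going out along `b`. Truncating the wedge gives closed paths whose conjugations converge to
`gᵢ`, which is `wᵢ` times the automorphism of the common ray, up to a local unitary
(`IsConePath.exists_closedPaths`, `stringAut_eq_mul`). The common ray cancels in `g₂ * g₁⁻¹`, so
this automorphism is `w₂ * w₁⁻¹` up to local unitaries. The products of closed strings fix `Ω` up to
a phase; after normalization they therefore converge strongly to a unitary which implements `g₂ *
g₁⁻¹` (`exists_implementing_limit`). By irreducibility every other intertwiner is a multiple of the
one so obtained, and weak limits of local observables of `Λ` lie in the double commutant. -/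

theorem dirVec_add_three (k : Fin 6) : dirVec (k + 3) = -dirVec k := by
  revert k; decide

theorem dirVec_add_one_add_sub_one (k : Fin 6) : dirVec (k + 1) + dirVec (k - 1) = dirVec k := by
  revert k; decide

theorem dirVec_add_two (k : Fin 6) : dirVec (k + 2) = dirVec (k + 1) - dirVec k := by
  revert k; decide

theorem dirVec_injective : Function.Injective dirVec := by decide

theorem dirVec_ne_zero (k : Fin 6) : dirVec k ≠ 0 := by
  revert k; decide

namespace Dart

/-- The hexagon straight ahead of an oriented edge. -/
def ahead (d : Dart) : Face := d.left + dirVec (d.dir + 1)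

/-- The hexagon straight behind an oriented edge. -/
def behind (d : Dart) : Face := d.left + dirVec (d.dir - 1)

/-- The same edge with the opposite orientation. -/
def reverse (d : Dart) : Dart := ⟨d.right, d.dir + 3⟩

/-- The oriented edge from which one reaches `d` by turning left. -/
def unturnLeft (d : Dart) : Dart := ⟨d.left, d.dir - 1⟩

/-- The oriented edge from which one reaches `d` by turning right. -/
def unturnRight (d : Dart) : Dart := ⟨d.behind, d.dir + 1⟩

@[simp] theorem turnLeft_left (d : Dart) : d.turnLeft.left = d.left := rfl
@[simp] theorem turnLeft_right (d : Dart) : d.turnLeft.right = d.ahead := rfl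
@[simp] theorem turnRight_left (d : Dart) : d.turnRight.left = d.ahead := rfl

@[simp] theorem turnRight_right (d : Dart) : d.turnRight.right = d.right := by
  simp only [turnRight, right, ← dirVec_add_one_add_sub_one d.dir, add_assoc]

@[simp] theorem unturnLeft_left (d : Dart) : d.unturnLeft.left = d.left := rfl
@[simp] theorem unturnLeft_right (d : Dart) : d.unturnLeft.right = d.behind := rfl
@[simp] theorem unturnRight_left (d : Dart) : d.unturnRight.left = d.behind := rfl

@[simp] theorem unturnRight_right (d : Dart) : d.unturnRight.right = d.right := by
  simp only [unturnRight, right, behind, ← dirVec_add_one_add_sub_one d.dir]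
  abel

@[simp] theorem unturnLeft_ahead (d : Dart) : d.unturnLeft.ahead = d.right := by
  simp [unturnLeft, ahead, right]

@[simp] theorem unturnRight_ahead (d : Dart) : d.unturnRight.ahead = d.left := by
  have h : dirVec (d.dir + 1 + 1) = -dirVec (d.dir - 1) := by
    generalize d.dir = k; revert k; decide
  simp [unturnRight, ahead, behind, h]

@[simp] theorem turnLeft_unturnLeft (d : Dart) : d.unturnLeft.turnLeft = d := by
  simp [unturnLeft, turnLeft]

@[simp] theorem unturnLeft_turnLeft (d : Dart) : d.turnLeft.unturnLeft = d := by
  simp [unturnLeft, turnLeft]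

@[simp] theorem turnRight_unturnRight (d : Dart) : d.unturnRight.turnRight = d := by
  ext1
  · rw [turnRight_left, unturnRight_ahead]
  · simp [unturnRight, turnRight]

@[simp] theorem turnRight_behind (d : Dart) : d.turnRight.behind = d.left := by
  have h : dirVec (d.dir - 1 - 1) = -dirVec (d.dir + 1) := by
    generalize d.dir = k; revert k; decide
  simp [turnRight, behind, h]

@[simp] theorem turnLeft_behind (d : Dart) : d.turnLeft.behind = d.right := by
  simp [turnLeft, behind, right]

@[simp] theorem unturnRight_turnRight (d : Dart) : d.turnRight.unturnRight = d := by
  ext1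
  · rw [unturnRight_left, turnRight_behind]
  · simp [unturnRight, turnRight]

@[simp] theorem reverse_left (d : Dart) : d.reverse.left = d.right := rfl

@[simp] theorem reverse_right (d : Dart) : d.reverse.right = d.left := by
  simp [reverse, right, dirVec_add_three]

@[simp] theorem reverse_ahead (d : Dart) : d.reverse.ahead = d.behind := by
  have h : dirVec d.dir + dirVec (d.dir + 3 + 1) = dirVec (d.dir - 1) := by
    generalize d.dir = k; revert k; decide
  rw [ahead, behind, ← h, ← add_assoc]; rfl

@[simp] theorem reverse_behind (d : Dart) : d.reverse.behind = d.ahead := by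
  have h : dirVec d.dir + dirVec (d.dir + 3 - 1) = dirVec (d.dir + 1) := by
    generalize d.dir = k; revert k; decide
  rw [ahead, behind, ← h, ← add_assoc]; rfl

@[simp] theorem reverse_reverse (d : Dart) : d.reverse.reverse = d := by
  have h : d.dir + 3 + 3 = d.dir := by
    generalize d.dir = k; revert k; decide
  ext1
  · simp
  · simp only [reverse, h]

theorem left_ne_right (d : Dart) : d.left ≠ d.right := by
  simp [right, dirVec_ne_zero]

theorem ahead_ne_left (d : Dart) : d.ahead ≠ d.left := by
  simp [ahead, dirVec_ne_zero]

theorem turnLeft_ne_turnRight (d : Dart) : d.turnLeft ≠ d.turnRight := fun h =>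
  d.ahead_ne_left (congrArg Dart.left h).symm

theorem eq_of_left_right {d d' : Dart} (h : d.left = d'.left) (h' : d.right = d'.right) :
    d = d' := by
  refine Dart.ext h (dirVec_injective ?_)
  simpa [right, h] using h'

/-- The hexagons on the two sides of an oriented edge. -/
theorem edge_faces (d : Dart) :
    (d.edge.face₁ = d.left ∧ d.edge.face₂ = d.right) ∨
      (d.edge.face₁ = d.right ∧ d.edge.face₂ = d.left) := by
  obtain ⟨f, k⟩ := d
  fin_cases k <;> simp [edge, Edge.face₁, Edge.face₂, right, dirVec, Prod.ext_iff]

@[simp] theorem edge_reverse (d : Dart) : d.reverse.edge = d.edge := by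
  obtain ⟨f, k⟩ := d
  fin_cases k <;> simp [edge, right, reverse, dirVec, Prod.ext_iff]

end Dart

/-- The oriented edge with the first face on its left. -/
def Edge.dart (e : Edge) : Dart := ⟨e.1, Fin.castLE (by norm_num) e.2⟩

@[simp] theorem Edge.dart_left (e : Edge) : e.dart.left = e.face₁ := rfl
@[simp] theorem Edge.dart_right (e : Edge) : e.dart.right = e.face₂ := rfl

@[simp] theorem Edge.dart_edge (e : Edge) : e.dart.edge = e := by
  obtain ⟨f, k⟩ := e
  fin_cases k <;> rfl

theorem Dart.edge_eq_iff {d d' : Dart} : d.edge = d'.edge ↔ d = d' ∨ d = d'.reverse := by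
  constructor
  · intro h
    rcases d.edge_faces with ⟨h1, h2⟩ | ⟨h1, h2⟩ <;>
      rcases d'.edge_faces with ⟨h3, h4⟩ | ⟨h3, h4⟩ <;> rw [h] at h1 h2
    · exact Or.inl (eq_of_left_right (h1.symm.trans h3) (h2.symm.trans h4))
    · refine Or.inr (eq_of_left_right (h1.symm.trans h3) ?_)
      rw [reverse_right]; exact h2.symm.trans h4
    · refine Or.inr (eq_of_left_right (h2.symm.trans h4) ?_)
      rw [reverse_right]; exact h1.symm.trans h3
    · exact Or.inl (eq_of_left_right (h2.symm.trans h4) (h1.symm.trans h3))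
  · rintro (rfl | rfl) <;> simp

theorem Edge.eq_dart_edge (e : Edge) : ∃ d : Dart, d.edge = e := ⟨e.dart, e.dart_edge⟩

/-! ### Boundaries of sets of hexagons -/

/-- The edges between a set of hexagons and its complement. -/
def edgeBoundary (G : Set Face) : Set Edge := {e | ¬ (e.face₁ ∈ G ↔ e.face₂ ∈ G)}

theorem Dart.edge_mem_edgeBoundary {G : Set Face} {d : Dart} :
    d.edge ∈ edgeBoundary G ↔ ¬ (d.left ∈ G ↔ d.right ∈ G) := by
  rcases d.edge_faces with ⟨h1, h2⟩ | ⟨h1, h2⟩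
  · simp [edgeBoundary, h1, h2]
  · simp only [edgeBoundary, Set.mem_ofPred_eq, h1, h2]; tauto

theorem mem_boundaryDarts {G : Set Face} {d : Dart} :
    d ∈ boundaryDarts G ↔ d.left ∈ G ∧ d.right ∉ G := Iff.rfl

theorem mem_boundary_iff_exists {F : Finset Face} {e : Edge} :
    e ∈ boundary F ↔ ∃ d : Dart, (d.left ∈ F ∧ d.right ∉ F) ∧ d.edge = e := by
  simp only [boundary, Finset.mem_image, Finset.mem_filter, Finset.mem_product,
    Finset.mem_univ, and_true]
  exact ⟨fun ⟨p, h, h'⟩ => ⟨⟨p.1, p.2⟩, h, h'⟩, fun ⟨d, h, h'⟩ => ⟨(d.left, d.dir), h, h'⟩⟩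

theorem exists_boundaryDart {G : Set Face} {e : Edge} (h : e ∈ edgeBoundary G) :
    ∃ d ∈ boundaryDarts G, d.edge = e := by
  obtain ⟨d, rfl⟩ := e.eq_dart_edge
  rw [Dart.edge_mem_edgeBoundary] at h
  by_cases h1 : d.left ∈ G
  · exact ⟨d, ⟨h1, by tauto⟩, rfl⟩
  · refine ⟨d.reverse, ⟨?_, ?_⟩, d.edge_reverse⟩
    · rw [Dart.reverse_left]; tauto
    · rwa [Dart.reverse_right]

theorem edge_mem_edgeBoundary_of_mem {G : Set Face} {d : Dart} (h : d ∈ boundaryDarts G) :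
    d.edge ∈ edgeBoundary G := by
  rw [Dart.edge_mem_edgeBoundary]
  have := h.1; have := h.2; tauto

theorem mem_boundary {F : Finset Face} {e : Edge} :
    e ∈ boundary F ↔ e ∈ edgeBoundary (F : Set Face) := by
  rw [mem_boundary_iff_exists]
  constructor
  · rintro ⟨d, ⟨h1, h2⟩, rfl⟩
    rw [Dart.edge_mem_edgeBoundary]
    simp [h1, h2]
  · intro h
    obtain ⟨d, hd, rfl⟩ := exists_boundaryDart h
    exact ⟨d, hd, rfl⟩

theorem reverse_notMem_boundaryDarts {G : Set Face} {d : Dart} (h : d ∈ boundaryDarts G) :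
    d.reverse ∉ boundaryDarts G := fun h' => h.2 h'.1

theorem edge_injOn_boundaryDarts (G : Set Face) : Set.InjOn Dart.edge (boundaryDarts G) := by
  intro d hd d' hd' h
  rcases Dart.edge_eq_iff.1 h with h | rfl
  · exact h
  · exact absurd hd (reverse_notMem_boundaryDarts hd')

theorem boundaryDarts_compl (G : Set Face) : boundaryDarts Gᶜ = Dart.reverse '' boundaryDarts G := by
  ext d
  constructor
  · rintro ⟨h1, h2⟩
    exact ⟨d.reverse, ⟨by simpa using h2, by simpa using h1⟩, d.reverse_reverse⟩
  · rintro ⟨d, ⟨h1, h2⟩, rfl⟩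
    exact ⟨by simpa using h2, by simpa using h1⟩

theorem edgeBoundary_compl (G : Set Face) : edgeBoundary Gᶜ = edgeBoundary G := by
  ext e; simp only [edgeBoundary, Set.mem_ofPred_eq, Set.mem_compl_iff]; tauto

open Classical in
/-- The oriented boundary edge following `d`. -/
def nextDart (G : Set Face) (d : Dart) : Dart := if d.ahead ∈ G then d.turnRight else d.turnLeft

open Classical in
/-- The oriented boundary edge preceding `d`. -/
def prevDart (G : Set Face) (d : Dart) : Dart :=
  if d.behind ∈ G then d.unturnRight else d.unturnLeft

/-- At the final vertex of `d` only the hexagons on the left, on the right and ahead meet. The left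
one is in `G`, the right one is not, so the one ahead decides which single boundary edge continues.
Boundaries therefore never branch, and `nextDart` is a permutation of them. -/
theorem nextDart_mem {G : Set Face} {d : Dart} (h : d ∈ boundaryDarts G) :
    nextDart G d ∈ boundaryDarts G := by
  unfold nextDart
  split_ifs with h'
  · exact ⟨h', by simpa using h.2⟩
  · exact ⟨h.1, h'⟩

theorem prevDart_mem {G : Set Face} {d : Dart} (h : d ∈ boundaryDarts G) :
    prevDart G d ∈ boundaryDarts G := by
  unfold prevDart
  split_ifs with h'
  · exact ⟨h', by simpa using h.2⟩
  · exact ⟨h.1, h'⟩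

theorem prevDart_nextDart {G : Set Face} {d : Dart} (h : d ∈ boundaryDarts G) :
    prevDart G (nextDart G d) = d := by
  unfold nextDart
  split_ifs with h'
  · rw [prevDart, if_pos (by simpa using h.1), Dart.unturnRight_turnRight]
  · rw [prevDart, if_neg (by simpa using h.2), Dart.unturnLeft_turnLeft]

theorem nextDart_prevDart {G : Set Face} {d : Dart} (h : d ∈ boundaryDarts G) :
    nextDart G (prevDart G d) = d := by
  unfold prevDart
  split_ifs with h'
  · rw [nextDart, if_pos (by simpa using h.1), Dart.turnRight_unturnRight]
  · rw [nextDart, if_neg (by simpa using h.2), Dart.turnLeft_unturnLeft]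

theorem follows_nextDart (G : Set Face) (d : Dart) : d.Follows (nextDart G d) := by
  unfold nextDart
  split_ifs
  · exact Or.inr rfl
  · exact Or.inl rfl

theorem eq_nextDart {G : Set Face} {d d' : Dart}
    (h' : d' ∈ boundaryDarts G) (hf : d.Follows d') : d' = nextDart G d := by
  unfold nextDart
  rcases hf with rfl | rfl
  · rw [if_neg (by simpa using h'.2)]
  · rw [if_pos (by simpa using h'.1)]

/-- The permutation of the oriented boundary of a set of hexagons along its orientation. -/
def nextPerm (G : Set Face) : Equiv.Perm (boundaryDarts G) where
  toFun d := ⟨nextDart G d, nextDart_mem d.2⟩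
  invFun d := ⟨prevDart G d, prevDart_mem d.2⟩
  left_inv d := Subtype.ext (prevDart_nextDart d.2)
  right_inv d := Subtype.ext (nextDart_prevDart d.2)

/-- A set of edges is a cycle if every vertex lies on an even number of its edges. -/
def IsCycle (A : Set Edge) : Prop :=
  ∀ d : Dart, (d.edge ∈ A ↔ ¬ (d.turnLeft.edge ∈ A ↔ d.turnRight.edge ∈ A))

/-! ### Finite cycles are boundaries -/

theorem exists_bound_of_finite {A : Set Edge} (hA : A.Finite) :
    ∃ N : ℕ, ∀ e ∈ A, |e.1.1| < N ∧ |e.1.2| < N := by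
  obtain ⟨N, hN⟩ := (hA.image fun e => e.1.1.natAbs + e.1.2.natAbs).bddAbove
  refine ⟨N + 1, fun e he => ?_⟩
  have := hN ⟨e, he, rfl⟩
  simp only [Int.abs_eq_natAbs] at this ⊢
  omega

open Classical in
/-- The indicator function of a set of edges, modulo two. -/
def edgeParity (A : Set Edge) (e : Edge) : ZMod 2 := if e ∈ A then 1 else 0

open Classical in
theorem edgeParity_eq_of_isCycle {A : Set Edge} (hA : IsCycle A) (d : Dart) :
    edgeParity A d.edge = edgeParity A d.turnLeft.edge + edgeParity A d.turnRight.edge := by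
  have := hA d
  unfold edgeParity
  by_cases h1 : d.edge ∈ A <;> by_cases h2 : d.turnLeft.edge ∈ A <;>
    by_cases h3 : d.turnRight.edge ∈ A <;> simp [h1, h2, h3] at this ⊢
  decide

/-- The lattice has two kinds of vertices; this and `edgeParity_down` are the cycle condition at
each kind in coordinates. -/
theorem edgeParity_up {A : Set Edge} (hA : IsCycle A) (x y : ℤ) :
    edgeParity A ((x, y), 0) = edgeParity A ((x, y), 1) + edgeParity A ((x + 1, y), 2) := by
  have := edgeParity_eq_of_isCycle hA ⟨(x, y), 0⟩
  simpa [Dart.edge, Dart.turnLeft, Dart.turnRight, Dart.right, dirVec,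
    show (0 - 1 : Fin 6) = 5 from rfl] using this

theorem edgeParity_down {A : Set Edge} (hA : IsCycle A) (x y : ℤ) :
    edgeParity A ((x, y), 1) = edgeParity A ((x, y), 2) + edgeParity A ((x - 1, y + 1), 0) := by
  have := edgeParity_eq_of_isCycle hA ⟨(x, y), 1⟩
  simpa [Dart.edge, Dart.turnLeft, Dart.turnRight, Dart.right, dirVec, sub_eq_add_neg,
    show (1 + 1 : Fin 6) = 2 from rfl] using this

/-- The parity of the number of edges of `A` on the horizontal segment from `(x, y)` to
`(N, y)`. -/
def rayParity (A : Set Edge) (N : ℤ) (x y : ℤ) : ZMod 2 :=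
  ∑ j ∈ Finset.range (N - x).toNat, edgeParity A ((x + j, y), 0)

theorem rayParity_of_le {A : Set Edge} {N x : ℤ} (h : N ≤ x) (y : ℤ) : rayParity A N x y = 0 := by
  rw [rayParity, show (N - x).toNat = 0 by omega]; simp

theorem rayParity_of_lt {A : Set Edge} {N x : ℤ} (h : x < N) (y : ℤ) :
    rayParity A N x y = edgeParity A ((x, y), 0) + rayParity A N (x + 1) y := by
  rw [rayParity, rayParity, show (N - x).toNat = (N - (x + 1)).toNat + 1 by omega,
    Finset.sum_range_succ', add_comm]
  congr 1
  · simp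
  · refine Finset.sum_congr rfl fun j _ => ?_
    rw [show x + ((j + 1 : ℕ) : ℤ) = x + 1 + j by push_cast; ring]

/-- The inside of a finite cycle consists of the hexagons from which a horizontal ray to the right
crosses the cycle an odd number of times. The cycle condition makes this parity jump exactly across
the edges of `A`, and it vanishes far away. -/
theorem exists_boundary_eq {A : Set Edge} (hA : A.Finite) (hc : IsCycle A) :
    ∃ F : Finset Face, edgeBoundary (F : Set Face) = A := by
  obtain ⟨N, hN⟩ := exists_bound_of_finite hA
  have h0 : ∀ x y : ℤ, ∀ k, ((N : ℤ) ≤ |x| ∨ (N : ℤ) ≤ |y|) → edgeParity A ((x, y), k) = 0 := by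
    intro x y k h
    rw [edgeParity, if_neg]
    intro h'
    have := hN _ h'
    simp only at this
    omega
  set n := rayParity A N with hn
  have e0 : ∀ x y, edgeParity A ((x, y), 0) = n x y + n (x + 1) y := by
    intro x y
    rcases lt_or_ge x N with h | h
    · rw [hn, rayParity_of_lt h, add_assoc, CharTwo.add_self_eq_zero, add_zero]
    · rw [hn, rayParity_of_le h, rayParity_of_le (by omega), h0 _ _ _ (Or.inl _), add_zero]
      exact h.trans (le_abs_self x)
  -- Induction from right to left. Beyond column `N` everything vanishes, and the cycle conditions
  -- at the vertices between two neighbouring columns carry the relation from `x + 1` to `x`.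
  have e1' : ∀ j : ℕ, ∀ x y, (N : ℤ) - j ≤ x → edgeParity A ((x, y), 1) = n x y + n x (y + 1) := by
    intro j
    induction j with
    | zero =>
      intro x y h
      rw [hn, rayParity_of_le (by omega), rayParity_of_le (by omega), h0 _ _ _ (Or.inl _), add_zero]
      exact (show (N : ℤ) ≤ x by omega).trans (le_abs_self x)
    | succ j ih =>
      intro x y h
      have h1 := edgeParity_up hc x y
      have h2 := edgeParity_down hc (x + 1) y
      have h3 := ih (x + 1) y (by push_cast at h; omega)
      have h4 := e0 x y
      have h5 := e0 x (y + 1)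
      rw [add_sub_cancel_right] at h2
      rw [h3, h5] at h2
      rw [h4] at h1
      generalize edgeParity A ((x, y), 1) = p1 at *
      generalize edgeParity A ((x + 1, y), 2) = p2 at *
      generalize n x y = q1 at *
      generalize n (x + 1) y = q2 at *
      generalize n x (y + 1) = q3 at *
      generalize n (x + 1) (y + 1) = q4 at *
      clear h3 h4 h5 h ih
      revert p1 p2 q1 q2 q3 q4
      decide
  have e1 : ∀ x y, edgeParity A ((x, y), 1) = n x y + n x (y + 1) := fun x y =>
    e1' (N - x).toNat x y (by omega)
  have e2 : ∀ x y, edgeParity A ((x, y), 2) = n x y + n (x - 1) (y + 1) := by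
    intro x y
    have h1 := edgeParity_up hc (x - 1) y
    rw [e0, e1, sub_add_cancel] at h1
    generalize edgeParity A ((x, y), 2) = p2 at *
    generalize n x y = q1 at *
    generalize n (x - 1) y = q2 at *
    generalize n (x - 1) (y + 1) = q3 at *
    revert p2 q1 q2 q3
    decide
  have z1 : ∀ x y, (N : ℤ) ≤ |y| → n x y = 0 := fun x y h =>
    Finset.sum_eq_zero fun j _ => h0 _ _ _ (Or.inr h)
  -- Left of `A` the ray may still cross `A`. There no edge of `A` separates vertically consecutive
  -- hexagons, so the parity is constant along the column, and above `A` it is zero.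
  have z2 : ∀ x : ℤ, x ≤ -N → ∀ j : ℕ, n x (N - j) = 0 := by
    intro x hx j
    induction j with
    | zero => exact z1 _ _ (by simp)
    | succ j ih =>
      have := e1 x (N - (j + 1 : ℕ))
      rw [h0 _ _ _ (Or.inl (by rw [abs_of_nonpos (by omega)]; omega)),
        show (N : ℤ) - (j + 1 : ℕ) + 1 = N - j by push_cast; ring, ih, add_zero] at this
      exact this.symm
  have z3 : ∀ x y : ℤ, (N : ℤ) ≤ |x| → n x y = 0 := by
    intro x y h
    rcases le_abs.1 h with h | h
    · exact rayParity_of_le h y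
    · rcases le_or_gt (N : ℤ) |y| with h' | h'
      · exact z1 x y h'
      · have := z2 x (by omega) (N - y).toNat
        rwa [show (N : ℤ) - (N - y).toNat = y by
          have := abs_lt.1 h'; omega] at this
  refine ⟨(Finset.Icc (-(N : ℤ)) N ×ˢ Finset.Icc (-(N : ℤ)) N).filter fun f => n f.1 f.2 ≠ 0, ?_⟩
  have hmem : ∀ x y : ℤ, ((x, y) ∈ (Finset.Icc (-(N : ℤ)) N ×ˢ Finset.Icc (-(N : ℤ)) N).filter
      fun f => n f.1 f.2 ≠ 0) ↔ n x y ≠ 0 := by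
    intro x y
    simp only [Finset.mem_filter, Finset.mem_product, Finset.mem_Icc, and_iff_right_iff_imp]
    intro h
    have h1 : |x| < N := by by_contra h'; exact h (z3 x y (by omega))
    have h2 : |y| < N := by by_contra h'; exact h (z1 x y (by omega))
    rw [abs_lt] at h1 h2
    omega
  have key : ∀ p q r : ZMod 2, p = q + r → (¬ (q ≠ 0 ↔ r ≠ 0) ↔ p ≠ 0) := by decide
  have hA' : ∀ e, e ∈ A ↔ edgeParity A e ≠ 0 := by
    intro e; unfold edgeParity; split_ifs with h <;> simp [h]
  ext ⟨⟨x, y⟩, k⟩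
  rw [hA', edgeBoundary, Set.mem_ofPred_eq, Finset.mem_coe, Finset.mem_coe]
  fin_cases k
  · have : Edge.face₂ ((x, y), 0) = (x + 1, y) := by simp [Edge.face₂, dirVec]
    simp only [Edge.face₁, Fin.zero_eta, this, hmem]
    exact key _ _ _ (e0 x y)
  · have : Edge.face₂ ((x, y), 1) = (x, y + 1) := by simp [Edge.face₂, dirVec]
    simp only [Edge.face₁, Fin.mk_one, this, hmem]
    exact key _ _ _ (e1 x y)
  · have : Edge.face₂ ((x, y), 2) = (x - 1, y + 1) := by
      simp [Edge.face₂, dirVec, sub_eq_add_neg]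
    simp only [Edge.face₁, Fin.reduceFinMk, this, hmem]
    exact key _ _ _ (e2 x y)

/-! ### The cubic form of a set of hexagons -/

open Classical in
/-- The indicator function of a set of hexagons, with values in `ℤ/4`. -/
def ind (G : Set Face) (f : Face) : ZMod 4 := if f ∈ G then 1 else 0

theorem ind_of_mem {G : Set Face} {f : Face} (h : f ∈ G) : ind G f = 1 := by simp [ind, h]
theorem ind_of_notMem {G : Set Face} {f : Face} (h : f ∉ G) : ind G f = 0 := by simp [ind, h]

theorem ind_eq_zero_or_one (G : Set Face) (f : Face) : ind G f = 0 ∨ ind G f = 1 := by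
  unfold ind; split_ifs <;> simp

theorem ind_compl (G : Set Face) (f : Face) : ind Gᶜ f = 1 - ind G f := by
  by_cases h : f ∈ G <;> simp [ind, h]

theorem ind_symmDiff (F G : Set Face) (f : Face) :
    ind (symmDiff F G) f = ind F f + ind G f - 2 * ind F f * ind G f := by
  by_cases h : f ∈ F <;> by_cases h' : f ∈ G <;>
    simp [ind, h, h', Set.mem_symmDiff]; decide

/-- The cubic form, polarized, at three hexagons around a vertex. -/
def cubic (m n : Face → ZMod 4) (a b c : Face) : ZMod 4 :=
  n a * n b * m c + n b * n c * m a + n c * n a * m b +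
    (m a * m b * n c + m b * m c * n a + m c * m a * n b)

/-- The local contribution to the Euler characteristic. -/
def eulerDensity (n : Face → ZMod 4) (f : Face) : ZMod 4 :=
  n f + (n f * n (f + dirVec 0) + n f * n (f + dirVec 1) + n f * n (f + dirVec 2)) +
    n f * n (f + dirVec 0) * n (f + dirVec 1) + n f * n (f + dirVec 1) * n (f + dirVec 2)

/-- Twice the Euler characteristic of a finite set of hexagons, modulo four. -/
def twiceEuler (F : Finset Face) : ZMod 4 := ∑ᶠ f, 2 * eulerDensity (ind F) f

/-- The symmetric coupling of two functions along an edge. -/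
def edgeForm (m n : Face → ZMod 4) (k : Fin 6) (f : Face) : ZMod 4 :=
  n f * m (f + dirVec k) + m f * n (f + dirVec k)

/-- The local contribution to the polarization of the Euler characteristic. -/
def couplingDensity (m n : Face → ZMod 4) (f : Face) : ZMod 4 :=
  (edgeForm m n 0 f + edgeForm m n 1 f + edgeForm m n 2 f) +
    cubic m n f (f + dirVec 0) (f + dirVec 1) + cubic m n f (f + dirVec 1) (f + dirVec 2)

/-- Twice the polarization of the Euler characteristic, modulo four. -/
def twiceCoupling (G : Set Face) (F : Finset Face) : ZMod 4 :=
  ∑ᶠ f, 2 * couplingDensity (ind G) (ind F) f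

theorem finite_support_of_local {F : Finset Face} {u : Face → ZMod 4}
    (h : ∀ f, ind F f = 0 → ind F (f + dirVec 0) = 0 → ind F (f + dirVec 1) = 0 →
      ind F (f + dirVec 2) = 0 → u f = 0) : u.support.Finite := by
  have hfin : ∀ a : Face, {f : Face | f + a ∈ F}.Finite := fun a =>
    F.finite_toSet.preimage (add_left_injective a).injOn
  refine ((((hfin 0).union (hfin (dirVec 0))).union (hfin (dirVec 1))).union
    (hfin (dirVec 2))).subset fun f hf => ?_
  by_contra hcon
  simp only [Set.mem_union, Set.mem_ofPred_eq, not_or, add_zero] at hcon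
  exact hf (h f (ind_of_notMem hcon.1.1.1) (ind_of_notMem hcon.1.1.2) (ind_of_notMem hcon.1.2)
    (ind_of_notMem hcon.2))

theorem finite_support_shift {u : Face → ZMod 4} (hu : u.support.Finite) (a : Face) :
    (fun f => u (f + a)).support.Finite :=
  hu.preimage (add_left_injective a).injOn

theorem finsum_shift (u : Face → ZMod 4) (a : Face) : ∑ᶠ f, u (f + a) = ∑ᶠ f, u f :=
  finsum_comp_equiv (Equiv.addRight a)

theorem finite_support_add {u v : Face → ZMod 4} (hu : u.support.Finite) (hv : v.support.Finite) :
    (fun f => u f + v f).support.Finite :=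
  (hu.union hv).subset (Function.support_add u v)

/-- For `u` with even values the right hand side vanishes modulo four. This removes the correction
terms in `twiceCoupling_compl`. -/
theorem finsum_add_shift {u : Face → ZMod 4} (hu : u.support.Finite) (a : Face) :
    ∑ᶠ f, (u f + u (f + a)) = ∑ᶠ f, 2 * u f := by
  rw [finsum_add_distrib hu (finite_support_shift hu a), finsum_shift, ← two_mul]
  exact mul_finsum' _ _ hu

/-- The indicator of a symmetric difference is `p + r - 2 * p * r`. After multiplication by two the
last term contributes nothing modulo four, so the doubled polynomial can be expanded as over the
field with two elements. The mixed terms form the coupling. -/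
theorem twiceEuler_symmDiff (F G : Finset Face) :
    twiceEuler (symmDiff F G) = twiceEuler F + twiceEuler G + twiceCoupling G F := by
  have h1 : (fun f => 2 * eulerDensity (ind F) f).support.Finite :=
    finite_support_of_local (F := F) fun f h0 h1 h2 h3 => by simp [eulerDensity, h0]
  have h2 : (fun f => 2 * eulerDensity (ind G) f).support.Finite :=
    finite_support_of_local (F := G) fun f h0 h1 h2 h3 => by simp [eulerDensity, h0]
  have h3 : (fun f => 2 * couplingDensity (ind G) (ind F) f).support.Finite :=
    finite_support_of_local (F := F) fun f h0 h1 h2 h3 => by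
      simp [couplingDensity, edgeForm, cubic, h0, h1, h2, h3]
  rw [twiceEuler, twiceEuler, twiceEuler, twiceCoupling, ← finsum_add_distrib h1 h2,
    ← finsum_add_distrib (finite_support_add h1 h2) h3]
  refine finsum_congr fun f => ?_
  have e1 : ∀ p q r s : ZMod 4, (p = 0 ∨ p = 1) → (q = 0 ∨ q = 1) → (r = 0 ∨ r = 1) →
      (s = 0 ∨ s = 1) →
      2 * ((p + r - 2 * p * r) * (q + s - 2 * q * s)) = 2 * (p * q + r * s + (p * s + r * q)) := by
    decide
  have e2 : ∀ p q r p' q' r' : ZMod 4, (p = 0 ∨ p = 1) → (q = 0 ∨ q = 1) → (r = 0 ∨ r = 1) →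
      (p' = 0 ∨ p' = 1) → (q' = 0 ∨ q' = 1) → (r' = 0 ∨ r' = 1) →
      2 * ((p + p' - 2 * p * p') * (q + q' - 2 * q * q') * (r + r' - 2 * r * r')) =
        2 * (p * q * r + p' * q' * r' + (p * q * r' + q * r * p' + r * p * q' +
          (p' * q' * r + q' * r' * p + r' * p' * q))) := by
    rintro p q r p' q' r' (rfl | rfl) (rfl | rfl) (rfl | rfl) (rfl | rfl) (rfl | rfl) (rfl | rfl) <;>
      decide
  have e3 : ∀ p p' : ZMod 4, (p = 0 ∨ p = 1) → (p' = 0 ∨ p' = 1) →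
      2 * (p + p' - 2 * p * p') = 2 * (p + p') := by decide
  have z := fun f => ind_eq_zero_or_one (F : Set Face) f
  have w := fun f => ind_eq_zero_or_one (G : Set Face) f
  simp only [eulerDensity, couplingDensity, edgeForm, cubic, mul_add, Finset.coe_symmDiff,
    ind_symmDiff]
  have := e1 _ _ _ _ (z f) (z (f + dirVec 0)) (w f) (w (f + dirVec 0))
  have := e1 _ _ _ _ (z f) (z (f + dirVec 1)) (w f) (w (f + dirVec 1))
  have := e1 _ _ _ _ (z f) (z (f + dirVec 2)) (w f) (w (f + dirVec 2))
  have := e2 _ _ _ _ _ _ (z f) (z (f + dirVec 0)) (z (f + dirVec 1)) (w f) (w (f + dirVec 0))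
    (w (f + dirVec 1))
  have := e2 _ _ _ _ _ _ (z f) (z (f + dirVec 1)) (z (f + dirVec 2)) (w f) (w (f + dirVec 1))
    (w (f + dirVec 2))
  have := e3 _ _ (z f) (w f)
  linear_combination e1 _ _ _ _ (z f) (z (f + dirVec 0)) (w f) (w (f + dirVec 0)) +
    e1 _ _ _ _ (z f) (z (f + dirVec 1)) (w f) (w (f + dirVec 1)) +
    e1 _ _ _ _ (z f) (z (f + dirVec 2)) (w f) (w (f + dirVec 2)) +
    e2 _ _ _ _ _ _ (z f) (z (f + dirVec 0)) (z (f + dirVec 1)) (w f) (w (f + dirVec 0))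
      (w (f + dirVec 1)) +
    e2 _ _ _ _ _ _ (z f) (z (f + dirVec 1)) (z (f + dirVec 2)) (w f) (w (f + dirVec 1))
      (w (f + dirVec 2)) + e3 _ _ (z f) (w f)

theorem add_dirVec_zero_add_dirVec_two (f : Face) : f + dirVec 0 + dirVec 2 = f + dirVec 1 := by
  rw [add_assoc]; congr 1

theorem add_dirVec_two_add_dirVec_zero (f : Face) : f + dirVec 2 + dirVec 0 = f + dirVec 1 := by
  rw [add_assoc]; congr 1

/-- Needed for closed paths which have the finite set of hexagons on their right: they are
boundaries of an infinite complement. -/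
theorem twiceCoupling_compl (G : Set Face) (F : Finset Face) :
    twiceCoupling Gᶜ F = twiceCoupling G F := by
  set n := ind (F : Set Face) with hn
  set m := ind G with hm
  set r : Fin 6 → Face → ZMod 4 := fun k f => 2 * (n f * n (f + dirVec k)) + 2 * edgeForm m n k f
    with hr
  have hq : (fun f => 2 * n f).support.Finite :=
    finite_support_of_local (F := F) fun f h0 h1 h2 h3 => by simp [hn, h0]
  have hr0 : (r 0).support.Finite :=
    finite_support_of_local (F := F) fun f h0 h1 h2 h3 => by simp [hr, hn, edgeForm, h0, h1]
  have hr2 : (r 2).support.Finite :=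
    finite_support_of_local (F := F) fun f h0 h1 h2 h3 => by simp [hr, hn, edgeForm, h0, h3]
  have h3 : (fun f => 2 * couplingDensity m n f).support.Finite :=
    finite_support_of_local (F := F) fun f h0 h1 h2 h3 => by
      simp [couplingDensity, edgeForm, cubic, hn, h0, h1, h2, h3]
  -- Replacing `m` by `1 - m` changes the density by an even function plus its translates only, and
  -- such terms sum to a multiple of four.
  have key : ∀ f, 2 * couplingDensity (ind Gᶜ) n f = 2 * couplingDensity m n f +
      ((2 * n f + 2 * n (f + dirVec 1)) + (r 0 f + r 0 (f + dirVec 2)) +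
        (r 2 f + r 2 (f + dirVec 0))) := by
    intro f
    simp only [couplingDensity, edgeForm, cubic, hr, ind_compl, ← hm,
      add_dirVec_zero_add_dirVec_two, add_dirVec_two_add_dirVec_zero]
    generalize n f = a0
    generalize m f = b0
    generalize n (f + dirVec 0) = a1
    generalize n (f + dirVec 1) = a2
    generalize n (f + dirVec 2) = a3
    generalize m (f + dirVec 0) = b1
    generalize m (f + dirVec 1) = b2
    generalize m (f + dirVec 2) = b3
    have e3 : ∀ x : ZMod 4, 3 * (x * 2) = x * 2 := by decide
    ring_nf
    reduce_mod_char
    simp only [e3]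
  have hz : ∀ u : Face → ZMod 4, (∀ f, 2 * u f = 0) → ∑ᶠ f, 2 * u f = 0 := by
    intro u hu; simp [hu]
  have e : ∀ x : ZMod 4, 2 * (2 * x) = 0 := by decide
  have hadd := @finite_support_add
  rw [twiceCoupling, twiceCoupling, finsum_congr key, finsum_add_distrib h3, finsum_add_distrib,
    finsum_add_distrib, finsum_add_shift hq, finsum_add_shift hr0, finsum_add_shift hr2, hz _ fun f => e _, hz (r 0) ?_, hz (r 2) ?_]
  · simp only [add_zero]; rfl
  · intro f; simp only [hr, ← mul_add, e]
  · intro f; simp only [hr, ← mul_add, e]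
  · exact hadd hq (finite_support_shift hq _)
  · exact hadd hr0 (finite_support_shift hr0 _)
  · exact hadd (hadd hq (finite_support_shift hq _)) (hadd hr0 (finite_support_shift hr0 _))
  · exact hadd hr2 (finite_support_shift hr2 _)
  · exact hadd (hadd (hadd hq (finite_support_shift hq _)) (hadd hr0 (finite_support_shift hr0 _)))
      (hadd hr2 (finite_support_shift hr2 _))

/-! ### The phases along a boundary -/

/-- The exponent of the phase which a semion string along the boundary of the hexagons in `m`
acquires at the final vertex of `d`, in the string configuration around the hexagons in `n`. -/
def turnExponent (m n : Face → ZMod 4) (a c b : Face) : ZMod 4 :=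
  m a * (1 - m c) * ((1 - m b) * (n b - n c) ^ 2 +
    m b * (2 * ((n a - n c) ^ 2 * (1 - (n b - n c) ^ 2))))

/-- The change of `n` on the left of the boundary of the hexagons in `m`. -/
def leftChange (m n : Face → ZMod 4) (a c b : Face) : ZMod 4 :=
  m a * (1 - m c) * (m b * (n b - n a))

/-- The three terms belong to the three oriented edges which end at a common vertex. The exponents
alone depend on the orientation of the boundary; `leftChange` repairs this and costs nothing, since
it telescopes along closed boundaries. What remains is a symmetric sum of edge terms and a cubic
term, checked on all values of the indicators. -/
theorem turnExponent_triangle {G H : Set Face} (a c b : Face) :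
    turnExponent (ind G) (ind H) a c b + turnExponent (ind G) (ind H) c b a +
      turnExponent (ind G) (ind H) b a c + (leftChange (ind G) (ind H) a c b +
      leftChange (ind G) (ind H) c b a + leftChange (ind G) (ind H) b a c) =
    (ind H a * ind G b + ind G a * ind H b + 2 * (ind H a * ind G b * ind G a * ind H b)) +
    (ind H b * ind G c + ind G b * ind H c + 2 * (ind H b * ind G c * ind G b * ind H c)) +
    (ind H c * ind G a + ind G c * ind H a + 2 * (ind H c * ind G a * ind G c * ind H a)) +
      2 * cubic (ind G) (ind H) a b c := by
  simp only [turnExponent, leftChange, cubic]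
  rcases ind_eq_zero_or_one G a with h | h <;> rcases ind_eq_zero_or_one G b with h' | h' <;>
  rcases ind_eq_zero_or_one G c with h'' | h'' <;> rcases ind_eq_zero_or_one H a with k | k <;>
  rcases ind_eq_zero_or_one H b with k' | k' <;> rcases ind_eq_zero_or_one H c with k'' | k'' <;>
  rw [h, h', h'', k, k', k''] <;> decide

/-- Oriented edges as pairs of a direction and a hexagon. -/
def dartEquiv : Fin 6 × Face ≃ Dart where
  toFun p := ⟨p.2, p.1⟩
  invFun d := (d.dir, d.left)
  left_inv _ := rfl
  right_inv _ := rfl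

theorem finsum_dart {u : Dart → ZMod 4} (hu : u.support.Finite) :
    ∑ᶠ d, u d = ∑ k : Fin 6, ∑ᶠ f : Face, u ⟨f, k⟩ := by
  have h : (fun p => u (dartEquiv p)).support.Finite := hu.preimage dartEquiv.injective.injOn
  rw [← finsum_comp_equiv dartEquiv, finsum_curry _ h, finsum_eq_sum_of_fintype]
  rfl

theorem finite_darts_of_left {S : Set Face} (hS : S.Finite) : {d : Dart | d.left ∈ S}.Finite := by
  refine ((Set.finite_univ (α := Fin 6)).prod hS |>.image dartEquiv).subset fun d hd => ?_
  exact ⟨(d.dir, d.left), ⟨trivial, hd⟩, rfl⟩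

theorem finite_darts_of_right {S : Set Face} (hS : S.Finite) :
    {d : Dart | d.right ∈ S}.Finite := by
  refine ((finite_darts_of_left hS).image Dart.reverse).subset fun d hd => ?_
  exact ⟨d.reverse, hd, d.reverse_reverse⟩

theorem finite_darts_of_ahead {S : Set Face} (hS : S.Finite) :
    {d : Dart | d.ahead ∈ S}.Finite := by
  refine ((finite_darts_of_left hS).image Dart.unturnRight).subset fun d hd => ?_
  exact ⟨d.turnRight, hd, d.unturnRight_turnRight⟩

theorem finite_support_of_dart {F : Finset Face} {u : Dart → ZMod 4}
    (h : ∀ d : Dart, ind F d.left = 0 → ind F d.right = 0 → ind F d.ahead = 0 → u d = 0) :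
    u.support.Finite := by
  refine (((finite_darts_of_left F.finite_toSet).union
    (finite_darts_of_right F.finite_toSet)).union
    (finite_darts_of_ahead F.finite_toSet)).subset fun d hd => ?_
  by_contra hcon
  simp only [Set.mem_union, Set.mem_ofPred_eq, not_or] at hcon
  exact hd (h d (ind_of_notMem hcon.1.1) (ind_of_notMem hcon.1.2) (ind_of_notMem hcon.2))

theorem leftChange_of_mem {G : Set Face} {d : Dart} (h : d ∈ boundaryDarts G)
    (n : Face → ZMod 4) :
    leftChange (ind G) n d.left d.right d.ahead = n (nextDart G d).left - n d.left := by
  rw [leftChange, ind_of_mem h.1, ind_of_notMem h.2, nextDart]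
  split_ifs with h'
  · rw [ind_of_mem h', Dart.turnRight_left]; ring
  · rw [ind_of_notMem h', Dart.turnLeft_left]; ring

theorem mul_eq_zero_of_notMem_boundaryDarts {G : Set Face} {d : Dart} (h : d ∉ boundaryDarts G)
    (x : ZMod 4) : ind G d.left * (1 - ind G d.right) * x = 0 := by
  by_cases h1 : d.left ∈ G
  · have : d.right ∈ G := by by_contra h2; exact h ⟨h1, h2⟩
    rw [ind_of_mem this]; ring
  · rw [ind_of_notMem h1]; ring

/-- Along the boundary the summand is the difference of `n` on the left of consecutive edges, and
`nextPerm` permutes these edges. -/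
theorem finsum_leftChange {G : Set Face} (hG : (boundaryDarts G).Finite) (n : Face → ZMod 4) :
    ∑ᶠ d : Dart, leftChange (ind G) n d.left d.right d.ahead = 0 := by
  have : Finite (boundaryDarts G) := hG
  have h1 : ∑ᶠ d : Dart, leftChange (ind G) n d.left d.right d.ahead =
      ∑ᶠ d ∈ boundaryDarts G, leftChange (ind G) n d.left d.right d.ahead := by
    refine finsum_congr fun d => ?_
    by_cases h : d ∈ boundaryDarts G
    · simp [h]
    · simp only [h, finsum_false]
      exact mul_eq_zero_of_notMem_boundaryDarts h _
  rw [h1, ← finsum_set_coe_eq_finsum_mem,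
    finsum_congr fun d : boundaryDarts G => leftChange_of_mem d.2 n,
    finsum_sub_distrib (Set.toFinite _) (Set.toFinite _), sub_eq_zero]
  exact finsum_comp_equiv (f := fun d : boundaryDarts G => n d.1.left) (nextPerm G)

/-- The phase collected by a closed semion string is the polarization of the sign of the state. The
sum over oriented edges is regrouped by their final vertices, where `turnExponent_triangle` applies.
-/
theorem finsum_turnExponent {G : Set Face} (hG : (boundaryDarts G).Finite) (F : Finset Face) :
    ∑ᶠ d : Dart, turnExponent (ind G) (ind F) d.left d.right d.ahead = twiceCoupling G F := by
  set n := ind (F : Set Face) with hn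
  set m := ind G with hm
  set u : Dart → ZMod 4 := fun d =>
    turnExponent m n d.left d.right d.ahead + leftChange m n d.left d.right d.ahead with hu
  have hu1 : (fun d : Dart => turnExponent m n d.left d.right d.ahead).support.Finite :=
    finite_support_of_dart (F := F) fun d h1 h2 h3 => by
      simp [turnExponent, hn, h1, h2, h3]
  have hu2 : (fun d : Dart => leftChange m n d.left d.right d.ahead).support.Finite :=
    finite_support_of_dart (F := F) fun d h1 h2 h3 => by
      simp [leftChange, hn, h1, h3]
  have hu3 : u.support.Finite := (hu1.union hu2).subset (Function.support_add _ _)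
  have hu4 : ∀ k, (fun f : Face => u ⟨f, k⟩).support.Finite := fun k =>
    hu3.preimage (f := fun f => (⟨f, k⟩ : Dart))
      (Function.Injective.injOn fun f g h => congrArg Dart.left h)
  have h1 : ∑ᶠ d : Dart, turnExponent m n d.left d.right d.ahead = ∑ᶠ d, u d := by
    rw [hu, finsum_add_distrib hu1 hu2, finsum_leftChange hG, add_zero]
  have hadd := @finite_support_add
  have hs := @finite_support_shift
  -- Each hexagon `f` accounts for two vertices. The translations give the three oriented edges
  -- ending at the same vertex the same label `f`: directions 0, 2, 4 at one vertex and 1, 3, 5 at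
  -- the other.
  rw [h1, finsum_dart hu3, Fin.sum_univ_six,
    ← finsum_shift (fun f => u ⟨f, 2⟩) (dirVec 0), ← finsum_shift (fun f => u ⟨f, 4⟩) (dirVec 1),
    ← finsum_shift (fun f => u ⟨f, 3⟩) (dirVec 1), ← finsum_shift (fun f => u ⟨f, 5⟩) (dirVec 2)]
  set ε : Fin 6 → Face → ZMod 4 := fun k f =>
    edgeForm m n k f + 2 * (n f * m (f + dirVec k) * m f * n (f + dirVec k)) with hε
  have hε0 : (ε 0).support.Finite :=
    finite_support_of_local (F := F) fun f h0 h1 h2 h3 => by simp [hε, hn, edgeForm, h0, h1]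
  have hε1 : (ε 1).support.Finite :=
    finite_support_of_local (F := F) fun f h0 h1 h2 h3 => by simp [hε, hn, edgeForm, h0, h2]
  have hε2 : (ε 2).support.Finite :=
    finite_support_of_local (F := F) fun f h0 h1 h2 h3 => by simp [hε, hn, edgeForm, h0, h3]
  have hcu : (fun f => 2 * cubic m n f (f + dirVec 1) (f + dirVec 0)).support.Finite :=
    finite_support_of_local (F := F) fun f h0 h1 h2 h3 => by simp [cubic, hn, h0, h1, h2]
  have hcd : (fun f => 2 * cubic m n f (f + dirVec 2) (f + dirVec 1)).support.Finite :=
    finite_support_of_local (F := F) fun f h0 h1 h2 h3 => by simp [cubic, hn, h0, h2, h3]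
  have key1 : ∀ f, u ⟨f, 0⟩ + u ⟨f + dirVec 0, 2⟩ + u ⟨f + dirVec 1, 4⟩ =
      ε 0 f + ε 1 f + ε 2 (f + dirVec 0) + 2 * cubic m n f (f + dirVec 1) (f + dirVec 0) := by
    intro f
    have e1 : f + dirVec 0 + dirVec 3 = f := by rw [add_assoc]; exact add_zero f
    have e2 : f + dirVec 1 + dirVec 4 = f := by rw [add_assoc]; exact add_zero f
    have e3 : f + dirVec 1 + dirVec 5 = f + dirVec 0 := by rw [add_assoc]; congr 1
    have := turnExponent_triangle (G := G) (H := F) f (f + dirVec 0) (f + dirVec 1)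
    simp only [hu, hε, edgeForm, Dart.right, Dart.ahead, add_dirVec_zero_add_dirVec_two,
      show (0 + 1 : Fin 6) = 1 from rfl, show (2 + 1 : Fin 6) = 3 from rfl,
      show (4 + 1 : Fin 6) = 5 from rfl, e1, e2, e3, ← hm, ← hn] at this ⊢
    linear_combination this
  have key2 : ∀ f, u ⟨f, 1⟩ + u ⟨f + dirVec 1, 3⟩ + u ⟨f + dirVec 2, 5⟩ =
      ε 1 f + ε 2 f + ε 0 (f + dirVec 2) + 2 * cubic m n f (f + dirVec 2) (f + dirVec 1) := by
    intro f
    have e1 : f + dirVec 1 + dirVec 3 = f + dirVec 2 := by rw [add_assoc]; congr 1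
    have e2 : f + dirVec 1 + dirVec 4 = f := by rw [add_assoc]; exact add_zero f
    have e3 : f + dirVec 2 + dirVec 5 = f := by rw [add_assoc]; exact add_zero f
    have := turnExponent_triangle (G := G) (H := F) f (f + dirVec 1) (f + dirVec 2)
    simp only [hu, hε, edgeForm, Dart.right, Dart.ahead, add_dirVec_two_add_dirVec_zero,
      show (1 + 1 : Fin 6) = 2 from rfl, show (3 + 1 : Fin 6) = 4 from rfl,
      show (5 + 1 : Fin 6) = 0 from rfl, e1, e2, e3, ← hm, ← hn] at this ⊢
    linear_combination this
  have lhs : ∀ a b c d e g : ZMod 4, a + b + c + d + e + g = (a + c + e) + (b + d + g) := by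
    intros; ring
  rw [lhs, ← finsum_add_distrib (hu4 0) (hs (hu4 2) _),
    ← finsum_add_distrib (hadd (hu4 0) (hs (hu4 2) _)) (hs (hu4 4) _),
    ← finsum_add_distrib (hu4 1) (hs (hu4 3) _),
    ← finsum_add_distrib (hadd (hu4 1) (hs (hu4 3) _)) (hs (hu4 5) _),
    finsum_congr key1, finsum_congr key2,
    finsum_add_distrib (hadd (hadd hε0 hε1) (hs hε2 _)) hcu,
    finsum_add_distrib (hadd (hadd hε1 hε2) (hs hε0 _)) hcd,
    finsum_add_distrib (hadd hε0 hε1) (hs hε2 _), finsum_add_distrib hε0 hε1,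
    finsum_add_distrib (hadd hε1 hε2) (hs hε0 _), finsum_add_distrib hε1 hε2,
    finsum_shift, finsum_shift]
  -- Every edge has two ends, so its term occurs twice. The doubling also kills the part of `ε`
  -- which already carries a factor two.
  have h4 : ∀ a b c d e : ZMod 4, a + b + c + d + (b + c + a + e) =
      (2 * a + 2 * b + 2 * c) + d + e := by intros; ring
  have hmul : ∀ {v : Face → ZMod 4}, v.support.Finite → (fun f => 2 * v f).support.Finite :=
    fun hv => hv.subset fun f hf h => hf (by simp [h])
  rw [h4, mul_finsum' _ _ hε0, mul_finsum' _ _ hε1, mul_finsum' _ _ hε2,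
    ← finsum_add_distrib (hmul hε0) (hmul hε1),
    ← finsum_add_distrib (hadd (hmul hε0) (hmul hε1)) (hmul hε2),
    ← finsum_add_distrib (hadd (hadd (hmul hε0) (hmul hε1)) (hmul hε2)) hcu,
    ← finsum_add_distrib (hadd (hadd (hadd (hmul hε0) (hmul hε1)) (hmul hε2)) hcu) hcd]
  refine finsum_congr fun f => ?_
  have e : ∀ x : ZMod 4, 2 * (2 * x) = 0 := by decide
  simp only [hε, couplingDensity, mul_add, e, ← hm, ← hn]
  simp only [cubic]
  ring

/-! ### The number of strings -/

theorem Dart.reverse_turnLeft_turnRight (d : Dart) : d.turnLeft.reverse.turnRight = d.reverse :=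
  eq_of_left_right (by simp) (by simp)

theorem Dart.reverse_turnRight_turnLeft (d : Dart) : d.turnRight.reverse.turnLeft = d.reverse :=
  eq_of_left_right (by simp) (by simp)

theorem Dart.Follows.reverse {d d' : Dart} (h : d.Follows d') : d'.reverse.Follows d.reverse := by
  rcases h with rfl | rfl
  · exact Or.inr (Dart.reverse_turnLeft_turnRight d).symm
  · exact Or.inl (Dart.reverse_turnRight_turnLeft d).symm

theorem follows_of_mem_boundaryDarts {G : Set Face} {d d' : Dart} (hd : d ∈ boundaryDarts G)
    (hf : d.Follows d') (he : d'.edge ∈ edgeBoundary G) : d' = nextDart G d := by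
  refine eq_nextDart ?_ hf
  rw [Dart.edge_mem_edgeBoundary] at he
  have h1 := hd.1
  have h2 := hd.2
  rcases hf with rfl | rfl
  · rw [Dart.turnLeft_left] at he
    exact ⟨h1, by tauto⟩
  · rw [Dart.turnRight_right] at he
    refine ⟨by tauto, by rwa [Dart.turnRight_right]⟩

theorem nextDart_ne (G : Set Face) (d : Dart) : nextDart G d ≠ d := by
  intro h
  have h' : (nextDart G d).dir = d.dir := by rw [h]
  revert h'
  unfold nextDart
  split_ifs
  · show d.dir - 1 ≠ d.dir
    generalize d.dir = k; revert k; decide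
  · show d.dir + 1 ≠ d.dir
    generalize d.dir = k; revert k; decide

theorem finite_boundaryDarts (F : Finset Face) : (boundaryDarts (F : Set Face)).Finite :=
  (finite_darts_of_left F.finite_toSet).subset fun _ h => h.1

instance (F : Finset Face) : Finite (boundaryDarts (F : Set Face)) := finite_boundaryDarts F

/-- The oriented boundary edge over a boundary edge. -/
def boundaryEquiv (F : Finset Face) :
    boundaryDarts (F : Set Face) ≃ ((boundary F : Finset Edge) : Set Edge) :=
  Equiv.ofBijective (fun d => ⟨d.1.edge, mem_boundary.2 (edge_mem_edgeBoundary_of_mem d.2)⟩) (by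
    constructor
    · intro d d' h
      exact Subtype.ext (edge_injOn_boundaryDarts _ d.2 d'.2 (congrArg Subtype.val h))
    · rintro ⟨e, he⟩
      obtain ⟨d, hd, rfl⟩ := exists_boundaryDart (mem_boundary.1 he)
      exact ⟨⟨d, hd⟩, rfl⟩)

/-- Adjacency of edges is witnessed by oriented edges of arbitrary orientation. Either both agree
with the orientation of the boundary or both are opposite to it; a mixed choice would put one
hexagon both inside and outside `F`. -/
theorem sameCycle_of_follows {F : Finset Face} {x y : boundaryDarts (F : Set Face)} {d d' : Dart}
    (hd : d.edge = x.1.edge) (hd' : d'.edge = y.1.edge) (h : d.Follows d') :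
    (nextPerm (F : Set Face)).SameCycle x y := by
  have hx := edge_mem_edgeBoundary_of_mem x.2
  have hy := edge_mem_edgeBoundary_of_mem y.2
  rcases Dart.edge_eq_iff.1 hd with rfl | rfl
  · have h1 := follows_of_mem_boundaryDarts x.2 h (hd' ▸ hy)
    have : y = nextPerm _ x := Subtype.ext (edge_injOn_boundaryDarts _ y.2 (nextDart_mem x.2)
      (by rw [← hd', h1]; rfl))
    rw [this]
    exact Equiv.Perm.sameCycle_apply_right.2 (Equiv.Perm.SameCycle.refl _ _)
  · have h0 := h.reverse
    rw [Dart.reverse_reverse] at h0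
    have h2 : d'.reverse ∈ boundaryDarts (F : Set Face) := by
      rcases Dart.edge_eq_iff.1 hd' with rfl | rfl
      · exfalso
        have hx1 := x.2.1
        have hx2 := x.2.2
        have hy1 := y.2.1
        have hy2 := y.2.2
        rcases h0 with h0 | h0
        · rw [h0, Dart.turnLeft_left, Dart.reverse_left] at hx1
          exact hy2 hx1
        · rw [h0, Dart.turnRight_right, Dart.reverse_right] at hx2
          exact hx2 hy1
      · rw [Dart.reverse_reverse]; exact y.2
    have h1 := follows_of_mem_boundaryDarts h2 h0 hx
    have h3 : y.1 = d'.reverse := edge_injOn_boundaryDarts _ y.2 h2 (by rw [← hd', Dart.edge_reverse])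
    have : x = nextPerm _ y := Subtype.ext (by rw [h1, ← h3]; rfl)
    rw [this]
    exact Equiv.Perm.sameCycle_apply_left.2 (Equiv.Perm.SameCycle.refl _ _)

/-- Loops become cycles of the boundary permutation, and the parity of their number can be read off
from its sign. -/
theorem numStrings_boundary (F : Finset Face) : numStrings (boundary F) =
    Nat.card (Quotient (Equiv.Perm.SameCycle.setoid (nextPerm (F : Set Face)))) := by
  set G := edgeGraph.induce ((boundary F : Finset Edge) : Set Edge) with hG
  set σ := nextPerm (F : Set Face) with hσ
  have h1 : ∀ x y, σ.SameCycle x y → G.Reachable (boundaryEquiv F x) (boundaryEquiv F y) := by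
    intro x y h
    obtain ⟨i, -, rfl⟩ := h.exists_pow_eq'
    induction i with
    | zero => exact SimpleGraph.Reachable.refl _
    | succ i ih =>
      refine (ih ⟨i, by simp⟩).trans (SimpleGraph.Adj.reachable ?_)
      rw [pow_succ', Equiv.Perm.mul_apply]
      set z := (σ ^ i) x
      rw [hG, SimpleGraph.comap_adj, edgeGraph, SimpleGraph.fromRel_adj]
      refine ⟨fun h => ?_, Or.inl ⟨z.1, nextDart F z.1, rfl, rfl, follows_nextDart _ _⟩⟩
      exact nextDart_ne F z.1 (edge_injOn_boundaryDarts _ (nextDart_mem z.2) z.2 h.symm)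
  have h2 : ∀ x y, G.Reachable (boundaryEquiv F x) (boundaryEquiv F y) → σ.SameCycle x y := by
    intro x y h
    rw [SimpleGraph.reachable_iff_reflTransGen] at h
    suffices ∀ z, Relation.ReflTransGen G.Adj (boundaryEquiv F x) z →
        σ.SameCycle x ((boundaryEquiv F).symm z) by
      simpa using this _ h
    intro z hz
    induction hz with
    | refl => simpa using Equiv.Perm.SameCycle.refl _ _
    | @tail b c _ hbc ih =>
      refine ih.trans ?_
      obtain ⟨b, rfl⟩ := (boundaryEquiv F).surjective b
      obtain ⟨c, rfl⟩ := (boundaryEquiv F).surjective c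
      simp only [Equiv.symm_apply_apply]
      rw [hG, SimpleGraph.comap_adj, edgeGraph, SimpleGraph.fromRel_adj] at hbc
      rcases hbc.2 with ⟨d, d', h1, h2, h3⟩ | ⟨d, d', h1, h2, h3⟩
      · exact sameCycle_of_follows h1 h2 h3
      · exact (sameCycle_of_follows h1 h2 h3).symm
  refine (Nat.card_congr (Equiv.ofBijective (Quotient.lift
    (fun x => G.connectedComponentMk (boundaryEquiv F x)) fun x y h =>
      SimpleGraph.ConnectedComponent.eq.2 (h1 x y h)) ⟨?_, ?_⟩)).symm
  · rintro ⟨x⟩ ⟨y⟩ h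
    exact Quotient.sound (h2 x y (SimpleGraph.ConnectedComponent.eq.1 h))
  · intro c
    obtain ⟨v, rfl⟩ := c.exists_rep
    obtain ⟨x, rfl⟩ := (boundaryEquiv F).surjective v
    exact ⟨⟦x⟧, rfl⟩

/-- A cycle of length `k` has sign `(-1) ^ (k + 1)`. Without fixed points the cycle type accounts
for all orbits. -/
theorem sign_eq_of_forall_ne {α : Type*} [Fintype α] [DecidableEq α] (σ : Equiv.Perm α)
    (h : ∀ x, σ x ≠ x) : Equiv.Perm.sign σ =
      (-1) ^ (Fintype.card α + Nat.card (Quotient (Equiv.Perm.SameCycle.setoid σ))) := by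
  rw [Equiv.Perm.sign_of_cycleType, Equiv.Perm.sum_cycleType]
  have hsupp : σ.support = Finset.univ := by ext; simp [h]
  congr 2
  · rw [hsupp, Finset.card_univ]
  · rw [Equiv.Perm.cycleType_def, Multiset.card_map, Finset.card_val, ← Nat.card_eq_finsetCard]
    refine (Nat.card_congr (Equiv.ofBijective (Quotient.lift (fun x =>
      (⟨σ.cycleOf x, Equiv.Perm.cycleOf_mem_cycleFactorsFinset_iff.2 (by simp [hsupp])⟩ :
        σ.cycleFactorsFinset)) fun x y hxy => ?_) ⟨?_, ?_⟩)).symm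
    · exact Subtype.ext (Equiv.Perm.SameCycle.cycleOf_eq hxy)
    · rintro ⟨x⟩ ⟨y⟩ hxy
      exact Quotient.sound ((Equiv.Perm.sameCycle_iff_cycleOf_eq_of_mem_support
        (by simp [hsupp]) (by simp [hsupp])).2 (congrArg Subtype.val hxy))
    · rintro ⟨c, hc⟩
      obtain ⟨x, hx⟩ := (Equiv.Perm.mem_cycleFactorsFinset_iff.1 hc).1.nonempty_support
      exact ⟨⟦x⟧, Subtype.ext (Equiv.Perm.cycle_is_cycleOf hx hc).symm⟩

/-! ### Adding one hexagon: the change of the boundary permutation and of the number of loops. -/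

/-- The six edges of a hexagon. -/
def sideDart (h : Face) (j : Fin 6) : Dart := ⟨h, j⟩

/-- The six edges pointing away from a hexagon. -/
def spokeDart (h : Face) (j : Fin 6) : Dart := (sideDart h (j - 1)).turnRight

@[simp] theorem sideDart_left (h : Face) (j : Fin 6) : (sideDart h j).left = h := rfl
@[simp] theorem sideDart_right (h : Face) (j : Fin 6) :
    (sideDart h j).right = h + dirVec j := rfl
@[simp] theorem sideDart_ahead (h : Face) (j : Fin 6) :
    (sideDart h j).ahead = h + dirVec (j + 1) := rfl
@[simp] theorem sideDart_behind (h : Face) (j : Fin 6) :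
    (sideDart h j).behind = h + dirVec (j - 1) := rfl
@[simp] theorem spokeDart_left (h : Face) (j : Fin 6) :
    (spokeDart h j).left = h + dirVec j := by simp [spokeDart]
@[simp] theorem spokeDart_right (h : Face) (j : Fin 6) :
    (spokeDart h j).right = h + dirVec (j - 1) := by simp [spokeDart]
@[simp] theorem spokeDart_behind (h : Face) (j : Fin 6) : (spokeDart h j).behind = h := by
  simp [spokeDart]

theorem eq_sideDart {d : Dart} {h : Face} (hd : d.left = h) : ∃ j, d = sideDart h j :=
  ⟨d.dir, Dart.ext hd rfl⟩

/-- The edges of a hexagon and the edges pointing away from it. -/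
def hexStar (h : Face) (p : Fin 6 × Bool) : Edge :=
  if p.2 then (spokeDart h p.1).edge else (sideDart h p.1).edge

/-- The six sides and the six spokes are twelve different edges, so permutations of their labels can
be transported to permutations of edges. -/
theorem hexStar_injective (h : Face) : Function.Injective (hexStar h) := by
  have key : ∀ j k, (sideDart h j).edge ≠ (spokeDart h k).edge := by
    intro j k hjk
    rcases Dart.edge_eq_iff.1 hjk with h' | h'
    · have := congrArg Dart.left h'
      simp [dirVec_ne_zero] at this
    · have := congrArg Dart.left h'
      simp [dirVec_ne_zero] at this
  rintro ⟨j, b⟩ ⟨k, c⟩ hjk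
  cases b <;> cases c <;> simp only [hexStar, if_true, if_false, Bool.false_eq_true] at hjk
  · rcases Dart.edge_eq_iff.1 hjk with h' | h'
    · rw [show j = k from congrArg Dart.dir h']
    · have := congrArg Dart.left h'
      simp [dirVec_ne_zero] at this
  · exact absurd hjk (key _ _)
  · exact absurd hjk.symm (key _ _)
  · rcases Dart.edge_eq_iff.1 hjk with h' | h'
    · have := congrArg Dart.left h'
      simp only [spokeDart_left, add_right_inj] at this
      rw [dirVec_injective this]
    · exfalso
      have h1 := congrArg Dart.left h'
      have h2 := congrArg Dart.right h'
      simp only [spokeDart_left, spokeDart_right, add_right_inj, Dart.reverse_left,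
        Dart.reverse_right] at h1 h2
      have h1 := dirVec_injective h1
      have h2 := dirVec_injective h2
      clear hjk h' key
      revert j k
      decide

/-- The permutation of the edges of `T` along the oriented boundary of `F`. -/
def edgePerm (T : Finset Edge) (F : Finset Face) (hT : boundary F ⊆ T) : Equiv.Perm T :=
  (nextPerm (F : Set Face)).extendDomain (p := fun x : T => x.1 ∈ boundary F)
    ((boundaryEquiv F).trans ⟨fun x => ⟨⟨x.1, hT x.2⟩, x.2⟩, fun x => ⟨x.1.1, x.2⟩,
      fun _ => rfl, fun _ => rfl⟩)

theorem sign_edgePerm (T : Finset Edge) (F : Finset Face) (hT : boundary F ⊆ T)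
    [Fintype (boundaryDarts (F : Set Face))] [DecidableEq (boundaryDarts (F : Set Face))] :
    Equiv.Perm.sign (edgePerm T F hT) = Equiv.Perm.sign (nextPerm (F : Set Face)) :=
  Equiv.Perm.sign_extendDomain _ _

theorem edgePerm_of_mem {T : Finset Edge} {F : Finset Face} (hT : boundary F ⊆ T) {x : T}
    {d : Dart} (hd : d ∈ boundaryDarts (F : Set Face)) (hx : x.1 = d.edge) :
    (edgePerm T F hT x : Edge) = (nextDart F d).edge := by
  have : x = ((boundaryEquiv F).trans ⟨fun x => ⟨⟨x.1, hT x.2⟩, x.2⟩, fun x => ⟨x.1.1, x.2⟩,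
      fun _ => rfl, fun _ => rfl⟩ : _ ≃ {x : T // x.1 ∈ boundary F}) ⟨d, hd⟩ := Subtype.ext hx
  rw [this, edgePerm, Equiv.Perm.extendDomain_apply_image]
  rfl

theorem edgePerm_of_notMem {T : Finset Edge} {F : Finset Face} (hT : boundary F ⊆ T) {x : T}
    (hx : x.1 ∉ boundary F) : edgePerm T F hT x = x :=
  Equiv.Perm.extendDomain_apply_not_subtype _ _ hx

open Classical in
/-- The permutation of the edges around a hexagon which describes the change of the oriented
boundary when the hexagon is added. -/
def togglePerm (F : Finset Face) (h : Face) : Equiv.Perm (Fin 6 × Bool) :=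
  (Equiv.prodCongrRight (fun j : Fin 6 =>
    if h + dirVec (j - 1) ∉ F ∧ h + dirVec j ∈ F then Equiv.swap false true else
      (1 : Equiv.Perm Bool)) : Equiv.Perm (Fin 6 × Bool)) *
  (Equiv.prodCongrLeft (fun b : Bool =>
    if b then (1 : Equiv.Perm (Fin 6)) else finRotate 6) : Equiv.Perm (Fin 6 × Bool))

open Classical in
theorem sign_togglePerm (F : Finset Face) (h : Face) : Equiv.Perm.sign (togglePerm F h) =
    -∏ j : Fin 6, (if h + dirVec (j - 1) ∉ F ∧ h + dirVec j ∈ F then (-1 : ℤˣ) else 1) := by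
  rw [togglePerm, Equiv.Perm.sign_mul, Equiv.Perm.sign_prodCongrRight,
    Equiv.Perm.sign_prodCongrLeft]
  have : ∏ b : Bool, Equiv.Perm.sign (if b then (1 : Equiv.Perm (Fin 6)) else finRotate 6) = -1 := by
    rw [Fintype.prod_bool]
    simp only [if_true, Bool.false_eq_true, if_false, sign_finRotate, Equiv.Perm.sign_one]
    decide
  rw [this, mul_neg_one]
  congr 1
  refine Finset.prod_congr rfl fun j _ => ?_
  split_ifs
  · exact Equiv.Perm.sign_swap (by decide)
  · exact Equiv.Perm.sign_one

theorem togglePerm_side {F : Finset Face} {h : Face} {j : Fin 6} :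
    togglePerm F h (j, false) =
      (j + 1, open Classical in decide (h + dirVec j ∉ F ∧ h + dirVec (j + 1) ∈ F)) := by
  simp only [togglePerm, Equiv.Perm.mul_apply, Equiv.prodCongrLeft_apply, Bool.false_eq_true,
    if_false, finRotate_apply, Equiv.prodCongrRight_apply, add_sub_cancel_right]
  split_ifs with h' <;> simp [h']

theorem togglePerm_spoke {F : Finset Face} {h : Face} {j : Fin 6} :
    togglePerm F h (j, true) =
      (j, open Classical in !decide (h + dirVec (j - 1) ∉ F ∧ h + dirVec j ∈ F)) := by
  simp only [togglePerm, Equiv.Perm.mul_apply, Equiv.prodCongrLeft_apply,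
    if_true, Equiv.prodCongrRight_apply, Equiv.Perm.one_apply]
  split_ifs with h' <;> simp [h']

/-- Both boundary permutations are extended by the identity to a common finite set `T`, where they
can be compared. They differ only around `h`: the six sides are rotated, and at each place where a
run of neighbours in `F` begins, a side is exchanged with the spoke on which the old boundary left
the hexagon. -/
theorem edgePerm_insert {T : Finset Edge} {F : Finset Face} {h : Face} (hh : h ∉ F)
    (hT : boundary F ⊆ T) (hT' : boundary (insert h F) ⊆ T) (ι : Fin 6 × Bool ↪ T)
    (hι : ∀ p, (ι p : Edge) = hexStar h p) :
    edgePerm T (insert h F) hT' = (togglePerm F h).viaFintypeEmbedding ι * edgePerm T F hT := by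
  classical
  have hside : ∀ j, (ι (j, false) : Edge) = (sideDart h j).edge := fun j => hι _
  have hspoke : ∀ j, (ι (j, true) : Edge) = (spokeDart h j).edge := fun j => hι _
  have hr : ∀ x : T, (∀ j, x.1 ≠ (sideDart h j).edge) → (∀ j, x.1 ≠ (spokeDart h j).edge) →
      (togglePerm F h).viaFintypeEmbedding ι x = x := by
    intro x h1 h2
    refine Equiv.Perm.viaFintypeEmbedding_apply_notMem_range _ _ ?_
    rintro ⟨⟨j, b⟩, rfl⟩
    cases b
    · exact h1 j (hside j)
    · exact h2 j (hspoke j)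
  have himg := fun p => (togglePerm F h).viaFintypeEmbedding_apply_image ι p
  have hneigh : ∀ k, h + dirVec k ∈ insert h F ↔ h + dirVec k ∈ F := by
    intro k; simp [dirVec_ne_zero]
  have hSr : ∀ j, (sideDart h j).reverse.turnRight = (sideDart h (j - 1)).reverse := fun j =>
    Dart.eq_of_left_right (by simp) (by simp)
  have hSl : ∀ j, (sideDart h j).reverse.turnLeft = spokeDart h j := fun j =>
    Dart.eq_of_left_right (by simp) (by simp)
  have hSr' : ∀ j, (sideDart h j).turnRight = spokeDart h (j + 1) := fun j => by
    rw [spokeDart, add_sub_cancel_right]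
  have hSl' : ∀ j, (sideDart h j).turnLeft = sideDart h (j + 1) := fun j => rfl
  ext1 x
  rw [Equiv.Perm.mul_apply]
  by_cases hx : x.1 ∈ boundary F
  · obtain ⟨d, hd, hdx⟩ := exists_boundaryDart (mem_boundary.1 hx)
    have hlh : d.left ≠ h := fun h' => hh (h' ▸ hd.1)
    have hE : (edgePerm T F hT x : Edge) = (nextDart F d).edge := edgePerm_of_mem hT hd hdx.symm
    -- If `h` is on the right, then `x` is a side of `h` shared with `F`. It leaves the boundary, so
    -- the new permutation has to fix it.
    by_cases hrh : d.right = h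
    · obtain ⟨j, hj⟩ := eq_sideDart (d := d.reverse) (h := h) hrh
      obtain rfl : d = (sideDart h j).reverse := by rw [← hj, Dart.reverse_reverse]
      have hj' : h + dirVec j ∈ F := hd.1
      have hx' : x.1 ∉ boundary (insert h F) := by
        rw [← hdx, Dart.edge_reverse, mem_boundary, Dart.edge_mem_edgeBoundary]
        simp [hj']
      have hxj : x = ι (j, false) := Subtype.ext (by rw [hside, ← hdx, Dart.edge_reverse])
      rw [edgePerm_of_notMem hT' hx']
      unfold nextDart at hE
      split_ifs at hE with ha
      · rw [hSr, Dart.edge_reverse] at hE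
        have : edgePerm T F hT x = ι (j - 1, false) := Subtype.ext (by rw [hE, hside])
        have ha' : h + dirVec (j - 1) ∈ F := by simpa using ha
        rw [this, himg, togglePerm_side, sub_add_cancel, hxj]
        simp [ha']
      · rw [hSl] at hE
        have : edgePerm T F hT x = ι (j, true) := Subtype.ext (by rw [hE, hspoke])
        have ha' : h + dirVec (j - 1) ∉ F := by simpa using ha
        rw [this, himg, togglePerm_spoke, hxj]
        simp [ha', hj']
    · have hd' : d ∈ boundaryDarts ((insert h F : Finset Face) : Set Face) :=
        ⟨Finset.mem_coe.2 (Finset.mem_insert_of_mem hd.1), by simpa [hrh] using hd.2⟩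
      have hE' : (edgePerm T (insert h F) hT' x : Edge) = (nextDart (insert h F : Finset Face) d).edge :=
        edgePerm_of_mem hT' hd' hdx.symm
      -- Here the boundary runs into `h`: before, it turned left along one side of `h`; afterwards
      -- it turns right along the next side.
      by_cases hah : d.ahead = h
      · obtain ⟨j, hj⟩ := eq_sideDart (d := d.turnLeft.reverse) (h := h) hah
        have hjt : d.turnLeft = (sideDart h j).reverse := by rw [← hj, Dart.reverse_reverse]
        have hright : d.right = h + dirVec (j + 1) := by
          rw [← Dart.turnLeft_behind, hjt, Dart.reverse_behind, sideDart_ahead]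
        rw [nextDart, if_neg (by rw [hah]; exact hh), hjt, Dart.edge_reverse] at hE
        rw [nextDart, if_pos (by simp [hah])] at hE'
        have hR : d.turnRight = sideDart h (j + 1) :=
          Dart.eq_of_left_right (by simp [hah]) (by simp [hright])
        rw [hR] at hE'
        have : edgePerm T F hT x = ι (j, false) := Subtype.ext (by rw [hE, hside])
        have hn : h + dirVec (j + 1) ∉ F := by rw [← hright]; exact hd.2
        rw [this, himg, togglePerm_side]
        refine Subtype.ext ?_
        rw [hE']
        simp [hn, hside]
      · have hnext : nextDart (insert h F : Finset Face) d = nextDart F d := by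
          simp [nextDart, hah]
        rw [hnext] at hE'
        set d' := nextDart (F : Set Face) d with hd'def
        have hd'm : d' ∈ boundaryDarts (F : Set Face) := nextDart_mem hd
        have hfaces : d'.left ≠ h ∧ d'.right ≠ h ∧ d'.behind ≠ h := by
          rw [hd'def]
          unfold nextDart
          split_ifs
          · simp [hah, hrh, hlh]
          · simp [hah, hrh, hlh]
        have e1 : ∀ j, d'.edge ≠ (sideDart h j).edge := by
          intro j hj
          rcases Dart.edge_eq_iff.1 hj with h' | h'
          · exact hfaces.1 (by rw [h']; rfl)
          · exact hfaces.2.1 (by rw [h']; simp)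
        refine Subtype.ext ?_
        rw [hE', ← hE]
        by_cases e2 : ∃ j, d'.edge = (spokeDart h j).edge
        · obtain ⟨j, hj⟩ := e2
          have : edgePerm T F hT x = ι (j, true) := Subtype.ext (by rw [hE, hj, hspoke])
          have hin : h + dirVec (j - 1) ∈ F := by
            rcases Dart.edge_eq_iff.1 hj with h' | h'
            · exact absurd (by rw [h']; simp) hfaces.2.2
            · have := hd'm.1
              rw [h'] at this
              simpa using this
          rw [this, himg, togglePerm_spoke]
          simp [hin]
        · push Not at e2
          rw [hr _ (fun j => by rw [hE]; exact e1 j) (fun j => by rw [hE]; exact e2 j)]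
  · rw [edgePerm_of_notMem hT hx]
    by_cases e1 : ∃ j, x.1 = (sideDart h j).edge
    · obtain ⟨j, hj⟩ := e1
      have hjF : h + dirVec j ∉ F := by
        intro h'
        refine hx ?_
        rw [hj, mem_boundary, Dart.edge_mem_edgeBoundary]
        simp [hh, h']
      have hxj : x = ι (j, false) := Subtype.ext (by rw [hside, hj])
      have hd : sideDart h j ∈ boundaryDarts ((insert h F : Finset Face) : Set Face) :=
        ⟨by simp, by simp [hjF, dirVec_ne_zero]⟩
      have hE' := edgePerm_of_mem hT' hd hj
      refine Subtype.ext ?_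
      rw [hE', hxj, himg, togglePerm_side]
      unfold nextDart
      split_ifs with ha
      · rw [hSr']
        have : h + dirVec (j + 1) ∈ F := by simpa [dirVec_ne_zero] using ha
        simp [this, hjF, hspoke]
      · rw [hSl']
        have : h + dirVec (j + 1) ∉ F := by simpa [dirVec_ne_zero] using ha
        simp [this, hside]
    · push Not at e1
      have hx' : x.1 ∉ boundary (insert h F) := by
        obtain ⟨d, hd⟩ := x.1.eq_dart_edge
        have hl : d.left ≠ h := fun h' => by
          obtain ⟨j, rfl⟩ := eq_sideDart h'
          exact e1 j hd.symm
        have hrt : d.right ≠ h := fun h' => by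
          obtain ⟨j, hj⟩ := eq_sideDart (d := d.reverse) h'
          exact e1 j (by rw [← hd, ← hj, Dart.edge_reverse])
        rw [← hd, mem_boundary, Dart.edge_mem_edgeBoundary]
        rw [← hd, mem_boundary, Dart.edge_mem_edgeBoundary] at hx
        simpa [hl, hrt] using hx
      rw [edgePerm_of_notMem hT' hx']
      by_cases e2 : ∃ j, x.1 = (spokeDart h j).edge
      · obtain ⟨j, hj⟩ := e2
        have hxj : x = ι (j, true) := Subtype.ext (by rw [hspoke, hj])
        have hnot : ¬ (h + dirVec (j - 1) ∉ F ∧ h + dirVec j ∈ F) := by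
          rw [hj, mem_boundary, Dart.edge_mem_edgeBoundary] at hx
          simp only [spokeDart_left, spokeDart_right, Finset.mem_coe] at hx
          tauto
        rw [hxj, himg, togglePerm_spoke]
        simp only [hnot, decide_false, Bool.not_false]
      · push Not at e2
        exact (hr x e1 e2).symm

open Classical in
/-- The number of maximal runs of hexagons of `F` around the hexagon `h`. -/
def numRuns (F : Finset Face) (h : Face) : ℕ :=
  (Finset.univ.filter fun j : Fin 6 => h + dirVec (j - 1) ∉ F ∧ h + dirVec j ∈ F).card

/-- The boundary changes by the symmetric difference with the six sides of `h`, so the parity of its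
length is preserved. -/
theorem card_boundary_insert {F : Finset Face} {h : Face} (hh : h ∉ F) :
    Even ((boundary (insert h F)).card + (boundary F).card) := by
  classical
  set E := Finset.univ.image fun j : Fin 6 => (sideDart h j).edge with hE
  have hcard : E.card = 6 := by
    rw [hE, Finset.card_image_of_injective]
    · simp
    · intro j k hjk
      have := hexStar_injective h (a₁ := (j, false)) (a₂ := (k, false)) hjk
      simpa using this
  have hsd : boundary (insert h F) = symmDiff (boundary F) E := by
    ext e
    rw [Finset.mem_symmDiff]
    obtain ⟨d, rfl⟩ := e.eq_dart_edge
    have hmem : d.edge ∈ E ↔ (d.left = h ∨ d.right = h) := by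
      simp only [hE, Finset.mem_image, Finset.mem_univ, true_and]
      constructor
      · rintro ⟨j, hj⟩
        rcases Dart.edge_eq_iff.1 hj with h' | h'
        · left; rw [← h']; rfl
        · right; rw [← Dart.reverse_left, ← h']; rfl
      · rintro (h' | h')
        · obtain ⟨j, rfl⟩ := eq_sideDart h'
          exact ⟨j, rfl⟩
        · obtain ⟨j, hj⟩ := eq_sideDart (d := d.reverse) h'
          exact ⟨j, by rw [← hj, Dart.edge_reverse]⟩
    have hne := d.left_ne_right
    rw [hmem, mem_boundary, mem_boundary, Dart.edge_mem_edgeBoundary, Dart.edge_mem_edgeBoundary,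
      Finset.mem_coe, Finset.mem_coe, Finset.mem_coe, Finset.mem_coe, Finset.mem_insert,
      Finset.mem_insert]
    by_cases h1 : d.left = h
    · have h2 : d.right ≠ h := fun h2 => hne (h1.trans h2.symm)
      simp [h1, h2, hh]
    · by_cases h2 : d.right = h
      · simp [h1, h2, hh]
      · simp [h1, h2]
  rw [hsd, symmDiff_def, Finset.sup_eq_union, Finset.card_union_of_disjoint disjoint_sdiff_sdiff]
  have h1 := Finset.card_sdiff_add_card_inter (boundary F) E
  have h2 := Finset.card_sdiff_add_card_inter E (boundary F)
  rw [Finset.inter_comm] at h2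
  rw [hcard] at h2
  exact ⟨(boundary F).card + 3 - (boundary F ∩ E).card, by omega⟩

/-- Compare signs in `edgePerm_insert`: the rotation of six sides is odd, every run gives one
transposition, and the numbers of boundary edges agree modulo two. Only the numbers of cycles are
left. -/
theorem parity_numStrings_insert {F : Finset Face} {h : Face} (hh : h ∉ F) :
    Even (numStrings (boundary (insert h F)) + (numStrings (boundary F) + numRuns F h + 1)) := by
  classical
  set T : Finset Edge := boundary F ∪ boundary (insert h F) ∪ Finset.univ.image (hexStar h) with hTdef
  have hT : boundary F ⊆ T := fun e he => by simp [hTdef, he]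
  have hT' : boundary (insert h F) ⊆ T := fun e he => by simp [hTdef, he]
  let ι : Fin 6 × Bool ↪ T := ⟨fun p => ⟨hexStar h p, by
    simp only [hTdef, Finset.mem_union, Finset.mem_image, Finset.mem_univ, true_and]
    exact Or.inr ⟨p, rfl⟩⟩, fun p q hpq => hexStar_injective h (congrArg Subtype.val hpq)⟩
  have := Fintype.ofFinite (boundaryDarts (F : Set Face))
  have := Fintype.ofFinite (boundaryDarts ((insert h F : Finset Face) : Set Face))
  have key := congrArg Equiv.Perm.sign (edgePerm_insert hh hT hT' ι fun p => rfl)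
  rw [Equiv.Perm.sign_mul, sign_edgePerm, sign_edgePerm, Equiv.Perm.viaFintypeEmbedding_sign,
    sign_togglePerm, sign_eq_of_forall_ne _ fun x hx => nextDart_ne _ _ (congrArg Subtype.val hx),
    sign_eq_of_forall_ne _ fun x hx => nextDart_ne _ _ (congrArg Subtype.val hx),
    ← numStrings_boundary, ← numStrings_boundary] at key
  have hcard : ∀ F : Finset Face, ∀ [Fintype (boundaryDarts (F : Set Face))],
      Fintype.card (boundaryDarts (F : Set Face)) = (boundary F).card := by
    intro F _
    rw [Fintype.card_congr (boundaryEquiv F)]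
    simp
  rw [hcard, hcard, Finset.prod_ite, Finset.prod_const_one, mul_one, Finset.prod_const] at key
  change _ = -(-1 : ℤˣ) ^ numRuns F h * _ at key
  have hev := card_boundary_insert hh
  have key2 : (-1 : ℤˣ) ^ ((boundary (insert h F)).card + numStrings (boundary (insert h F)) +
      (numRuns F h + 1 + ((boundary F).card + numStrings (boundary F)))) = 1 := by
    rw [pow_add, key, pow_add _ (numRuns F h + 1), pow_succ, mul_neg_one, ← pow_two]
    exact Int.units_sq _
  have h3 := (neg_one_pow_eq_one_iff_even (R := ℤˣ) (by decide)).1 key2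
  rw [Nat.even_iff] at h3 hev ⊢
  omega

theorem twiceEuler_singleton (h : Face) : twiceEuler {h} = 2 := by
  rw [twiceEuler, finsum_eq_single _ h]
  · have : ∀ k, ind (({h} : Finset Face) : Set Face) (h + dirVec k) = 0 := fun k =>
      ind_of_notMem (by simp [dirVec_ne_zero])
    rw [eulerDensity, this, this, this, ind_of_mem (by simp)]
    decide
  · intro f hf
    rw [eulerDensity, ind_of_notMem (by simpa using hf)]
    ring

/-- By `finsum_turnExponent` the coupling counts the changes of the indicator of `F` around the six
neighbours of `h`, and each run has a beginning and an end. -/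
theorem twiceCoupling_singleton (F : Finset Face) (h : Face) :
    twiceCoupling (({h} : Finset Face) : Set Face) F = 2 * (numRuns F h : ZMod 4) := by
  classical
  set n := ind (F : Set Face) with hn
  have h1 : ∀ j, turnExponent (ind (({h} : Finset Face) : Set Face)) n h (h + dirVec j)
      (h + dirVec (j + 1)) = (n (h + dirVec (j + 1)) - n (h + dirVec j)) ^ 2 := by
    intro j
    have : ∀ k, ind (({h} : Finset Face) : Set Face) (h + dirVec k) = 0 := fun k =>
      ind_of_notMem (by simp [dirVec_ne_zero])
    rw [turnExponent, this, this, ind_of_mem (by simp)]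
    ring
  have h2 : ∑ᶠ d : Dart, turnExponent (ind (({h} : Finset Face) : Set Face)) n d.left d.right d.ahead
      = ∑ j : Fin 6, (n (h + dirVec (j + 1)) - n (h + dirVec j)) ^ 2 := by
    rw [finsum_eq_finsetSum_of_support_subset (s := Finset.univ.image (sideDart h))]
    · rw [Finset.sum_image fun j _ k _ hjk => congrArg Dart.dir hjk]
      exact Finset.sum_congr rfl fun j _ => h1 j
    · intro d hd
      by_contra hcon
      refine hd ?_
      have : d.left ≠ h := fun h' => hcon (by
        obtain ⟨j, rfl⟩ := eq_sideDart h'; simp)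
      show turnExponent _ _ _ _ _ = 0
      rw [turnExponent, ind_of_notMem (by simpa using this)]
      ring
  rw [← finsum_turnExponent (finite_boundaryDarts _), h2, numRuns, Finset.card_filter]
  have h3 : ∀ j, ((if h + dirVec (j - 1) ∉ F ∧ h + dirVec j ∈ F then 1 else 0 : ℕ) : ZMod 4) =
      (1 - n (h + dirVec (j - 1))) * n (h + dirVec j) := by
    intro j
    by_cases h1 : h + dirVec (j - 1) ∈ F <;> by_cases h2 : h + dirVec j ∈ F <;>
      simp [hn, ind, h1, h2]
  rw [Nat.cast_sum, Finset.sum_congr rfl fun j _ => h3 j]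
  have h4 := fun j => ind_eq_zero_or_one (F : Set Face) (h + dirVec j)
  rw [← hn] at h4
  rw [Fin.sum_univ_six, Fin.sum_univ_six]
  simp only [show (0 - 1 : Fin 6) = 5 from rfl, show (1 - 1 : Fin 6) = 0 from rfl,
    show (2 - 1 : Fin 6) = 1 from rfl, show (3 - 1 : Fin 6) = 2 from rfl,
    show (4 - 1 : Fin 6) = 3 from rfl, show (5 - 1 : Fin 6) = 4 from rfl,
    show (0 + 1 : Fin 6) = 1 from rfl, show (1 + 1 : Fin 6) = 2 from rfl,
    show (2 + 1 : Fin 6) = 3 from rfl, show (3 + 1 : Fin 6) = 4 from rfl,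
    show (4 + 1 : Fin 6) = 5 from rfl, show (5 + 1 : Fin 6) = 0 from rfl]
  rcases h4 0 with e | e <;> rcases h4 1 with e' | e' <;> rcases h4 2 with e'' | e'' <;>
    rcases h4 3 with k | k <;> rcases h4 4 with k' | k' <;> rcases h4 5 with k'' | k'' <;>
    rw [e, e', e'', k, k', k''] <;> decide

theorem twiceEuler_empty : twiceEuler ∅ = 0 := by
  rw [twiceEuler, ← finsum_zero]
  refine finsum_congr fun f => ?_
  rw [eulerDensity, ind_of_notMem (by simp)]
  ring

/-- The number of strings in the boundary of a finite set of hexagons has the parity of its Euler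
characteristic. -/
theorem two_mul_numStrings (F : Finset Face) :
    2 * (numStrings (boundary F) : ZMod 4) = twiceEuler F := by
  classical
  induction F using Finset.induction_on with
  | empty =>
    rw [twiceEuler_empty, numStrings_boundary]
    have : IsEmpty (boundaryDarts ((∅ : Finset Face) : Set Face)) := ⟨fun d => by simpa using d.2.1⟩
    rw [Nat.card_of_isEmpty]
    simp
  | insert h F hh ih =>
    have h1 : insert h F = symmDiff F {h} := by
      ext f
      rw [Finset.mem_symmDiff, Finset.mem_insert, Finset.mem_singleton]
      by_cases hf : f = h
      · simp [hf, hh]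
      · simp [hf]
    have h2 := parity_numStrings_insert hh
    rw [h1, twiceEuler_symmDiff, ← ih, twiceEuler_singleton, twiceCoupling_singleton, ← h1]
    obtain ⟨r, hr⟩ := h2
    have h3 := congrArg (fun n : ℕ => 2 * (n : ZMod 4)) hr
    simp only [Nat.cast_add, Nat.cast_one] at h3
    have h4 : ∀ x y z r : ZMod 4, 2 * (x + (y + z + 1)) = 2 * (r + r) →
        2 * x = 2 * y + 2 + 2 * z := by decide
    exact h4 _ _ _ _ h3

/-! ### Pauli operators on string configurations -/

theorem pauliXOp_apply (e : Edge) (ψ : ConfigSpace) (α : Finset Edge) :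
    (pauliXOp e ψ : ∀ _, ℂ) α = ψ (flip e α) := rfl

theorem pauliZOp_apply (e : Edge) (ψ : ConfigSpace) (α : Finset Edge) :
    (pauliZOp e ψ : ∀ _, ℂ) α = (if e ∈ α then -1 else 1) * ψ α := rfl

theorem flip_flip (e : Edge) (α : Finset Edge) : flip e (flip e α) = α :=
  (flip e).left_inv α

theorem mem_flip {e e' : Edge} {α : Finset Edge} :
    e' ∈ flip e α ↔ ¬ (e' ∈ α ↔ e' = e) := by
  show e' ∈ symmDiff α {e} ↔ _
  rw [Finset.mem_symmDiff, Finset.mem_singleton]; tauto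

theorem flip_comm (e e' : Edge) (α : Finset Edge) : flip e (flip e' α) = flip e' (flip e α) :=
  symmDiff_right_comm _ _ _

theorem ket_apply (α β : Finset Edge) : (ket α : ∀ _, ℂ) β = if β = α then 1 else 0 := by
  classical
  rw [ket, lp.single_apply, Pi.single_apply]

theorem inner_ket_left (α : Finset Edge) (ψ : ConfigSpace) : ⟪ket α, ψ⟫_ℂ = ψ α := by
  rw [ket, lp.inner_single_left]; simp

theorem inner_ket_ket (α β : Finset Edge) : ⟪ket α, ket β⟫_ℂ = if α = β then 1 else 0 := by
  rw [inner_ket_left, ket_apply]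

theorem pauliXOp_ket (e : Edge) (α : Finset Edge) : pauliXOp e (ket α) = ket (flip e α) := by
  ext β
  rw [pauliXOp_apply, ket_apply, ket_apply]
  congr 1
  rw [eq_iff_iff]
  exact ⟨fun h => by rw [← h, flip_flip], fun h => by rw [h, flip_flip]⟩

theorem pauliZOp_ket (e : Edge) (α : Finset Edge) :
    pauliZOp e (ket α) = (if e ∈ α then -1 else 1 : ℂ) • ket α := by
  ext β
  rw [pauliZOp_apply, ket_apply, lp.coeFn_smul, Pi.smul_apply, ket_apply, smul_eq_mul]
  by_cases h : β = α
  · rw [h]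
  · simp [h]

/-- Every vector is the norm convergent sum of its components along the kets. All operator
identities below are checked in this way. -/
theorem ext_ket {A B : ConfigSpace →L[ℂ] ConfigSpace} (h : ∀ α, A (ket α) = B (ket α)) : A = B := by
  ext1 ψ
  have hs := lp.hasSum_single (p := 2) (by norm_num) ψ
  have h1 : ∀ α, lp.single 2 α (ψ α) = (ψ α) • ket α := by
    intro α
    rw [ket, ← lp.single_smul]
    simp
  simp only [h1] at hs
  have hA := hs.mapL A
  have hB := hs.mapL B
  simp only [map_smul, h] at hA hB
  exact hA.unique hB

theorem obs_ext {A B : Obs} (h : ∀ α, A.1 (ket α) = B.1 (ket α)) : A = B :=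
  Subtype.ext (ext_ket h)

theorem isSelfAdjoint_of_ket {A : ConfigSpace →L[ℂ] ConfigSpace}
    (h : ∀ α β, ⟪A (ket α), ket β⟫_ℂ = ⟪ket α, A (ket β)⟫_ℂ) : star A = A := by
  refine ext_ket fun β => ?_
  ext α
  rw [← inner_ket_left, ← inner_ket_left, ContinuousLinearMap.star_eq_adjoint,
    ContinuousLinearMap.adjoint_inner_right, h]

theorem star_pauliX (e : Edge) : star (pauliX e) = pauliX e := by
  refine Subtype.ext (isSelfAdjoint_of_ket (A := pauliXOp e) fun α β => ?_)
  rw [pauliXOp_ket, pauliXOp_ket, inner_ket_ket, inner_ket_ket]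
  congr 1
  rw [eq_iff_iff]
  exact ⟨fun h => by rw [← h, flip_flip], fun h => by rw [h, flip_flip]⟩

theorem star_pauliZ (e : Edge) : star (pauliZ e) = pauliZ e := by
  refine Subtype.ext (isSelfAdjoint_of_ket (A := pauliZOp e) fun α β => ?_)
  rw [pauliZOp_ket, pauliZOp_ket, inner_smul_left, inner_smul_right, inner_ket_ket]
  by_cases h : α = β
  · subst h; split_ifs <;> simp
  · simp [h]

theorem mul_ket (A B : Obs) (α : Finset Edge) : (A * B).1 (ket α) = A.1 (B.1 (ket α)) := rfl

theorem pauliX_ket (e : Edge) (α : Finset Edge) : (pauliX e).1 (ket α) = ket (flip e α) :=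
  pauliXOp_ket e α

theorem pauliX_mul_self (e : Edge) : pauliX e * pauliX e = 1 := by
  refine obs_ext fun α => ?_
  rw [mul_ket, pauliX_ket, pauliX_ket, flip_flip]; rfl

theorem pauliX_comm (e e' : Edge) : Commute (pauliX e) (pauliX e') := by
  refine obs_ext fun α => ?_
  rw [mul_ket, mul_ket, pauliX_ket, pauliX_ket, pauliX_ket, pauliX_ket, flip_comm]

/-- The observable `D` is diagonal in the basis of string configurations. -/
def IsDiag (D : Obs) (φ : Finset Edge → ℂ) : Prop := ∀ α, D.1 (ket α) = φ α • ket α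

namespace IsDiag

variable {D D' : Obs} {φ φ' : Finset Edge → ℂ}

theorem one : IsDiag 1 1 := fun α => by simp

theorem mul (h : IsDiag D φ) (h' : IsDiag D' φ') : IsDiag (D * D') (φ * φ') := fun α => by
  rw [mul_ket, h' α, map_smul, h α, smul_smul, Pi.mul_apply, mul_comm]

theorem add (h : IsDiag D φ) (h' : IsDiag D' φ') : IsDiag (D + D') (φ + φ') := fun α => by
  show D.1 (ket α) + D'.1 (ket α) = _
  rw [h α, h' α, ← add_smul]; rfl

theorem sub (h : IsDiag D φ) (h' : IsDiag D' φ') : IsDiag (D - D') (φ - φ') := fun α => by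
  show D.1 (ket α) - D'.1 (ket α) = _
  rw [h α, h' α, ← sub_smul]; rfl

theorem smul (h : IsDiag D φ) (c : ℂ) : IsDiag (c • D) (c • φ) := fun α => by
  show c • D.1 (ket α) = _
  rw [h α, smul_smul]; rfl

theorem congr (h : IsDiag D φ) (h' : ∀ α, φ α = φ' α) : IsDiag D φ' := fun α => by rw [h α, h' α]

theorem ext (h : IsDiag D φ) (h' : IsDiag D' φ) : D = D' := obs_ext fun α => by rw [h α, h' α]

theorem commute (h : IsDiag D φ) (h' : IsDiag D' φ') : Commute D D' :=
  (h.mul h').ext ((h'.mul h).congr fun α => mul_comm _ _)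

theorem star (h : IsDiag D φ) : IsDiag (star D) (fun α => starRingEnd ℂ (φ α)) := fun α => by
  ext β
  rw [← inner_ket_left]
  show ⟪ket β, (Star.star D.1) (ket α)⟫_ℂ = _
  rw [ContinuousLinearMap.star_eq_adjoint, ContinuousLinearMap.adjoint_inner_right, h β,
    inner_smul_left, inner_ket_ket, lp.coeFn_smul, Pi.smul_apply, ket_apply, smul_eq_mul]
  by_cases h : β = α
  · rw [h]
  · simp [h]

theorem commute_pauliX (h : IsDiag D φ) {e : Edge} (he : ∀ α, φ (flip e α) = φ α) :
    Commute D (pauliX e) := obs_ext fun α => by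
  rw [mul_ket, mul_ket, pauliX_ket, h, h, map_smul, pauliX_ket, he]

theorem prod {ι : Type*} (l : List ι) (D : ι → Obs) (φ : ι → Finset Edge → ℂ)
    (h : ∀ i ∈ l, IsDiag (D i) (φ i)) : IsDiag (l.map D).prod (l.map φ).prod := by
  induction l with
  | nil => simpa using one
  | cons i l ih =>
    rw [List.map_cons, List.prod_cons, List.map_cons, List.prod_cons]
    exact (h i (by simp)).mul (ih fun j hj => h j (by simp [hj]))

theorem mem_unitary (h : IsDiag D φ) (hφ : ∀ α, ‖φ α‖ = 1) : D ∈ unitary Obs := by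
  have hc : ∀ α, starRingEnd ℂ (φ α) * φ α = 1 := fun α => by
    rw [mul_comm, Complex.mul_conj, Complex.normSq_eq_norm_sq, hφ]; simp
  rw [Unitary.mem_iff]
  exact ⟨(h.star.mul h).ext (one.congr fun α => (hc α).symm),
    (h.mul h.star).ext (one.congr fun α => by rw [Pi.mul_apply, mul_comm, hc]; rfl)⟩

end IsDiag

theorem isDiag_pauliZ (e : Edge) : IsDiag (pauliZ e) fun α => if e ∈ α then -1 else 1 :=
  fun α => pauliZOp_ket e α

theorem pauliX_pauliZ_of_ne {e e' : Edge} (h : e ≠ e') : Commute (pauliX e) (pauliZ e') :=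
  ((isDiag_pauliZ e').commute_pauliX fun α => by
    simp only [mem_flip, h.symm, iff_false, not_not]).symm

theorem pauliX_mul_pauliZ (e : Edge) : pauliX e * pauliZ e = -(pauliZ e * pauliX e) := by
  refine obs_ext fun α => ?_
  show (pauliX e * pauliZ e).1 (ket α) = -(pauliZ e * pauliX e).1 (ket α)
  rw [mul_ket, mul_ket, isDiag_pauliZ, map_smul, pauliX_ket, isDiag_pauliZ, ← neg_smul]
  congr 1
  by_cases h : e ∈ α <;> simp [mem_flip, h]

theorem pauliX_mem_unitary (e : Edge) : pauliX e ∈ unitary Obs := by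
  rw [Unitary.mem_iff, star_pauliX, pauliX_mul_self]; simp

/-! ### The generators are dense -/

theorem dense_localObs : Dense ((localObs Set.univ : StarSubalgebra ℂ Obs) : Set Obs) := by
  have hmap : ((localObs Set.univ).map quasiLocal.subtype : StarSubalgebra ℂ _) =
      StarAlgebra.adjoin ℂ (Set.range pauliXOp ∪ Set.range pauliZOp) := by
    rw [localObs, StarAlgHom.map_adjoin]
    congr 1
    rw [Set.image_union, Set.image_univ, Set.image_univ, ← Set.range_comp, ← Set.range_comp]
    rfl
  intro x
  rw [closure_subtype]
  have h1 : ((↑) : Obs → (ConfigSpace →L[ℂ] ConfigSpace)) '' (localObs Set.univ : Set Obs) =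
      (StarAlgebra.adjoin ℂ (Set.range pauliXOp ∪ Set.range pauliZOp) : Set _) := by
    rw [← hmap]; rfl
  rw [h1]
  exact x.2

/-- A closed star subalgebra which contains the Pauli matrices is everything. -/
theorem obs_induction {p : Obs → Prop} (hX : ∀ e, p (pauliX e)) (hZ : ∀ e, p (pauliZ e))
    (hc : ∀ c : ℂ, p (algebraMap ℂ Obs c)) (hadd : ∀ x y, p x → p y → p (x + y))
    (hmul : ∀ x y, p x → p y → p (x * y)) (hclosed : IsClosed {x | p x}) (x : Obs) : p x := by
  have : (localObs Set.univ : Set Obs) ⊆ {x | p x} := by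
    intro x hx
    -- The property is not assumed to be stable under adjoints. As the generators are self-adjoint,
    -- it can be carried along for `x` and `star x` together.
    have hstar : p x ∧ p (star x) := by
      refine StarAlgebra.adjoin_induction (p := fun x _ => p x ∧ p (star x)) ?_ ?_ ?_ ?_ ?_ hx
      · rintro y (⟨e, -, rfl⟩ | ⟨e, -, rfl⟩)
        · rw [star_pauliX]; exact ⟨hX e, hX e⟩
        · rw [star_pauliZ]; exact ⟨hZ e, hZ e⟩
      · intro c
        rw [← algebraMap_star_comm]; exact ⟨hc _, hc _⟩
      · intro y z _ _ h1 h2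
        rw [star_add]; exact ⟨hadd _ _ h1.1 h2.1, hadd _ _ h1.2 h2.2⟩
      · intro y z _ _ h1 h2
        rw [star_mul]; exact ⟨hmul _ _ h1.1 h2.1, hmul _ _ h2.2 h1.2⟩
      · intro y _ h
        rw [star_star]; exact h.symm
    exact hstar.1
  have h2 := hclosed.closure_subset_iff.2 this
  exact h2 (dense_localObs x)

theorem pauliX_mem_localObs {Y : Set Edge} {e : Edge} (h : e ∈ Y) : pauliX e ∈ localObs Y :=
  StarAlgebra.subset_adjoin ℂ _ (Or.inl ⟨e, h, rfl⟩)

theorem pauliZ_mem_localObs {Y : Set Edge} {e : Edge} (h : e ∈ Y) : pauliZ e ∈ localObs Y :=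
  StarAlgebra.subset_adjoin ℂ _ (Or.inr ⟨e, h, rfl⟩)

/-! ### The factors of a string operator -/

/-- The factor of a string operator at an edge of the path. -/
def edgeOp (a : Anyon) (e : Edge) : Obs :=
  match a with
  | .vacuum => 1
  | .semion => pauliX e
  | .antisemion => pauliX e
  | .boundState => 1

/-- The phase of a string operator at an occupied R-leg. -/
def legPhase (a : Anyon) : ℂ :=
  match a with
  | .vacuum => 1
  | .semion => Complex.I
  | .antisemion => -Complex.I
  | .boundState => -1

/-- The phase of a string operator at an L-vertex with `s = 1`. -/
def turnPhase (a : Anyon) : ℂ :=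
  match a with
  | .vacuum => 1
  | .semion => -1
  | .antisemion => -1
  | .boundState => 1

/-- The factor of a string operator at the vertex between consecutive edges of a path. -/
def vertexOp (a : Anyon) (p : Dart × Dart) : Obs :=
  if p.2 = p.1.turnLeft then phaseAt (legPhase a) p.1.turnRight.edge
  else if p.2 = p.1.turnRight then
    (if turnPhase a = 1 then 1 else signAt (p.1.edge, p.2.edge))
  else 1

/-- The eigenvalues of `vertexOp`. -/
def vertexVal (a : Anyon) (p : Dart × Dart) (α : Finset Edge) : ℂ :=
  if p.2 = p.1.turnLeft then (if p.1.turnRight.edge ∈ α then legPhase a else 1)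
  else if p.2 = p.1.turnRight then
    (if p.1.edge ∈ α ∧ p.2.edge ∉ α then turnPhase a else 1)
  else 1

theorem norm_legPhase (a : Anyon) : ‖legPhase a‖ = 1 := by cases a <;> simp [legPhase]
theorem norm_turnPhase (a : Anyon) : ‖turnPhase a‖ = 1 := by cases a <;> simp [turnPhase]
theorem turnPhase_eq (a : Anyon) : turnPhase a = 1 ∨ turnPhase a = -1 := by
  cases a <;> simp [turnPhase]

theorem isDiag_phaseAt (c : ℂ) (e : Edge) : IsDiag (phaseAt c e) fun α => if e ∈ α then c else 1 :=
  (((IsDiag.one.add (isDiag_pauliZ e)).smul (1 / 2)).add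
    ((IsDiag.one.sub (isDiag_pauliZ e)).smul (c / 2))).congr fun α => by
      simp only [Pi.add_apply, Pi.sub_apply, Pi.smul_apply, Pi.one_apply, smul_eq_mul]
      split_ifs <;> ring

theorem isDiag_signAt (v : Edge × Edge) :
    IsDiag (signAt v) fun α => if v.1 ∈ α ∧ v.2 ∉ α then -1 else 1 :=
  (IsDiag.one.sub ((((IsDiag.one.sub (isDiag_pauliZ v.1)).mul
    (IsDiag.one.add (isDiag_pauliZ v.2))).smul (1 / 4)).smul 2)).congr fun α => by
      simp only [Pi.add_apply, Pi.sub_apply, Pi.smul_apply, Pi.one_apply, smul_eq_mul, Pi.mul_apply]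
      by_cases h1 : v.1 ∈ α <;> by_cases h2 : v.2 ∈ α <;> simp [h1, h2] <;> ring

theorem isDiag_vertexOp (a : Anyon) (p : Dart × Dart) : IsDiag (vertexOp a p) (vertexVal a p) := by
  unfold vertexOp
  split_ifs with h1 h2 h3
  · exact (isDiag_phaseAt _ _).congr fun α => by rw [vertexVal, if_pos h1]
  · exact IsDiag.one.congr fun α => by rw [vertexVal, if_neg h1, if_pos h2, h3]; simp
  · refine (isDiag_signAt _).congr fun α => ?_
    rw [vertexVal, if_neg h1, if_pos h2, (turnPhase_eq a).resolve_left h3]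
  · exact IsDiag.one.congr fun α => by rw [vertexVal, if_neg h1, if_neg h2]; rfl

theorem norm_vertexVal (a : Anyon) (p : Dart × Dart) (α : Finset Edge) :
    ‖vertexVal a p α‖ = 1 := by
  unfold vertexVal
  split_ifs <;> simp [norm_legPhase, norm_turnPhase]

theorem vertexOp_mem_unitary (a : Anyon) (p : Dart × Dart) : vertexOp a p ∈ unitary Obs :=
  (isDiag_vertexOp a p).mem_unitary (norm_vertexVal a p)

theorem edgeOp_mem_unitary (a : Anyon) (e : Edge) : edgeOp a e ∈ unitary Obs := by
  cases a
  · exact one_mem _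
  · exact pauliX_mem_unitary e
  · exact pauliX_mem_unitary e
  · exact one_mem _

/-- The consecutive pairs in a list. -/
def consecutive (l : List Dart) : List (Dart × Dart) := l.zip l.tail

@[simp] theorem consecutive_cons_cons (d d' : Dart) (l : List Dart) :
    consecutive (d :: d' :: l) = (d, d') :: consecutive (d' :: l) := rfl

/-- The diagonal factors commute, so the separate products over R-legs and over L-vertices merge
into one product over the vertices of the path. Comparing eigenvalues avoids reordering operators.
-/
theorem isDiag_legs (c : ℂ) (a : Anyon) (hc : legPhase a = c) (l : List Dart) :
    IsDiag (((rLegs l).map (phaseAt c)).prod *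
      ((lVertices l).map fun v => if turnPhase a = 1 then 1 else signAt v).prod)
      ((consecutive l).map (vertexVal a)).prod := by
  have hs : ∀ v, IsDiag (if turnPhase a = 1 then 1 else signAt v) fun α =>
      if v.1 ∈ α ∧ v.2 ∉ α then turnPhase a else 1 := by
    intro v
    split_ifs with h
    · exact IsDiag.one.congr fun α => by rw [h]; simp
    · rw [(turnPhase_eq a).resolve_left h]; exact isDiag_signAt v
  suffices h : ((rLegs l).map fun e α => if e ∈ α then c else (1 : ℂ)).prod *
      ((lVertices l).map fun v α => if v.1 ∈ α ∧ v.2 ∉ α then turnPhase a else 1).prod =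
      ((consecutive l).map (vertexVal a)).prod by
    rw [← h]
    exact (IsDiag.prod _ _ _ fun e _ => isDiag_phaseAt c e).mul (IsDiag.prod _ _ _ fun v _ => hs v)
  induction l with
  | nil => simp [rLegs, lVertices, consecutive]
  | cons d l ih =>
    cases l with
    | nil => simp [rLegs, lVertices, consecutive]
    | cons d' l =>
      rw [consecutive_cons_cons, List.map_cons, List.prod_cons, ← ih, rLegs, lVertices,
        List.map_append, List.map_append, List.prod_append, List.prod_append]
      have : (List.map (fun e α => if e ∈ α then c else (1 : ℂ))
          (if d' = d.turnLeft then [d.turnRight.edge] else [])).prod *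
          (List.map (fun v α => if v.1 ∈ α ∧ v.2 ∉ α then turnPhase a else (1 : ℂ))
          (if d' = d.turnRight then [(d.edge, d'.edge)] else [])).prod = vertexVal a (d, d') := by
        funext α
        rw [vertexVal]
        by_cases h1 : d' = d.turnLeft
        · have : d' ≠ d.turnRight := h1 ▸ d.turnLeft_ne_turnRight
          simp only [h1, if_true, if_neg (d.turnLeft_ne_turnRight)]
          simp [hc]
        · by_cases h2 : d' = d.turnRight
          · simp [h2, d.turnLeft_ne_turnRight.symm]
          · simp [h1, h2]
      rw [← this]
      ring

/-- The uniform description of all four types as edge factors times vertex factors; from here on the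
types differ only through `edgeOp`, `legPhase` and `turnPhase`. -/
theorem stringOpAux_eq (a : Anyon) (E : List Edge) (l : List Dart) :
    stringOpAux a E l = (E.map (edgeOp a)).prod * ((consecutive l).map (vertexOp a)).prod := by
  have h2 := IsDiag.prod (consecutive l) _ _ fun p _ => isDiag_vertexOp a p
  have h1 := (isDiag_legs (legPhase a) a rfl l).ext h2
  rw [← h1]
  have hone : ∀ {ι : Type} (l : List ι), (l.map fun _ => (1 : Obs)).prod = 1 := by
    intro ι l; induction l <;> simp_all
  cases a
  · have : phaseAt (1 : ℂ) = fun _ => (1 : Obs) := by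
      funext e
      exact (isDiag_phaseAt 1 e).ext (IsDiag.one.congr fun α => by simp)
    have hE : (E.map (edgeOp .vacuum)).prod = 1 := hone E
    rw [hE]
    simp only [stringOpAux, turnPhase, legPhase, this, hone, if_true, mul_one]
  · have : (-1 : ℂ) ≠ 1 := by norm_num
    simp only [stringOpAux, turnPhase, legPhase, this, if_false]
    rw [mul_assoc]; rfl
  · have : (-1 : ℂ) ≠ 1 := by norm_num
    simp only [stringOpAux, turnPhase, legPhase, this, if_false]
    rw [mul_assoc]; rfl
  · have : phaseAt (-1 : ℂ) = pauliZ := by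
      funext e
      exact (isDiag_phaseAt _ e).ext (isDiag_pauliZ e)
    have hE : (E.map (edgeOp .boundState)).prod = 1 := hone E
    rw [hE]
    simp only [stringOpAux, turnPhase, legPhase, this, hone, if_true, mul_one, one_mul]

/-! ### Products of Pauli matrices -/

/-- The product of `σ^X` over a finite set of sites. -/
def xOp (A : Finset Edge) : Obs := (A.toList.map pauliX).prod

/-- The product of `σ^Z` over a finite set of sites. -/
def zOp (B : Finset Edge) : Obs := (B.toList.map pauliZ).prod

/-- The eigenvalue of `zOp`. -/
def zVal (B α : Finset Edge) : ℂ := ∏ e ∈ B, if e ∈ α then -1 else 1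

theorem prod_pauliX_ket {E : List Edge} (hE : E.Nodup) (α : Finset Edge) :
    ((E.map pauliX).prod).1 (ket α) = ket (symmDiff α E.toFinset) := by
  induction E with
  | nil => simp [← Finset.bot_eq_empty]
  | cons e E ih =>
    have hE' := List.nodup_cons.1 hE
    rw [List.map_cons, List.prod_cons, mul_ket, ih hE'.2, pauliX_ket]
    congr 1
    ext x
    rw [mem_flip, List.toFinset_cons, Finset.mem_symmDiff, Finset.mem_symmDiff, Finset.mem_insert]
    have : x = e → x ∉ E.toFinset := by rintro rfl; simpa using hE'.1
    tauto

theorem xOp_ket (A α : Finset Edge) : (xOp A).1 (ket α) = ket (symmDiff α A) := by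
  rw [xOp, prod_pauliX_ket A.nodup_toList, Finset.toList_toFinset]

theorem prod_pauliX_eq {E : List Edge} (hE : E.Nodup) : (E.map pauliX).prod = xOp E.toFinset :=
  obs_ext fun α => by rw [prod_pauliX_ket hE, xOp_ket]

theorem isDiag_zOp (B : Finset Edge) : IsDiag (zOp B) (zVal B) := by
  refine (IsDiag.prod B.toList pauliZ _ fun e _ => isDiag_pauliZ e).congr fun α => ?_
  rw [zVal, ← Finset.prod_map_toList]
  generalize B.toList = l
  induction l <;> simp_all

theorem xOp_empty : xOp ∅ = 1 := by simp [xOp]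

theorem zOp_empty : zOp ∅ = 1 := by simp [zOp]

theorem xOp_mul (A A' : Finset Edge) : xOp A * xOp A' = xOp (symmDiff A A') :=
  obs_ext fun α => by rw [mul_ket, xOp_ket, xOp_ket, xOp_ket, symmDiff_assoc, symmDiff_comm A']

theorem xOp_singleton (e : Edge) : xOp {e} = pauliX e := by simp [xOp]

theorem zOp_singleton (e : Edge) : zOp {e} = pauliZ e := by simp [zOp]

theorem zVal_symmDiff_right (B α β : Finset Edge) : zVal B (symmDiff α β) = zVal B α * zVal B β := by
  rw [zVal, zVal, zVal, ← Finset.prod_mul_distrib]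
  refine Finset.prod_congr rfl fun e _ => ?_
  by_cases h1 : e ∈ α <;> by_cases h2 : e ∈ β <;> simp [Finset.mem_symmDiff, h1, h2]

theorem zVal_comm (B α : Finset Edge) : zVal B α = zVal α B := by
  rw [zVal, zVal, Finset.prod_ite, Finset.prod_ite]
  simp only [Finset.prod_const, one_pow, mul_one, Finset.filter_mem_eq_inter, Finset.inter_comm]

theorem zVal_symmDiff_left (B B' α : Finset Edge) :
    zVal (symmDiff B B') α = zVal B α * zVal B' α := by
  rw [zVal_comm, zVal_symmDiff_right, zVal_comm α B, zVal_comm α B']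

theorem zOp_mul (B B' : Finset Edge) : zOp B * zOp B' = zOp (symmDiff B B') :=
  ((isDiag_zOp B).mul (isDiag_zOp B')).ext ((isDiag_zOp _).congr fun α => zVal_symmDiff_left B B' α)

theorem zVal_eq (B α : Finset Edge) : zVal B α = 1 ∨ zVal B α = -1 := by
  unfold zVal
  refine Finset.prod_induction _ (fun z : ℂ => z = 1 ∨ z = -1) ?_ (Or.inl rfl) ?_
  · rintro _ _ (rfl | rfl) (rfl | rfl) <;> simp
  · intro e _; split_ifs <;> simp

theorem zOp_mul_xOp (B A : Finset Edge) : zOp B * xOp A = zVal B A • (xOp A * zOp B) := by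
  refine obs_ext fun α => ?_
  show (zOp B * xOp A).1 (ket α) = zVal B A • (xOp A * zOp B).1 (ket α)
  rw [mul_ket, mul_ket, xOp_ket, isDiag_zOp, isDiag_zOp, map_smul, xOp_ket, smul_smul,
    zVal_symmDiff_right, mul_comm]

theorem zOp_mem_unitary (B : Finset Edge) : zOp B ∈ unitary Obs :=
  (isDiag_zOp B).mem_unitary fun α => by rcases zVal_eq B α with h | h <;> simp [h]

/-- The span of the products of Pauli matrices `σ^Z`. -/
def diagSpan : Submodule ℂ Obs := Submodule.span ℂ (Set.range zOp)

theorem zOp_mem_diagSpan (B : Finset Edge) : zOp B ∈ diagSpan := Submodule.subset_span ⟨B, rfl⟩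

theorem mul_mem_diagSpan {x y : Obs} (hx : x ∈ diagSpan) (hy : y ∈ diagSpan) : x * y ∈ diagSpan := by
  have h := Submodule.mul_mem_mul hx hy
  rw [diagSpan, Submodule.span_mul_span] at h
  refine Submodule.span_mono ?_ h
  rintro _ ⟨_, ⟨B, rfl⟩, _, ⟨B', rfl⟩, rfl⟩
  exact ⟨_, (zOp_mul B B').symm⟩

theorem one_mem_diagSpan : (1 : Obs) ∈ diagSpan := zOp_empty ▸ zOp_mem_diagSpan ∅

theorem pauliZ_mem_diagSpan (e : Edge) : pauliZ e ∈ diagSpan := zOp_singleton e ▸ zOp_mem_diagSpan _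

theorem prod_mem_diagSpan {l : List Obs} (h : ∀ x ∈ l, x ∈ diagSpan) : l.prod ∈ diagSpan := by
  induction l with
  | nil => exact one_mem_diagSpan
  | cons x l ih =>
    rw [List.prod_cons]
    exact mul_mem_diagSpan (h x (by simp)) (ih fun y hy => h y (by simp [hy]))

theorem vertexOp_mem_diagSpan (a : Anyon) (p : Dart × Dart) : vertexOp a p ∈ diagSpan := by
  have h1 := one_mem_diagSpan
  unfold vertexOp
  split_ifs
  · exact add_mem (diagSpan.smul_mem _ (add_mem h1 (pauliZ_mem_diagSpan _)))
      (diagSpan.smul_mem _ (sub_mem h1 (pauliZ_mem_diagSpan _)))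
  · exact h1
  · exact sub_mem h1 (diagSpan.smul_mem _ (diagSpan.smul_mem _ (mul_mem_diagSpan
      (sub_mem h1 (pauliZ_mem_diagSpan _)) (add_mem h1 (pauliZ_mem_diagSpan _)))))
  · exact h1

theorem star_zOp (B : Finset Edge) : star (zOp B) = zOp B :=
  (isDiag_zOp B).star.ext ((isDiag_zOp B).congr fun α => by
    rcases zVal_eq B α with h | h <;> simp [h])

theorem star_mem_diagSpan {x : Obs} (hx : x ∈ diagSpan) : star x ∈ diagSpan := by
  induction hx using Submodule.span_induction with
  | mem x h => obtain ⟨B, rfl⟩ := h; rw [star_zOp]; exact zOp_mem_diagSpan B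
  | zero => rw [star_zero]; exact zero_mem _
  | add x y _ _ hx hy => rw [star_add]; exact add_mem hx hy
  | smul c x _ hx => rw [star_smul]; exact diagSpan.smul_mem _ hx

/-- Pauli matrices commute or anticommute, so left multiplication by a generator preserves the span
of the ordered monomials, which contains `1`. -/
theorem localObs_le_span {x : Obs} (hx : x ∈ localObs Set.univ) :
    x ∈ Submodule.span ℂ {O : Obs | ∃ A B, O = xOp A * zOp B} := by
  set M := Submodule.span ℂ {O : Obs | ∃ A B, O = xOp A * zOp B} with hM
  have hX : ∀ e, ∀ y ∈ M, pauliX e * y ∈ M := by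
    intro e y hy
    induction hy using Submodule.span_induction with
    | mem y h =>
      obtain ⟨A, B, rfl⟩ := h
      rw [← mul_assoc, ← xOp_singleton, xOp_mul]
      exact Submodule.subset_span ⟨_, _, rfl⟩
    | zero => rw [mul_zero]; exact zero_mem _
    | add x y _ _ hx hy => rw [mul_add]; exact add_mem hx hy
    | smul c x _ hx => rw [mul_smul_comm]; exact M.smul_mem _ hx
  have hZ : ∀ e, ∀ y ∈ M, pauliZ e * y ∈ M := by
    intro e y hy
    induction hy using Submodule.span_induction with
    | mem y h =>
      obtain ⟨A, B, rfl⟩ := h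
      rw [← mul_assoc, ← zOp_singleton, zOp_mul_xOp, smul_mul_assoc, mul_assoc, zOp_mul]
      exact M.smul_mem _ (Submodule.subset_span ⟨_, _, rfl⟩)
    | zero => rw [mul_zero]; exact zero_mem _
    | add x y _ _ hx hy => rw [mul_add]; exact add_mem hx hy
    | smul c x _ hx => rw [mul_smul_comm]; exact M.smul_mem _ hx
  have key : ∀ y ∈ M, x * y ∈ M ∧ star x * y ∈ M := by
    refine StarAlgebra.adjoin_induction (p := fun x _ => ∀ y ∈ M, x * y ∈ M ∧ star x * y ∈ M)
      ?_ ?_ ?_ ?_ ?_ hx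
    · rintro _ (⟨e, -, rfl⟩ | ⟨e, -, rfl⟩) y hy
      · rw [star_pauliX]; exact ⟨hX e y hy, hX e y hy⟩
      · rw [star_pauliZ]; exact ⟨hZ e y hy, hZ e y hy⟩
    · intro c y hy
      rw [← algebraMap_star_comm, ← Algebra.smul_def, ← Algebra.smul_def]
      exact ⟨M.smul_mem _ hy, M.smul_mem _ hy⟩
    · intro u v _ _ h1 h2 y hy
      rw [star_add, add_mul, add_mul]
      exact ⟨add_mem (h1 y hy).1 (h2 y hy).1, add_mem (h1 y hy).2 (h2 y hy).2⟩
    · intro u v _ _ h1 h2 y hy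
      rw [star_mul, mul_assoc, mul_assoc]
      exact ⟨(h1 _ (h2 y hy).1).1, (h2 _ (h1 y hy).2).2⟩
    · intro u _ h y hy
      rw [star_star]; exact (h y hy).symm
  have h1 : (1 : Obs) ∈ M := Submodule.subset_span ⟨∅, ∅, by rw [xOp_empty, zOp_empty, one_mul]⟩
  simpa using (key 1 h1).1

/-! ### Closed string operators on string soups -/

/-- The character `x ↦ i ^ x`. -/
def phase : AddChar (ZMod 4) ℂ := AddChar.zmodChar 4 Complex.I_pow_four

theorem phase_one : phase 1 = Complex.I := by
  rw [phase, AddChar.zmodChar_apply, show (1 : ZMod 4).val = 1 from rfl, pow_one]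

theorem phase_two : phase 2 = -1 := by
  rw [phase, AddChar.zmodChar_apply, show (2 : ZMod 4).val = 2 from rfl, Complex.I_sq]

theorem phase_three : phase 3 = -Complex.I := by
  rw [phase, AddChar.zmodChar_apply, show (3 : ZMod 4).val = 3 from rfl, Complex.I_pow_three]

/-- The multiple of the phase exponent of a semion string which an anyon string acquires. -/
def charge (a : Anyon) : ZMod 4 :=
  match a with
  | .vacuum => 0
  | .semion => 1
  | .antisemion => 3
  | .boundState => 2

/-- The edges flipped by a string. -/
def flips (a : Anyon) (A : Finset Edge) : Finset Edge :=
  match a with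
  | .vacuum => ∅
  | .semion => A
  | .antisemion => A
  | .boundState => ∅

theorem Dart.edge_mem_boundary {F : Finset Face} {d : Dart} :
    d.edge ∈ boundary F ↔ ¬ (d.left ∈ F ↔ d.right ∈ F) := by
  rw [mem_boundary, Dart.edge_mem_edgeBoundary]; rfl

/-- This explains the form of `turnExponent`. At a left turn the R-leg separates the hexagons ahead
and on the right, and gives `i` if exactly one of them is in `F`. At a right turn the sign is `i ^
2`, present if the incoming edge is occupied and the outgoing one is not. The other anyons acquire a
fixed multiple of this exponent. -/
theorem vertexVal_nextDart (a : Anyon) {G : Set Face} {d : Dart} (hd : d ∈ boundaryDarts G)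
    (F : Finset Face) : vertexVal a (d, nextDart G d) (boundary F) =
      phase (charge a * turnExponent (ind G) (ind F) d.left d.right d.ahead) := by
  have hb : phase (2 * 2) = 1 := by
    rw [show (2 * 2 : ZMod 4) = 0 from rfl, AddChar.map_zero_eq_one]
  have hc : phase (3 * 2) = -1 := by
    rw [show (3 * 2 : ZMod 4) = 2 from rfl, phase_two]
  have hl := d.turnLeft_ne_turnRight
  rw [turnExponent, ind_of_mem hd.1, ind_of_notMem hd.2, vertexVal, nextDart]
  by_cases hG : d.ahead ∈ G
  · rw [ind_of_mem hG]
    simp only [hG, if_true, hl.symm, if_false, Dart.edge_mem_boundary, Dart.turnRight_left,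
      Dart.turnRight_right]
    by_cases h1 : d.left ∈ F <;> by_cases h2 : d.right ∈ F <;> by_cases h3 : d.ahead ∈ F <;>
      cases a <;> simp [h1, h2, h3, ind, turnPhase, charge, phase_two, hb, hc]
  · rw [ind_of_notMem hG]
    simp only [hG, if_true, if_false, Dart.edge_mem_boundary, Dart.turnRight_left,
      Dart.turnRight_right]
    by_cases h2 : d.right ∈ F <;> by_cases h3 : d.ahead ∈ F <;>
      cases a <;>
      simp [h2, h3, ind, legPhase, charge, phase_one, phase_two, phase_three]

/-- The product of the factors of a string operator along the boundary of `G`, listed in any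
order. -/
def loopOp (a : Anyon) (G : Set Face) (l : List Dart) : Obs :=
  (l.map fun d => edgeOp a d.edge).prod * (l.map fun d => vertexOp a (d, nextDart G d)).prod

theorem prod_edgeOp_ket (a : Anyon) {E : List Edge} (hE : E.Nodup) (α : Finset Edge) :
    ((E.map (edgeOp a)).prod).1 (ket α) = ket (symmDiff α (flips a E.toFinset)) := by
  have hone : (E.map fun _ => (1 : Obs)).prod = 1 := by induction E <;> simp_all
  cases a
  · have hE' : (E.map (edgeOp .vacuum)).prod = 1 := hone
    rw [hE']
    simp [flips, ← Finset.bot_eq_empty]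
  · exact prod_pauliX_ket hE α
  · exact prod_pauliX_ket hE α
  · have hE' : (E.map (edgeOp .boundState)).prod = 1 := hone
    rw [hE']
    simp [flips, ← Finset.bot_eq_empty]

theorem loopOp_mem_unitary (a : Anyon) (G : Set Face) (l : List Dart) :
    loopOp a G l ∈ unitary Obs := by
  refine mul_mem (list_prod_mem fun x hx => ?_) (list_prod_mem fun x hx => ?_)
  · obtain ⟨d, -, rfl⟩ := List.mem_map.1 hx; exact edgeOp_mem_unitary a _
  · obtain ⟨d, -, rfl⟩ := List.mem_map.1 hx; exact vertexOp_mem_unitary a _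

/-- The coupling takes only the values 0 and 2. Therefore closed semion and anti-semion strings act
alike on closed configurations, and closed strings of the bound state act trivially. -/
theorem twice_twiceCoupling (G : Set Face) (F : Finset Face) : 2 * twiceCoupling G F = 0 := by
  rw [twiceCoupling]
  by_cases h : (Function.support fun f => 2 * couplingDensity (ind G) (ind F) f).Finite
  · rw [mul_finsum' _ _ h]
    refine (finsum_congr fun f => ?_).trans finsum_zero
    rw [← mul_assoc, show (2 * 2 : ZMod 4) = 0 from rfl, zero_mul]
  · rw [finsum_of_infinite_support h, mul_zero]

theorem sum_turnExponent {G : Set Face} {l : List Dart} (hl : l.Nodup)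
    (hG : ∀ d, d ∈ l ↔ d ∈ boundaryDarts G) (F : Finset Face) :
    (l.map fun d => turnExponent (ind G) (ind F) d.left d.right d.ahead).sum =
      twiceCoupling G F := by
  classical
  have hfin : (boundaryDarts G).Finite := l.toFinset.finite_toSet.subset fun d hd => by
    simpa using (hG d).2 hd
  rw [← finsum_turnExponent hfin, finsum_eq_sum_of_support_subset (s := l.toFinset),
    List.sum_toFinset _ hl]
  intro d hd
  simp only [List.coe_toFinset, Set.mem_ofPred_eq]
  rw [hG]
  by_contra h
  refine hd ?_
  exact mul_eq_zero_of_notMem_boundaryDarts h _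

/-- The vertex factors multiply to the sum of the turn exponents, which is the coupling; the edge
factors flip the boundary. `E` is a finite set with the same boundary as `G`, which may be infinite.
-/
theorem loopOp_ket (a : Anyon) {G : Set Face} {l : List Dart} (hl : l.Nodup)
    (hG : ∀ d, d ∈ l ↔ d ∈ boundaryDarts G) {E : Finset Face}
    (hE : edgeBoundary (E : Set Face) = edgeBoundary G) (F : Finset Face) :
    (loopOp a G l).1 (ket (boundary F)) = phase (charge a * twiceCoupling G F) •
      ket (symmDiff (boundary F) (flips a (boundary E))) := by
  have hnd : (l.map Dart.edge).Nodup :=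
    hl.map_on fun d hd d' hd' h => edge_injOn_boundaryDarts G ((hG d).1 hd) ((hG d').1 hd') h
  have hD := IsDiag.prod l _ _ fun d _ => isDiag_vertexOp a (d, nextDart G d)
  have hval : (l.map fun d => vertexVal a (d, nextDart G d)).prod (boundary F) =
      phase (charge a * twiceCoupling G F) := by
    rw [← sum_turnExponent hl hG, ← List.sum_map_mul_left]
    have : ∀ l' : List Dart, (∀ d ∈ l', d ∈ boundaryDarts G) →
        (l'.map fun d => vertexVal a (d, nextDart G d)).prod (boundary F) =
        phase (l'.map fun d =>
          charge a * turnExponent (ind G) (ind F) d.left d.right d.ahead).sum := by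
      intro l' h
      induction l' with
      | nil => simp
      | cons d l' ih =>
        rw [List.map_cons, List.prod_cons, List.map_cons, List.sum_cons, AddChar.map_add_eq_mul,
          Pi.mul_apply, ih fun d' hd' => h d' (by simp [hd']),
          vertexVal_nextDart a (h d (by simp))]
    exact this l fun d hd => (hG d).1 hd
  have hedge : (l.map fun d => edgeOp a d.edge) = (l.map Dart.edge).map (edgeOp a) := by simp
  have hset : (l.map Dart.edge).toFinset = boundary E := by
    ext e
    rw [mem_boundary, hE]
    simp only [List.mem_toFinset, List.mem_map]
    constructor
    · rintro ⟨d, hd, rfl⟩; exact edge_mem_edgeBoundary_of_mem ((hG d).1 hd)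
    · intro h
      obtain ⟨d, hd, rfl⟩ := exists_boundaryDart h
      exact ⟨d, (hG d).2 hd, rfl⟩
  rw [loopOp, mul_ket, hD, hval, map_smul, hedge, prod_edgeOp_ket a hnd, hset]

theorem boundary_symmDiff (F E : Finset Face) :
    boundary (symmDiff F E) = symmDiff (boundary F) (boundary E) := by
  ext e
  simp only [Finset.mem_symmDiff, mem_boundary, edgeBoundary, Set.mem_ofPred_eq,
    Finset.mem_coe]
  tauto

theorem neg_one_pow_numStrings (F : Finset Face) :
    (-1 : ℂ) ^ numStrings (boundary F) = phase (twiceEuler F) := by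
  rw [← two_mul_numStrings, ← phase_two, ← AddChar.map_nsmul_eq_pow]
  congr 1
  rw [nsmul_eq_mul, mul_comm]

/-- The eigenvalue of a closed string operator on the double semion state. -/
def loopVal (a : Anyon) (E : Finset Face) : ℂ :=
  match a with
  | .vacuum => 1
  | .semion => phase (-twiceEuler E)
  | .antisemion => phase (-twiceEuler E)
  | .boundState => 1

theorem norm_loopVal (a : Anyon) (E : Finset Face) : ‖loopVal a E‖ = 1 := by
  cases a <;> simp [loopVal]

/-- Replacing `F` by its symmetric difference with `E` permutes the subsets of the patch, since the
patch contains `E`. By `twiceEuler_symmDiff` the sign changes by the coupling, which the string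
supplies, and by the constant `twiceEuler E`, which becomes the eigenvalue. -/
theorem loopOp_approxVector (a : Anyon) {G : Set Face} {l : List Dart} (hl : l.Nodup)
    (hG : ∀ d, d ∈ l ↔ d ∈ boundaryDarts G) {E : Finset Face}
    (hE : G = E ∨ G = (E : Set Face)ᶜ) {n : ℕ} (hn : E ⊆ patch n) :
    (loopOp a G l).1 (approxVector n) = loopVal a E • approxVector n := by
  have hE1 : edgeBoundary (E : Set Face) = edgeBoundary G := by
    rcases hE with rfl | rfl
    · rfl
    · rw [edgeBoundary_compl]
  have hE2 : ∀ F, twiceCoupling G F = twiceCoupling E F := by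
    intro F
    rcases hE with rfl | rfl
    · rfl
    · rw [twiceCoupling_compl]
  have h2 := twice_twiceCoupling G
  have h3 : ∀ F, 3 * twiceCoupling G F = twiceCoupling G F := fun F => by
    linear_combination h2 F
  have h4 : ∀ F, (1 : ZMod 4) * twiceCoupling G F = twiceCoupling G F := fun F => one_mul _
  rw [approxVector, map_smul, smul_comm (loopVal a E)]
  refine congrArg _ ?_
  rw [map_sum, Finset.smul_sum]
  simp only [map_smul, loopOp_ket a hl hG hE1, smul_smul]
  have flipped : ∑ F ∈ (patch n).powerset, ((-1 : ℂ) ^ numStrings (boundary F) *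
      phase (twiceCoupling G F)) • ket (symmDiff (boundary F) (boundary E)) =
      ∑ F ∈ (patch n).powerset, (phase (-twiceEuler E) * (-1) ^ numStrings (boundary F)) •
        ket (boundary F) := by
    refine Finset.sum_bij' (fun F _ => symmDiff F E) (fun F _ => symmDiff F E) ?_ ?_ ?_ ?_ ?_
    · intro F hF
      rw [Finset.mem_powerset] at hF ⊢
      exact symmDiff_le_sup.trans (sup_le hF hn)
    · intro F hF
      rw [Finset.mem_powerset] at hF ⊢
      exact symmDiff_le_sup.trans (sup_le hF hn)
    · intro F _; exact symmDiff_symmDiff_cancel_right _ _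
    · intro F _; exact symmDiff_symmDiff_cancel_right _ _
    · intro F _
      rw [boundary_symmDiff, ← boundary_symmDiff, neg_one_pow_numStrings, neg_one_pow_numStrings,
        ← AddChar.map_add_eq_mul, ← AddChar.map_add_eq_mul, twiceEuler_symmDiff, hE2]
      congr 2
      ring
  cases a
  · simp [charge, flips, loopVal, ← Finset.bot_eq_empty]
  · simpa only [charge, h4, flips, loopVal] using flipped
  · simpa only [charge, h3, flips, loopVal] using flipped
  · simp [charge, flips, loopVal, h2, ← Finset.bot_eq_empty]

/-! ### Local topological order -/

/-- `W` is a unitary which multiplies all approximating vectors from the `N`-th one on by `c`. -/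
def IsStabilizer (N : ℕ) (W : Obs) (c : ℂ) : Prop :=
  W ∈ unitary Obs ∧ ∀ n, N ≤ n → W.1 (approxVector n) = c • approxVector n

/-- A functional which is compatible with all stabilizers. -/
def Respects (N : ℕ) (f : Obs →ₗ[ℂ] ℂ) : Prop :=
  ∀ W c, IsStabilizer N W c → ∀ O, f (W * O) = c * f O ∧ f (O * W) = c * f O

/-- An observable whose expectation is determined by stabilizers. -/
def IsDetermined (O : Obs) : Prop :=
  ∃ (N : ℕ) (c : ℂ), ∀ f, Respects N f → f O = c * f 1

theorem Respects.mono {N N' : ℕ} (h : N ≤ N') {f : Obs →ₗ[ℂ] ℂ} (hf : Respects N' f) :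
    Respects N f := fun W c hW => hf W c ⟨hW.1, fun n hn => hW.2 n (h.trans hn)⟩

theorem patch_mono {m n : ℕ} (h : m ≤ n) : patch m ⊆ patch n := by
  intro f hf
  have h' : (m : ℤ) ≤ n := by exact_mod_cast h
  simp only [patch, Finset.mem_filter, Finset.mem_product, Finset.mem_Icc] at hf ⊢
  omega

theorem exists_mem_patch (f : Face) : ∃ n, f ∈ patch n := by
  refine ⟨f.1.natAbs + f.2.natAbs + 1, ?_⟩
  simp only [patch, Finset.mem_filter, Finset.mem_product, Finset.mem_Icc]
  simp only [Int.abs_eq_natAbs]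
  omega

theorem exists_subset_patch (E : Finset Face) : ∃ N, ∀ n, N ≤ n → E ⊆ patch n := by
  classical
  choose N hN using exists_mem_patch
  exact ⟨E.sup N, fun n hn f hf => patch_mono ((Finset.le_sup hf).trans hn) (hN f)⟩

theorem exists_loop (E : Finset Face) (a : Anyon) : ∃ (l : List Dart) (N : ℕ),
    IsStabilizer N (loopOp a E l) (loopVal a E) ∧ l.Nodup ∧
      ∀ d, d ∈ l ↔ d ∈ boundaryDarts (E : Set Face) := by
  have hfin : (boundaryDarts (E : Set Face)).Finite := finite_boundaryDarts E
  obtain ⟨N, hN⟩ := exists_subset_patch E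
  have hl : hfin.toFinset.toList.Nodup := Finset.nodup_toList _
  have hG : ∀ d, d ∈ hfin.toFinset.toList ↔ d ∈ boundaryDarts (E : Set Face) := by simp
  exact ⟨_, N, ⟨loopOp_mem_unitary _ _ _, fun n hn =>
    loopOp_approxVector a hl hG (Or.inl rfl) (hN n hn)⟩, hl, hG⟩

theorem loopOp_semion_eq {G : Set Face} {l : List Dart} (hl : l.Nodup)
    (hG : ∀ d, d ∈ l ↔ d ∈ boundaryDarts G) {E : Finset Face}
    (hE : edgeBoundary (E : Set Face) = edgeBoundary G) :
    loopOp .semion G l = xOp (boundary E) *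
      (l.map fun d => vertexOp .semion (d, nextDart G d)).prod := by
  have hnd : (l.map Dart.edge).Nodup :=
    hl.map_on fun d hd d' hd' h => edge_injOn_boundaryDarts G ((hG d).1 hd) ((hG d').1 hd') h
  have hset : (l.map Dart.edge).toFinset = boundary E := by
    ext e
    rw [mem_boundary, hE]
    simp only [List.mem_toFinset, List.mem_map]
    constructor
    · rintro ⟨d, hd, rfl⟩; exact edge_mem_edgeBoundary_of_mem ((hG d).1 hd)
    · intro h
      obtain ⟨d, hd, rfl⟩ := exists_boundaryDart h
      exact ⟨d, (hG d).2 hd, rfl⟩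
  rw [loopOp, ← hset, ← prod_pauliX_eq hnd, List.map_map]
  rfl

theorem zVal_singleton (e : Edge) (α : Finset Edge) : zVal {e} α = if e ∈ α then -1 else 1 := by
  rw [zVal, Finset.prod_singleton]

theorem isStabilizer_zOp {B : Finset Edge} (hB : ∀ F : Finset Face, zVal B (boundary F) = 1) (N : ℕ) :
    IsStabilizer N (zOp B) 1 := by
  refine ⟨zOp_mem_unitary B, fun n _ => ?_⟩
  rw [one_smul, approxVector, map_smul, map_sum]
  refine congrArg _ (Finset.sum_congr rfl fun F _ => ?_)
  rw [map_smul, isDiag_zOp, hB, one_smul]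

namespace IsDetermined

theorem add {x y : Obs} (hx : IsDetermined x) (hy : IsDetermined y) : IsDetermined (x + y) := by
  obtain ⟨N, c, h⟩ := hx
  obtain ⟨N', c', h'⟩ := hy
  refine ⟨max N N', c + c', fun f hf => ?_⟩
  rw [map_add, h f (hf.mono (le_max_left _ _)), h' f (hf.mono (le_max_right _ _)), add_mul]

theorem smul {x : Obs} (hx : IsDetermined x) (z : ℂ) : IsDetermined (z • x) := by
  obtain ⟨N, c, h⟩ := hx
  exact ⟨N, z * c, fun f hf => by rw [map_smul, h f hf, smul_eq_mul, mul_assoc]⟩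

theorem zero : IsDetermined 0 := ⟨0, 0, fun f _ => by simp⟩

theorem stabilizer_mul {x W : Obs} {c : ℂ} {N : ℕ} (hx : IsDetermined x) (hW : IsStabilizer N W c) :
    IsDetermined (W * x) := by
  obtain ⟨N', c', h⟩ := hx
  refine ⟨max N N', c * c', fun f hf => ?_⟩
  rw [((hf.mono (le_max_left _ _)) W c hW x).1, h f (hf.mono (le_max_right _ _)), mul_assoc]

/-- A compatible functional has the same value `c * f x` on `W * x` and on `x * W`; anticommutation
makes these values opposite. -/
theorem of_anticommute {x W : Obs} {c : ℂ} {N : ℕ} (hW : IsStabilizer N W c) (hc : c ≠ 0)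
    (h : W * x = -(x * W)) : IsDetermined x := by
  refine ⟨N, 0, fun f hf => ?_⟩
  have h1 := (hf W c hW x).1
  rw [h, map_neg, (hf W c hW x).2] at h1
  have : c * f x = 0 := by linear_combination -h1 / 2
  rw [zero_mul]
  exact (mul_eq_zero.1 this).resolve_left hc

/-- If `B` meets the boundary of every hexagon in an even number of edges, then it does so for all
finite sets of hexagons, and the product of `σ^Z` over `B` fixes every closed configuration.
Otherwise it anticommutes with the semion string around some hexagon. -/
theorem zOp (B : Finset Edge) : IsDetermined (zOp B) := by
  classical
  by_cases h : ∀ f : Face, zVal B (boundary {f}) = 1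
  · have hB : ∀ F : Finset Face, zVal B (boundary F) = 1 := by
      intro F
      induction F using Finset.induction_on with
      | empty =>
        have : boundary ∅ = ∅ := by
          ext e; simp [mem_boundary, edgeBoundary]
        rw [this, zVal_comm]; rfl
      | insert f F hf ih =>
        have : insert f F = symmDiff F {f} := by
          ext x
          rw [Finset.mem_insert, Finset.mem_symmDiff, Finset.mem_singleton]
          have : x = f → x ∉ F := by rintro rfl; exact hf
          tauto
        rw [this, boundary_symmDiff, zVal_symmDiff_right, ih, h, one_mul]
    refine ⟨0, 1, fun f hf => ?_⟩
    have := (hf _ _ (isStabilizer_zOp hB 0) 1).1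
    rwa [mul_one] at this
  · push Not at h
    obtain ⟨f, hf⟩ := h
    have hf' := (zVal_eq B (boundary {f})).resolve_left hf
    obtain ⟨l, N, hW, hl, hG⟩ := exists_loop {f} .semion
    refine of_anticommute hW (by rw [← norm_ne_zero_iff, norm_loopVal]; norm_num) ?_
    rw [loopOp_semion_eq hl hG rfl, ← mul_assoc, zOp_mul_xOp, hf']
    have hD := IsDiag.prod l _ _ fun d _ => isDiag_vertexOp .semion
      (d, nextDart (({f} : Finset Face) : Set Face) d)
    have hc := (hD.commute (isDiag_zOp B)).eq
    rw [neg_one_smul, neg_mul, neg_neg, mul_assoc, mul_assoc, hc]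

theorem of_mem_diagSpan {x : Obs} (hx : x ∈ diagSpan) : IsDetermined x := by
  induction hx using Submodule.span_induction with
  | mem x h => obtain ⟨B, rfl⟩ := h; exact zOp B
  | zero => exact zero
  | add x y _ _ hx hy => exact hx.add hy
  | smul c x _ hx => exact hx.smul c

/-- If `A` is a cycle, then it bounds a finite set, and a closed semion string along it removes the
`σ^X` at the cost of a diagonal operator. If not, the product of `σ^Z` around a vertex with an odd
number of edges in `A` is a stabilizer which anticommutes. -/
theorem xOp_mul_zOp (A B : Finset Edge) : IsDetermined (xOp A * DoubleSemion.zOp B) := by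
  classical
  by_cases hA : IsCycle (A : Set Edge)
  · obtain ⟨E, hE⟩ := exists_boundary_eq A.finite_toSet hA
    have hE' : boundary E = A := by
      ext e; rw [mem_boundary, hE]; rfl
    obtain ⟨l, N, hW, hl, hG⟩ := exists_loop E .semion
    set D := (l.map fun d => vertexOp .semion (d, nextDart (E : Set Face) d)).prod with hD
    have hDu : D ∈ unitary Obs := list_prod_mem fun x hx => by
      obtain ⟨d, -, rfl⟩ := List.mem_map.1 hx; exact vertexOp_mem_unitary _ _
    have hDd : D ∈ diagSpan := prod_mem_diagSpan fun x hx => by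
      obtain ⟨d, -, rfl⟩ := List.mem_map.1 hx; exact vertexOp_mem_diagSpan _ _
    have hx : xOp A * DoubleSemion.zOp B = loopOp .semion E l * (star D * DoubleSemion.zOp B) := by
      rw [loopOp_semion_eq hl hG rfl, ← hD, hE', mul_assoc, ← mul_assoc D,
        (Unitary.mem_iff.1 hDu).2, one_mul]
    rw [hx]
    exact (of_mem_diagSpan (mul_mem_diagSpan (star_mem_diagSpan hDd)
      (zOp_mem_diagSpan B))).stabilizer_mul hW
  · rw [IsCycle] at hA
    push Not at hA
    obtain ⟨d, hd⟩ := hA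
    -- The three edges at the violated vertex. As a symmetric difference, `S` has a multiplicative
    -- eigenvalue without a proof that the edges are distinct.
    set S : Finset Edge := symmDiff (symmDiff {d.edge} {d.turnLeft.edge}) {d.turnRight.edge} with hS
    have hval : ∀ α, zVal S α = (if d.edge ∈ α then -1 else 1) *
        (if d.turnLeft.edge ∈ α then -1 else 1) * (if d.turnRight.edge ∈ α then -1 else 1) := by
      intro α
      rw [hS, zVal_symmDiff_left, zVal_symmDiff_left, zVal_singleton, zVal_singleton, zVal_singleton]
    have h1 : ∀ F : Finset Face, zVal S (boundary F) = 1 := by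
      intro F
      rw [hval]
      simp only [Dart.edge_mem_boundary, Dart.turnLeft_left, Dart.turnLeft_right,
        Dart.turnRight_left, Dart.turnRight_right]
      by_cases h1 : d.left ∈ F <;> by_cases h2 : d.right ∈ F <;> by_cases h3 : d.ahead ∈ F <;>
        simp [h1, h2, h3]
    refine of_anticommute (isStabilizer_zOp h1 0) one_ne_zero ?_
    have h2 : zVal S A = -1 := by
      rw [hval]
      simp only [Finset.mem_coe] at hd
      by_cases h1 : d.edge ∈ A <;> by_cases h2 : d.turnLeft.edge ∈ A <;>
        by_cases h3 : d.turnRight.edge ∈ A <;> simp [h1, h2, h3] at hd ⊢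
    rw [← mul_assoc, zOp_mul_xOp, h2, neg_one_smul, neg_mul, mul_assoc, mul_assoc,
      (((isDiag_zOp S).commute (isDiag_zOp B))).eq]

end IsDetermined

theorem isDetermined_of_mem_localObs {x : Obs} (hx : x ∈ localObs Set.univ) : IsDetermined x := by
  have h := localObs_le_span hx
  clear hx
  induction h using Submodule.span_induction with
  | mem x h => obtain ⟨A, B, rfl⟩ := h; exact IsDetermined.xOp_mul_zOp A B
  | zero => exact IsDetermined.zero
  | add x y _ _ hx hy => exact hx.add hy
  | smul c x _ hx => exact hx.smul c

/-! ### The double semion state -/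

/-- A nonempty set of hexagons without boundary contains with each hexagon the whole row to its
right, hence is infinite. -/
theorem boundary_injective : Function.Injective boundary := by
  intro F F' h
  have h0 : boundary (symmDiff F F') = ∅ := by
    rw [boundary_symmDiff, h, symmDiff_self]; rfl
  suffices hD : symmDiff F F' = ∅ by
    rw [← Finset.bot_eq_empty, symmDiff_eq_bot] at hD; exact hD
  by_contra hne
  obtain ⟨f, hf⟩ := Finset.nonempty_iff_ne_empty.2 hne
  have hstep : ∀ n : ℕ, ((f.1 + n, f.2) : Face) ∈ symmDiff F F' := by
    intro n
    induction n with
    | zero => simpa using hf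
    | succ n ih =>
      by_contra hn
      have : (Dart.mk (f.1 + n, f.2) 0).edge ∈ boundary (symmDiff F F') := by
        rw [Dart.edge_mem_boundary]
        have hr : (Dart.mk (f.1 + n, f.2) 0).right = (f.1 + (n + 1 : ℕ), f.2) := by
          ext <;> simp [Dart.right, dirVec, add_assoc]
        rw [hr]
        tauto
      rw [h0] at this
      exact absurd this (Finset.notMem_empty _)
  have hinj : Function.Injective fun n : ℕ => ((f.1 + n, f.2) : Face) := fun m n h => by
    simpa using h
  exact (Set.infinite_range_of_injective hinj)
    ((symmDiff F F').finite_toSet.subset (by rintro _ ⟨n, rfl⟩; exact hstep n))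

theorem inner_approxVector (n : ℕ) : ⟪approxVector n, approxVector n⟫_ℂ = 1 := by
  have h : ⟪∑ F ∈ (patch n).powerset, ((-1 : ℂ) ^ numStrings (boundary F)) • ket (boundary F),
      ∑ F ∈ (patch n).powerset, ((-1 : ℂ) ^ numStrings (boundary F)) • ket (boundary F)⟫_ℂ =
      2 ^ (patch n).card := by
    rw [sum_inner]
    have : ∀ F ∈ (patch n).powerset,
        ⟪((-1 : ℂ) ^ numStrings (boundary F)) • ket (boundary F),
          ∑ F ∈ (patch n).powerset, ((-1 : ℂ) ^ numStrings (boundary F)) • ket (boundary F)⟫_ℂ = 1 := by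
      intro F hF
      rw [inner_sum, Finset.sum_eq_single_of_mem F hF]
      · rw [inner_smul_left, inner_smul_right, inner_ket_ket, if_pos rfl, mul_one, map_pow,
          map_neg, map_one, ← mul_pow]
        norm_num
      · intro F' _ hne
        rw [inner_smul_left, inner_smul_right, inner_ket_ket,
          if_neg fun h => hne (boundary_injective h).symm]
        simp
    rw [Finset.sum_congr rfl this, Finset.sum_const, Finset.card_powerset]
    simp
  rw [approxVector, inner_smul_left, inner_smul_right, h, Complex.conj_ofReal, ← mul_assoc,
    ← Complex.ofReal_mul, Real.mul_self_sqrt (by positivity)]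
  push_cast
  field_simp

theorem norm_approxVector (n : ℕ) : ‖approxVector n‖ = 1 := by
  have h2 := inner_self_eq_norm_sq (𝕜 := ℂ) (approxVector n)
  rw [inner_approxVector, RCLike.one_re] at h2
  nlinarith [norm_nonneg (approxVector n)]

/-- The approximating states as linear functionals. -/
def approxFunctional (n : ℕ) : Obs →ₗ[ℂ] ℂ where
  toFun := approxState n
  map_add' x y := by
    show ⟪_, (x.1 + y.1) _⟫_ℂ = _
    rw [add_apply, inner_add_right]; rfl
  map_smul' c x := by
    show ⟪_, (c • x.1) _⟫_ℂ = _
    rw [smul_apply, inner_smul_right]; rfl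

theorem approxState_one (n : ℕ) : approxState n 1 = 1 := inner_approxVector n

theorem norm_approxState_le (n : ℕ) (O : Obs) : ‖approxState n O‖ ≤ ‖O‖ := by
  refine (norm_inner_le_norm _ _).trans ?_
  rw [norm_approxVector, one_mul]
  refine (O.1.le_opNorm _).trans ?_
  rw [norm_approxVector, mul_one]
  rfl

theorem IsStabilizer.star {N : ℕ} {W : Obs} {c : ℂ} (h : IsStabilizer N W c) :
    IsStabilizer N (star W) (starRingEnd ℂ c) := by
  refine ⟨Unitary.star_mem h.1, fun n hn => ?_⟩
  have h1 : (Star.star W).1 (W.1 (approxVector n)) = approxVector n := by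
    show (Star.star W * W).1 (approxVector n) = _
    rw [(Unitary.mem_iff.1 h.1).1]; rfl
  have h2 : c * starRingEnd ℂ c = 1 := by
    have h3 : ‖W.1 (approxVector n)‖ = 1 := by
      have h4 : ⟪W.1 (approxVector n), W.1 (approxVector n)⟫_ℂ = 1 := by
        rw [← ContinuousLinearMap.adjoint_inner_right, ← ContinuousLinearMap.star_eq_adjoint]
        show ⟪_, (Star.star W).1 (W.1 (approxVector n))⟫_ℂ = 1
        rw [h1, inner_approxVector]
      have h5 := inner_self_eq_norm_sq (𝕜 := ℂ) (W.1 (approxVector n))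
      rw [h4, RCLike.one_re] at h5
      nlinarith [norm_nonneg (W.1 (approxVector n))]
    rw [h.2 n hn, norm_smul, norm_approxVector, mul_one] at h3
    rw [Complex.mul_conj, Complex.normSq_eq_norm_sq, h3]; simp
  rw [h.2 n hn, map_smul] at h1
  have h3 := congrArg (fun v => starRingEnd ℂ c • v) h1
  simp only [smul_smul, mul_comm _ c, h2, one_smul] at h3
  exact h3

theorem respects_approxFunctional (n : ℕ) : Respects n (approxFunctional n) := by
  intro W c hW O
  constructor
  · show ⟪approxVector n, W.1 (O.1 (approxVector n))⟫_ℂ = c * ⟪approxVector n, O.1 (approxVector n)⟫_ℂ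
    rw [← ContinuousLinearMap.adjoint_inner_left, ← ContinuousLinearMap.star_eq_adjoint]
    show ⟪(star W).1 (approxVector n), _⟫_ℂ = _
    rw [hW.star.2 n le_rfl, inner_smul_left, Complex.conj_conj]
  · show ⟪approxVector n, O.1 (W.1 (approxVector n))⟫_ℂ = c * ⟪approxVector n, O.1 (approxVector n)⟫_ℂ
    rw [hW.2 n le_rfl, map_smul, inner_smul_right]

/-- The same constant is the limit of the expectations and the ratio `f x / f 1` forced on every
compatible functional. The second half is what proves irreducibility. -/
theorem eventually_const_of_mem_localObs {x : Obs} (hx : x ∈ localObs Set.univ) :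
    ∃ c : ℂ, (∃ N, ∀ f, Respects N f → f x = c * f 1) ∧ Tendsto (fun n => approxState n x) atTop (𝓝 c) := by
  obtain ⟨N, c, h⟩ := isDetermined_of_mem_localObs hx
  refine ⟨c, ⟨N, h⟩, tendsto_const_nhds.congr' ?_⟩
  filter_upwards [eventually_ge_atTop N] with n hn
  have := h _ ((respects_approxFunctional n).mono hn)
  show c = approxFunctional n x
  rw [this]
  show c = c * approxState n 1
  rw [approxState_one, mul_one]

theorem cauchySeq_approxState (O : Obs) : CauchySeq fun n => approxState n O := by
  rw [Metric.cauchySeq_iff]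
  intro ε hε
  obtain ⟨x, hx, hxO⟩ := Metric.dense_iff.1 dense_localObs O (ε / 3) (by linarith)
  obtain ⟨c, -, hc⟩ := eventually_const_of_mem_localObs hxO
  obtain ⟨N, hN⟩ := Metric.cauchySeq_iff.1 hc.cauchySeq (ε / 3) (by linarith)
  rw [Metric.mem_ball, dist_eq_norm] at hx
  have hd : ∀ n, dist (approxState n O) (approxState n x) < ε / 3 := by
    intro n
    rw [dist_comm, dist_eq_norm]
    show ‖approxFunctional n x - approxFunctional n O‖ < _
    rw [← map_sub]
    exact (norm_approxState_le n _).trans_lt hx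
  refine ⟨N, fun m hm n hn => ?_⟩
  have h1 := dist_triangle4 (approxState m O) (approxState m x) (approxState n x) (approxState n O)
  have h2 := hN m hm n hn
  have h3 := hd m
  have h4 := hd n
  rw [dist_comm] at h4
  linarith

theorem exists_isDoubleSemionState : ∃ ω : Obs →L[ℂ] ℂ, IsDoubleSemionState ω := by
  choose g hg using fun O => cauchySeq_tendsto_of_complete (cauchySeq_approxState O)
  refine ⟨LinearMap.mkContinuous
    { toFun := g
      map_add' := fun x y => tendsto_nhds_unique (hg _) (((hg x).add (hg y)).congr fun n =>
        ((approxFunctional n).map_add x y).symm)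
      map_smul' := fun c x => tendsto_nhds_unique (hg _) (((hg x).const_mul c).congr fun n =>
        ((approxFunctional n).map_smul c x).symm) } 1 fun x => ?_, hg⟩
  rw [one_mul]
  exact le_of_tendsto (hg x).norm (Eventually.of_forall fun n => norm_approxState_le n x)

scoped instance : IsClosed (quasiLocal : Set (ConfigSpace →L[ℂ] ConfigSpace)) :=
  StarSubalgebra.isClosed_topologicalClosure _

-- The C*-structure makes representations contractive and automorphisms isometric, on which all
-- limit arguments below rest.
scoped instance : CStarAlgebra Obs := StarSubalgebra.cstarAlgebra quasiLocal

/-! ### Stabilizers and irreducibility in the GNS representation. -/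

section GNS

variable {ω : Obs →L[ℂ] ℂ} {H : Type*} [NormedAddCommGroup H] [InnerProductSpace ℂ H]
  [CompleteSpace H] {π : Obs →⋆ₐ[ℂ] (H →L[ℂ] H)} {Ω : H}

theorem norm_representation_le (π : Obs →⋆ₐ[ℂ] (H →L[ℂ] H)) (O : Obs) : ‖π O‖ ≤ ‖O‖ :=
  NonUnitalStarAlgHom.norm_apply_le π O

theorem continuous_representation (π : Obs →⋆ₐ[ℂ] (H →L[ℂ] H)) : Continuous π :=
  AddMonoidHomClass.continuous_of_bound π 1 fun O => by
    rw [one_mul]; exact norm_representation_le π O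

theorem inner_representation (h : IsGNSTriple ω π Ω) (x y : Obs) :
    ⟪π x Ω, π y Ω⟫_ℂ = ω (star x * y) := by
  rw [← h.expectation, map_mul, map_star, ContinuousLinearMap.mul_apply,
    ContinuousLinearMap.star_eq_adjoint, ContinuousLinearMap.adjoint_inner_right]

/-- With `X = W - c` the expectation of `star X * X` vanishes in all late approximating states,
hence in `ω`, so `π X` annihilates `Ω`. -/
theorem IsStabilizer.representation (hω : IsDoubleSemionState ω) (h : IsGNSTriple ω π Ω)
    {N : ℕ} {W : Obs} {c : ℂ} (hW : IsStabilizer N W c) : π W Ω = c • Ω := by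
  set X : Obs := W - algebraMap ℂ Obs c with hX
  have h0 : ω (Star.star X * X) = 0 := by
    refine tendsto_nhds_unique (hω _) (tendsto_const_nhds.congr' ?_)
    filter_upwards [eventually_ge_atTop N] with n hn
    have : X.1 (approxVector n) = 0 := by
      show W.1 (approxVector n) - (algebraMap ℂ (ConfigSpace →L[ℂ] ConfigSpace) c) (approxVector n) = 0
      rw [hW.2 n hn, Algebra.algebraMap_eq_smul_one, smul_apply,
        ContinuousLinearMap.one_apply, sub_self]
    show 0 = ⟪approxVector n, (Star.star X).1 (X.1 (approxVector n))⟫_ℂ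
    rw [this, map_zero, inner_zero_right]
  rw [← inner_representation h, inner_self_eq_zero, hX, map_sub, AlgHomClass.commutes,
    Algebra.algebraMap_eq_smul_one] at h0
  rwa [sub_apply, smul_apply, ContinuousLinearMap.one_apply, sub_eq_zero] at h0

/-- For `A` in the commutant, the functional which takes `O` to the matrix element of `A * π O` at
`Ω` is compatible with all stabilizers, so it is a multiple of `ω`, first on local observables and
then by continuity. Cyclicity of `Ω` turns this into an identity of operators. -/
theorem commutant_trivial (hω : IsDoubleSemionState ω) (h : IsGNSTriple ω π Ω) {A : H →L[ℂ] H}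
    (hA : ∀ O, A * π O = π O * A) : ∃ c : ℂ, A = c • 1 := by
  set f : Obs →ₗ[ℂ] ℂ :=
    { toFun := fun O => ⟪Ω, A (π O Ω)⟫_ℂ
      map_add' := fun x y => by rw [map_add, add_apply, map_add, inner_add_right]
      map_smul' := fun c x => by
        rw [map_smul, smul_apply, map_smul, inner_smul_right]; rfl } with hf
  have hfO : ∀ O, f O = ⟪Ω, A (π O Ω)⟫_ℂ := fun _ => rfl
  have hcomm : ∀ O v, A (π O v) = π O (A v) := fun O v => by
    have := DFunLike.congr_fun (hA O) v
    exact this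
  have hresp : ∀ N, Respects N f := by
    intro N W c hW O
    constructor
    · rw [hfO, hfO, map_mul, ContinuousLinearMap.mul_apply, hcomm,
        ← ContinuousLinearMap.adjoint_inner_left, ← ContinuousLinearMap.star_eq_adjoint, ← map_star,
        hW.star.representation hω h, inner_smul_left, Complex.conj_conj]
    · rw [hfO, hfO, map_mul, ContinuousLinearMap.mul_apply, hW.representation hω h, map_smul,
        map_smul, inner_smul_right]
  have hloc : ∀ x ∈ localObs Set.univ, f x = ω x * f 1 := by
    intro x hx
    obtain ⟨c, ⟨N, hN⟩, hc⟩ := eventually_const_of_mem_localObs hx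
    rw [hN f (hresp N), tendsto_nhds_unique (hω x) hc]
  have hcont : Continuous fun O => f O := by
    have h1 : Continuous fun O => π O Ω :=
      (ContinuousLinearMap.apply ℂ H Ω).continuous.comp (continuous_representation π)
    exact (continuous_const (y := Ω)).inner (𝕜 := ℂ) (A.continuous.comp h1)
  have hall : ∀ x, f x = ω x * f 1 := by
    have := dense_localObs.closure_eq ▸ closure_minimal (s := (localObs Set.univ : Set Obs))
      (t := {x | f x = ω x * f 1}) hloc
      (isClosed_eq hcont (ω.continuous.mul continuous_const))
    exact fun x => this (Set.mem_univ x)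
  refine ⟨f 1, ?_⟩
  have hv : ∀ O, A (π O Ω) = f 1 • π O Ω := by
    intro O
    refine h.cyclic.eq_of_inner_right (𝕜 := ℂ) ?_
    intro O'
    have h1 := hall (star O' * O)
    rw [hfO, map_mul, ContinuousLinearMap.mul_apply, hcomm, map_star,
      ContinuousLinearMap.star_eq_adjoint, ContinuousLinearMap.adjoint_inner_right] at h1
    show ⟪π O' Ω, _⟫_ℂ = ⟪π O' Ω, _⟫_ℂ
    rw [h1, inner_smul_right, inner_representation h, mul_comm]
  refine ContinuousLinearMap.coeFn_injective ?_
  refine h.cyclic.equalizer A.continuous ((f 1 • (1 : H →L[ℂ] H))).continuous ?_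
  funext O
  exact hv O

end GNS

/-! ### Limits of inner automorphisms -/

/-- The star automorphisms of the quasi-local algebra. -/
abbrev Aut : Type := Obs ≃⋆ₐ[ℂ] Obs

/-- Conjugation with a unitary. -/
abbrev Ad : unitary Obs →* Aut := Unitary.conjStarAlgAut ℂ Obs

theorem Ad_apply (u : unitary Obs) (O : Obs) : Ad u O = u * O * star (u : Obs) := rfl

theorem norm_aut (α : Aut) (O : Obs) : ‖α O‖ = ‖O‖ := NonUnitalStarAlgHom.norm_map α α.injective O

theorem aut_mul_apply (α β : Aut) (O : Obs) : (α * β) O = α (β O) := rfl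

theorem aut_inv_apply_self (α : Aut) (O : Obs) : α⁻¹ (α O) = O := by
  rw [← aut_mul_apply, inv_mul_cancel]; rfl

theorem aut_apply_inv_self (α : Aut) (O : Obs) : α (α⁻¹ O) = O := by
  rw [← aut_mul_apply, mul_inv_cancel]; rfl

/-- Conjugating `Ad u` with an automorphism. -/
def mapUnitary (α : Aut) (u : unitary Obs) : unitary Obs :=
  ⟨α u, by
    have h := Unitary.mem_iff.1 u.2
    rw [Unitary.mem_iff, ← map_star, ← map_mul, ← map_mul, h.1, h.2, map_one]
    exact ⟨rfl, rfl⟩⟩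

theorem mul_Ad (α : Aut) (u : unitary Obs) : α * Ad u = Ad (mapUnitary α u) * α := by
  ext1 O
  rw [aut_mul_apply, aut_mul_apply, Ad_apply, Ad_apply, map_mul, map_mul, map_star]
  rfl

/-- Pointwise convergence of automorphisms in norm. -/
def ConvergesTo {κ : Type*} (𝓕 : Filter κ) (β : κ → Aut) (α : Aut) : Prop :=
  ∀ O, Tendsto (fun k => β k O) 𝓕 (𝓝 (α O))

namespace ConvergesTo

variable {κ : Type*} {𝓕 : Filter κ} {β γ : κ → Aut} {α δ : Aut}

theorem unique [𝓕.NeBot] (h : ConvergesTo 𝓕 β α) (h' : ConvergesTo 𝓕 β δ) : α = δ := by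
  ext1 O
  exact tendsto_nhds_unique (h O) (h' O)

theorem const (α : Aut) : ConvergesTo 𝓕 (fun _ => α) α := fun _ => tendsto_const_nhds

theorem mul (h : ConvergesTo 𝓕 β α) (h' : ConvergesTo 𝓕 γ δ) :
    ConvergesTo 𝓕 (fun k => β k * γ k) (α * δ) := by
  intro O
  have h1 : Tendsto (fun k => β k (γ k O) - β k (δ O)) 𝓕 (𝓝 0) := by
    rw [tendsto_zero_iff_norm_tendsto_zero]
    have h2 := tendsto_iff_norm_sub_tendsto_zero.1 (h' O)
    refine h2.congr fun k => ?_
    rw [← map_sub, norm_aut]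
  have h2 := h1.add (h (δ O))
  simp only [sub_add_cancel, zero_add] at h2
  exact h2

theorem inv (h : ConvergesTo 𝓕 β α) : ConvergesTo 𝓕 (fun k => (β k)⁻¹) α⁻¹ := by
  intro O
  rw [tendsto_iff_norm_sub_tendsto_zero]
  have h2 := tendsto_iff_norm_sub_tendsto_zero.1 (h (α⁻¹ O))
  refine h2.congr fun k => ?_
  rw [aut_apply_inv_self, ← norm_aut (β k)⁻¹, map_sub, aut_inv_apply_self, norm_sub_rev]

theorem congr' (h : ConvergesTo 𝓕 β α) (h' : ∀ᶠ k in 𝓕, β k = γ k) : ConvergesTo 𝓕 γ α :=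
  fun O => (h O).congr' (h'.mono fun k hk => by rw [hk])

end ConvergesTo

/-- The Pauli matrices. -/
def generators : Set Obs := Set.range pauliX ∪ Set.range pauliZ

theorem star_mem_generators {g : Obs} (h : g ∈ generators) : star g = g := by
  rcases h with ⟨e, rfl⟩ | ⟨e, rfl⟩
  · exact star_pauliX e
  · exact star_pauliZ e

theorem aut_algebraMap (α : Aut) (c : ℂ) : α (algebraMap ℂ Obs c) = algebraMap ℂ Obs c := by
  rw [Algebra.algebraMap_eq_smul_one, map_smul, map_one]

/-- Automorphisms are isometric, so the set where convergence holds is closed under norm limits as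
well as under sums and products. -/
theorem ConvergesTo.of_generators {κ : Type*} {𝓕 : Filter κ} {β : κ → Aut} {α : Aut}
    (h : ∀ g ∈ generators, Tendsto (fun k => β k g) 𝓕 (𝓝 (α g))) : ConvergesTo 𝓕 β α := by
  refine obs_induction (fun e => h _ (Or.inl ⟨e, rfl⟩)) (fun e => h _ (Or.inr ⟨e, rfl⟩)) ?_ ?_ ?_ ?_
  · intro c
    simp only [aut_algebraMap]
    exact tendsto_const_nhds
  · intro x y hx hy
    simp only [map_add]
    exact hx.add hy
  · intro x y hx hy
    simp only [map_mul]
    exact hx.mul hy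
  · rw [← isSeqClosed_iff_isClosed]
    intro x y hx hxy
    rw [Set.mem_ofPred_eq, Metric.tendsto_nhds]
    intro ε hε
    obtain ⟨n, hn⟩ := (Metric.tendsto_nhds.1 hxy (ε / 3) (by linarith)).exists
    filter_upwards [Metric.tendsto_nhds.1 (hx n) (ε / 3) (by linarith)] with k hk
    have h1 : dist (β k y) (β k (x n)) < ε / 3 := by
      rw [dist_eq_norm, ← map_sub, norm_aut, ← dist_eq_norm, dist_comm]; exact hn
    have h2 : dist (α (x n)) (α y) < ε / 3 := by
      rw [dist_eq_norm, ← map_sub, norm_aut, ← dist_eq_norm]; exact hn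
    linarith [dist_triangle4 (β k y) (β k (x n)) (α (x n)) (α y)]

theorem exists_tendsto_of_generators {κ : Type*} {𝓕 : Filter κ} [𝓕.NeBot] {β : κ → Aut}
    (h : ∀ g ∈ generators, ∃ y, Tendsto (fun k => β k g) 𝓕 (𝓝 y)) (O : Obs) :
    ∃ y, Tendsto (fun k => β k O) 𝓕 (𝓝 y) := by
  revert O
  refine obs_induction (fun e => h _ (Or.inl ⟨e, rfl⟩)) (fun e => h _ (Or.inr ⟨e, rfl⟩)) ?_ ?_ ?_ ?_
  · intro c
    simp only [aut_algebraMap]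
    exact ⟨_, tendsto_const_nhds⟩
  · rintro x y ⟨x', hx⟩ ⟨y', hy⟩
    simp only [map_add]
    exact ⟨_, hx.add hy⟩
  · rintro x y ⟨x', hx⟩ ⟨y', hy⟩
    simp only [map_mul]
    exact ⟨_, hx.mul hy⟩
  · rw [← isSeqClosed_iff_isClosed]
    intro x y hx hxy
    rw [Set.mem_ofPred_eq]
    refine cauchy_map_iff_exists_tendsto.1 (Metric.cauchy_iff.2 ⟨inferInstance, fun ε hε => ?_⟩)
    obtain ⟨n, hn⟩ := (Metric.tendsto_nhds.1 hxy (ε / 4) (by linarith)).exists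
    obtain ⟨z, hz⟩ := hx n
    refine ⟨{O | dist O z < ε / 2}, ?_, ?_⟩
    · rw [Filter.mem_map]
      filter_upwards [Metric.tendsto_nhds.1 hz (ε / 4) (by linarith)] with k hk
      have h1 : dist (β k y) (β k (x n)) < ε / 4 := by
        rw [dist_eq_norm, ← map_sub, norm_aut, ← dist_eq_norm, dist_comm]; exact hn
      show dist (β k y) z < ε / 2
      linarith [dist_triangle (β k y) (β k (x n)) z]
    · intro u hu v hv
      have h1 : dist u z < ε / 2 := hu
      have h2 : dist v z < ε / 2 := hv
      linarith [dist_triangle_right u v z]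

/-- A pointwise limit of automorphisms is an isometric homomorphism but need not be surjective.
Convergence of the inverses supplies the inverse map. -/
theorem exists_convergesTo {κ : Type*} {𝓕 : Filter κ} [𝓕.NeBot] {β : κ → Aut}
    (h : ∀ g ∈ generators, ∃ y, Tendsto (fun k => β k g) 𝓕 (𝓝 y))
    (h' : ∀ g ∈ generators, ∃ y, Tendsto (fun k => (β k)⁻¹ g) 𝓕 (𝓝 y)) :
    ∃ α, ConvergesTo 𝓕 β α := by
  choose f hf using exists_tendsto_of_generators h
  choose f' hf' using exists_tendsto_of_generators h'
  have cancel : ∀ {β : κ → Aut} {x y z : Obs}, Tendsto (fun k => β k x) 𝓕 (𝓝 y) →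
      Tendsto (fun k => (β k)⁻¹ y) 𝓕 (𝓝 z) → z = x := by
    intro β x y z h1 h2
    refine tendsto_nhds_unique h2 (tendsto_iff_norm_sub_tendsto_zero.2 ?_)
    refine (tendsto_iff_norm_sub_tendsto_zero.1 h1).congr fun k => ?_
    rw [← norm_aut (β k)⁻¹, map_sub, aut_inv_apply_self, norm_sub_rev]
  refine ⟨
    { toFun := f
      invFun := f'
      left_inv := fun x => cancel (hf x) (hf' _)
      right_inv := fun x => cancel (β := fun k => (β k)⁻¹) (hf' x) (by simpa using hf _)
      map_mul' := fun x y => tendsto_nhds_unique (hf _) (((hf x).mul (hf y)).congr fun k =>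
        (map_mul _ _ _).symm)
      map_add' := fun x y => tendsto_nhds_unique (hf _) (((hf x).add (hf y)).congr fun k =>
        (map_add _ _ _).symm)
      map_star' := fun x => tendsto_nhds_unique (hf _) ((hf x).star.congr fun k =>
        (map_star _ _).symm)
      map_smul' := fun c x => tendsto_nhds_unique (hf _) (((hf x).const_smul c).congr fun k =>
        (map_smul _ _ _).symm) }, hf⟩

/-! ### Infinite products of commuting local unitaries -/

/-- A family of commuting unitaries, all but finitely many of which commute with any given Pauli
matrix. -/
structure LocallyFiniteFamily {ι : Type} (u : ι → unitary Obs) : Prop where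
  commute : ∀ i j, Commute (u i) (u j)
  finite : ∀ g ∈ generators, {i | ¬ Commute (u i : Obs) g}.Finite

namespace LocallyFiniteFamily

variable {ι : Type} {u : ι → unitary Obs}

theorem Ad_of_commute {u : unitary Obs} {g : Obs} (h : Commute (u : Obs) g) : Ad u g = g := by
  rw [Ad_apply, h.eq, mul_assoc, (Unitary.mem_iff.1 u.2).2, mul_one]

theorem commute_prod (h : LocallyFiniteFamily u) (i : ι) (l : List ι) :
    Commute (u i) (l.map u).prod := by
  refine Commute.list_prod_right _ _ fun v hv => ?_
  obtain ⟨j, -, rfl⟩ := List.mem_map.1 hv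
  exact h.commute i j

open scoped Classical in
-- A factor which commutes with `g` may be moved next to `g` through the others and then drops out.
theorem Ad_prod_filter (h : LocallyFiniteFamily u) {F : Finset ι} {g : Obs}
    (hF : ∀ i, ¬ Commute (u i : Obs) g → i ∈ F) (l : List ι) :
    Ad (l.map u).prod g = Ad (((l.filter (· ∈ F))).map u).prod g := by
  induction l with
  | nil => rfl
  | cons i l ih =>
    rw [List.map_cons, List.prod_cons, map_mul, aut_mul_apply, ih]
    by_cases hi : i ∈ F
    · rw [List.filter_cons_of_pos (by simpa using hi), List.map_cons, List.prod_cons, map_mul]; rfl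
    · rw [List.filter_cons_of_neg (by simpa using hi), ← aut_mul_apply, ← map_mul,
        (h.commute_prod i _).eq, map_mul, aut_mul_apply,
        Ad_of_commute (not_not.1 fun hc => hi (hF i hc))]

open scoped Classical in
-- Only finitely many factors act on a given generator, so the conjugations are eventually constant
-- on it. The unitary `v` does not depend on the net of finite lists, which makes the infinite
-- product independent of the exhaustion.
theorem eventually_Ad_eq (h : LocallyFiniteFamily u) (S : Set ι) {g : Obs} (hg : g ∈ generators) :
    ∃ v : unitary Obs, ∀ {κ : Type} (𝓕 : Filter κ) (l : κ → List ι),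
      (∀ k, (l k).Nodup) → (∀ i, ∀ᶠ k in 𝓕, (i ∈ l k ↔ i ∈ S)) →
      ∀ᶠ k in 𝓕, Ad ((l k).map u).prod g = Ad v g ∧ Ad ((l k).map u).prod⁻¹ g = Ad v⁻¹ g := by
  set F := (h.finite g hg).toFinset with hF
  refine ⟨(((F.filter (· ∈ S)).toList).map u).prod, fun 𝓕 l hnd hl => ?_⟩
  have hinv : ∀ l : List ι, (l.map u).prod⁻¹ = (l.map fun i => (u i)⁻¹).prod := by
    intro l
    induction l with
    | nil => simp
    | cons i l ih =>
      rw [List.map_cons, List.prod_cons, List.map_cons, List.prod_cons, mul_inv_rev, ← ih,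
        ((h.commute_prod i l).inv_inv).eq]
  have h' : LocallyFiniteFamily fun i => (u i)⁻¹ := by
    refine ⟨fun i j => (h.commute i j).inv_inv, fun g hg => (h.finite g hg).subset ?_⟩
    intro i hi hc
    refine hi ?_
    have := hc.star_star
    rw [star_mem_generators hg] at this
    exact this
  filter_upwards [(Filter.eventually_all_finset F).2 fun i _ => hl i] with k hk
  have hperm : ((l k).filter (· ∈ F)).Perm (F.filter (· ∈ S)).toList := by
    refine (List.perm_ext_iff_of_nodup ((hnd k).filter _) (Finset.nodup_toList _)).2 fun i => ?_
    simp only [List.mem_filter, decide_eq_true_eq, Finset.mem_toList, Finset.mem_filter]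
    constructor
    · rintro ⟨h1, h2⟩; exact ⟨h2, (hk i h2).1 h1⟩
    · rintro ⟨h1, h2⟩; exact ⟨(hk i h1).2 h2, h1⟩
  constructor
  · rw [h.Ad_prod_filter (F := F) (fun i hi => by simpa [hF] using hi)]
    congr 2
    refine (hperm.map u).prod_eq' ?_
    exact List.pairwise_map.2 (List.pairwise_of_forall h.commute)
  · rw [hinv, hinv, h'.Ad_prod_filter (F := F) ?_]
    · congr 2
      refine (hperm.map _).prod_eq' ?_
      exact List.pairwise_map.2 (List.pairwise_of_forall h'.commute)
    · intro i hi
      rw [hF, Set.Finite.mem_toFinset, Set.mem_ofPred_eq]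
      intro hc
      refine hi ?_
      have := hc.star_star
      rw [star_mem_generators hg] at this
      exact this

open scoped Classical in
/-- Conjugation with the infinite product of the unitaries with index in `S`. -/
theorem exists_limit (h : LocallyFiniteFamily u) (S : Set ι) : ∃ α : Aut,
    ∀ {κ : Type} (𝓕 : Filter κ) (l : κ → List ι),
      (∀ k, (l k).Nodup) → (∀ i, ∀ᶠ k in 𝓕, (i ∈ l k ↔ i ∈ S)) →
      ConvergesTo 𝓕 (fun k => Ad ((l k).map u).prod) α := by
  choose v hv using fun g : generators => h.eventually_Ad_eq S g.2
  set l₀ : Finset ι → List ι := fun s => (s.filter (· ∈ S)).toList with hl₀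
  have hnd : ∀ s, (l₀ s).Nodup := fun s => Finset.nodup_toList _
  have hmem : ∀ i, ∀ᶠ s in atTop, (i ∈ l₀ s ↔ i ∈ S) := fun i => by
    filter_upwards [eventually_ge_atTop ({i} : Finset ι)] with s hs
    have : i ∈ s := hs (Finset.mem_singleton_self i)
    simp [hl₀, this]
  obtain ⟨α, hα⟩ := exists_convergesTo (𝓕 := atTop) (β := fun s => Ad ((l₀ s).map u).prod)
    (fun g hg => ⟨_, tendsto_const_nhds.congr' ((hv ⟨g, hg⟩ atTop l₀ hnd hmem).mono
      fun k hk => hk.1.symm)⟩)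
    (fun g hg => ⟨Ad (v ⟨g, hg⟩)⁻¹ g, tendsto_const_nhds.congr' ((hv ⟨g, hg⟩ atTop l₀ hnd hmem).mono
      fun k hk => by simpa only [map_inv] using hk.2.symm)⟩)
  have hαg : ∀ g : generators, α g = Ad (v g) g := fun g =>
    tendsto_nhds_unique (hα g) (tendsto_const_nhds.congr' ((hv g atTop l₀ hnd hmem).mono
      fun k hk => hk.1.symm))
  refine ⟨α, fun 𝓕 l h1 h2 => ConvergesTo.of_generators fun g hg => ?_⟩
  rw [hαg ⟨g, hg⟩]
  exact tendsto_const_nhds.congr' ((hv ⟨g, hg⟩ 𝓕 l h1 h2).mono fun k hk => hk.1.symm)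

/-- Conjugation with the infinite product of the unitaries with index in `S`. -/
def limAd (h : LocallyFiniteFamily u) (S : Set ι) : Aut := (h.exists_limit S).choose

theorem convergesTo_limAd (h : LocallyFiniteFamily u) (S : Set ι) {κ : Type} {𝓕 : Filter κ}
    {l : κ → List ι} (hl : ∀ k, (l k).Nodup) (hS : ∀ i, ∀ᶠ k in 𝓕, (i ∈ l k ↔ i ∈ S)) :
    ConvergesTo 𝓕 (fun k => Ad ((l k).map u).prod) (h.limAd S) :=
  (h.exists_limit S).choose_spec 𝓕 l hl hS

theorem limAd_list (h : LocallyFiniteFamily u) {l : List ι} (hl : l.Nodup) :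
    h.limAd {i | i ∈ l} = Ad (l.map u).prod :=
  (h.convergesTo_limAd (𝓕 := (atTop : Filter ℕ)) {i | i ∈ l} (l := fun _ => l) (fun _ => hl)
    fun i => Eventually.of_forall fun _ => Iff.rfl).unique (ConvergesTo.const _)

open scoped Classical in
theorem exists_lists (S : Set ι) : ∃ l : Finset ι → List ι, (∀ s, (l s).Nodup) ∧
    (∀ s, ∀ i ∈ l s, i ∈ S) ∧ ∀ i, ∀ᶠ s in atTop, (i ∈ l s ↔ i ∈ S) := by
  refine ⟨fun s => (s.filter (· ∈ S)).toList, fun s => Finset.nodup_toList _, ?_, fun i => ?_⟩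
  · intro s i hi
    simp only [Finset.mem_toList, Finset.mem_filter] at hi
    exact hi.2
  · filter_upwards [eventually_ge_atTop ({i} : Finset ι)] with s hs
    have : i ∈ s := hs (Finset.mem_singleton_self i)
    simp [this]

theorem limAd_union (h : LocallyFiniteFamily u) {S T : Set ι} (hd : Disjoint S T) :
    h.limAd (S ∪ T) = h.limAd S * h.limAd T := by
  obtain ⟨l, h1, h2, h3⟩ := exists_lists S
  obtain ⟨l', h1', h2', h3'⟩ := exists_lists T
  have hS := h.convergesTo_limAd S h1 h3
  have hT := h.convergesTo_limAd T h1' h3'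
  have hST := h.convergesTo_limAd (S ∪ T) (𝓕 := atTop) (l := fun s => l s ++ l' s)
    (fun s => List.Nodup.append (h1 s) (h1' s) fun i hi hi' =>
      Set.disjoint_left.1 hd (h2 s i hi) (h2' s i hi'))
    (fun i => by
      filter_upwards [h3 i, h3' i] with s hs hs'
      rw [List.mem_append, hs, hs']; rfl)
  refine hST.unique ((hS.mul hT).congr' (Eventually.of_forall fun s => ?_))
  rw [List.map_append, List.prod_append, map_mul]

/-- Changing finitely many factors changes the infinite product by a finite product. -/
theorem limAd_eq_of_finite_diff (h : LocallyFiniteFamily u) {S T : Set ι}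
    {M : Subgroup (unitary Obs)} (hf : (S \ T).Finite) (hf' : (T \ S).Finite)
    (hM : ∀ i ∈ S \ T, u i ∈ M) (hM' : ∀ i ∈ T \ S, u i ∈ M) :
    ∃ v ∈ M, h.limAd S = Ad v * h.limAd T := by
  have key : ∀ {S T : Set ι}, (S \ T).Finite → (∀ i ∈ S \ T, u i ∈ M) →
      ∃ v ∈ M, h.limAd S = Ad v * h.limAd (S ∩ T) := by
    intro S T hf hM
    have h1 : h.limAd (S \ T) = Ad (hf.toFinset.toList.map u).prod := by
      rw [← h.limAd_list (Finset.nodup_toList _)]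
      congr 1
      ext i
      simp
    refine ⟨(hf.toFinset.toList.map u).prod, list_prod_mem fun v hv => ?_, ?_⟩
    · obtain ⟨i, hi, rfl⟩ := List.mem_map.1 hv
      exact hM i (by simpa using hi)
    · rw [← h1, ← h.limAd_union (Set.disjoint_sdiff_inter), Set.diff_union_inter]
  obtain ⟨v, hv, e⟩ := key hf hM
  obtain ⟨v', hv', e'⟩ := key hf' hM'
  refine ⟨v * v'⁻¹, M.mul_mem hv (M.inv_mem hv'), ?_⟩
  rw [e, e', Set.inter_comm T S, map_mul, map_inv, mul_assoc, inv_mul_cancel_left]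

/-- An automorphism which fixes the factors commutes with the infinite product. -/
theorem commute_limAd (h : LocallyFiniteFamily u) {S : Set ι} {β : Aut}
    (hβ : ∀ i ∈ S, β (u i) = u i) : Commute β (h.limAd S) := by
  obtain ⟨l, h1, h2, h3⟩ := exists_lists S
  have hS := h.convergesTo_limAd S h1 h3
  have e1 := (ConvergesTo.const (𝓕 := atTop) β).mul hS
  have e2 := hS.mul (ConvergesTo.const (𝓕 := atTop) β)
  refine e1.unique (e2.congr' (Eventually.of_forall fun s => ?_))
  rw [mul_Ad]
  congr 2
  refine Subtype.ext ?_
  show _ = β ((List.map u (l s)).prod : unitary Obs)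
  have : ∀ l' : List ι, (∀ i ∈ l', i ∈ S) →
      β (((l'.map u).prod : unitary Obs) : Obs) = ((l'.map u).prod : unitary Obs) := by
    intro l' hl'
    induction l' with
    | nil => exact map_one β
    | cons i l' ih =>
      rw [List.map_cons, List.prod_cons, Submonoid.coe_mul, map_mul, hβ i (hl' i (by simp)),
        ih fun j hj => hl' j (by simp [hj])]
  exact (this _ (h2 s)).symm

end LocallyFiniteFamily

theorem LocallyFiniteFamily.limAd_apply_of_commute {ι : Type} {u : ι → unitary Obs}
    (h : LocallyFiniteFamily u) {S : Set ι} {g : Obs} (hS : ∀ i ∈ S, Commute (u i : Obs) g) :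
    h.limAd S g = g := by
  obtain ⟨l, h1, h2, h3⟩ := exists_lists S
  refine tendsto_nhds_unique (h.convergesTo_limAd S h1 h3 g) (tendsto_const_nhds.congr fun s => ?_)
  refine (Ad_of_commute ?_).symm
  have : ∀ l' : List ι, (∀ i ∈ l', i ∈ S) → Commute (((l'.map u).prod : unitary Obs) : Obs) g := by
    intro l' hl'
    induction l' with
    | nil => exact Commute.one_left g
    | cons i l' ih =>
      rw [List.map_cons, List.prod_cons, Submonoid.coe_mul]
      exact (hS i (hl' i (by simp))).mul_left (ih fun j hj => hl' j (by simp [hj]))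
  exact this _ (h2 s)

/-! ### String automorphisms -/

/-- The unitary factor of a string operator at an edge. -/
def edgeU (a : Anyon) (e : Edge) : unitary Obs := ⟨edgeOp a e, edgeOp_mem_unitary a e⟩

/-- The unitary factor of a string operator at a vertex. -/
def vertexU (a : Anyon) (p : Dart × Dart) : unitary Obs := ⟨vertexOp a p, vertexOp_mem_unitary a p⟩

theorem edgeOp_eq (a : Anyon) : (∀ e, edgeOp a e = 1) ∨ ∀ e, edgeOp a e = pauliX e := by
  cases a
  · exact Or.inl fun _ => rfl
  · exact Or.inr fun _ => rfl
  · exact Or.inr fun _ => rfl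
  · exact Or.inl fun _ => rfl

theorem commute_edgeOp_pauliX (a : Anyon) (e e' : Edge) : Commute (edgeOp a e) (pauliX e') := by
  rcases edgeOp_eq a with h | h
  · rw [h]; exact Commute.one_left _
  · rw [h]; exact pauliX_comm e e'

theorem commute_edgeOp (a : Anyon) (e e' : Edge) : Commute (edgeOp a e) (edgeOp a e') := by
  rcases edgeOp_eq a with h | h
  · rw [h]; exact Commute.one_left _
  · rw [h, h]; exact pauliX_comm e e'

theorem commute_edgeOp_pauliZ (a : Anyon) {e e' : Edge} (hne : e ≠ e') :
    Commute (edgeOp a e) (pauliZ e') := by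
  rcases edgeOp_eq a with h | h
  · rw [h]; exact Commute.one_left _
  · rw [h]; exact pauliX_pauliZ_of_ne hne

theorem commute_vertexOp_pauliX (a : Anyon) {p : Dart × Dart} {e : Edge} (h1 : p.1.edge ≠ e)
    (h2 : p.2.edge ≠ e) (h3 : p.1.turnRight.edge ≠ e) : Commute (vertexOp a p) (pauliX e) :=
  (isDiag_vertexOp a p).commute_pauliX fun α => by
    simp only [vertexVal, mem_flip, h1, h2, h3, iff_false, not_not]

theorem locallyFinite_edgeU (a : Anyon) : LocallyFiniteFamily (edgeU a) where
  commute e e' := Subtype.ext (commute_edgeOp a e e')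
  finite := by
    rintro _ (⟨e, rfl⟩ | ⟨e, rfl⟩)
    · refine Set.finite_empty.subset fun i hi => hi (commute_edgeOp_pauliX a i e)
    · refine (Set.finite_singleton e).subset fun i hi => ?_
      by_contra hne
      exact hi (commute_edgeOp_pauliZ a hne)

theorem finite_darts_of_edge (e : Edge) : {d : Dart | d.edge = e}.Finite := by
  refine (Set.toFinite {e.dart, e.dart.reverse}).subset fun d hd => ?_
  have : d.edge = e.dart.edge := by rw [Edge.dart_edge]; exact hd
  exact Dart.edge_eq_iff.1 this

theorem finite_following {K : Set Dart} (hK : K.Finite) :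
    {p : Dart × Dart | p.1.Follows p.2 ∧ (p.1 ∈ K ∨ p.2 ∈ K)}.Finite := by
  refine (((hK.image fun d => (d, d.turnLeft)).union (hK.image fun d => (d, d.turnRight))).union
    ((hK.image fun d => (d.unturnLeft, d)).union (hK.image fun d => (d.unturnRight, d)))).subset ?_
  rintro ⟨d, d'⟩ ⟨h, h'⟩
  rcases h' with h' | h'
  · left
    rcases h with h | h
    · left; exact ⟨d, h', Prod.ext rfl h.symm⟩
    · right; exact ⟨d, h', Prod.ext rfl h.symm⟩
  · right
    rcases h with h | h
    · left; exact ⟨d', h', Prod.ext (by rw [show d' = d.turnLeft from h]; simp) rfl⟩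
    · right; exact ⟨d', h', Prod.ext (by rw [show d' = d.turnRight from h]; simp) rfl⟩

/-- The vertex factors are diagonal, so only `σ^X` can fail to commute with them, and it does so
only at vertices whose two edges or third leg include the given site. Pairs which are not
consecutive have factor `1` and do not spoil finiteness. -/
theorem locallyFinite_vertexU (a : Anyon) : LocallyFiniteFamily (vertexU a) where
  commute p p' := Subtype.ext ((isDiag_vertexOp a p).commute (isDiag_vertexOp a p'))
  finite := by
    rintro _ (⟨e, rfl⟩ | ⟨e, rfl⟩)
    · have hN := finite_darts_of_edge e
      refine (finite_following (hN.union (hN.image Dart.unturnRight))).subset fun p hp => ?_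
      by_cases hf : p.1.Follows p.2
      · refine ⟨hf, ?_⟩
        by_contra hn
        refine hp (commute_vertexOp_pauliX a ?_ ?_ ?_)
        · exact fun h => hn (Or.inl (Or.inl h))
        · exact fun h => hn (Or.inr (Or.inl h))
        · exact fun h => hn (Or.inl (Or.inr ⟨p.1.turnRight, h, Dart.unturnRight_turnRight _⟩))
      · refine absurd ?_ hp
        have h1 : p.2 ≠ p.1.turnLeft := fun h => hf (Or.inl h)
        have h2 : p.2 ≠ p.1.turnRight := fun h => hf (Or.inr h)
        show Commute (vertexOp a p) _
        rw [vertexOp, if_neg h1, if_neg h2]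
        exact Commute.one_left _
    · exact Set.finite_empty.subset fun p hp =>
        hp ((isDiag_vertexOp a p).commute (isDiag_pauliZ e))

/-- The vertices passed by the paths formed by a set of oriented edges. -/
def pairs (D : Set Dart) : Set (Dart × Dart) := {p | p.1 ∈ D ∧ p.2 ∈ D ∧ p.1.Follows p.2}

/-- Conjugation with the edge factors of a string operator. -/
def edgeAut (a : Anyon) (S : Set Edge) : Aut := (locallyFinite_edgeU a).limAd S

/-- Conjugation with the vertex factors of a string operator. -/
def vertexAut (a : Anyon) (V : Set (Dart × Dart)) : Aut := (locallyFinite_vertexU a).limAd V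

/-- Conjugation with the formal string operator of a possibly infinite set of oriented edges. -/
def stringAut (a : Anyon) (D : Set Dart) : Aut :=
  edgeAut a (Dart.edge '' D) * vertexAut a (pairs D)

/-- The strictly local unitaries supported in a set of sites. -/
def localUnitary (Y : Set Edge) : Subgroup (unitary Obs) where
  carrier := {u | (u : Obs) ∈ localObs Y}
  mul_mem' {u v} h h' := by
    have h1 : (u : Obs) ∈ localObs Y := h
    have h2 : (v : Obs) ∈ localObs Y := h'
    exact mul_mem h1 h2
  one_mem' := one_mem (localObs Y)
  inv_mem' {u} h := by
    have h' : star (u : Obs) ∈ localObs Y := star_mem h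
    rw [← Unitary.star_eq_inv]
    exact h'

theorem mem_localUnitary {Y : Set Edge} {u : unitary Obs} :
    u ∈ localUnitary Y ↔ (u : Obs) ∈ localObs Y := Iff.rfl

theorem edgeU_mem_localUnitary (a : Anyon) {Y : Set Edge} {e : Edge} (h : e ∈ Y) :
    edgeU a e ∈ localUnitary Y := by
  show edgeOp a e ∈ localObs Y
  rcases edgeOp_eq a with h' | h'
  · rw [h']; exact one_mem _
  · rw [h']; exact pauliX_mem_localObs h

/-- The edges and R-legs of the paths formed by `D` lie in `Y`. -/
def Inside (Y : Set Edge) (D : Set Dart) : Prop :=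
  (∀ d ∈ D, d.edge ∈ Y) ∧ ∀ p ∈ pairs D, p.2 = p.1.turnLeft → p.1.turnRight.edge ∈ Y

theorem vertexU_mem_localUnitary (a : Anyon) {Y : Set Edge} {D : Set Dart} (h : Inside Y D)
    {p : Dart × Dart} (hp : p ∈ pairs D) : vertexU a p ∈ localUnitary Y := by
  show vertexOp a p ∈ localObs Y
  have h1 := one_mem (localObs Y)
  have hZ : ∀ e ∈ Y, pauliZ e ∈ localObs Y := fun e he => pauliZ_mem_localObs he
  unfold vertexOp
  split_ifs with c1 c2 c3
  · have := hZ _ (h.2 p hp c1)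
    exact add_mem ((localObs Y).smul_mem (add_mem h1 this) _)
      ((localObs Y).smul_mem (sub_mem h1 this) _)
  · exact h1
  · exact sub_mem h1 ((localObs Y).smul_mem ((localObs Y).smul_mem (mul_mem
      (sub_mem h1 (hZ _ (h.1 _ hp.1))) (add_mem h1 (hZ _ (h.1 _ hp.2.1)))) _) _)
  · exact h1

/-- The edge factors fix every `σ^X`, and on `σ^Z` at `e` only the factor at `e` itself acts. This
keeps the corrections in `stringAut_eq_mul` local. -/
theorem edgeAut_mem_localObs (a : Anyon) (S : Set Edge) {Y : Set Edge} {x : Obs}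
    (hx : x ∈ localObs Y) : edgeAut a S x ∈ localObs Y := by
  refine StarAlgebra.adjoin_induction (p := fun x _ => edgeAut a S x ∈ localObs Y) ?_ ?_ ?_ ?_ ?_ hx
  · rintro _ (⟨e, he, rfl⟩ | ⟨e, he, rfl⟩)
    · rw [edgeAut, LocallyFiniteFamily.limAd_apply_of_commute _
        fun i _ => commute_edgeOp_pauliX a i e]
      exact pauliX_mem_localObs he
    · obtain ⟨v, hv, h⟩ := (locallyFinite_edgeU a).limAd_eq_of_finite_diff (S := S) (T := S \ {e})
        (M := localUnitary Y)
        ((Set.finite_singleton e).subset fun i hi => by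
          by_contra hne; exact hi.2 ⟨hi.1, hne⟩)
        (Set.finite_empty.subset fun i hi => hi.2 hi.1.1)
        (fun i hi => by
          have : i = e := by by_contra hne; exact hi.2 ⟨hi.1, hne⟩
          rw [this]; exact edgeU_mem_localUnitary a he)
        (fun i hi => absurd hi.1.1 hi.2)
      rw [edgeAut, h, aut_mul_apply, LocallyFiniteFamily.limAd_apply_of_commute _
        fun i hi => commute_edgeOp_pauliZ a hi.2]
      have hv' : (v : Obs) ∈ localObs Y := hv
      exact mul_mem (mul_mem hv' (pauliZ_mem_localObs he)) (star_mem hv')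
  · intro c
    rw [aut_algebraMap]; exact (localObs Y).algebraMap_mem c
  · intro x y _ _ hx hy
    rw [map_add]; exact add_mem hx hy
  · intro x y _ _ hx hy
    rw [map_mul]; exact mul_mem hx hy
  · intro x _ hx
    rw [map_star]; exact star_mem hx

theorem mapUnitary_edgeAut_mem (a : Anyon) (S : Set Edge) {Y : Set Edge} {u : unitary Obs}
    (hu : u ∈ localUnitary Y) : mapUnitary (edgeAut a S) u ∈ localUnitary Y :=
  edgeAut_mem_localObs a S hu

/-- Two oriented edges are so close to each other that the factors of string operators at these
edges may fail to commute. -/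
def Touch (d d' : Dart) : Prop :=
  d.edge = d'.edge ∨ d.Follows d' ∨ d'.Follows d ∨ d.turnRight.edge = d'.edge

/-- The string automorphism of a set of oriented edges which is, up to finitely many of them, the
union of two sets which are far away from each other. -/
theorem stringAut_eq_mul (a : Anyon) {Y : Set Edge} {D D₁ D₂ : Set Dart} (hD : Inside Y D)
    (hD₁ : Inside Y D₁) (hD₂ : Inside Y D₂) (hf : (D \ (D₁ ∪ D₂)).Finite)
    (hf' : ((D₁ ∪ D₂) \ D).Finite)
    (hT : {p : Dart × Dart | p.1 ∈ D₁ ∧ p.2 ∈ D₂ ∧ Touch p.1 p.2}.Finite) :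
    ∃ v ∈ localUnitary Y, stringAut a D = Ad v * (stringAut a D₁ * stringAut a D₂) := by
  -- The finitely many edges of `D₁` which come close to `D₂`. Every overlap and every failure of
  -- commutation below occurs at one of them.
  set K := Prod.fst '' {p : Dart × Dart | p.1 ∈ D₁ ∧ p.2 ∈ D₂ ∧ Touch p.1 p.2} with hKdef
  have hK : K.Finite := hT.image _
  have hKmem : ∀ d₁ ∈ D₁, ∀ d₂ ∈ D₂, Touch d₁ d₂ → d₁ ∈ K := fun d₁ h₁ d₂ h₂ h =>
    ⟨(d₁, d₂), ⟨h₁, h₂, h⟩, rfl⟩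
  have fE := locallyFinite_edgeU a
  have fV := locallyFinite_vertexU a
  set E₁ := Dart.edge '' D₁ with hE₁
  set E₂ := Dart.edge '' D₂ with hE₂
  set V₁ := pairs D₁ with hV₁
  set V₂ := pairs D₂ with hV₂
  have mE : ∀ {D' : Set Dart}, Inside Y D' → ∀ e ∈ Dart.edge '' D', edgeU a e ∈ localUnitary Y := by
    rintro D' h _ ⟨d, hd, rfl⟩; exact edgeU_mem_localUnitary a (h.1 d hd)
  -- the edge factors
  have hE₁₂ : (E₁ ∩ E₂).Finite := (hK.image Dart.edge).subset (by
    rintro _ ⟨⟨d, hd, rfl⟩, ⟨d', hd', h⟩⟩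
    exact ⟨d, hKmem d hd d' hd' (Or.inl h.symm), rfl⟩)
  obtain ⟨v₁, hv₁, e₁⟩ := fE.limAd_eq_of_finite_diff (S := Dart.edge '' D) (T := (E₁ \ E₂) ∪ E₂)
    (M := localUnitary Y)
    ((hf.image Dart.edge).subset (by
      rintro _ ⟨⟨d, hd, rfl⟩, h⟩
      rw [Set.diff_union_self] at h
      refine ⟨d, ⟨hd, ?_⟩, rfl⟩
      rintro (h' | h')
      · exact h (Or.inl ⟨d, h', rfl⟩)
      · exact h (Or.inr ⟨d, h', rfl⟩)))
    ((hf'.image Dart.edge).subset (by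
      rintro _ ⟨⟨⟨d, hd, rfl⟩, -⟩ | ⟨d, hd, rfl⟩, h⟩
      · exact ⟨d, Set.mem_diff_of_mem (Or.inl hd) fun h' => h ⟨d, h', rfl⟩, rfl⟩
      · exact ⟨d, Set.mem_diff_of_mem (Or.inr hd) fun h' => h ⟨d, h', rfl⟩, rfl⟩))
    (fun e he => mE hD e he.1)
    (fun e he => he.1.elim (fun h => mE hD₁ e h.1) (mE hD₂ e))
  obtain ⟨v₂, hv₂, e₂⟩ := fE.limAd_eq_of_finite_diff (S := E₁ \ E₂) (T := E₁) (M := localUnitary Y)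
    (Set.finite_empty.subset fun e he => he.2 he.1.1)
    (hE₁₂.subset fun e he => ⟨he.1, by by_contra h; exact he.2 ⟨he.1, h⟩⟩)
    (fun e he => absurd he.1.1 he.2) (fun e he => mE hD₁ e he.1)
  rw [fE.limAd_union Set.disjoint_sdiff_left, e₂, mul_assoc, ← mul_assoc (Ad v₁), ← map_mul] at e₁
  -- the vertex factors
  have hV₁₂ : (V₁ ∩ V₂).Finite := (finite_following hK).subset fun p hp =>
    ⟨hp.1.2.2, Or.inl (hKmem _ hp.1.1 _ hp.2.1 (Or.inl rfl))⟩
  obtain ⟨v₃, hv₃, e₃⟩ := fV.limAd_eq_of_finite_diff (S := pairs D) (T := (V₁ \ V₂) ∪ V₂)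
    (M := localUnitary Y)
    ((finite_following (hf.union hK)).subset (by
      rintro p ⟨hp, h⟩
      refine ⟨hp.2.2, ?_⟩
      rw [Set.diff_union_self] at h
      by_cases h1 : p.1 ∈ D₁ ∪ D₂
      · by_cases h2 : p.2 ∈ D₁ ∪ D₂
        · rcases h1 with h1 | h1 <;> rcases h2 with h2 | h2
          · exact absurd (Or.inl ⟨h1, h2, hp.2.2⟩) h
          · exact Or.inl (Or.inr (hKmem _ h1 _ h2 (Or.inr (Or.inl hp.2.2))))
          · exact Or.inr (Or.inr (hKmem _ h2 _ h1 (Or.inr (Or.inr (Or.inl hp.2.2)))))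
          · exact absurd (Or.inr ⟨h1, h2, hp.2.2⟩) h
        · exact Or.inr (Or.inl ⟨hp.2.1, h2⟩)
      · exact Or.inl (Or.inl ⟨hp.1, h1⟩)))
    ((finite_following hf').subset (by
      rintro p ⟨hp, h⟩
      rw [Set.diff_union_self] at hp
      have hp' : p.1 ∈ D₁ ∪ D₂ ∧ p.2 ∈ D₁ ∪ D₂ ∧ p.1.Follows p.2 :=
        hp.elim (fun h => ⟨Or.inl h.1, Or.inl h.2.1, h.2.2⟩) fun h => ⟨Or.inr h.1, Or.inr h.2.1, h.2.2⟩
      refine ⟨hp'.2.2, ?_⟩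
      by_contra hn
      rw [not_or] at hn
      exact h ⟨by by_contra h1; exact hn.1 ⟨hp'.1, h1⟩,
        by by_contra h1; exact hn.2 ⟨hp'.2.1, h1⟩, hp'.2.2⟩))
    (fun p hp => vertexU_mem_localUnitary a hD hp.1)
    (fun p hp => hp.1.elim (fun h => vertexU_mem_localUnitary a hD₁ h.1)
      (vertexU_mem_localUnitary a hD₂))
  obtain ⟨v₄, hv₄, e₄⟩ := fV.limAd_eq_of_finite_diff (S := V₁ \ V₂) (T := V₁) (M := localUnitary Y)
    (Set.finite_empty.subset fun e he => he.2 he.1.1)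
    (hV₁₂.subset fun e he => ⟨he.1, by by_contra h; exact he.2 ⟨he.1, h⟩⟩)
    (fun e he => absurd he.1.1 he.2) (fun e he => vertexU_mem_localUnitary a hD₁ he.1)
  rw [fV.limAd_union Set.disjoint_sdiff_left, e₄, mul_assoc, ← mul_assoc (Ad v₃), ← map_mul] at e₃
  -- the commutator
  set B := {p : Dart × Dart | p.1.Follows p.2 ∧ (p.1 ∈ K ∨ p.2 ∈ K)} with hB
  have hBf : B.Finite := finite_following hK
  obtain ⟨v₅, hv₅, e₅⟩ := fV.limAd_eq_of_finite_diff (S := V₁ \ B) (T := V₁) (M := localUnitary Y)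
    (Set.finite_empty.subset fun e he => he.2 he.1.1)
    (hBf.subset fun e he => by by_contra h; exact he.2 ⟨he.1, h⟩)
    (fun e he => absurd he.1.1 he.2) (fun e he => vertexU_mem_localUnitary a hD₁ he.1)
  -- Without the finitely many vertices at `K`, the vertex factors of `D₁` commute with the edge
  -- factors of `D₂`. Removing these vertices costs the local unitary `v₅`.
  have hcomm : Commute (vertexAut a (V₁ \ B)) (edgeAut a E₂) := by
    refine fE.commute_limAd ?_
    rintro _ ⟨d₂, hd₂, rfl⟩
    refine LocallyFiniteFamily.limAd_apply_of_commute _ fun p hp => ?_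
    show Commute (vertexOp a p) (edgeOp a d₂.edge)
    rcases edgeOp_eq a with h | h
    · rw [h]; exact Commute.one_right _
    · rw [h]
      refine commute_vertexOp_pauliX a ?_ ?_ ?_
      · exact fun h => hp.2 ⟨hp.1.2.2, Or.inl (hKmem _ hp.1.1 _ hd₂ (Or.inl h))⟩
      · exact fun h => hp.2 ⟨hp.1.2.2, Or.inr (hKmem _ hp.1.2.1 _ hd₂ (Or.inl h))⟩
      · exact fun h => hp.2 ⟨hp.1.2.2, Or.inl (hKmem _ hp.1.1 _ hd₂ (Or.inr (Or.inr (Or.inr h))))⟩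
  have e₁' : edgeAut a (Dart.edge '' D) = Ad (v₁ * v₂) * (edgeAut a E₁ * edgeAut a E₂) := e₁
  have e₃' : vertexAut a (pairs D) = Ad (v₃ * v₄) * (vertexAut a V₁ * vertexAut a V₂) := e₃
  have e₅' : vertexAut a (V₁ \ B) = Ad v₅ * vertexAut a V₁ := e₅
  have e₅'' : vertexAut a V₁ = Ad v₅⁻¹ * vertexAut a (V₁ \ B) := by
    rw [e₅', map_inv, inv_mul_cancel_left]
  have e₆ : edgeAut a E₂ * vertexAut a V₁ =
      Ad (mapUnitary (edgeAut a E₂) v₅⁻¹ * v₅) * (vertexAut a V₁ * edgeAut a E₂) := by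
    rw [e₅'', ← mul_assoc, mul_Ad, mul_assoc, ← hcomm.eq, e₅', map_mul, map_inv]
    group
  have m := fun {u} S (hu : u ∈ localUnitary Y) => mapUnitary_edgeAut_mem a S hu
  refine ⟨(v₁ * v₂) * (mapUnitary (edgeAut a E₁) (mapUnitary (edgeAut a E₂) (v₃ * v₄))) *
    mapUnitary (edgeAut a E₁) (mapUnitary (edgeAut a E₂) v₅⁻¹ * v₅), ?_, ?_⟩
  · exact mul_mem (mul_mem (mul_mem hv₁ hv₂) (m _ (m _ (mul_mem hv₃ hv₄))))
      (m _ (mul_mem (m _ (inv_mem hv₅)) hv₅))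
  · calc stringAut a D = Ad (v₁ * v₂) * (edgeAut a E₁ * (edgeAut a E₂ * Ad (v₃ * v₄)) *
          (vertexAut a V₁ * vertexAut a V₂)) := by
          rw [stringAut, e₁', e₃']; group
      _ = Ad (v₁ * v₂) * (Ad (mapUnitary (edgeAut a E₁) (mapUnitary (edgeAut a E₂) (v₃ * v₄))) *
          (edgeAut a E₁ * (edgeAut a E₂ * vertexAut a V₁) * vertexAut a V₂)) := by
          rw [mul_Ad, ← mul_assoc (edgeAut a E₁), mul_Ad]; simp only [mul_assoc]
      _ = _ := by
          rw [e₆, ← mul_assoc (edgeAut a E₁), mul_Ad, map_mul, map_mul]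
          simp only [stringAut, mul_assoc, map_mul]
          rfl

/-! ### String automorphisms as limits of finite strings -/

theorem pairs_boundaryDarts {G : Set Face} {p : Dart × Dart} :
    p ∈ pairs (boundaryDarts G) ↔ p.1 ∈ boundaryDarts G ∧ p.2 = nextDart G p.1 :=
  ⟨fun h => ⟨h.1, eq_nextDart h.2.1 h.2.2⟩,
    fun h => ⟨h.1, h.2 ▸ nextDart_mem h.1, h.2 ▸ follows_nextDart G p.1⟩⟩

theorem coe_prod_edgeU (a : Anyon) (l : List Edge) :
    (((l.map (edgeU a)).prod : unitary Obs) : Obs) = (l.map (edgeOp a)).prod := by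
  rw [Submonoid.coe_list_prod, List.map_map]; rfl

theorem coe_prod_vertexU (a : Anyon) (l : List (Dart × Dart)) :
    (((l.map (vertexU a)).prod : unitary Obs) : Obs) = (l.map (vertexOp a)).prod := by
  rw [Submonoid.coe_list_prod, List.map_map]; rfl

theorem eventually_mem_edge_image {κ : Type*} {𝓕 : Filter κ} {l : κ → List Dart} {D : Set Dart}
    (h : ∀ d, ∀ᶠ k in 𝓕, (d ∈ l k ↔ d ∈ D)) (e : Edge) :
    ∀ᶠ k in 𝓕, (e ∈ (l k).map Dart.edge ↔ e ∈ Dart.edge '' D) := by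
  have hfin := finite_darts_of_edge e
  filter_upwards [(Filter.eventually_all_finset hfin.toFinset).2 fun d _ => h d] with k hk
  simp only [List.mem_map, Set.mem_image]
  constructor
  · rintro ⟨d, hd, he⟩
    exact ⟨d, (hk d (by simpa using he)).1 hd, he⟩
  · rintro ⟨d, hd, he⟩
    exact ⟨d, (hk d (by simpa using he)).2 hd, he⟩

/-- The lists of edges and of vertices are kept separate so that truncated paths and closed
boundaries, whose vertices are listed differently, are covered at once. -/
theorem convergesTo_stringAut (a : Anyon) {κ : Type} {𝓕 : Filter κ} {W : κ → unitary Obs}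
    {l : κ → List Dart} {l' : κ → List (Dart × Dart)} {D : Set Dart}
    (hW : ∀ k, (W k : Obs) = (((l k).map Dart.edge).map (edgeOp a)).prod *
      ((l' k).map (vertexOp a)).prod)
    (hl : ∀ k, ((l k).map Dart.edge).Nodup) (hl' : ∀ k, (l' k).Nodup)
    (hD : ∀ d, ∀ᶠ k in 𝓕, (d ∈ l k ↔ d ∈ D)) (hp : ∀ p, ∀ᶠ k in 𝓕, (p ∈ l' k ↔ p ∈ pairs D)) :
    ConvergesTo 𝓕 (fun k => Ad (W k)) (stringAut a D) := by
  refine (((locallyFinite_edgeU a).convergesTo_limAd _ hl (eventually_mem_edge_image hD)).mul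
    ((locallyFinite_vertexU a).convergesTo_limAd _ hl' hp)).congr'
      (Eventually.of_forall fun k => ?_)
  rw [← map_mul]
  congr 1
  refine Subtype.ext ?_
  rw [hW, Submonoid.coe_mul, coe_prod_edgeU, coe_prod_vertexU]

theorem openString_eq (a : Anyon) (l : List Dart) :
    openString a l = ((l.map Dart.edge).map (edgeOp a)).prod *
      ((consecutive l).map (vertexOp a)).prod := stringOpAux_eq a _ _

/-- The string operator of a finite path as a unitary. -/
def openU (a : Anyon) (l : List Dart) : unitary Obs :=
  ((l.map Dart.edge).map (edgeU a)).prod * ((consecutive l).map (vertexU a)).prod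

theorem coe_openU (a : Anyon) (l : List Dart) : (openU a l : Obs) = openString a l := by
  rw [openU, Submonoid.coe_mul, coe_prod_edgeU, coe_prod_vertexU, openString_eq]

theorem conjTruncation_eq (a : Anyon) (P : ℕ → Dart) (n : ℕ) (O : Obs) :
    conjTruncation a P n O = Ad (openU a (truncation P n)) O := by
  rw [Ad_apply, coe_openU]; rfl

theorem truncation_succ (P : ℕ → Dart) (n : ℕ) : truncation P (n + 1) = P n :: truncation P n := by
  simp [truncation, List.range_succ]

theorem mem_consecutive_truncation {P : ℕ → Dart} {n : ℕ} {p : Dart × Dart} :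
    p ∈ consecutive (truncation P n) ↔ ∃ i, i + 1 < n ∧ p = (P (i + 1), P i) := by
  induction n with
  | zero => simp [truncation, consecutive]
  | succ n ih =>
    cases n with
    | zero => simp [truncation, consecutive]
    | succ n =>
      rw [truncation_succ, truncation_succ, consecutive_cons_cons, ← truncation_succ, List.mem_cons,
        ih]
      constructor
      · rintro (h | ⟨i, hi, h⟩)
        · exact ⟨n, by omega, h⟩
        · exact ⟨i, by omega, h⟩
      · rintro ⟨i, hi, h⟩
        by_cases hin : i = n
        · left; rw [h, hin]
        · right; exact ⟨i, by omega, h⟩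

theorem nodup_consecutive_truncation {P : ℕ → Dart} (hP : Function.Injective P) (n : ℕ) :
    (consecutive (truncation P n)).Nodup := by
  induction n with
  | zero => simp [truncation, consecutive]
  | succ n ih =>
    cases n with
    | zero => simp [truncation, consecutive]
    | succ n =>
      rw [truncation_succ, truncation_succ, consecutive_cons_cons, ← truncation_succ,
        List.nodup_cons]
      refine ⟨fun h => ?_, ih⟩
      obtain ⟨i, hi, h⟩ := mem_consecutive_truncation.1 h
      have := hP (Prod.ext_iff.1 h).2
      omega

/-- Within the boundary of a set of hexagons every edge has only one successor and one predecessor,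
so the path has no further pairs of consecutive edges. -/
theorem pairs_range {P : ℕ → Dart} (hP : ∀ i, (P (i + 1)).Follows (P i)) {F : Set Face}
    (hF : ∀ i, P i ∈ boundaryDarts F) (hinj : Function.Injective P) :
    pairs (Set.range P) = Set.range fun i => (P (i + 1), P i) := by
  have hnext : ∀ i, nextDart F (P (i + 1)) = P i := fun i => (eq_nextDart (hF i) (hP i)).symm
  ext ⟨d, d'⟩
  constructor
  · rintro ⟨⟨i, rfl⟩, ⟨j, rfl⟩, h⟩
    have h1 : P j = nextDart F (P i) := eq_nextDart (hF j) h
    have h2 : P i = P (j + 1) := by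
      rw [← prevDart_nextDart (hF i), ← h1, ← hnext j, prevDart_nextDart (hF (j + 1))]
    exact ⟨j, Prod.ext h2.symm rfl⟩
  · rintro ⟨i, h⟩
    rw [← h]
    exact ⟨⟨i + 1, rfl⟩, ⟨i, rfl⟩, hP i⟩

theorem convergesTo_path (a : Anyon) {P : ℕ → Dart} (hP : ∀ i, (P (i + 1)).Follows (P i))
    {F : Set Face} (hF : ∀ i, P i ∈ boundaryDarts F)
    (hinj : Function.Injective fun i => (P i).edge) :
    ConvergesTo atTop (fun n => Ad (openU a (truncation P n))) (stringAut a (Set.range P)) := by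
  have hinj' : Function.Injective P := fun i j h => hinj (congrArg Dart.edge h)
  refine convergesTo_stringAut a (l := truncation P) (l' := fun n => consecutive (truncation P n))
    (fun n => by rw [coe_openU, openString_eq]) (fun n => ?_)
    (fun n => nodup_consecutive_truncation hinj' n) (fun d => ?_) (fun p => ?_)
  · rw [truncation, ← List.map_reverse, List.map_map]
    exact (List.nodup_reverse.2 List.nodup_range).map hinj
  · by_cases hd : d ∈ Set.range P
    · obtain ⟨i, rfl⟩ := hd
      filter_upwards [eventually_gt_atTop i] with n hn
      refine iff_of_true ?_ ⟨i, rfl⟩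
      simp only [truncation, List.mem_reverse, List.mem_map, List.mem_range]
      exact ⟨i, hn, rfl⟩
    · refine Eventually.of_forall fun n => iff_of_false (fun h => hd ?_) hd
      simp only [truncation, List.mem_reverse, List.mem_map, List.mem_range] at h
      obtain ⟨i, -, h⟩ := h
      exact ⟨i, h⟩
  · rw [pairs_range hP hF hinj']
    by_cases hp : p ∈ Set.range fun i => (P (i + 1), P i)
    · obtain ⟨i, rfl⟩ := hp
      filter_upwards [eventually_gt_atTop (i + 1)] with n hn
      exact iff_of_true (mem_consecutive_truncation.2 ⟨i, hn, rfl⟩) ⟨i, rfl⟩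
    · refine Eventually.of_forall fun n => iff_of_false (fun h => hp ?_) hp
      obtain ⟨i, -, h⟩ := mem_consecutive_truncation.1 h
      exact ⟨i, h.symm⟩

/-- The product of the string operator factors along a boundary as a unitary. -/
def loopU (a : Anyon) (G : Set Face) (l : List Dart) : unitary Obs :=
  ⟨loopOp a G l, loopOp_mem_unitary a G l⟩

/-- Closed strings converge to an open one as soon as the boundaries converge edge by edge; no
estimate is needed, by local finiteness. -/
theorem convergesTo_loops (a : Anyon) {κ : Type} {𝓕 : Filter κ} {G : κ → Set Face}
    {l : κ → List Dart} {D : Set Dart} (hl : ∀ k, (l k).Nodup)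
    (hG : ∀ k d, d ∈ l k ↔ d ∈ boundaryDarts (G k))
    (hD : ∀ d, ∀ᶠ k in 𝓕, (d ∈ boundaryDarts (G k) ↔ d ∈ D)) :
    ConvergesTo 𝓕 (fun k => Ad (loopU a (G k) (l k))) (stringAut a D) := by
  refine convergesTo_stringAut a (l := l) (l' := fun k => (l k).map fun d => (d, nextDart (G k) d))
    (fun k => ?_) (fun k => ?_) (fun k => ?_) (fun d => ?_) (fun p => ?_)
  · rw [List.map_map, List.map_map]; rfl
  · exact (hl k).map_on fun d hd d' hd' h =>
      edge_injOn_boundaryDarts _ ((hG k d).1 hd) ((hG k d').1 hd') h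
  · exact (hl k).map fun d d' h => (Prod.ext_iff.1 h).1
  · filter_upwards [hD d] with k hk
    rw [hG, hk]
  · filter_upwards [hD p.1, hD p.2] with k h1 h2
    have : p ∈ (l k).map (fun d => (d, nextDart (G k) d)) ↔ p ∈ pairs (boundaryDarts (G k)) := by
      rw [pairs_boundaryDarts, List.mem_map]
      constructor
      · rintro ⟨d, hd, rfl⟩; exact ⟨(hG k d).1 hd, rfl⟩
      · rintro ⟨h3, h4⟩; exact ⟨p.1, (hG k _).2 h3, Prod.ext rfl h4.symm⟩
    rw [this]
    exact ⟨fun h => ⟨h1.1 h.1, h2.1 h.2.1, h.2.2⟩, fun h => ⟨h1.2 h.1, h2.2 h.2.1, h.2.2⟩⟩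

/-! ### The support of a string automorphism -/

theorem localObs_le_obsOn (Y : Set Edge) : localObs Y ≤ obsOn Y :=
  StarSubalgebra.le_topologicalClosure _

theorem neg_pauliZ_ne (e : Edge) : -pauliZ e ≠ pauliZ e := by
  intro h
  have h1 : (-pauliZ e).1 (ket ∅) = (pauliZ e).1 (ket ∅) := by rw [h]
  have h2 : (-pauliZ e).1 (ket ∅) = -((pauliZ e).1 (ket ∅)) := rfl
  rw [h2, isDiag_pauliZ] at h1
  have h3 := congrArg (fun v : ConfigSpace => (v : ∀ _, ℂ) ∅) h1
  simp [ket_apply] at h3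
  norm_num at h3

/-- Turns the support of the automorphism into geometry; semions suffice. An edge of the path
outside `Y` would reverse the sign of its `σ^Z`. An R-leg outside `Y` would give a nontrivial phase
factor that does not commute with its `σ^X`. -/
theorem inside_of_support {P : ℕ → Dart} (hP : ∀ i, (P (i + 1)).Follows (P i))
    {F : Set Face} (hF : ∀ i, P i ∈ boundaryDarts F)
    (hinj : Function.Injective fun i => (P i).edge) {Y : Set Edge}
    (hs : ∀ O ∈ obsOn Yᶜ, Tendsto (fun n => conjTruncation .semion P n O) atTop (𝓝 O)) :
    Inside Y (Set.range P) := by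
  have hα : ∀ O ∈ obsOn Yᶜ, stringAut .semion (Set.range P) O = O := fun O hO =>
    tendsto_nhds_unique (convergesTo_path .semion hP hF hinj O)
      ((hs O hO).congr fun n => conjTruncation_eq _ _ _ _)
  have fE := locallyFinite_edgeU .semion
  have fV := locallyFinite_vertexU .semion
  have hedge : ∀ d ∈ Set.range P, d.edge ∈ Y := by
    intro d hd
    by_contra hY
    have h1 := hα _ (localObs_le_obsOn _ (pauliZ_mem_localObs hY))
    have h2 : vertexAut .semion (pairs (Set.range P)) (pauliZ d.edge) = pauliZ d.edge :=
      fV.limAd_apply_of_commute fun p _ => (isDiag_vertexOp _ p).commute (isDiag_pauliZ _)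
    have h3 : edgeAut .semion (Dart.edge '' Set.range P) =
        Ad (edgeU .semion d.edge) * edgeAut .semion (Dart.edge '' Set.range P \ {d.edge}) := by
      have : Ad (edgeU .semion d.edge) = edgeAut .semion {d.edge} := by
        have := fE.limAd_list (List.nodup_singleton d.edge)
        rw [List.map_singleton, List.prod_singleton] at this
        rw [← this, edgeAut]
        congr 1
        ext i; simp
      rw [this, edgeAut, edgeAut, edgeAut, ← fE.limAd_union Set.disjoint_sdiff_right]
      have hsub : {d.edge} ⊆ Dart.edge '' Set.range P := Set.singleton_subset_iff.2 ⟨d, hd, rfl⟩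
      rw [Set.union_diff_cancel hsub]
    rw [stringAut, aut_mul_apply, h2, h3, aut_mul_apply, edgeAut,
      fE.limAd_apply_of_commute fun i hi => commute_edgeOp_pauliZ .semion hi.2, Ad_apply] at h1
    change pauliX d.edge * pauliZ d.edge * star (pauliX d.edge) = _ at h1
    rw [star_pauliX, pauliX_mul_pauliZ, neg_mul, mul_assoc, pauliX_mul_self, mul_one] at h1
    exact neg_pauliZ_ne _ h1
  refine ⟨hedge, fun p hp hpl => ?_⟩
  by_contra hY
  set j := p.1.turnRight.edge with hj
  have h1 := hα _ (localObs_le_obsOn _ (pauliX_mem_localObs hY))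
  have h2 : ∀ S, edgeAut .semion S (pauliX j) = pauliX j := fun S =>
    fE.limAd_apply_of_commute fun e _ => commute_edgeOp_pauliX _ e j
  set V := pairs (Set.range P) with hV
  have h3 : vertexAut .semion V (pauliX j) = pauliX j := by
    rw [stringAut, aut_mul_apply] at h1
    exact EquivLike.injective (edgeAut .semion (Dart.edge '' Set.range P)) (h1.trans (h2 _).symm)
  -- The vertices with `j` as R-leg. There are at most two, one for each orientation of `j`, so the
  -- total phase at `j` is a power of `i` with exponent at most two.
  set T : Set (Dart × Dart) := {q | q.2 = q.1.turnLeft ∧ q.1.turnRight.edge = j} with hT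
  have hTsub : T ⊆ {(j.dart.unturnRight, j.dart.unturnRight.turnLeft),
      (j.dart.reverse.unturnRight, j.dart.reverse.unturnRight.turnLeft)} := by
    rintro ⟨d, d'⟩ ⟨h, h'⟩
    have h4 : d.turnRight.edge = j.dart.edge := by rw [Edge.dart_edge]; exact h'
    simp only at h
    rcases Dart.edge_eq_iff.1 h4 with h5 | h5
    · left
      rw [← h5, Dart.unturnRight_turnRight, h]
    · right
      rw [Set.mem_singleton_iff, ← h5, Dart.unturnRight_turnRight, h]
  have hTf : (V ∩ T).Finite := (Set.toFinite _).subset (Set.inter_subset_right.trans hTsub)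
  set L := hTf.toFinset.toList with hL
  have hLT : ∀ q ∈ L, q ∈ V ∩ T := fun q hq => by simpa [hL] using hq
  have h4 : vertexAut .semion V = Ad (L.map (vertexU .semion)).prod * vertexAut .semion (V \ T) := by
    rw [← fV.limAd_list (Finset.nodup_toList _), vertexAut, vertexAut, ← fV.limAd_union]
    · congr 1
      ext q
      by_cases hq : q ∈ T <;> simp [hq]
    · rw [Set.disjoint_left]
      intro q hq hq'
      exact hq'.2 (hLT q hq).2
  have h5 : vertexAut .semion (V \ T) (pauliX j) = pauliX j := by
    refine fV.limAd_apply_of_commute fun q hq => ?_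
    show Commute (vertexOp .semion q) _
    by_cases hql : q.2 = q.1.turnLeft
    · have hne : q.1.turnRight.edge ≠ j := fun h => hq.2 ⟨hql, h⟩
      exact (isDiag_vertexOp _ q).commute_pauliX fun α => by
        simp only [vertexVal, hql, if_true, mem_flip, hne, iff_false, not_not]
    · have hne1 : q.1.edge ≠ j := fun h => hY (h ▸ hedge _ hq.1.1)
      have hne2 : q.2.edge ≠ j := fun h => hY (h ▸ hedge _ hq.1.2.1)
      exact (isDiag_vertexOp _ q).commute_pauliX fun α => by
        simp only [vertexVal, hql, if_false, mem_flip, hne1, hne2, iff_false, not_not]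
  rw [h4, aut_mul_apply, h5] at h3
  have hval : ∀ L' : List (Dart × Dart), (∀ q ∈ L', q ∈ T) → ∀ α : Finset Edge,
      (((L'.map (vertexU .semion)).prod : unitary Obs) : Obs).1 (ket α) =
        (if j ∈ α then Complex.I else 1) ^ L'.length • ket α := by
    intro L' hL' α
    rw [coe_prod_vertexU, IsDiag.prod L' _ _ fun q _ => isDiag_vertexOp .semion q]
    congr 1
    induction L' with
    | nil => simp
    | cons q L' ih =>
      have hq := hL' q (by simp)
      rw [List.map_cons, List.prod_cons, Pi.mul_apply, ih fun q' hq' => hL' q' (by simp [hq']),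
        vertexVal, if_pos hq.1, hq.2, List.length_cons, pow_succ']
      rfl
  have hcard : L.length ≤ 2 := by
    rw [hL, Finset.length_toList, ← Set.ncard_eq_toFinset_card _ hTf]
    refine (Set.ncard_le_ncard (Set.inter_subset_right.trans hTsub) (Set.toFinite _)).trans ?_
    exact (Set.ncard_insert_le _ _).trans (by rw [Set.ncard_singleton])
  have hpos : 0 < L.length := by
    refine List.length_pos_of_mem (a := p) ?_
    simp only [hL, Finset.mem_toList, Set.Finite.mem_toFinset]
    exact ⟨hp, hpl, rfl⟩
  set u := (L.map (vertexU .semion)).prod with hu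
  rw [Ad_apply] at h3
  have h6 : (u : Obs) * pauliX j = pauliX j * u := by
    have : u * pauliX j * star (u : Obs) * u = pauliX j * u := by rw [h3]
    rwa [mul_assoc, (Unitary.mem_iff.1 u.2).1, mul_one] at this
  have h7 : ((u : Obs) * pauliX j).1 (ket ∅) = (pauliX j * (u : Obs)).1 (ket ∅) := by rw [h6]
  rw [mul_ket, mul_ket, hval L (fun q hq => (hLT q hq).2), pauliX_ket,
    hval L (fun q hq => (hLT q hq).2), map_smul, pauliX_ket] at h7
  have h8 := congrArg (fun v : ConfigSpace => (v : ∀ _, ℂ) (flip j ∅)) h7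
  simp only [lp.coeFn_smul, Pi.smul_apply, ket_apply, mem_flip, Finset.notMem_empty, if_true,
    if_false, one_pow, smul_eq_mul, mul_one, iff_true, not_false_iff] at h8
  -- The exponents one and two give `i` and `-1`, both different from `1`.
  interval_cases L.length
  · rw [pow_one] at h8
    exact absurd (congrArg Complex.re h8) (by simp)
  · rw [Complex.I_sq] at h8
    norm_num at h8

/-! ### Strong limits of unitaries -/

section StrongLimit

variable {H : Type*} [NormedAddCommGroup H] [InnerProductSpace ℂ H] [CompleteSpace H]

theorem norm_unitary_apply {u : H →L[ℂ] H} (hu : u ∈ unitary (H →L[ℂ] H)) (ξ : H) : ‖u ξ‖ = ‖ξ‖ := by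
  have h1 : ⟪u ξ, u ξ⟫_ℂ = ⟪ξ, ξ⟫_ℂ := by
    rw [← ContinuousLinearMap.adjoint_inner_right, ← ContinuousLinearMap.star_eq_adjoint,
      ← ContinuousLinearMap.mul_apply, (Unitary.mem_iff.1 hu).1]; rfl
  have h2 := inner_self_eq_norm_sq (𝕜 := ℂ) (u ξ)
  rw [h1, inner_self_eq_norm_sq] at h2
  exact ((sq_eq_sq₀ (norm_nonneg _) (norm_nonneg _)).1 h2).symm

theorem exists_strong_limit {u : ℕ → H →L[ℂ] H} (hu : ∀ n, u n ∈ unitary (H →L[ℂ] H)) {s : Set H}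
    (hs : Dense s) (h : ∀ ξ ∈ s, ∃ y, Tendsto (fun n => u n ξ) atTop (𝓝 y)) :
    ∃ U : H →L[ℂ] H, ∀ ξ, Tendsto (fun n => u n ξ) atTop (𝓝 (U ξ)) := by
  have hall : ∀ ξ, ∃ y, Tendsto (fun n => u n ξ) atTop (𝓝 y) := by
    intro ξ
    refine cauchySeq_tendsto_of_complete (Metric.cauchySeq_iff.2 fun ε hε => ?_)
    obtain ⟨x, hx, hxs⟩ := Metric.dense_iff.1 hs ξ (ε / 3) (by linarith)
    obtain ⟨y, hy⟩ := h x hxs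
    obtain ⟨N, hN⟩ := Metric.cauchySeq_iff.1 hy.cauchySeq (ε / 3) (by linarith)
    have hd : ∀ n, dist (u n ξ) (u n x) < ε / 3 := by
      intro n
      rw [dist_eq_norm, ← map_sub, norm_unitary_apply (hu n), ← dist_eq_norm, dist_comm]
      exact hx
    refine ⟨N, fun m hm n hn => ?_⟩
    have h4 := hd n
    rw [dist_comm] at h4
    linarith [dist_triangle4 (u m ξ) (u m x) (u n x) (u n ξ), hN m hm n hn, hd m]
  choose g hg using hall
  refine ⟨LinearMap.mkContinuous
    { toFun := g
      map_add' := fun x y => tendsto_nhds_unique (hg _) (((hg x).add (hg y)).congr fun n =>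
        ((u n).map_add x y).symm)
      map_smul' := fun c x => tendsto_nhds_unique (hg _) (((hg x).const_smul c).congr fun n =>
        ((u n).map_smul c x).symm) } 1 fun x => ?_, hg⟩
  rw [one_mul]
  exact le_of_tendsto (hg x).norm (Eventually.of_forall fun n => (norm_unitary_apply (hu n) x).le)

/-- A strong limit of unitaries is in general only an isometry; strong convergence of the adjoints
as well makes it unitary. -/
theorem unitary_of_strong_limit {u : ℕ → H →L[ℂ] H} (hu : ∀ n, u n ∈ unitary (H →L[ℂ] H))
    {U U' : H →L[ℂ] H} (hU : ∀ ξ, Tendsto (fun n => u n ξ) atTop (𝓝 (U ξ)))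
    (hU' : ∀ ξ, Tendsto (fun n => star (u n) ξ) atTop (𝓝 (U' ξ))) : U ∈ unitary (H →L[ℂ] H) := by
  have hstar : star U = U' := by
    rw [ContinuousLinearMap.star_eq_adjoint]
    refine ((ContinuousLinearMap.eq_adjoint_iff U' U).2 fun ξ η => ?_).symm
    refine tendsto_nhds_unique ((hU' ξ).inner tendsto_const_nhds)
      (((tendsto_const_nhds (x := ξ)).inner (hU η)).congr fun n => ?_)
    rw [ContinuousLinearMap.star_eq_adjoint, ContinuousLinearMap.adjoint_inner_left]
  have cancel : ∀ {u : ℕ → H →L[ℂ] H} {U U' : H →L[ℂ] H}, (∀ n, u n ∈ unitary (H →L[ℂ] H)) →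
      (∀ ξ, Tendsto (fun n => u n ξ) atTop (𝓝 (U ξ))) →
      (∀ ξ, Tendsto (fun n => star (u n) ξ) atTop (𝓝 (U' ξ))) → U' * U = 1 := by
    intro u U U' hu hU hU'
    ext1 ξ
    refine tendsto_nhds_unique (hU' (U ξ)) (tendsto_iff_norm_sub_tendsto_zero.2 ?_)
    refine (tendsto_iff_norm_sub_tendsto_zero.1 (hU ξ)).congr fun n => ?_
    rw [← norm_unitary_apply (Unitary.star_mem (hu n)), map_sub, ← ContinuousLinearMap.mul_apply,
      (Unitary.mem_iff.1 (hu n)).1, norm_sub_rev]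
  rw [Unitary.mem_iff, hstar]
  exact ⟨cancel hu hU hU', cancel (u := fun n => star (u n)) (fun n => Unitary.star_mem (hu n)) hU'
    fun ξ => by simpa only [star_star] using hU ξ⟩

end StrongLimit

/-! ### Implementing limits of inner automorphisms -/

section Implement

variable {ω : Obs →L[ℂ] ℂ} {H : Type*} [NormedAddCommGroup H] [InnerProductSpace ℂ H]
  [CompleteSpace H] {π : Obs →⋆ₐ[ℂ] (H →L[ℂ] H)} {Ω : H}

theorem representation_mem_unitary (π : Obs →⋆ₐ[ℂ] (H →L[ℂ] H)) {u : Obs} (hu : u ∈ unitary Obs) :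
    π u ∈ unitary (H →L[ℂ] H) := by
  rw [Unitary.mem_iff, ← map_star, ← map_mul, ← map_mul, (Unitary.mem_iff.1 hu).1,
    (Unitary.mem_iff.1 hu).2, map_one]
  exact ⟨rfl, rfl⟩

theorem smul_mem_unitary {u : H →L[ℂ] H} (hu : u ∈ unitary (H →L[ℂ] H)) {c : ℂ} (hc : ‖c‖ = 1) :
    c • u ∈ unitary (H →L[ℂ] H) := by
  have h : starRingEnd ℂ c * c = 1 := by
    rw [mul_comm, Complex.mul_conj, Complex.normSq_eq_norm_sq, hc]; simp
  rw [Unitary.mem_iff, star_smul, smul_mul_smul_comm, smul_mul_smul_comm,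
    (Unitary.mem_iff.1 hu).1, (Unitary.mem_iff.1 hu).2, mul_comm c]
  constructor <;>
  · rw [show star c * c = 1 from h, one_smul]

/-- After normalization the unitaries fix `Ω`, so their action on `π O Ω` is `π (Ad (V n) O) Ω`.
This converges because the automorphisms do, on a dense set of vectors, and the same applies to the
adjoints. -/
theorem exists_implementing_limit (h : IsGNSTriple ω π Ω) {V : ℕ → unitary Obs} {c : ℕ → ℂ}
    (hc : ∀ n, ‖c n‖ = 1) (hV : ∀ n, π (V n) Ω = c n • Ω) {α : Aut}
    (hα : ConvergesTo atTop (fun n => Ad (V n)) α) :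
    ∃ U ∈ unitary (H →L[ℂ] H), (∀ O, U * π O = π (α O) * U) ∧
      ∀ ξ, Tendsto (fun n => (starRingEnd ℂ (c n) • π (V n)) ξ) atTop (𝓝 (U ξ)) := by
  have hcc : ∀ n, starRingEnd ℂ (c n) * c n = 1 := fun n => by
    rw [mul_comm, Complex.mul_conj, Complex.normSq_eq_norm_sq, hc]; simp
  set u : ℕ → H →L[ℂ] H := fun n => starRingEnd ℂ (c n) • π (V n) with hu
  have hun : ∀ n, u n ∈ unitary (H →L[ℂ] H) := fun n =>
    smul_mem_unitary (representation_mem_unitary π (V n).2) (by rw [RCLike.norm_conj, hc])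
  have hΩ : ∀ n, u n Ω = Ω := fun n => by
    rw [hu]; simp only [smul_apply, hV, smul_smul, hcc, one_smul]
  have hΩ' : ∀ n, star (u n) Ω = Ω := fun n => by
    conv_lhs => rw [← hΩ n]
    rw [← ContinuousLinearMap.mul_apply, (Unitary.mem_iff.1 (hun n)).1]; rfl
  have hmul : ∀ n O, u n * π O = π (Ad (V n) O) * u n := fun n O => by
    rw [hu]
    simp only [smul_mul_assoc, mul_smul_comm, ← map_mul, Ad_apply]
    rw [mul_assoc, (Unitary.mem_iff.1 (V n).2).1, mul_one]
  have hmul' : ∀ n O, star (u n) * π O = π ((Ad (V n))⁻¹ O) * star (u n) := fun n O => by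
    have h1 := hmul n ((Ad (V n))⁻¹ O)
    rw [aut_apply_inv_self] at h1
    calc star (u n) * π O = star (u n) * (π O * u n) * star (u n) := by
          rw [mul_assoc, mul_assoc, (Unitary.mem_iff.1 (hun n)).2, mul_one]
      _ = _ := by
          rw [← h1, ← mul_assoc, (Unitary.mem_iff.1 (hun n)).1, one_mul]
  have hdense : Dense (Set.range fun O => π O Ω) := h.cyclic
  have hlim : ∀ {β : ℕ → Aut} {γ : Aut}, ConvergesTo atTop β γ → ∀ O,
      Tendsto (fun n => π (β n O)) atTop (𝓝 (π (γ O))) := fun hβ O =>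
    ((continuous_representation π).tendsto _).comp (hβ O)
  have happ : ∀ {β : ℕ → Aut} {γ : Aut}, ConvergesTo atTop β γ → ∀ O,
      Tendsto (fun n => π (β n O) Ω) atTop (𝓝 (π (γ O) Ω)) := fun hβ O =>
    ((ContinuousLinearMap.apply ℂ H Ω).continuous.tendsto _).comp (hlim hβ O)
  obtain ⟨U, hU⟩ := exists_strong_limit hun hdense (by
    rintro _ ⟨O, rfl⟩
    refine ⟨_, (happ hα O).congr fun n => ?_⟩
    have := DFunLike.congr_fun (hmul n O) Ω
    simp only [ContinuousLinearMap.mul_apply, hΩ] at this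
    exact this.symm)
  obtain ⟨U', hU'⟩ := exists_strong_limit (fun n => Unitary.star_mem (hun n)) hdense (by
    rintro _ ⟨O, rfl⟩
    refine ⟨_, (happ hα.inv O).congr fun n => ?_⟩
    have := DFunLike.congr_fun (hmul' n O) Ω
    simp only [ContinuousLinearMap.mul_apply, hΩ'] at this
    exact this.symm)
  refine ⟨U, unitary_of_strong_limit hun hU hU', fun O => ?_, hU⟩
  ext1 ξ
  refine tendsto_nhds_unique (hU (π O ξ)) ?_
  have h1 : Tendsto (fun n => π (Ad (V n) O) (u n ξ)) atTop (𝓝 (π (α O) (U ξ))) :=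
    ((isBoundedBilinearMap_apply (𝕜 := ℂ) (E := H) (F := H)).continuous.tendsto
      (π (α O), U ξ)).comp ((hlim hα O).prodMk_nhds (hU ξ))
  refine h1.congr fun n => ?_
  have := DFunLike.congr_fun (hmul n O) ξ
  exact this.symm

/-- Both unitaries intertwine the same representations, so `U' * star U` commutes with all of `π`,
since `w₂` is onto; irreducibility makes it a scalar. -/
theorem eq_smul_of_implements (hω : IsDoubleSemionState ω) (h : IsGNSTriple ω π Ω) {w₁ w₂ : Aut}
    {U U' : H →L[ℂ] H} (hUI : Implements U π w₁ w₂) (hU' : Implements U' π w₁ w₂) :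
    ∃ ζ : ℂ, ‖ζ‖ = 1 ∧ U' = ζ • U := by
  have hUu := hUI.1
  obtain ⟨ζ, hζ⟩ : ∃ ζ : ℂ, U' * star U = ζ • 1 := by
    refine commutant_trivial hω h fun O => ?_
    have h2 : ∀ {U : H →L[ℂ] H}, Implements U π w₁ w₂ → U * π (w₁ (w₂⁻¹ O)) = π O * U := by
      intro U hU
      have := hU.2 (w₂⁻¹ O)
      rw [aut_apply_inv_self] at this
      rw [← this, mul_assoc, (Unitary.mem_iff.1 hU.1).1, mul_one]
    have h3 : star U * π O = π (w₁ (w₂⁻¹ O)) * star U := by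
      calc star U * π O = star U * (π O * U) * star U := by
            rw [mul_assoc, mul_assoc, (Unitary.mem_iff.1 hUu).2, mul_one]
        _ = _ := by rw [← h2 hUI, ← mul_assoc, (Unitary.mem_iff.1 hUu).1, one_mul]
    rw [mul_assoc, h3, ← mul_assoc, h2 hU', mul_assoc]
  have hU'eq : U' = ζ • U := by
    have := congrArg (· * U) hζ
    simp only [mul_assoc, (Unitary.mem_iff.1 hUu).1, mul_one, smul_mul_assoc, one_mul] at this
    exact this
  have hζ1 : ‖ζ‖ = 1 := by
    have h1 : ‖(U' * star U) Ω‖ = ‖Ω‖ :=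
      norm_unitary_apply (mul_mem hU'.1 (Unitary.star_mem hUu)) Ω
    rw [hζ, smul_apply, norm_smul, ContinuousLinearMap.one_apply] at h1
    -- `ω 1 = 1` excludes the zero vector, so the modulus of `ζ` can be read off from `Ω`.
    have hΩ : ‖Ω‖ ≠ 0 := by
      intro h0
      have h2 := h.expectation 1
      rw [norm_eq_zero.1 h0, inner_zero_left] at h2
      have h3 := hω 1
      simp only [approxState_one] at h3
      rw [← h2] at h3
      exact one_ne_zero (tendsto_nhds_unique tendsto_const_nhds h3)
    exact mul_right_cancel₀ hΩ (h1.trans (one_mul _).symm)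
  exact ⟨ζ, hζ1, hU'eq⟩

/-- Commuting with a fixed operator of the commutant is preserved under limits of matrix elements.
-/
theorem mem_vonNeumann_of_weak_limit {Y : Set Edge} {X : ℕ → Obs} (hX : ∀ n, X n ∈ localObs Y)
    {z : ℕ → ℂ} {U : H →L[ℂ] H}
    (hU : ∀ ξ η : H, Tendsto (fun n => ⟪ξ, (z n • π (X n)) η⟫_ℂ) atTop (𝓝 ⟪ξ, U η⟫_ℂ)) :
    U ∈ vonNeumann π Y := by
  rw [vonNeumann, Set.mem_centralizer_iff]
  intro A hA
  rw [Set.mem_centralizer_iff] at hA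
  ext1 η
  refine ext_inner_left ℂ fun ξ => ?_
  rw [ContinuousLinearMap.mul_apply, ContinuousLinearMap.mul_apply,
    ← ContinuousLinearMap.adjoint_inner_left, ← ContinuousLinearMap.star_eq_adjoint]
  refine tendsto_nhds_unique (hU (star A ξ) η) ((hU ξ (A η)).congr fun n => ?_)
  have h3 := hA _ ⟨_, localObs_le_obsOn Y (hX n), rfl⟩
  have h4 := DFunLike.congr_fun h3 η
  rw [ContinuousLinearMap.mul_apply, ContinuousLinearMap.mul_apply] at h4
  rw [ContinuousLinearMap.star_eq_adjoint, ContinuousLinearMap.adjoint_inner_left, smul_apply,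
    smul_apply, map_smul, h4]

/-- If the transporting automorphism is, up to local unitaries, a limit of conjugations with
products of closed strings, then the unitaries which implement it are weak limits. -/
theorem implements_of_closedStrings (hω : IsDoubleSemionState ω) (h : IsGNSTriple ω π Ω)
    {a : Anyon} {Y : Set Edge} {w₁ w₂ g₁ g₂ : Aut} {v₁ v₂ : unitary Obs}
    (hv₁ : v₁ ∈ localUnitary Y) (hv₂ : v₂ ∈ localUnitary Y)
    (hw : w₂ * w₁⁻¹ = Ad v₂⁻¹ * (g₂ * g₁⁻¹) * Ad v₁)
    {Q Q' : ℕ → List Dart} {C C' : ℕ → unitary Obs}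
    (hC : ∀ n, (C n : Obs) = closedString a (Q n)) (hC' : ∀ n, (C' n : Obs) = closedString a (Q' n))
    (hQ : ∀ n, IsClosedPath (Q n) ∧ closedString a (Q n) ∈ localObs Y)
    (hQ' : ∀ n, IsClosedPath (Q' n) ∧ closedString a (Q' n) ∈ localObs Y)
    {c c' : ℕ → ℂ} (hc : ∀ n, ‖c n‖ = 1) (hc' : ∀ n, ‖c' n‖ = 1)
    (hs : ∀ n, ∃ N, IsStabilizer N (C n) (c n)) (hs' : ∀ n, ∃ N, IsStabilizer N (C' n) (c' n))
    (hg₁ : ConvergesTo atTop (fun n => Ad (C n)) g₁)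
    (hg₂ : ConvergesTo atTop (fun n => Ad (C' n)) g₂) :
    (∃ U : H →L[ℂ] H, Implements U π w₁ w₂) ∧ ∀ U : H →L[ℂ] H, Implements U π w₁ w₂ →
      U ∈ vonNeumann π Y ∧ IsWeakLimitOfClosedStrings π a Y U := by
  have hVΩ : ∀ n, π ((C' n * (C n)⁻¹ : unitary Obs) : Obs) Ω =
      (starRingEnd ℂ (c n) * c' n) • Ω := by
    intro n
    obtain ⟨N, hN⟩ := hs n
    obtain ⟨N', hN'⟩ := hs' n
    rw [Submonoid.coe_mul, map_mul, ContinuousLinearMap.mul_apply, ← Unitary.star_eq_inv]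
    have := hN.star.representation hω h
    rw [Unitary.coe_star, this, map_smul, hN'.representation hω h, smul_smul]
  have hα : ConvergesTo atTop (fun n => Ad (C' n * (C n)⁻¹)) (g₂ * g₁⁻¹) :=
    (hg₂.mul hg₁.inv).congr' (Eventually.of_forall fun n => by
      simp only [map_mul, map_inv])
  obtain ⟨U₀, hU₀, himp, hlim⟩ := exists_implementing_limit h (c := fun n => starRingEnd ℂ (c n) * c' n)
    (fun n => by rw [norm_mul, RCLike.norm_conj, hc, hc', one_mul]) hVΩ hα
  set z : ℕ → ℂ := fun n => starRingEnd ℂ (starRingEnd ℂ (c n) * c' n) with hz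
  have hz1 : ∀ n, ‖z n‖ = 1 := fun n => by
    rw [hz]; simp only [RCLike.norm_conj, norm_mul, hc, hc', one_mul]
  set T : Obs := Subtype.val v₁ with hT
  set T' : Obs := Subtype.val v₂⁻¹ with hT'
  -- `U₀` implements `g₂ * g₁⁻¹`, and the factorization `hw` dictates the two local unitaries around
  -- it. This is also why `T` and `T'` do not depend on `n`.
  set U := π T' * U₀ * π T with hU
  have hUu : U ∈ unitary (H →L[ℂ] H) :=
    mul_mem (mul_mem (representation_mem_unitary π v₂⁻¹.2) hU₀) (representation_mem_unitary π v₁.2)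
  have hUimp : ∀ O, U * π (w₁ O) = π (w₂ O) * U := by
    intro O
    have h1 : w₂ O = Ad v₂⁻¹ ((g₂ * g₁⁻¹) (Ad v₁ (w₁ O))) := by
      rw [← aut_mul_apply, ← aut_mul_apply, ← hw, aut_mul_apply, aut_inv_apply_self]
    have hAd : ∀ (v : unitary Obs) (x : Obs), π v * π x = π (Ad v x) * π v := by
      intro v x
      rw [← map_mul, ← map_mul, Ad_apply, mul_assoc, (Unitary.mem_iff.1 v.2).1, mul_one]
    rw [hU, h1, mul_assoc, hT, hAd, ← mul_assoc, mul_assoc _ U₀, himp, hT', ← mul_assoc, hAd]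
    simp only [mul_assoc]
  have hUI : Implements U π w₁ w₂ := ⟨hUu, fun O => by
    rw [hUimp, mul_assoc, (Unitary.mem_iff.1 hUu).2, mul_one]⟩
  have hX : ∀ n, T' * closedString a (Q' n) * star (closedString a (Q n)) * T =
      T' * ((C' n * (C n)⁻¹ : unitary Obs) : Obs) * T := by
    intro n
    rw [Submonoid.coe_mul, ← Unitary.star_eq_inv, Unitary.coe_star, hC, hC', ← mul_assoc]
  have hTm : T ∈ localObs Y := hv₁
  have hTm' : T' ∈ localObs Y := inv_mem hv₂
  have hweak : ∀ ζ : ℂ, ‖ζ‖ = 1 → ∀ ξ η : H, Tendsto (fun n => ⟪ξ, ((ζ * z n) •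
      π (T' * closedString a (Q' n) * star (closedString a (Q n)) * T)) η⟫_ℂ) atTop
      (𝓝 ⟪ξ, (ζ • U) η⟫_ℂ) := by
    intro ζ _ ξ η
    refine tendsto_const_nhds.inner ?_
    have h1 := (((π T').continuous.tendsto _).comp (hlim (π T η))).const_smul ζ
    refine h1.congr fun n => ?_
    rw [hX, map_mul, map_mul]
    simp only [Function.comp, smul_apply, ContinuousLinearMap.mul_apply, map_smul, smul_smul, hz]
  refine ⟨⟨U, hUI⟩, fun U' hU' => ?_⟩
  obtain ⟨ζ, hζ1, hU'eq⟩ := eq_smul_of_implements hω h hUI hU'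
  have hw' := hweak ζ hζ1
  rw [← hU'eq] at hw'
  exact ⟨mem_vonNeumann_of_weak_limit (fun n => mul_mem (mul_mem (mul_mem hTm' (hQ' n).2)
      (star_mem (hQ n).2)) hTm) hw', Q, Q', T, T', fun n => ζ * z n, hQ, hQ', ⟨v₁.2, hTm⟩,
    ⟨v₂⁻¹.2, hTm'⟩, fun n => by rw [norm_mul, hζ1, hz1, one_mul], hw'⟩

end Implement

/-! ### Connected boundaries -/

/-- Two hexagons are joined by a path of adjacent hexagons in `S`. -/
def Joined (S : Set Face) : Face → Face → Prop :=
  Relation.ReflTransGen fun f g => f ∈ S ∧ g ∈ S ∧ ∃ k, g = f + dirVec k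

theorem Joined.iff_of_boundary {S : Set Face} {F : Set Face}
    (hF : ∀ d : Dart, d.left ∈ S → d.right ∈ S → (d.left ∈ F ↔ d.right ∈ F)) {f g : Face}
    (h : Joined S f g) : f ∈ F ↔ g ∈ F := by
  induction h with
  | refl => rfl
  | tail _ h ih =>
    obtain ⟨h1, h2, k, rfl⟩ := h
    exact ih.trans (hF ⟨_, k⟩ h1 h2)

/-- A set of boundary edges of `G` which is closed under following the boundary is a cycle. -/
theorem isCycle_of_invariant {G : Set Face} {O : Set Dart} (hO : O ⊆ boundaryDarts G)
    (hn : ∀ d ∈ boundaryDarts G, (d ∈ O ↔ nextDart G d ∈ O)) : IsCycle (Dart.edge '' O) := by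
  have hmem : ∀ d ∈ boundaryDarts G, (d.edge ∈ Dart.edge '' O ↔ d ∈ O) := by
    intro d hd
    refine ⟨?_, fun h => ⟨d, h, rfl⟩⟩
    rintro ⟨d', hd', h⟩
    rwa [← edge_injOn_boundaryDarts G (hO hd') hd h]
  have hnot : ∀ d : Dart, (d.left ∈ G ↔ d.right ∈ G) → d.edge ∉ Dart.edge '' O := by
    rintro d hd ⟨d', hd', h⟩
    have := edge_mem_edgeBoundary_of_mem (hO hd')
    rw [h, Dart.edge_mem_edgeBoundary] at this
    exact this hd
  have key : ∀ x y : Dart, x ∈ boundaryDarts G → y ∈ boundaryDarts G → x.Follows y →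
      (x.edge ∈ Dart.edge '' O ↔ y.edge ∈ Dart.edge '' O) := by
    intro x y hx hy h
    rw [hmem x hx, hmem y hy, eq_nextDart hy h]
    exact hn x hx
  intro d
  have f1 : d.Follows d.turnLeft := Or.inl rfl
  have f2 : d.Follows d.turnRight := Or.inr rfl
  have f3 : d.turnRight.reverse.Follows d.turnLeft :=
    Or.inr (Dart.eq_of_left_right (by simp) (by simp))
  have f4 : d.turnLeft.reverse.Follows d.turnRight :=
    Or.inl (Dart.eq_of_left_right (by simp) (by simp))
  by_cases h1 : d.left ∈ G <;> by_cases h2 : d.right ∈ G <;> by_cases h3 : d.ahead ∈ G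
  · have n1 := hnot d (iff_of_true h1 h2)
    have n2 := hnot d.turnLeft (iff_of_true h1 h3)
    have n3 := hnot d.turnRight (iff_of_true h3 (by simpa using h2))
    tauto
  · have n1 := hnot d (iff_of_true h1 h2)
    have := key _ _ (by simp [boundaryDarts, h2, h3]) (by simp [boundaryDarts, h1, h3]) f3
    rw [Dart.edge_reverse] at this
    tauto
  · have n1 := hnot d.turnLeft (iff_of_true h1 h3)
    have := key _ _ ⟨h1, h2⟩ (by simp [boundaryDarts, h2, h3]) f2
    tauto
  · have n1 := hnot d.turnRight (iff_of_false h3 (by simpa using h2))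
    have := key _ _ ⟨h1, h2⟩ (by simp [boundaryDarts, h1, h3]) f1
    tauto
  · have n1 := hnot d.turnRight (iff_of_true h3 (by simpa using h2))
    have := key _ _ (by simp [boundaryDarts, h1, h3]) (by simp [boundaryDarts, h1, h2]) f1.reverse
    rw [Dart.edge_reverse, Dart.edge_reverse] at this
    tauto
  · have n1 := hnot d.turnLeft (iff_of_false h1 h3)
    have := key _ _ (by simp [boundaryDarts, h2, h3]) (by simp [boundaryDarts, h1, h2]) f2.reverse
    rw [Dart.edge_reverse, Dart.edge_reverse] at this
    tauto
  · have n1 := hnot d (iff_of_false h1 h2)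
    have := key _ _ (by simp [boundaryDarts, h1, h3]) (by simp [boundaryDarts, h2, h3]) f4
    rw [Dart.edge_reverse] at this
    tauto
  · have n1 := hnot d (iff_of_false h1 h2)
    have n2 := hnot d.turnLeft (iff_of_false h1 h3)
    have n3 := hnot d.turnRight (iff_of_false h3 (by simpa using h2))
    tauto

theorem iterate_nextDart_mem {G : Set Face} {d : Dart} (hd : d ∈ boundaryDarts G) (i : ℕ) :
    (nextDart G)^[i] d ∈ boundaryDarts G := by
  induction i with
  | zero => exact hd
  | succ i ih => rw [Function.iterate_succ_apply']; exact nextDart_mem ih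

theorem exists_period {G : Set Face} (hG : (boundaryDarts G).Finite) {d : Dart}
    (hd : d ∈ boundaryDarts G) : ∃ n, 0 < n ∧ (nextDart G)^[n] d = d := by
  obtain ⟨m, n, hmn, h⟩ := hG.exists_lt_map_eq_of_forall_mem (iterate_nextDart_mem hd)
  refine ⟨n - m, by omega, ?_⟩
  induction m generalizing n with
  | zero => exact h.symm
  | succ m ih =>
    obtain ⟨n, rfl⟩ : ∃ k, n = k + 1 := ⟨n - 1, by omega⟩
    rw [Function.iterate_succ_apply', Function.iterate_succ_apply'] at h
    have h' := congrArg (prevDart G) h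
    rw [prevDart_nextDart (iterate_nextDart_mem hd _),
      prevDart_nextDart (iterate_nextDart_mem hd _)] at h'
    have := ih n (by omega) h'
    rwa [Nat.add_sub_add_right]

theorem consecutive_map_range (f : ℕ → Dart) (n : ℕ) :
    consecutive ((List.range (n + 1)).map f) = (List.range n).map fun i => (f i, f (i + 1)) := by
  refine List.ext_getElem ?_ fun i h1 h2 => ?_
  · simp [consecutive]
  · simp [consecutive]

/-- The boundary of a finite connected set of hexagons without holes, and that of its complement,
is a single closed path. -/
theorem exists_closedPath {E : Finset Face} (hne : E.Nonempty)
    (hconn : ∀ f ∈ E, ∀ g ∈ E, Joined (E : Set Face) f g)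
    (hout : ∀ f ∉ E, ∀ N : Finset Face, ∃ g ∉ N, Joined (E : Set Face)ᶜ f g)
    {G : Set Face} (hG : G = E ∨ G = (E : Set Face)ᶜ) :
    ∃ l : List Dart, IsClosedPath l ∧ l.Nodup ∧ (∀ d, d ∈ l ↔ d ∈ boundaryDarts G) ∧
      ∀ a, closedString a l = loopOp a G l := by
  have hEG : edgeBoundary (E : Set Face) = edgeBoundary G := by
    rcases hG with rfl | rfl
    · rfl
    · rw [edgeBoundary_compl]
  have hGf : (boundaryDarts G).Finite := by
    rcases hG with rfl | rfl
    · exact finite_boundaryDarts E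
    · rw [boundaryDarts_compl]; exact (finite_boundaryDarts E).image _
  obtain ⟨d₀, hd₀⟩ : (boundaryDarts G).Nonempty := by
    have h1 : boundary E ≠ ∅ := fun h => by
      have : boundary E = boundary ∅ := by
        rw [h]; ext e; simp [mem_boundary, edgeBoundary]
      exact hne.ne_empty (boundary_injective this)
    obtain ⟨e, he⟩ := Finset.nonempty_iff_ne_empty.2 h1
    rw [mem_boundary, hEG] at he
    obtain ⟨d, hd, -⟩ := exists_boundaryDart he
    exact ⟨d, hd⟩
  set s : ℕ → Dart := fun i => (nextDart G)^[i] d₀ with hs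
  have hsG : ∀ i, s i ∈ boundaryDarts G := iterate_nextDart_mem hd₀
  have hss : ∀ i, s (i + 1) = nextDart G (s i) := fun i => Function.iterate_succ_apply' _ _ _
  obtain ⟨p, hp0, hp⟩ := exists_period hGf hd₀
  have hinv : ∀ d ∈ boundaryDarts G, (d ∈ Set.range s ↔ nextDart G d ∈ Set.range s) := by
    intro d hd
    constructor
    · rintro ⟨i, rfl⟩; exact ⟨i + 1, hss i⟩
    · rintro ⟨i, hi⟩
      have hcancel : ∀ j, s (j + 1) = nextDart G d → d ∈ Set.range s := fun j hj =>
        ⟨j, by rw [← prevDart_nextDart (hsG j), ← hss, hj, prevDart_nextDart hd]⟩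
      cases i with
      | zero =>
        obtain ⟨q, rfl⟩ : ∃ q, p = q + 1 := ⟨p - 1, by omega⟩
        refine hcancel q ?_
        rw [← hi]; exact hp
      | succ i => exact hcancel i hi
  have hsub : Set.range s ⊆ boundaryDarts G := by rintro _ ⟨i, rfl⟩; exact hsG i
  -- One orbit of the boundary is itself a finite cycle, hence bounds some `F`. It remains to see
  -- that `F = E`, so that the orbit is the whole boundary.
  obtain ⟨F, hF⟩ := exists_boundary_eq ((hGf.subset hsub).image Dart.edge)
    (isCycle_of_invariant hsub hinv)
  have hFE : ∀ e, e ∈ edgeBoundary (F : Set Face) → e ∈ edgeBoundary (E : Set Face) := by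
    intro e he
    rw [hF] at he
    obtain ⟨d, hd, rfl⟩ := he
    rw [hEG]
    exact edge_mem_edgeBoundary_of_mem (hsub hd)
  have hconst : ∀ d : Dart, (d.left ∈ E ↔ d.right ∈ E) → (d.left ∈ F ↔ d.right ∈ F) := by
    intro d hd
    by_contra h
    have := hFE d.edge (Dart.edge_mem_edgeBoundary.2 h)
    exact Dart.edge_mem_edgeBoundary.1 this hd
  -- Membership in `F` can change only across the boundary of `E`. Outside `E` every hexagon is
  -- joined to infinity, where the finite set `F` is left.
  have hF1 : ∀ f ∈ F, f ∈ E := by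
    intro f hf
    by_contra hfE
    obtain ⟨g, hg, hfg⟩ := hout f hfE F
    exact hg ((hfg.iff_of_boundary (F := (F : Set Face)) fun d h1 h2 =>
      hconst d (iff_of_false h1 h2)).1 hf)
  have hFne : F.Nonempty := by
    by_contra h
    rw [Finset.not_nonempty_iff_eq_empty] at h
    have : (s 0).edge ∈ edgeBoundary (F : Set Face) := by rw [hF]; exact ⟨_, ⟨0, rfl⟩, rfl⟩
    rw [h] at this
    simp [edgeBoundary] at this
  have hFeq : F = E := by
    refine Finset.Subset.antisymm hF1 fun g hg => ?_
    obtain ⟨f, hf⟩ := hFne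
    exact ((hconn f (hF1 f hf) g hg).iff_of_boundary (F := (F : Set Face)) fun d h1 h2 =>
      hconst d (iff_of_true h1 h2)).1 hf
  have hrange : ∀ d, d ∈ boundaryDarts G ↔ d ∈ Set.range s := by
    refine fun d => ⟨fun hd => ?_, fun h => hsub h⟩
    have h1 := edge_mem_edgeBoundary_of_mem hd
    rw [← hEG, ← hFeq, hF] at h1
    obtain ⟨d', hd', h⟩ := h1
    rwa [← edge_injOn_boundaryDarts G (hsub hd') hd h]
  -- Cutting at the minimal period, rather than at `p`, yields a list without repetitions.
  have hper : d₀ ∈ Function.periodicPts (nextDart G) := ⟨p, hp0, hp⟩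
  set n := Function.minimalPeriod (nextDart G) d₀ with hn
  have hn0 : 0 < n := Function.minimalPeriod_pos_of_mem_periodicPts hper
  have hsn : s n = s 0 := Function.iterate_minimalPeriod
  set l := (List.range n).map s with hl
  have hmem : ∀ d, d ∈ l ↔ d ∈ boundaryDarts G := by
    intro d
    rw [hrange, hl, List.mem_map]
    constructor
    · rintro ⟨i, -, rfl⟩; exact ⟨i, rfl⟩
    · rintro ⟨i, rfl⟩
      refine ⟨i % n, List.mem_range.2 (Nat.mod_lt _ hn0), ?_⟩
      exact Function.iterate_mod_minimalPeriod_eq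
  have hnd : l.Nodup := List.nodup_range.map_on fun i hi j hj h =>
    Function.iterate_injOn_Iio_minimalPeriod (List.mem_range.1 hi) (List.mem_range.1 hj) h
  have htake : l ++ l.take 1 = (List.range (n + 1)).map s := by
    obtain ⟨m, hm⟩ : ∃ m, n = m + 1 := ⟨n - 1, by omega⟩
    have : l.take 1 = [s n] := by
      rw [hsn, hl, hm, List.range_succ_eq_map]
      simp
    rw [this, List.range_succ, List.map_append]
    rfl
  refine ⟨l, ⟨?_, ?_, ?_⟩, hnd, hmem, fun a => ?_⟩
  · exact List.ne_nil_of_mem (List.mem_map.2 ⟨0, List.mem_range.2 hn0, rfl⟩)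
  · exact hnd.map_on fun d hd d' hd' h =>
      edge_injOn_boundaryDarts _ ((hmem d).1 hd) ((hmem d').1 hd') h
  · rw [htake, List.isChain_map]
    refine List.isChain_iff_getElem.2 fun i hi => ?_
    simp only [List.getElem_range]
    rw [hss]
    exact follows_nextDart G _
  · rw [closedString, stringOpAux_eq, htake, consecutive_map_range, loopOp, List.map_map]
    congr 2
    rw [hl, List.map_map, List.map_map]
    refine List.map_congr_left fun i _ => ?_
    simp only [Function.comp, hss]

/-! ### The geometry of hexagons -/

/-- The real inner product of two vectors in the plane. -/
def dot (u x : ℂ) : ℝ := u.re * x.re + u.im * x.im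

theorem dot_add (u x y : ℂ) : dot u (x + y) = dot u x + dot u y := by simp [dot]; ring
theorem dot_sub (u x y : ℂ) : dot u (x - y) = dot u x - dot u y := by simp [dot]; ring
theorem dot_neg (u x : ℂ) : dot u (-x) = -dot u x := by simp [dot]; ring
theorem dot_smul (u : ℂ) (c : ℝ) (x : ℂ) : dot u (c • x) = c * dot u x := by simp [dot]; ring
theorem add_dot (u v x : ℂ) : dot (u + v) x = dot u x + dot v x := by simp [dot]; ring
theorem neg_dot (u x : ℂ) : dot (-u) x = -dot u x := by simp [dot]; ring
theorem dot_zero (u : ℂ) : dot u 0 = 0 := by simp [dot]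

theorem dot_self (x : ℂ) : dot x x = ‖x‖ ^ 2 := by
  rw [← Complex.normSq_eq_norm_sq, Complex.normSq_apply, dot]

theorem dot_comm (u x : ℂ) : dot u x = dot x u := by unfold dot; ring

theorem dot_eq_inner (u x : ℂ) : dot u x = ⟪u, x⟫_ℝ := by
  rw [Complex.inner]; simp [dot]; ring

theorem abs_dot_le (u x : ℂ) : |dot u x| ≤ ‖u‖ * ‖x‖ := by
  rw [dot_eq_inner]; exact abs_real_inner_le_norm u x

theorem continuous_dot (u : ℂ) : Continuous (dot u) := by
  unfold dot; fun_prop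

theorem center_add (f g : Face) : center (f + g) = center f + center g := by
  apply Complex.ext
  · simp [center]; ring
  · simp [center]; ring

/-- The displacement from the centre of a hexagon to the centre of its `k`-th neighbour. -/
def step (k : Fin 6) : ℂ := center (dirVec k)

theorem center_add_dirVec (f : Face) (k : Fin 6) : center (f + dirVec k) = center f + step k :=
  center_add f _

theorem sqrt_three_sq : √(3 : ℝ) * √3 = 3 := Real.mul_self_sqrt (by norm_num)

theorem step_add_three (k : Fin 6) : step (k + 3) = -step k := by
  have h : center (dirVec (k + 3) + dirVec k) = 0 := by
    rw [dirVec_add_three, neg_add_cancel]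
    apply Complex.ext <;> simp [center]
  rw [center_add] at h
  exact eq_neg_of_add_eq_zero_left h

theorem step_re_im (k : Fin 6) : (step k).re = √3 * (((dirVec k).1 : ℝ) + ((dirVec k).2 : ℝ) / 2) ∧
    (step k).im = 3 / 2 * ((dirVec k).2 : ℝ) := ⟨rfl, rfl⟩

theorem norm_sq_step (k : Fin 6) : ‖step k‖ ^ 2 = 3 := by
  have h3 := sqrt_three_sq
  rw [← dot_self, dot, (step_re_im k).1, (step_re_im k).2]
  fin_cases k <;> simp [dirVec] <;> nlinarith

theorem norm_step_le (k : Fin 6) : ‖step k‖ ≤ 2 := by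
  have := norm_sq_step k
  nlinarith [norm_nonneg (step k)]

theorem norm_sq_center (f : Face) : ‖center f‖ ^ 2 = 3 * ((f.1 : ℝ) ^ 2 + f.1 * f.2 + (f.2 : ℝ) ^ 2) := by
  have h3 := sqrt_three_sq
  rw [← dot_self, dot]
  simp only [center]
  linear_combination (f.1 + f.2 / 2 : ℝ) ^ 2 * h3

theorem finite_faces_norm_le (R : ℝ) : {f : Face | ‖center f‖ ≤ R}.Finite := by
  obtain ⟨N, hN⟩ := exists_nat_gt R
  refine ((Set.finite_Icc (-(N : ℤ)) N).prod (Set.finite_Icc (-(N : ℤ)) N)).subset ?_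
  rintro f hf
  have h1 := norm_sq_center f
  have hf' : ‖center f‖ ≤ R := hf
  have h0 := norm_nonneg (center f)
  have h2 : ‖center f‖ ^ 2 ≤ (N : ℝ) ^ 2 := pow_le_pow_left₀ h0 (by linarith) 2
  have h3 : (f.1 : ℝ) ^ 2 ≤ (N : ℝ) ^ 2 := by
    nlinarith [sq_nonneg ((f.1 : ℝ) + 2 * f.2), sq_nonneg (f.1 : ℝ)]
  have h4 : (f.2 : ℝ) ^ 2 ≤ (N : ℝ) ^ 2 := by
    nlinarith [sq_nonneg (2 * (f.1 : ℝ) + f.2), sq_nonneg (f.2 : ℝ)]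
  have hN0 : (0 : ℝ) ≤ N := Nat.cast_nonneg N
  have h5 := abs_le.1 (abs_le_of_sq_le_sq h3 hN0)
  have h6 := abs_le.1 (abs_le_of_sq_le_sq h4 hN0)
  refine ⟨⟨?_, ?_⟩, ⟨?_, ?_⟩⟩
  · exact_mod_cast h5.1
  · exact_mod_cast h5.2
  · exact_mod_cast h6.1
  · exact_mod_cast h6.2

/-- The closed hexagon around the origin. -/
def cell : Set ℂ := {y | ∀ k, dot (step k) y ≤ 3 / 2}

/-- The closed hexagon with a given label. -/
def closedHexagon (f : Face) : Set ℂ := {x | x - center f ∈ cell}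

theorem dist_le_dist_center_iff (x : ℂ) (f : Face) (k : Fin 6) :
    dist x (center f) ≤ dist x (center (f + dirVec k)) ↔ dot (step k) (x - center f) ≤ 3 / 2 := by
  have h : ‖x - center (f + dirVec k)‖ ^ 2 =
      ‖x - center f‖ ^ 2 - 2 * dot (step k) (x - center f) + 3 := by
    rw [center_add_dirVec, ← norm_sq_step k, ← dot_self, ← dot_self, ← dot_self]
    simp [dot]; ring
  rw [dist_eq_norm, dist_eq_norm, ← sq_le_sq₀ (norm_nonneg _) (norm_nonneg _), h]
  constructor <;> intro h <;> linarith

theorem dist_lt_dist_center_iff (x : ℂ) (f : Face) (k : Fin 6) :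
    dist x (center f) < dist x (center (f + dirVec k)) ↔ dot (step k) (x - center f) < 3 / 2 := by
  have h : ‖x - center (f + dirVec k)‖ ^ 2 =
      ‖x - center f‖ ^ 2 - 2 * dot (step k) (x - center f) + 3 := by
    rw [center_add_dirVec, ← norm_sq_step k, ← dot_self, ← dot_self, ← dot_self]
    simp [dot]; ring
  rw [dist_eq_norm, dist_eq_norm, ← sq_lt_sq₀ (norm_nonneg _) (norm_nonneg _), h]
  constructor <;> intro h <;> linarith

theorem mem_hexagon {f : Face} {x : ℂ} :
    x ∈ hexagon f ↔ ∀ k, dot (step k) (x - center f) < 3 / 2 :=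
  forall_congr' fun k => dist_lt_dist_center_iff x f k

theorem mem_closedHexagon {f : Face} {x : ℂ} : x ∈ closedHexagon f ↔ x - center f ∈ cell := Iff.rfl

theorem exists_mem_closedHexagon (x : ℂ) : ∃ f, x ∈ closedHexagon f := by
  have hfin := finite_faces_norm_le (‖x‖ + dist x (center 0))
  have hne : ((0 : Face)) ∈ {f : Face | ‖center f‖ ≤ ‖x‖ + dist x (center 0)} := by
    have : ‖center 0‖ ≤ ‖x‖ + ‖x - center 0‖ := by
      have := norm_sub_norm_le (center 0) x
      rw [norm_sub_rev] at this
      linarith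
    rwa [← dist_eq_norm] at this
  obtain ⟨f, hf, hmin⟩ := Set.exists_min_image _ (fun f => dist x (center f)) hfin ⟨0, hne⟩
  refine ⟨f, fun k => (dist_le_dist_center_iff x f k).1 ?_⟩
  by_cases h : f + dirVec k ∈ {f : Face | ‖center f‖ ≤ ‖x‖ + dist x (center 0)}
  · exact hmin _ h
  · have h1 : ‖x‖ + dist x (center 0) < ‖center (f + dirVec k)‖ := not_le.1 h
    have h2 := hmin 0 hne
    have h3 := norm_sub_norm_le (center (f + dirVec k)) x
    rw [norm_sub_rev, ← dist_eq_norm] at h3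
    linarith

/-- The hexagon lies in the box `|re| ≤ √3 / 2`, `|im| ≤ 1`, whose corners have squared norm `7 /
4`. The bound is crude but sufficient for `eq_or_adjacent`. -/
theorem norm_sq_le_of_mem_cell {y : ℂ} (hy : y ∈ cell) : ‖y‖ ^ 2 ≤ 7 / 4 := by
  have h3 := sqrt_three_sq
  have hs : 0 < √(3 : ℝ) := Real.sqrt_pos.2 (by norm_num)
  have e : ∀ k, dot (step k) y = √3 * (((dirVec k).1 : ℝ) + ((dirVec k).2 : ℝ) / 2) * y.re +
    3 / 2 * ((dirVec k).2 : ℝ) * y.im := fun k => rfl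
  have h0 := hy 0
  have h1 := hy 1
  have h2 := hy 2
  have h3' := hy 3
  have h4 := hy 4
  have h5 := hy 5
  rw [e] at h0 h1 h2 h3' h4 h5
  simp [dirVec] at h0 h1 h2 h3' h4 h5
  have a1 : y.im ≤ 1 := by linarith
  have a2 : -1 ≤ y.im := by linarith
  have a3 : (√3 * y.re) ^ 2 ≤ (3 / 2) ^ 2 := sq_le_sq' (by linarith) (by linarith)
  have a4 : y.re ^ 2 ≤ 3 / 4 := by nlinarith
  have a5 : y.im ^ 2 ≤ 1 := by nlinarith
  rw [← dot_self, dot]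
  nlinarith

theorem norm_le_of_mem_cell {y : ℂ} (hy : y ∈ cell) : ‖y‖ ≤ 2 := by
  nlinarith [norm_sq_le_of_mem_cell hy, norm_nonneg y]

theorem neg_mem_cell {y : ℂ} (hy : y ∈ cell) : -y ∈ cell := by
  intro k
  have := hy (k + 3)
  rwa [step_add_three, neg_dot, ← dot_neg] at this

theorem isClosed_cell : IsClosed cell := by
  have : cell = ⋂ k, {y | dot (step k) y ≤ 3 / 2} := by ext y; simp [cell]
  rw [this]
  exact isClosed_iInter fun k => isClosed_le (continuous_dot _) continuous_const

theorem zero_mem_cell : (0 : ℂ) ∈ cell := fun k => by rw [dot_zero]; norm_num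

theorem isCompact_cell : IsCompact cell :=
  Metric.isCompact_of_isClosed_isBounded isClosed_cell
    ((Metric.isBounded_iff_subset_closedBall 0).2 ⟨2, fun y hy => by
      rw [mem_closedBall_zero_iff]; exact norm_le_of_mem_cell hy⟩)

theorem isClosed_closedHexagon (f : Face) : IsClosed (closedHexagon f) :=
  isClosed_cell.preimage (continuous_id.sub continuous_const)

/-- The width of the hexagon in a given direction. -/
theorem exists_width (u : ℂ) : ∃ p ∈ cell, ∀ y ∈ cell, dot u y ≤ dot u p := by
  obtain ⟨p, hp, h⟩ := isCompact_cell.exists_isMaxOn ⟨0, zero_mem_cell⟩ (continuous_dot u).continuousOn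
  exact ⟨p, hp, h⟩

/-- A point of the hexagon which is extremal in the direction `u`. -/
def extremal (u : ℂ) : ℂ := (exists_width u).choose

theorem extremal_mem (u : ℂ) : extremal u ∈ cell := (exists_width u).choose_spec.1

/-- The extension of the hexagon in the direction `u`. -/
def width (u : ℂ) : ℝ := dot u (extremal u)

theorem dot_le_width {u y : ℂ} (hy : y ∈ cell) : dot u y ≤ width u :=
  (exists_width u).choose_spec.2 y hy

theorem neg_width_le {u y : ℂ} (hy : y ∈ cell) : -width u ≤ dot u y := by
  have := dot_le_width (u := u) (neg_mem_cell hy)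
  rw [dot_neg] at this
  linarith

/-- With a common point the squared distance of the centres is at most `4 * (7 / 4) = 7`. Squared
distances of centres are three times the values 0, 1, 3, … of `m ^ 2 + m * n + n ^ 2`, so only equal
and adjacent hexagons remain. -/
theorem eq_or_adjacent {f g : Face} {x : ℂ} (hf : x ∈ closedHexagon f) (hg : x ∈ closedHexagon g) :
    f = g ∨ ∃ k, g = f + dirVec k := by
  have h1 := norm_sq_le_of_mem_cell hf
  have h2 := norm_sq_le_of_mem_cell hg
  have h3 : ‖center (g - f)‖ ^ 2 ≤ 7 := by
    have h4 : center (g - f) = (x - center f) - (x - center g) := by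
      have := center_add f (g - f)
      rw [add_sub_cancel] at this
      rw [this]; ring
    rw [h4]
    have h5 := norm_sub_le (x - center f) (x - center g)
    nlinarith [norm_nonneg (x - center f - (x - center g)), norm_nonneg (x - center f),
      norm_nonneg (x - center g), sq_nonneg (‖x - center f‖ - ‖x - center g‖)]
  rw [norm_sq_center] at h3
  obtain ⟨⟨m, n⟩, e⟩ : ∃ p : ℤ × ℤ, g - f = p := ⟨_, rfl⟩
  rw [e] at h3
  simp only at h3
  have h6 : m ^ 2 + m * n + n ^ 2 < 3 := by
    have : ((m ^ 2 + m * n + n ^ 2 : ℤ) : ℝ) < 3 := by push_cast; linarith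
    exact_mod_cast this
  have hm : m ^ 2 < 2 ^ 2 := by nlinarith [sq_nonneg (m + 2 * n)]
  have hn : n ^ 2 < 2 ^ 2 := by nlinarith [sq_nonneg (n + 2 * m)]
  have hm' := abs_lt.1 (abs_lt_of_sq_lt_sq hm (by norm_num))
  have hn' := abs_lt.1 (abs_lt_of_sq_lt_sq hn (by norm_num))
  have hg : g = f + (m, n) := by rw [← e]; abel
  clear e h1 h2 h3 hm hn
  obtain ⟨hm1, hm2⟩ := hm'
  obtain ⟨hn1, hn2⟩ := hn'
  have key : ((m, n) : Face) = 0 ∨ ∃ k, ((m, n) : Face) = dirVec k := by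
    interval_cases m <;> interval_cases n <;> first | omega | decide
  rcases key with h | ⟨k, h⟩
  · left; rw [hg, h, add_zero]
  · right; exact ⟨k, by rw [hg, h]⟩

/-! ### Hexagons which meet a set -/

/-- The hexagons whose closure meets a set. -/
def meeting (K : Set ℂ) : Set Face := {f | (closedHexagon f ∩ K).Nonempty}

theorem meeting_mono {K K' : Set ℂ} (h : K ⊆ K') : meeting K ⊆ meeting K' :=
  fun _ hf => hf.mono (Set.inter_subset_inter_right _ h)

theorem norm_sub_center_le {f : Face} {x : ℂ} (h : x ∈ closedHexagon f) : ‖x - center f‖ ≤ 2 :=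
  norm_le_of_mem_cell h

theorem finite_meeting {K : Set ℂ} (hK : Bornology.IsBounded K) : (meeting K).Finite := by
  obtain ⟨R, hR⟩ := (Metric.isBounded_iff_subset_closedBall 0).1 hK
  refine (finite_faces_norm_le (R + 2)).subset ?_
  rintro f ⟨x, hx, hxK⟩
  have h1 := norm_sub_center_le hx
  have h2 := hR hxK
  rw [mem_closedBall_zero_iff] at h2
  have h3 := norm_sub_norm_le (center f) x
  rw [norm_sub_rev] at h3
  show ‖center f‖ ≤ R + 2
  linarith

/-- If the hexagons meeting `T` fell into two classes, the unions of the closed hexagons in each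
would be two closed sets covering `T`. By connectedness they share a point, and hexagons with a
common point are adjacent. -/
theorem joined_meeting {T : Set ℂ} (hT : IsPreconnected T) (hb : Bornology.IsBounded T)
    {f g : Face} (hf : f ∈ meeting T) (hg : g ∈ meeting T) : Joined (meeting T) f g := by
  by_contra hfg
  have hfin := finite_meeting hb
  set A : Set Face := {h ∈ meeting T | Joined (meeting T) f h} with hA
  set B : Set Face := {h ∈ meeting T | ¬ Joined (meeting T) f h} with hB
  have hcl : ∀ S : Set Face, S ⊆ meeting T → IsClosed (⋃ h ∈ S, closedHexagon h) := fun S hS =>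
    (hfin.subset hS).isClosed_biUnion fun h _ => isClosed_closedHexagon h
  have hcover : T ⊆ (⋃ h ∈ A, closedHexagon h) ∪ ⋃ h ∈ B, closedHexagon h := by
    intro x hx
    obtain ⟨h, hh⟩ := exists_mem_closedHexagon x
    have hm : h ∈ meeting T := ⟨x, hh, hx⟩
    by_cases hj : Joined (meeting T) f h
    · exact Or.inl (Set.mem_biUnion (show h ∈ A from ⟨hm, hj⟩) hh)
    · exact Or.inr (Set.mem_biUnion (show h ∈ B from ⟨hm, hj⟩) hh)
  have hTA : (T ∩ ⋃ h ∈ A, closedHexagon h).Nonempty := by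
    obtain ⟨x, hx, hxT⟩ := hf
    exact ⟨x, hxT, Set.mem_biUnion (show f ∈ A from ⟨⟨x, hx, hxT⟩, Relation.ReflTransGen.refl⟩) hx⟩
  have hTB : (T ∩ ⋃ h ∈ B, closedHexagon h).Nonempty := by
    obtain ⟨x, hx, hxT⟩ := hg
    exact ⟨x, hxT, Set.mem_biUnion (show g ∈ B from ⟨⟨x, hx, hxT⟩, hfg⟩) hx⟩
  obtain ⟨x, -, hxA, hxB⟩ := isPreconnected_closed_iff.1 hT _ _ (hcl A fun h hh => hh.1)
    (hcl B fun h hh => hh.1) hcover hTA hTB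
  obtain ⟨h, hhA, hxh⟩ := Set.mem_iUnion₂.1 hxA
  obtain ⟨h', hhB, hxh'⟩ := Set.mem_iUnion₂.1 hxB
  rcases eq_or_adjacent hxh hxh' with rfl | hk
  · exact hhB.2 hhA.2
  · exact hhB.2 (hhA.2.tail ⟨hhA.1, hhB.1, hk⟩)

theorem Joined.mono {S S' : Set Face} (h : S ⊆ S') {f g : Face} (hj : Joined S f g) : Joined S' f g :=
  Relation.ReflTransGen.mono (fun _ _ hh => ⟨h hh.1, h hh.2.1, hh.2.2⟩) _ _ hj

theorem joined_of_convex {K : Set ℂ} (hK : Convex ℝ K) {f g : Face} (hf : f ∈ meeting K)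
    (hg : g ∈ meeting K) : Joined (meeting K) f g := by
  obtain ⟨x, hx, hxK⟩ := hf
  obtain ⟨y, hy, hyK⟩ := hg
  have hseg : segment ℝ x y ⊆ K := hK.segment_subset hxK hyK
  refine (joined_meeting (convex_segment x y).isPreconnected ?_ ⟨x, hx, left_mem_segment ℝ x y⟩
    ⟨y, hy, right_mem_segment ℝ x y⟩).mono (meeting_mono hseg)
  rw [← convexHull_pair]
  exact isBounded_convexHull.2 (Set.toFinite _).isBounded

theorem isOpen_hexagon (f : Face) : IsOpen (hexagon f) := by
  have : hexagon f = ⋂ k, {x | dot (step k) (x - center f) < 3 / 2} := by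
    ext x; rw [mem_hexagon]; simp
  rw [this]
  exact isOpen_iInter_of_finite fun k => isOpen_lt
    ((continuous_dot _).comp (continuous_id.sub continuous_const)) continuous_const

theorem convex_hexagon (f : Face) : Convex ℝ (hexagon f) := by
  intro x hx y hy a b ha hb hab
  rw [mem_hexagon] at hx hy ⊢
  intro k
  have e : a • x + b • y - center f = a • (x - center f) + b • (y - center f) := by
    have : center f = (a + b) • center f := by rw [hab, one_smul]
    conv_lhs => rw [this]
    rw [add_smul, smul_sub, smul_sub]; abel
  rw [e, dot_add, dot_smul, dot_smul]
  have h1 := hx k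
  have h2 := hy k
  rcases ha.eq_or_lt with rfl | ha'
  · have : b = 1 := by linarith
    rw [this]; linarith
  · nlinarith

/-- Shrinking a point of a closed hexagon towards the centre gives points of the open hexagon. -/
theorem shrink_mem_hexagon {f : Face} {x : ℂ} (hx : x ∈ closedHexagon f) {t : ℝ} (ht : 0 ≤ t)
    (ht1 : t < 1) : center f + t • (x - center f) ∈ hexagon f := by
  rw [mem_hexagon]
  intro k
  rw [add_sub_cancel_left, dot_smul]
  have := hx k
  nlinarith

theorem tendsto_shrink (f : Face) (x : ℂ) :
    Tendsto (fun t : ℝ => center f + t • (x - center f)) (𝓝[<] 1) (𝓝 x) := by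
  have : Continuous fun t : ℝ => center f + t • (x - center f) := by fun_prop
  have h := (this.tendsto 1).mono_left (nhdsWithin_le_nhds (s := Set.Iio (1 : ℝ)))
  simpa using h

/-- A common point of an open set and a closed hexagon can be shrunk slightly towards the centre.
Closed hexagons are preferable because they cover the plane. -/
theorem overlapping_eq_meeting {K : Set ℂ} (hK : IsOpen K) : overlapping K = meeting K := by
  ext f
  constructor
  · rintro ⟨x, hx, hxK⟩
    exact ⟨x, fun k => (mem_hexagon.1 hx k).le, hxK⟩
  · rintro ⟨x, hx, hxK⟩
    have h1 : ∀ᶠ t : ℝ in 𝓝[<] 1, center f + t • (x - center f) ∈ K :=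
      (tendsto_shrink f x).eventually (hK.mem_nhds hxK)
    have h2 : ∀ᶠ t : ℝ in 𝓝[<] 1, 0 < t ∧ t < 1 :=
      Ioo_mem_nhdsLT (by norm_num)
    obtain ⟨t, h3, h4, h5⟩ := (h1.and h2).exists
    exact ⟨_, shrink_mem_hexagon hx h4.le h5, h3⟩

/-- The six steps come in opposite pairs and span the plane. -/
theorem exists_step_neg {φ : ℂ →L[ℝ] ℝ} (hφ : φ ≠ 0) : ∃ k, φ (step k) < 0 := by
  by_contra! h
  have h0 : φ (step 0) = 0 := by
    have := h (0 + 3)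
    rw [step_add_three, map_neg] at this
    linarith [h 0]
  have h1 : φ (step 1) = 0 := by
    have := h (1 + 3)
    rw [step_add_three, map_neg] at this
    linarith [h 1]
  refine hφ ?_
  ext1 x
  have hs : √(3 : ℝ) ≠ 0 := (Real.sqrt_pos.2 (by norm_num)).ne'
  have h3 := sqrt_three_sq
  have hx : x = (x.re / √3 - x.im / 3) • step 0 + (2 / 3 * x.im) • step 1 := by
    apply Complex.ext
    · simp [(step_re_im _).1, dirVec]
      field_simp
      ring
    · simp [(step_re_im _).2, dirVec]
      ring
  rw [hx, map_add, map_smul, map_smul, h0, h1]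
  simp

/-- The hexagons which do not meet a convex set are joined to infinity. -/
theorem joined_infinity {K : Set ℂ} (hK : Convex ℝ K) {f : Face} (hf : f ∉ meeting K)
    (N : Finset Face) : ∃ g ∉ N, Joined (meeting K)ᶜ f g := by
  have hdisj : Disjoint (hexagon f) K := by
    rw [Set.disjoint_left]
    intro x hx hxK
    exact hf ⟨x, fun k => (mem_hexagon.1 hx k).le, hxK⟩
  -- Separate the open hexagon from `K` by a linear functional and march in a lattice direction in
  -- which the functional decreases; `K` stays on the other side.
  obtain ⟨k, hk⟩ : ∃ k, ∀ i : ℕ, f + i • dirVec k ∉ meeting K := by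
    rcases K.eq_empty_or_nonempty with rfl | ⟨z, hz⟩
    · exact ⟨0, fun i h => by obtain ⟨x, -, hx⟩ := h; exact hx⟩
    obtain ⟨φ, c, h1, h2⟩ := geometric_hahn_banach_open (convex_hexagon f) (isOpen_hexagon f) hK hdisj
    have hφ : φ ≠ 0 := by
      rintro rfl
      have h3 := h1 (center f) (mem_hexagon.2 fun k => by rw [sub_self, dot_zero]; norm_num)
      have h4 := h2 z hz
      simp at h3 h4
      linarith
    obtain ⟨k, hk⟩ := exists_step_neg hφ
    refine ⟨k, fun i hi => ?_⟩
    rcases Nat.eq_zero_or_pos i with rfl | hpos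
    · exact hf (by simpa using hi)
    obtain ⟨x, hx, hxK⟩ := hi
    have hc : center (f + i • dirVec k) = center f + (i : ℝ) • step k := by
      clear hx hpos
      induction i with
      | zero => simp
      | succ i ih =>
        rw [succ_nsmul, ← add_assoc, center_add_dirVec, ih]
        push_cast
        rw [add_smul, one_smul, add_assoc]
    have hx' : x - (i : ℝ) • step k ∈ closedHexagon f := by
      rw [mem_closedHexagon, hc] at hx
      rw [mem_closedHexagon]
      convert hx using 1
      abel
    have h3 : φ (x - (i : ℝ) • step k) ≤ c := by
      refine le_of_tendsto ((φ.continuous.tendsto _).comp (tendsto_shrink f _)) ?_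
      have h2 : ∀ᶠ t : ℝ in 𝓝[<] 1, 0 < t ∧ t < 1 := Ioo_mem_nhdsLT (by norm_num)
      filter_upwards [h2] with t ht
      exact (h1 _ (shrink_mem_hexagon hx' ht.1.le ht.2)).le
    rw [map_sub, map_smul, smul_eq_mul] at h3
    have h4 := h2 x hxK
    have : (0 : ℝ) < i := by exact_mod_cast hpos
    nlinarith
  have hinj : Function.Injective fun i : ℕ => f + i • dirVec k := by
    intro i j h
    have h1 : i • dirVec k = j • dirVec k := add_left_cancel h
    have h2 : ((i : ℤ) - j) • dirVec k = 0 := by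
      rw [sub_smul, natCast_zsmul, natCast_zsmul, h1, sub_self]
    rcases smul_eq_zero.1 h2 with h3 | h3
    · omega
    · exact absurd h3 (dirVec_ne_zero k)
  obtain ⟨_, ⟨i, rfl⟩, hi⟩ := (Set.infinite_range_of_injective hinj).exists_notMem_finset N
  refine ⟨_, hi, ?_⟩
  clear hi
  show Joined (meeting K)ᶜ f (f + i • dirVec k)
  induction i with
  | zero => rw [zero_smul, add_zero]; exact Relation.ReflTransGen.refl
  | succ i ih =>
    refine Relation.ReflTransGen.tail ih ⟨hk i, hk (i + 1), k, ?_⟩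
    rw [succ_nsmul, add_assoc]

/-! ### Boundaries of wedges -/

/-- The area of the parallelogram spanned by two vectors. -/
def det (u w : ℂ) : ℝ := u.re * w.im - u.im * w.re

theorem det_smul (u w x : ℂ) :
    det u w • x = dot u x • (-(Complex.I * w)) + dot w x • (Complex.I * u) := by
  apply Complex.ext
  · simp [det, dot]; ring
  · simp [det, dot]; ring

/-- Two linearly independent coordinates control the norm. Hence an exceptional set bounded in two
independent directions contains only finitely many edges. -/
theorem abs_det_mul_norm_le (u w x : ℂ) :
    |det u w| * ‖x‖ ≤ |dot u x| * ‖w‖ + |dot w x| * ‖u‖ := by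
  rw [← Real.norm_eq_abs, ← norm_smul, det_smul]
  refine (norm_add_le _ _).trans (le_of_eq ?_)
  rw [norm_smul, norm_smul, norm_neg, norm_mul, norm_mul, Complex.norm_I, Real.norm_eq_abs,
    Real.norm_eq_abs, one_mul, one_mul]

namespace Dart

theorem mid_eq (d : Dart) : d.edge.mid = (1 / 2 : ℝ) • (center d.left + center d.right) := by
  have h : ∀ x y : ℂ, midpoint ℝ x y = (1 / 2 : ℝ) • (x + y) := fun x y => by
    rw [midpoint_eq_smul_add]; norm_num
  rcases d.edge_faces with ⟨h1, h2⟩ | ⟨h1, h2⟩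
  · rw [Edge.mid, h1, h2, h]
  · rw [Edge.mid, h1, h2, h, add_comm]

theorem center_right (d : Dart) : center d.right = center d.left + step d.dir :=
  center_add_dirVec _ _

theorem dot_mid (u : ℂ) (d : Dart) :
    dot u d.edge.mid = (dot u (center d.left) + dot u (center d.right)) / 2 := by
  rw [mid_eq, dot_smul, dot_add]; ring

theorem norm_mid_sub_left_le (d : Dart) : ‖d.edge.mid - center d.left‖ ≤ 1 := by
  have h : d.edge.mid - center d.left = (1 / 2 : ℝ) • step d.dir := by
    rw [mid_eq, center_right, smul_add, smul_add]
    module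
  rw [h, norm_smul]
  have := norm_step_le d.dir
  norm_num
  linarith

theorem norm_mid_sub_right_le (d : Dart) : ‖d.edge.mid - center d.right‖ ≤ 1 := by
  have := d.reverse.norm_mid_sub_left_le
  rwa [edge_reverse, reverse_left] at this

theorem abs_dot_mid_sub_left_le (u : ℂ) (d : Dart) :
    |dot u d.edge.mid - dot u (center d.left)| ≤ ‖u‖ := by
  rw [← dot_sub]
  exact (abs_dot_le _ _).trans (mul_le_of_le_one_right (norm_nonneg u) d.norm_mid_sub_left_le)

theorem abs_dot_mid_sub_right_le (u : ℂ) (d : Dart) :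
    |dot u d.edge.mid - dot u (center d.right)| ≤ ‖u‖ := by
  rw [← dot_sub]
  exact (abs_dot_le _ _).trans (mul_le_of_le_one_right (norm_nonneg u) d.norm_mid_sub_right_le)

theorem norm_mid_turnRight_sub_le (d : Dart) : ‖d.turnRight.edge.mid - d.edge.mid‖ ≤ 2 := by
  have h1 := d.turnRight.norm_mid_sub_right_le
  rw [turnRight_right] at h1
  have h2 := d.norm_mid_sub_right_le
  calc ‖d.turnRight.edge.mid - d.edge.mid‖
      = ‖(d.turnRight.edge.mid - center d.right) - (d.edge.mid - center d.right)‖ := by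
        congr 1; ring
    _ ≤ _ := norm_sub_le _ _
    _ ≤ 2 := by linarith

theorem norm_mid_turnLeft_sub_le (d : Dart) : ‖d.turnLeft.edge.mid - d.edge.mid‖ ≤ 2 := by
  have h1 := d.turnLeft.norm_mid_sub_left_le
  rw [turnLeft_left] at h1
  have h2 := d.norm_mid_sub_left_le
  calc ‖d.turnLeft.edge.mid - d.edge.mid‖
      = ‖(d.turnLeft.edge.mid - center d.left) - (d.edge.mid - center d.left)‖ := by
        congr 1; ring
    _ ≤ _ := norm_sub_le _ _
    _ ≤ 2 := by linarith

theorem Follows.norm_mid_sub_le {d d' : Dart} (h : d.Follows d') :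
    ‖d'.edge.mid - d.edge.mid‖ ≤ 2 := by
  rcases h with rfl | rfl
  · exact d.norm_mid_turnLeft_sub_le
  · exact d.norm_mid_turnRight_sub_le

end Dart

theorem Touch.norm_mid_sub_le {d d' : Dart} (h : Touch d d') :
    ‖d'.edge.mid - d.edge.mid‖ ≤ 2 := by
  rcases h with h | h | h | h
  · rw [h, sub_self, norm_zero]; norm_num
  · exact h.norm_mid_sub_le
  · rw [norm_sub_rev]; exact h.norm_mid_sub_le
  · rw [← h]; exact d.norm_mid_turnRight_sub_le

theorem finite_darts_norm_le (R : ℝ) : {d : Dart | ‖d.edge.mid‖ ≤ R}.Finite := by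
  have hfin : ((fun p : Face × Fin 6 => Dart.mk p.1 p.2) ''
      ({f : Face | ‖center f‖ ≤ R + 1} ×ˢ Set.univ)).Finite :=
    ((finite_faces_norm_le (R + 1)).prod Set.finite_univ).image _
  refine hfin.subset fun d hd => ⟨(d.left, d.dir), ⟨?_, Set.mem_univ _⟩, rfl⟩
  have h1 := d.norm_mid_sub_left_le
  have h2 : ‖d.edge.mid‖ ≤ R := hd
  have h3 := norm_sub_norm_le (center d.left) d.edge.mid
  rw [norm_sub_rev] at h3
  show ‖center d.left‖ ≤ R + 1
  linarith

theorem finite_darts_dot_le {u w : ℂ} (h : det u w ≠ 0) (M : ℝ) :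
    {d : Dart | |dot u d.edge.mid| ≤ M ∧ |dot w d.edge.mid| ≤ M}.Finite := by
  refine (finite_darts_norm_le ((M * ‖w‖ + M * ‖u‖) / |det u w|)).subset fun d hd => ?_
  obtain ⟨h1, h2⟩ : |dot u d.edge.mid| ≤ M ∧ |dot w d.edge.mid| ≤ M := hd
  show ‖d.edge.mid‖ ≤ _
  rw [le_div_iff₀ (abs_pos.2 h), mul_comm]
  refine (abs_det_mul_norm_le u w _).trans ?_
  gcongr

theorem eventually_dot_large {u w : ℂ} (h : det u w ≠ 0) (M : ℝ) :
    ∀ᶠ d : Dart in cofinite, M < |dot u d.edge.mid| ∨ M < |dot w d.edge.mid| := by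
  refine mem_cofinite.2 ((finite_darts_dot_le h M).subset fun d hd => ?_)
  have : ¬ (M < |dot u d.edge.mid| ∨ M < |dot w d.edge.mid|) := hd
  push Not at this
  exact this

/-- The hexagons whose centre has its coordinate in the direction `u` in the set `U`. -/
def half (u : ℂ) (U : Set ℝ) : Set Face := {f | dot u (center f) ∈ U}

/-- The part of the oriented boundary of a set of hexagons which is far in the direction `w`. -/
def ray (F : Set Face) (w : ℂ) (C : ℝ) : Set Dart := {d ∈ boundaryDarts F | C < dot w d.edge.mid}

/-- The wedge between two lines. The sets `U` and `V` are half lines. -/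
def wedge (u : ℂ) (U : Set ℝ) (w : ℂ) (V : Set ℝ) (m : ℝ) : Set ℂ :=
  {x | dot u x - width u ∈ U ∧ dot w x - width w ∈ V ∧ m < dot (u + w) x}

theorem wedge_comm (u : ℂ) (U : Set ℝ) (w : ℂ) (V : Set ℝ) (m : ℝ) :
    wedge u U w V m = wedge w V u U m := by
  ext x; simp only [wedge, Set.mem_ofPred_eq, add_comm u w]; tauto

theorem mem_boundaryDarts_compl {F : Set Face} {d : Dart} :
    d ∈ boundaryDarts Fᶜ ↔ d.reverse ∈ boundaryDarts F := by
  rw [mem_boundaryDarts, mem_boundaryDarts, Dart.reverse_left, Dart.reverse_right,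
    Set.mem_compl_iff, Set.mem_compl_iff, not_not, and_comm]

theorem mem_ray_compl {F : Set Face} {w : ℂ} {C : ℝ} {d : Dart} :
    d ∈ ray Fᶜ w C ↔ d.reverse ∈ ray F w C := by
  show d ∈ boundaryDarts Fᶜ ∧ _ ↔ d.reverse ∈ boundaryDarts F ∧ _
  rw [mem_boundaryDarts_compl, Dart.edge_reverse]

theorem tendsto_reverse : Tendsto Dart.reverse cofinite cofinite :=
  Function.Injective.tendsto_cofinite fun d d' h => by
    rw [← d.reverse_reverse, h, d'.reverse_reverse]

variable {u w : ℂ} {U V : Set ℝ} {a b : ℝ}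

theorem strip_of_boundary (hU : Set.Ioi a ⊆ U) (hU' : U ⊆ Set.Ici a) {d : Dart}
    (hd : d ∈ boundaryDarts (half u U)) : |dot u d.edge.mid| ≤ |a| + ‖u‖ := by
  have h1 : a ≤ dot u (center d.left) := hU' hd.1
  have h2 : dot u (center d.right) ≤ a := not_lt.1 fun h => hd.2 (hU h)
  have h3 := abs_le.1 (d.abs_dot_mid_sub_left_le u)
  have h4 := abs_le.1 (d.abs_dot_mid_sub_right_le u)
  have h5 := neg_abs_le a
  have h6 := le_abs_self a
  exact abs_le.2 ⟨by linarith, by linarith⟩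

theorem width_nonneg (u : ℂ) : 0 ≤ width u := by
  have := dot_le_width (u := u) zero_mem_cell
  rwa [dot_zero] at this

/-- Far out in the direction `u` only the condition on `w` is left. The point of the hexagon which
is extremal in the direction `w` makes up for the shift by `width w` in `wedge`. -/
theorem mem_meeting_wedge_of_large (hU : Set.Ioi a ⊆ U) (hV' : V ⊆ Set.Ici b) {m : ℝ}
    {f : Face} (hf : |a| + |b| + |m| + 2 * width u < dot u (center f))
    (hf' : dot w (center f) ∈ V) : f ∈ meeting (wedge u U w V m) := by
  have h0 := width_nonneg w
  have h0' := width_nonneg u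
  have h1 := neg_width_le (u := u) (extremal_mem w)
  have h2 : b ≤ dot w (center f) := hV' hf'
  have h3 := le_abs_self a
  have h4 := neg_abs_le b
  have h5 := le_abs_self m
  have h6 := abs_nonneg m
  have h7 := abs_nonneg a
  have h8 := abs_nonneg b
  have hw : dot w (extremal w) = width w := rfl
  refine ⟨center f + extremal w, ?_, ?_, ?_, ?_⟩
  · rw [mem_closedHexagon, add_sub_cancel_left]; exact extremal_mem w
  · refine hU (show a < _ from ?_)
    rw [dot_add]; linarith
  · rwa [dot_add, hw, add_sub_cancel_right]
  · rw [add_dot, dot_add, dot_add, hw]; linarith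

/-- A hexagon reaches exactly `width u` beyond its centre in the direction `u`. With the shift built
into `wedge`, the half line for points becomes the same half line for centres. -/
theorem half_of_mem_meeting_wedge (hU : Set.Ioi a ⊆ U) (hU' : U ⊆ Set.Ici a) {m : ℝ} {f : Face}
    (hf : f ∈ meeting (wedge u U w V m)) : dot u (center f) ∈ U := by
  obtain ⟨x, hx, hxU, -⟩ := hf
  have h1 : dot u x ≤ dot u (center f) + width u := by
    have := dot_le_width (u := u) hx
    rw [dot_sub] at this; linarith
  have h2 : a ≤ dot u x - width u := hU' hxU
  rcases eq_or_lt_of_le (show dot u x - width u ≤ dot u (center f) by linarith) with h | h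
  · rwa [← h]
  · exact hU (lt_of_le_of_lt h2 h)

theorem boundary_wedge_of_large (hU : Set.Ioi a ⊆ U) (hU' : U ⊆ Set.Ici a) (hV : Set.Ioi b ⊆ V)
    (hV' : V ⊆ Set.Ici b) {m C : ℝ} {d : Dart}
    (hd : |a| + |b| + |m| + |C| + 2 * width u + ‖u‖ < |dot u d.edge.mid|) :
    d ∈ boundaryDarts (meeting (wedge u U w V m)) ↔
      d ∈ ray (half u U) w C ∪ ray (half w V) u C := by
  have h1 := abs_le.1 (d.abs_dot_mid_sub_left_le u)
  have h2 := abs_le.1 (d.abs_dot_mid_sub_right_le u)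
  have h0 := width_nonneg u
  have h3 := le_abs_self a
  have h3' := neg_abs_le a
  have h4 := abs_nonneg b
  have h5 := abs_nonneg m
  have h6 := abs_nonneg a
  have h7 := le_abs_self C
  have h8 := neg_abs_le C
  have h9 := norm_nonneg u
  have h10 := abs_nonneg C
  rcases lt_abs.1 hd with h | h
  · have hl : dot u (center d.left) ∈ U := hU (show a < _ by linarith)
    have hr : dot u (center d.right) ∈ U := hU (show a < _ by linarith)
    have key : ∀ f, |a| + |b| + |m| + 2 * width u < dot u (center f) →
        (f ∈ meeting (wedge u U w V m) ↔ f ∈ half w V) := fun f hf =>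
      ⟨fun h => half_of_mem_meeting_wedge hV hV' (by rwa [wedge_comm] at h),
        fun h => mem_meeting_wedge_of_large hU hV' hf h⟩
    rw [mem_boundaryDarts, key _ (by linarith), key _ (by linarith)]
    constructor
    · exact fun h' => Or.inr ⟨h', by linarith⟩
    · rintro (h' | h')
      · exact absurd hr h'.1.2
      · exact h'.1
  · constructor
    · intro h'
      have : a ≤ dot u (center d.left) := hU' (half_of_mem_meeting_wedge hU hU' h'.1)
      linarith
    · rintro (h' | h')
      · have : a ≤ dot u (center d.left) := hU' h'.1.1
        linarith
      · have := h'.2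
        linarith

/-- Far from its apex, the boundary of a wedge consists of two rays. -/
theorem boundary_wedge (h : det u w ≠ 0) (hU : Set.Ioi a ⊆ U) (hU' : U ⊆ Set.Ici a)
    (hV : Set.Ioi b ⊆ V) (hV' : V ⊆ Set.Ici b) (m C : ℝ) :
    ∀ᶠ d in cofinite, (d ∈ boundaryDarts (meeting (wedge u U w V m)) ↔
      d ∈ ray (half u U) w C ∪ ray (half w V) u C) := by
  have h0 := width_nonneg u
  have h0' := width_nonneg w
  have h9 := norm_nonneg u
  have h10 := norm_nonneg w
  filter_upwards [eventually_dot_large h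
    (|a| + |b| + |m| + |C| + 2 * width u + 2 * width w + ‖u‖ + ‖w‖)] with d hd
  rcases hd with hd | hd
  · exact boundary_wedge_of_large hU hU' hV hV' (by linarith)
  · rw [wedge_comm, Set.union_comm]
    exact boundary_wedge_of_large hV hV' hU hU' (by linarith)

/-- Passing to complements reverses all boundary edges, and reversal preserves cofinite sets. -/
theorem boundary_wedge_compl (h : det u w ≠ 0) (hU : Set.Ioi a ⊆ U) (hU' : U ⊆ Set.Ici a)
    (hV : Set.Ioi b ⊆ V) (hV' : V ⊆ Set.Ici b) (m C : ℝ) :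
    ∀ᶠ d in cofinite, (d ∈ boundaryDarts (meeting (wedge u U w V m))ᶜ ↔
      d ∈ ray (half u U)ᶜ w C ∪ ray (half w V)ᶜ u C) := by
  filter_upwards [tendsto_reverse.eventually (boundary_wedge h hU hU' hV hV' m C)] with d hd
  rw [Set.mem_union, mem_ray_compl, mem_ray_compl, mem_boundaryDarts_compl]
  exact hd

/-- A ray along a line does not depend, up to finitely many edges, on the functional which measures
the distance along the line. -/
theorem ray_congr {F : Set Face} {B : ℝ} (hF : ∀ d ∈ boundaryDarts F, |dot u d.edge.mid| ≤ B)
    {w' : ℂ} (h : det u w ≠ 0) {α β : ℝ} (hα : 0 < α) (hw : w' = α • w + β • u) (C C' : ℝ) :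
    ∀ᶠ d in cofinite, (d ∈ ray F w C ↔ d ∈ ray F w' C') := by
  have hw' : ∀ x, dot w' x = α * dot w x + β * dot u x := fun x => by
    rw [hw]; simp [dot]; ring
  filter_upwards [eventually_dot_large h (|B| + |C| + (|C'| + |β| * |B|) / α)] with d hd
  have hpos : 0 ≤ (|C'| + |β| * |B|) / α := by positivity
  have e1 := abs_nonneg C
  have e2 := abs_nonneg B
  refine and_congr_right fun hdF => ?_
  have h1 := hF d hdF
  have h2 := le_abs_self B
  have h3 : |dot w d.edge.mid| > |B| + |C| + (|C'| + |β| * |B|) / α := by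
    rcases hd with hd | hd
    · linarith
    · exact hd
  have h4 : |β * dot u d.edge.mid| ≤ |β| * |B| := by
    rw [abs_mul]; exact mul_le_mul_of_nonneg_left (h1.trans h2) (abs_nonneg β)
  have h4' := abs_le.1 h4
  have h5 : α * ((|C'| + |β| * |B|) / α) = |C'| + |β| * |B| := by field_simp
  have h6 := le_abs_self C
  have h7 := neg_abs_le C
  have h8 := le_abs_self C'
  have h9 := neg_abs_le C'
  rw [hw']
  rcases lt_abs.1 h3 with h | h
  · have : α * ((|C'| + |β| * |B|) / α) < α * dot w d.edge.mid :=
      mul_lt_mul_of_pos_left (by linarith) hα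
    exact ⟨fun _ => by linarith, fun _ => by linarith⟩
  · have : α * ((|C'| + |β| * |B|) / α) < α * -dot w d.edge.mid :=
      mul_lt_mul_of_pos_left (by linarith) hα
    exact ⟨fun _ => by linarith, fun _ => by linarith⟩

/-- Two sets of oriented edges in strips of different directions touch finitely often. -/
theorem finite_touch (h : det u w ≠ 0) {X Y : Set Dart} {B B' : ℝ}
    (hX : ∀ᶠ d in cofinite, d ∈ X → |dot u d.edge.mid| ≤ B)
    (hY : ∀ᶠ d in cofinite, d ∈ Y → |dot w d.edge.mid| ≤ B') :
    {p : Dart × Dart | p.1 ∈ X ∧ p.2 ∈ Y ∧ Touch p.1 p.2}.Finite := by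
  have hbd : ∀ (Z : Set Dart) (u : ℂ) (B : ℝ), (∀ᶠ d in cofinite, d ∈ Z → |dot u d.edge.mid| ≤ B) →
      ∃ B', ∀ d ∈ Z, |dot u d.edge.mid| ≤ B' := by
    intro Z u B hZ
    obtain ⟨N, hN⟩ := ((mem_cofinite.1 hZ).image fun d => |dot u d.edge.mid|).bddAbove
    refine ⟨max B N, fun d hd => ?_⟩
    by_cases hd' : d ∈ Z → |dot u d.edge.mid| ≤ B
    · exact (hd' hd).trans (le_max_left _ _)
    · exact (hN ⟨d, hd', rfl⟩).trans (le_max_right _ _)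
  obtain ⟨A, hA⟩ := hbd X u B hX
  obtain ⟨A', hA'⟩ := hbd Y w B' hY
  have e1 := norm_nonneg u
  have e2 := norm_nonneg w
  have hfin := finite_darts_dot_le h (|A| + |A'| + 2 * ‖u‖ + 2 * ‖w‖)
  refine (hfin.prod hfin).subset ?_
  rintro ⟨d, d'⟩ ⟨h1, h2, h3⟩
  have h4 := h3.norm_mid_sub_le
  have h5 : ∀ z, |dot z d'.edge.mid - dot z d.edge.mid| ≤ 2 * ‖z‖ := fun z => by
    rw [← dot_sub]
    refine (abs_dot_le _ _).trans ?_
    rw [mul_comm]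
    gcongr
  have h6 := hA d h1
  have h7 := hA' d' h2
  have h8 := abs_nonneg A
  have h9 := abs_nonneg A'
  have h10 := le_abs_self A
  have h11 := le_abs_self A'
  have h12 := abs_le.1 (h5 u)
  have h13 := abs_le.1 (h5 w)
  have h14 := abs_le.1 h6
  have h15 := abs_le.1 h7
  exact ⟨⟨by linarith, abs_le.2 ⟨by linarith, by linarith⟩⟩,
    ⟨abs_le.2 ⟨by linarith, by linarith⟩, by linarith⟩⟩

theorem sqrt_three_mul_I_mul_step (k : Fin 6) :
    (√3 : ℝ) • (Complex.I * step k) = (2 : ℝ) • step (k + 1) - step k := by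
  have h3 := sqrt_three_sq
  apply Complex.ext
  · simp [(step_re_im _).1, (step_re_im _).2]
    fin_cases k <;> simp [dirVec] <;> ring
  · simp [(step_re_im _).1, (step_re_im _).2]
    fin_cases k <;> simp [dirVec] <;> nlinarith

theorem step_add_two (k : Fin 6) : step (k + 2) = step (k + 1) - step k := by
  rw [eq_sub_iff_add_eq, step, step, ← center_add, dirVec_add_two, sub_add_cancel]; rfl

/-- The boundary of a half plane moves strictly along the half plane. -/
theorem dot_mid_lt_of_follows {n : ℂ} {c : ℝ} {d d' : Dart}
    (hd : d ∈ boundaryDarts (half n (Set.Ioi c))) (hd' : d' ∈ boundaryDarts (half n (Set.Ioi c)))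
    (h : d.Follows d') :
    dot (-(Complex.I * n)) d.edge.mid < dot (-(Complex.I * n)) d'.edge.mid := by
  have hl : c < dot n (center d.left) := hd.1
  have hr : dot n (center d.right) ≤ c := not_lt.1 hd.2
  have hs : 0 < √(3 : ℝ) := Real.sqrt_pos.2 (by norm_num)
  have hrot : ∀ x, dot (-(Complex.I * n)) x = dot n (Complex.I * x) := fun x => by
    simp [dot]; ring
  -- Up to the factor `√3`, progress along the line is a combination of heights of steps above the
  -- line. The side on which each of the three hexagons at the vertex lies determines the sign.
  have hk : ∀ k, √3 * dot (-(Complex.I * n)) (step k) = 2 * dot n (step (k + 1)) - dot n (step k) :=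
    fun k => by
      rw [hrot, ← dot_smul, sqrt_three_mul_I_mul_step, dot_sub, dot_smul]
  have ha : center d.ahead = center d.left + step (d.dir + 1) := center_add_dirVec _ _
  have hr' := d.center_right
  have h0 := hk d.dir
  have h1 := hk (d.dir + 1)
  have e : d.dir + 1 + 1 = d.dir + 2 := by
    generalize d.dir = k; revert k; decide
  rw [e, step_add_two, dot_sub] at h1
  rw [Dart.dot_mid, Dart.dot_mid]
  rcases h with rfl | rfl
  · have ha' : dot n (center d.ahead) ≤ c := not_lt.1 hd'.2
    rw [Dart.turnLeft_left, Dart.turnLeft_right]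
    have : 0 < √3 * (dot (-(Complex.I * n)) (step (d.dir + 1)) -
        dot (-(Complex.I * n)) (step d.dir)) := by
      rw [mul_sub, h0, h1]
      rw [ha, dot_add] at ha'
      rw [hr', dot_add] at hr
      linarith
    have := pos_of_mul_pos_right this hs.le
    rw [ha, hr', dot_add, dot_add]
    linarith
  · have ha' : c < dot n (center d.ahead) := hd'.1
    rw [Dart.turnRight_left, Dart.turnRight_right]
    have : 0 < √3 * dot (-(Complex.I * n)) (step (d.dir + 1)) := by
      rw [h1]
      rw [ha, dot_add] at ha'
      rw [hr', dot_add] at hr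
      linarith
    have := pos_of_mul_pos_right this hs.le
    rw [ha, dot_add]
    linarith

/-- An injective path does not stay in a ray if it runs against its direction. -/
theorem not_eventually_mem_ray {n w : ℂ} {c C : ℝ} {R : ℕ → Dart} (hR : Function.Injective R)
    {t : ℂ} (ht : det n t ≠ 0) (hanti : ∀ᶠ i in atTop, R i ∈ boundaryDarts (half n (Set.Ioi c)) →
      R (i + 1) ∈ boundaryDarts (half n (Set.Ioi c)) →
        dot t (R (i + 1)).edge.mid ≤ dot t (R i).edge.mid)
    {α β : ℝ} (hα : 0 < α) (hw : w = α • t + β • n) :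
    ¬ ∀ᶠ i in atTop, R i ∈ ray (half n (Set.Ioi c)) w C := by
  intro h
  have hstrip : ∀ d ∈ boundaryDarts (half n (Set.Ioi c)), |dot n d.edge.mid| ≤ |c| + ‖n‖ :=
    fun d hd => strip_of_boundary subset_rfl Set.Ioi_subset_Ici_self hd
  have hev : Tendsto R atTop cofinite := by
    rw [← Nat.cofinite_eq_atTop]; exact hR.tendsto_cofinite
  have h' : ∀ᶠ i in atTop, R i ∈ ray (half n (Set.Ioi c)) t 0 := by
    filter_upwards [h, hev.eventually (ray_congr hstrip ht hα hw 0 C)] with i h1 h2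
    exact h2.2 h1
  obtain ⟨N, hN⟩ := eventually_atTop.1 (h'.and hanti)
  -- From the index `N` on, the path does not advance in the direction `t`. But an injective path in
  -- a strip leaves every bounded set, so on this ray its coordinate along `t` has to grow.
  have hmono : ∀ i, dot t (R (N + i)).edge.mid ≤ dot t (R N).edge.mid := by
    intro i
    induction i with
    | zero => exact le_rfl
    | succ i ih =>
      exact ((hN (N + i) (by omega)).2 (hN (N + i) (by omega)).1.1
        (hN (N + i + 1) (by omega)).1.1).trans ih
  obtain ⟨M, hM⟩ := eventually_atTop.1 (hev.eventually (eventually_dot_large ht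
    (|c| + ‖n‖ + |dot t (R N).edge.mid|)))
  have h1 := hM (N + M) (by omega)
  have h2 := (hN (N + M) (by omega)).1
  have h3 := hstrip _ h2.1
  have h4 := hmono M
  have h5 : 0 < dot t (R (N + M)).edge.mid := h2.2
  have h6 := le_abs_self (dot t (R N).edge.mid)
  have h7 := abs_nonneg c
  have h8 := norm_nonneg n
  rw [abs_of_pos h5] at h1
  rcases h1 with h1 | h1 <;> linarith [abs_nonneg (dot t (R N).edge.mid)]

/-- A path in the union of two sets which touch finitely often is eventually in one of them. -/
theorem eventually_mem_or {X Y : Set Dart} {R : ℕ → Dart} (hR : Function.Injective R)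
    (hT : ∀ i, Touch (R i) (R (i + 1))) (hT' : ∀ i, Touch (R (i + 1)) (R i))
    (hXY : {p : Dart × Dart | p.1 ∈ X ∧ p.2 ∈ Y ∧ Touch p.1 p.2}.Finite)
    (h : ∀ᶠ i in atTop, R i ∈ X ∪ Y) :
    (∀ᶠ i in atTop, R i ∈ X) ∨ ∀ᶠ i in atTop, R i ∈ Y := by
  have hev : Tendsto R atTop cofinite := by
    rw [← Nat.cofinite_eq_atTop]; exact hR.tendsto_cofinite
  have h1 : ∀ᶠ i in atTop, ∀ d', ¬ (R i ∈ X ∧ d' ∈ Y ∧ Touch (R i) d') := by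
    filter_upwards [hev.eventually (hXY.image Prod.fst).compl_mem_cofinite] with i hi d' hd'
    exact hi ⟨(R i, d'), hd', rfl⟩
  have h2 := (tendsto_add_atTop_nat 1).eventually h1
  obtain ⟨N, hN⟩ := eventually_atTop.1 ((h.and h1).and h2)
  have step : ∀ i, N ≤ i → (R i ∈ X ↔ R (i + 1) ∈ X) := by
    intro i hi
    obtain ⟨⟨a1, a2⟩, a3⟩ := hN i hi
    obtain ⟨⟨b1, b2⟩, b3⟩ := hN (i + 1) (by omega)
    constructor
    · intro hx
      by_contra hx'
      exact a2 (R (i + 1)) ⟨hx, b1.resolve_left hx', hT i⟩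
    · intro hx
      by_contra hx'
      exact b2 (R i) ⟨hx, a1.resolve_left hx', hT' i⟩
  have all : ∀ i, R (N + i) ∈ X ↔ R N ∈ X := by
    intro i
    induction i with
    | zero => exact Iff.rfl
    | succ i ih => exact (step (N + i) (by omega)).symm.trans ih
  by_cases hx : R N ∈ X
  · refine Or.inl (eventually_atTop.2 ⟨N, fun i hi => ?_⟩)
    obtain ⟨j, rfl⟩ := Nat.exists_eq_add_of_le hi
    exact (all j).2 hx
  · refine Or.inr (eventually_atTop.2 ⟨N, fun i hi => ?_⟩)
    obtain ⟨j, rfl⟩ := Nat.exists_eq_add_of_le hi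
    exact (hN (N + j) (by omega)).1.1.resolve_left fun h' => hx ((all j).1 h')

/-! ### The legs of a cone -/

theorem dot_mul_mul {z : ℂ} (hz : ‖z‖ = 1) (x y : ℂ) : dot (z * x) (z * y) = dot x y := by
  have h : z.re * z.re + z.im * z.im = 1 := by
    have := dot_self z
    rw [hz, dot] at this
    linarith
  simp only [dot, Complex.mul_re, Complex.mul_im]
  linear_combination (x.re * y.re + x.im * y.im) * h

theorem det_combination (u w : ℂ) (α β : ℝ) : det u (α • w + β • u) = α * det u w := by
  simp [det]; ring

/-- A cone of half angle below `π / 2` is the intersection of two half planes; squaring reduces this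
to `sin² + cos² = 1`. -/
theorem norm_lt_iff {ξ η α : ℝ} (h0 : 0 < α) (h1 : α < Real.pi / 2) :
    √(ξ ^ 2 + η ^ 2) * Real.cos α < ξ ↔
      0 < ξ * Real.sin α - η * Real.cos α ∧ 0 < ξ * Real.sin α + η * Real.cos α := by
  have hs : 0 < Real.sin α := Real.sin_pos_of_pos_of_lt_pi h0 (by linarith [Real.pi_pos])
  have hc : 0 < Real.cos α := Real.cos_pos_of_mem_Ioo ⟨by linarith, h1⟩
  have hsc := Real.sin_sq_add_cos_sq α
  have hN := Real.sq_sqrt (show 0 ≤ ξ ^ 2 + η ^ 2 by positivity)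
  have hN0 := Real.sqrt_nonneg (ξ ^ 2 + η ^ 2)
  set N := √(ξ ^ 2 + η ^ 2)
  constructor
  · intro h
    have hξ : 0 < ξ := lt_of_le_of_lt (mul_nonneg hN0 hc.le) h
    have h2 : (N * Real.cos α) ^ 2 < ξ ^ 2 := pow_lt_pow_left₀ h (mul_nonneg hN0 hc.le) two_ne_zero
    have h3 : (η * Real.cos α) ^ 2 < (ξ * Real.sin α) ^ 2 := by
      have : (ξ * Real.sin α) ^ 2 - (η * Real.cos α) ^ 2 = ξ ^ 2 - (N * Real.cos α) ^ 2 := by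
        rw [mul_pow N, hN]
        linear_combination ξ ^ 2 * hsc
      linarith
    have h4 := abs_lt.1 (abs_lt_of_sq_lt_sq h3 (mul_pos hξ hs).le)
    exact ⟨by linarith, by linarith⟩
  · rintro ⟨h1, h2⟩
    have hξ : 0 < ξ := pos_of_mul_pos_left (show 0 < ξ * Real.sin α by linarith) hs.le
    have h3 : (η * Real.cos α) ^ 2 < (ξ * Real.sin α) ^ 2 :=
      sq_lt_sq' (by linarith) (by linarith)
    have h4 : (N * Real.cos α) ^ 2 < ξ ^ 2 := by
      have : (ξ * Real.sin α) ^ 2 - (η * Real.cos α) ^ 2 = ξ ^ 2 - (N * Real.cos α) ^ 2 := by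
        rw [mul_pow N, hN]
        linear_combination ξ ^ 2 * hsc
      linarith
    exact lt_of_pow_lt_pow_left₀ 2 hξ.le h4

namespace Cone

variable (Λ : Cone)

/-- The direction of the right leg of the right half of a cone. -/
def rightLeg : ℂ := Λ.axis * Complex.exp ((-(Λ.angle / 2) : ℝ) * Complex.I)

/-- The normal vector of the left leg of the right half of a cone. -/
def leftNormal : ℂ := -(Complex.I * Λ.axis)

/-- The normal vector of the right leg of the right half of a cone. -/
def rightNormal : ℂ := Complex.I * Λ.rightLeg

/-- The offset of the line of hexagons along the left leg of the right half of a cone. -/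
def leftOffset : ℝ := dot Λ.leftNormal Λ.apex - width Λ.leftNormal

/-- The offset of the line of hexagons along the right leg of the right half of a cone. -/
def rightOffset : ℝ := dot Λ.rightNormal Λ.apex - width Λ.rightNormal

theorem det_leftNormal_axis : det Λ.leftNormal Λ.axis = 1 := by
  have h := dot_self Λ.axis
  rw [Λ.norm_axis, dot] at h
  simp [leftNormal, det]
  linarith

theorem rightLeg_eq : Λ.rightLeg =
    Λ.axis * ((Real.cos (Λ.angle / 2) : ℝ) - (Real.sin (Λ.angle / 2) : ℝ) * Complex.I) := by
  rw [rightLeg, Complex.exp_mul_I, ← Complex.ofReal_cos, ← Complex.ofReal_sin, Real.cos_neg,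
    Real.sin_neg]
  push_cast
  ring

theorem rightNormal_eq : Λ.rightNormal = Real.sin (Λ.angle / 2) • Λ.axis +
    (-Real.cos (Λ.angle / 2)) • Λ.leftNormal := by
  rw [rightNormal, rightLeg_eq, leftNormal, Complex.real_smul, Complex.real_smul]
  push_cast
  linear_combination (-Λ.axis * Complex.sin (Λ.angle / 2)) * Complex.I_mul_I

theorem leftNormal_eq : Λ.leftNormal = Real.sin (Λ.angle / 2) • Λ.rightLeg +
    (-Real.cos (Λ.angle / 2)) • Λ.rightNormal := by
  have h := Complex.sin_sq_add_cos_sq (Λ.angle / 2 : ℂ)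
  rw [rightNormal, rightLeg_eq, leftNormal, Complex.real_smul, Complex.real_smul]
  push_cast
  linear_combination (-Λ.axis * Complex.cos (Λ.angle / 2) * Complex.sin (Λ.angle / 2)) *
    Complex.I_mul_I + (Λ.axis * Complex.I) * h

/-- The right half has opening angle less than `π` even if `Λ` is not convex, so it is a wedge. The
third condition in `wedge` follows here from the other two. -/
theorem region_rightHalf : Λ.rightHalf.region =
    wedge Λ.leftNormal (Set.Ioi Λ.leftOffset) Λ.rightNormal (Set.Ioi Λ.rightOffset)
      (dot (Λ.leftNormal + Λ.rightNormal) Λ.apex) := by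
  have hpos := Λ.angle_pos
  have hlt := Λ.angle_lt
  ext x
  have hr : ‖Λ.rightHalf.axis‖ = 1 := Λ.rightHalf.norm_axis
  set r := Λ.rightHalf.axis with hrdef
  have hx : ∃ y : ℂ, x - Λ.apex = r * y := by
    refine ⟨(x - Λ.apex) / r, ?_⟩
    rw [mul_div_cancel₀]
    rintro h
    rw [h, norm_zero] at hr
    exact zero_ne_one hr
  obtain ⟨y, hy⟩ := hx
  have hx' : x = Λ.apex + r * y := by rw [← hy]; ring
  have hv : Λ.axis = r * Complex.exp ((Λ.angle / 4 : ℝ) * Complex.I) := by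
    rw [hrdef, rightHalf, mul_assoc, ← Complex.exp_add, ← add_mul, ← Complex.ofReal_add]
    simp
  have hl : Λ.leftNormal = r * (-(Complex.I * Complex.exp ((Λ.angle / 4 : ℝ) * Complex.I))) := by
    rw [leftNormal, hv]; ring
  have hrt : Λ.rightNormal = r * (Complex.I * Complex.exp ((-(Λ.angle / 4) : ℝ) * Complex.I)) := by
    have : Λ.rightLeg = r * Complex.exp ((-(Λ.angle / 4) : ℝ) * Complex.I) := by
      rw [rightLeg, hrdef, rightHalf, mul_assoc, ← Complex.exp_add, ← add_mul, ← Complex.ofReal_add]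
      congr 4; ring
    rw [rightNormal, this]; ring
  have h1 : dot Λ.leftNormal (x - Λ.apex) =
      y.re * Real.sin (Λ.angle / 4) - y.im * Real.cos (Λ.angle / 4) := by
    rw [hl, hy, dot_mul_mul hr]
    simp [dot, Complex.exp_re, Complex.exp_im]
    ring
  have h2 : dot Λ.rightNormal (x - Λ.apex) =
      y.re * Real.sin (Λ.angle / 4) + y.im * Real.cos (Λ.angle / 4) := by
    rw [hrt, hy, dot_mul_mul hr]
    simp [dot, Complex.exp_re, Complex.exp_im]
    ring
  have h3 : x ∈ Λ.rightHalf.region ↔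
      √(y.re ^ 2 + y.im ^ 2) * Real.cos (Λ.angle / 4) < y.re := by
    show ‖x - Λ.apex‖ * Real.cos (Λ.angle / 2 / 2) < ⟪x - Λ.apex, r⟫_ℝ ↔ _
    have e1 : ‖x - Λ.apex‖ = √(y.re ^ 2 + y.im ^ 2) := by
      rw [hy, norm_mul, hr, one_mul, Complex.norm_eq_sqrt_sq_add_sq]
    have e2 : ⟪x - Λ.apex, r⟫_ℝ = y.re := by
      have := dot_mul_mul hr y 1
      rw [mul_one] at this
      rw [← dot_eq_inner, hy, this]
      simp [dot]
    rw [e1, e2, show Λ.angle / 2 / 2 = Λ.angle / 4 by ring]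
  rw [h3, norm_lt_iff (by linarith) (by linarith), ← h1, ← h2]
  simp only [wedge, Set.mem_ofPred_eq, Set.mem_Ioi, leftOffset, rightOffset, dot_sub, add_dot]
  constructor
  · rintro ⟨a1, a2⟩; exact ⟨by linarith, by linarith, by linarith⟩
  · rintro ⟨a1, a2, -⟩; exact ⟨by linarith, by linarith⟩

theorem isOpen_region : IsOpen Λ.region := by
  refine isOpen_lt ?_ ?_ <;> fun_prop

end Cone

theorem Dart.Follows.touch {d d' : Dart} (h : d.Follows d') : Touch d d' := Or.inr (Or.inl h)

theorem Dart.Follows.touch' {d d' : Dart} (h : d.Follows d') : Touch d' d :=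
  Or.inr (Or.inr (Or.inl h))

/-- Up to finitely many edges, the path `P_Λ` is the ray along the axis of the cone. -/
theorem IsConePath.mem_range_iff {Λ : Cone} {P : ℕ → Dart} (h : IsConePath Λ P) (C : ℝ) :
    ∀ᶠ d in cofinite, (d ∈ Set.range P ↔
      d ∈ ray (half Λ.leftNormal (Set.Ioi Λ.leftOffset)) Λ.axis C) := by
  obtain ⟨r, -, ⟨Q, hP, hQ, hPi, hQi, -, hPQ⟩, -⟩ := h
  have hPi' : Function.Injective P := fun i j h => hPi (congrArg Dart.edge h)
  have hQi' : Function.Injective Q := fun i j h => hQi (congrArg Dart.edge h)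
  have hpos := Λ.angle_pos
  have hlt := Λ.angle_lt
  have hsin : 0 < Real.sin (Λ.angle / 2) :=
    Real.sin_pos_of_pos_of_lt_pi (by linarith) (by linarith)
  have hdet1 : det Λ.leftNormal Λ.axis ≠ 0 := Λ.det_leftNormal_axis.symm ▸ one_ne_zero
  have hdet2 : det Λ.rightNormal Λ.rightLeg ≠ 0 := by
    have h1 : det Λ.rightNormal Λ.rightLeg = -‖Λ.rightLeg‖ ^ 2 := by
      rw [← dot_self, Cone.rightNormal]; simp [det, dot]; ring
    rw [h1, Cone.rightLeg, norm_mul, Λ.norm_axis, Complex.norm_exp_ofReal_mul_I]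
    norm_num
  have hdet0 : det Λ.leftNormal Λ.rightNormal ≠ 0 := by
    have : det Λ.leftNormal Λ.rightNormal = Real.sin (Λ.angle / 2) * det Λ.leftNormal Λ.axis := by
      rw [Λ.rightNormal_eq, det_combination]
    rw [this, Λ.det_leftNormal_axis, mul_one]
    exact hsin.ne'
  have hw1 : Λ.rightNormal = Real.sin (Λ.angle / 2) • Λ.axis +
      (-Real.cos (Λ.angle / 2)) • Λ.leftNormal := Λ.rightNormal_eq
  have hw2 : Λ.leftNormal = Real.sin (Λ.angle / 2) • Λ.rightLeg +
      (-Real.cos (Λ.angle / 2)) • Λ.rightNormal := Λ.leftNormal_eq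
  have hr1 : -(Complex.I * Λ.leftNormal) = -Λ.axis := by
    rw [Cone.leftNormal, mul_neg, ← mul_assoc, Complex.I_mul_I]; simp
  have hr2 : -(Complex.I * Λ.rightNormal) = Λ.rightLeg := by
    rw [Cone.rightNormal, ← mul_assoc, Complex.I_mul_I]; simp
  set X := ray (half Λ.leftNormal (Set.Ioi Λ.leftOffset)) Λ.rightNormal 0 with hX
  set Y := ray (half Λ.rightNormal (Set.Ioi Λ.rightOffset)) Λ.leftNormal 0 with hY
  have hXs : ∀ d ∈ boundaryDarts (half Λ.leftNormal (Set.Ioi Λ.leftOffset)),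
      |dot Λ.leftNormal d.edge.mid| ≤ |Λ.leftOffset| + ‖Λ.leftNormal‖ :=
    fun d hd => strip_of_boundary subset_rfl Set.Ioi_subset_Ici_self hd
  have hYs : ∀ d ∈ boundaryDarts (half Λ.rightNormal (Set.Ioi Λ.rightOffset)),
      |dot Λ.rightNormal d.edge.mid| ≤ |Λ.rightOffset| + ‖Λ.rightNormal‖ :=
    fun d hd => strip_of_boundary subset_rfl Set.Ioi_subset_Ici_self hd
  have hunion : ∀ᶠ d in cofinite, (d ∈ Set.range P ∪ Set.range Q ↔ d ∈ X ∪ Y) := by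
    have hfar : ∀ᶠ d : Dart in cofinite, r < dist d.edge.mid Λ.apex := by
      refine mem_cofinite.2 ((finite_darts_norm_le (r + ‖Λ.apex‖)).subset fun d hd => ?_)
      have h1 : dist d.edge.mid Λ.apex ≤ r := not_lt.1 hd
      rw [dist_eq_norm] at h1
      show ‖d.edge.mid‖ ≤ _
      have := norm_sub_norm_le d.edge.mid Λ.apex
      linarith
    have hb := boundary_wedge hdet0 (U := Set.Ioi Λ.leftOffset) (V := Set.Ioi Λ.rightOffset)
      subset_rfl Set.Ioi_subset_Ici_self subset_rfl Set.Ioi_subset_Ici_self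
      (dot (Λ.leftNormal + Λ.rightNormal) Λ.apex) 0
    rw [← Cone.region_rightHalf, ← overlapping_eq_meeting Λ.rightHalf.isOpen_region] at hb
    filter_upwards [hfar, hb] with d h1 h2
    rw [hPQ, ← h2]
    exact ⟨fun h => h.1, fun h => ⟨h, h1⟩⟩
  have htouch : {p : Dart × Dart | p.1 ∈ X ∧ p.2 ∈ Y ∧ Touch p.1 p.2}.Finite :=
    finite_touch hdet0 (Eventually.of_forall fun d hd => hXs d hd.1)
      (Eventually.of_forall fun d hd => hYs d hd.1)
  have hevP : Tendsto P atTop cofinite := by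
    rw [← Nat.cofinite_eq_atTop]; exact hPi'.tendsto_cofinite
  have hevQ : Tendsto Q atTop cofinite := by
    rw [← Nat.cofinite_eq_atTop]; exact hQi'.tendsto_cofinite
  -- The oriented ray along the right leg runs outwards, whereas `P` is numbered against its
  -- orientation and goes to infinity. Hence `P` cannot stay in the right ray.
  have hPX : ∀ᶠ i in atTop, P i ∈ X := by
    refine (eventually_mem_or hPi' (fun i => (hP i).touch') (fun i => (hP i).touch) htouch
      ((hevP.eventually hunion).mono fun i hi => hi.1 (Or.inl ⟨i, rfl⟩))).resolve_right fun hY' => ?_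
    refine not_eventually_mem_ray hPi' hdet2 (Eventually.of_forall fun i h1 h2 => ?_) hsin hw2 hY'
    have := dot_mid_lt_of_follows h2 h1 (hP i)
    rw [hr2] at this
    exact this.le
  -- For the same reason `Q`, which runs outwards, cannot stay in the left ray, which runs inwards.
  have hQY : ∀ᶠ i in atTop, Q i ∈ Y := by
    refine (eventually_mem_or hQi' (fun i => (hQ i).touch) (fun i => (hQ i).touch') htouch
      ((hevQ.eventually hunion).mono fun i hi => hi.1 (Or.inr ⟨i, rfl⟩))).resolve_left fun hX' => ?_
    refine not_eventually_mem_ray hQi' hdet1 (Eventually.of_forall fun i h1 h2 => ?_) hsin hw1 hX'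
    have := dot_mid_lt_of_follows h1 h2 (hQ i)
    rw [hr1, neg_dot, neg_dot] at this
    linarith
  have hfin : ∀ {R : ℕ → Dart} {Z : Set Dart}, (∀ᶠ i in atTop, R i ∈ Z) →
      ∀ᶠ d in cofinite, d ∈ Set.range R → d ∈ Z := by
    intro R Z hR
    obtain ⟨N, hN⟩ := eventually_atTop.1 hR
    refine mem_cofinite.2 (((Finset.range N).finite_toSet.image R).subset fun d hd => ?_)
    have hd' : ¬ (d ∈ Set.range R → d ∈ Z) := hd
    push Not at hd'
    obtain ⟨⟨i, rfl⟩, hi⟩ := hd'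
    refine ⟨i, ?_, rfl⟩
    rw [Finset.coe_range]
    exact not_le.1 fun h => hi (hN i h)
  have hXY : ∀ᶠ d in cofinite, ¬ (d ∈ X ∧ d ∈ Y) :=
    mem_cofinite.2 ((htouch.image Prod.fst).subset fun d hd =>
      ⟨(d, d), ⟨(not_not.1 hd).1, (not_not.1 hd).2, Or.inl rfl⟩, rfl⟩)
  filter_upwards [hunion, hfin hPX, hfin hQY, hXY, ray_congr hXs hdet1 hsin hw1 C 0]
    with d h1 h2 h3 h4 h5
  rw [h5]
  refine ⟨h2, fun h => ?_⟩
  rcases h1.2 (Or.inl h) with h' | h'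
  · exact h'
  · exact absurd ⟨h, h3 h'⟩ h4

/-! ### Directions in a cone -/

namespace Cone

/-- The function which is positive exactly on the directions in a cone. -/
def gauge (Λ : Cone) (y : ℂ) : ℝ := dot y Λ.axis - ‖y‖ * Real.cos (Λ.angle / 2)

variable (Λ : Cone)

theorem mem_region_iff {x : ℂ} : x ∈ Λ.region ↔ 0 < Λ.gauge (x - Λ.apex) := by
  rw [gauge, sub_pos, dot_eq_inner]; rfl

/-- Both the inner product with the unit axis and the norm change by at most `‖z‖`. Bounded
displacements are thus harmless where the gauge is large. -/
theorem sub_le_gauge_add (y z : ℂ) : Λ.gauge y - 2 * ‖z‖ ≤ Λ.gauge (y + z) := by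
  have h1 := abs_dot_le z Λ.axis
  rw [Λ.norm_axis, mul_one] at h1
  have h2 : |(‖y + z‖ - ‖y‖) * Real.cos (Λ.angle / 2)| ≤ ‖z‖ := by
    rw [abs_mul]
    have h3 : |‖y + z‖ - ‖y‖| ≤ ‖z‖ := by
      have := abs_norm_sub_norm_le (y + z) y
      rwa [add_sub_cancel_left] at this
    calc _ ≤ ‖z‖ * 1 := mul_le_mul h3 (Real.abs_cos_le_one _) (abs_nonneg _) (norm_nonneg _)
      _ = ‖z‖ := mul_one _
  have h3 := abs_le.1 h1
  have h4 := abs_le.1 h2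
  have h5 : dot (y + z) Λ.axis = dot y Λ.axis + dot z Λ.axis := add_dot _ _ _
  rw [gauge, gauge, h5]
  linarith

theorem gauge_smul {t : ℝ} (ht : 0 ≤ t) (y : ℂ) : Λ.gauge (t • y) = t * Λ.gauge y := by
  have h : dot (t • y) Λ.axis = t * dot y Λ.axis := by simp [dot]; ring
  rw [gauge, gauge, h, norm_smul, Real.norm_of_nonneg ht]
  ring

theorem continuous_gauge : Continuous Λ.gauge := by
  unfold gauge dot; fun_prop

theorem cos_lt_one : Real.cos (Λ.angle / 2) < 1 := by
  have hpos := Λ.angle_pos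
  have hlt := Λ.angle_lt
  have := Real.cos_lt_cos_of_nonneg_of_le_pi le_rfl (y := Λ.angle / 2) (by linarith) (by linarith)
  rwa [Real.cos_zero] at this

theorem neg_one_lt_cos : -1 < Real.cos (Λ.angle / 2) := by
  have hpos := Λ.angle_pos
  have hlt := Λ.angle_lt
  have := Real.cos_lt_cos_of_nonneg_of_le_pi (x := Λ.angle / 2) (y := Real.pi) (by linarith) le_rfl
    (by linarith)
  rwa [Real.cos_pi] at this

theorem gauge_axis_pos : 0 < Λ.gauge Λ.axis := by
  rw [gauge, dot_self, Λ.norm_axis]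
  linarith [Λ.cos_lt_one]

variable {Λ} {Λ' : Cone}

/-- A half line in the smaller cone stays in the larger one, and far out the position of the apexes
does not matter. -/
theorem gauge_nonneg_of_subset (h : Λ'.region ⊆ Λ.region) {y : ℂ} (hy : 0 < Λ'.gauge y) :
    0 ≤ Λ.gauge y := by
  by_contra! hneg
  have hA := norm_nonneg (Λ'.apex - Λ.apex)
  set A := ‖Λ'.apex - Λ.apex‖ with hAdef
  -- Chosen such that `t * Λ.gauge y = -(2 * A + 1)`, while moving the apex changes the gauge by at
  -- most `2 * A`.
  set t : ℝ := (2 * A + 1) / -Λ.gauge y with ht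
  have htpos : 0 < t := div_pos (by linarith) (by linarith)
  have h1 : Λ'.apex + t • y ∈ Λ.region := h (by
    rw [mem_region_iff, add_sub_cancel_left, gauge_smul _ htpos.le]
    exact mul_pos htpos hy)
  rw [mem_region_iff] at h1
  have h2 := Λ.sub_le_gauge_add (Λ'.apex + t • y - Λ.apex) (-(Λ'.apex - Λ.apex))
  rw [norm_neg, show Λ'.apex + t • y - Λ.apex + -(Λ'.apex - Λ.apex) = t • y by ring,
    gauge_smul _ htpos.le] at h2
  have h3 : t * Λ.gauge y = -(2 * A + 1) := by
    have := hneg.ne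
    rw [ht]; field_simp
  linarith

/-- The axis is interior to the smaller cone. If it lay on the boundary of the larger one, a small
rotation away from `Λ.axis` would leave the larger cone but not the smaller one. -/
theorem gauge_axis_pos_of_subset (h : Λ'.region ⊆ Λ.region) : 0 < Λ.gauge Λ'.axis := by
  have h0 := gauge_nonneg_of_subset h Λ'.gauge_axis_pos
  refine lt_of_le_of_ne h0 fun heq => ?_
  have c1 := Λ.cos_lt_one
  have c2 := Λ.neg_one_lt_cos
  set C := Real.cos (Λ.angle / 2) with hC
  set v := Λ'.axis with hv
  have hv1 : ‖v‖ = 1 := Λ'.norm_axis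
  have hA : dot v Λ.axis = C := by
    have : dot v Λ.axis - ‖v‖ * C = 0 := heq.symm
    rw [hv1] at this; linarith
  -- The component of the larger axis orthogonal to `v`. Moving by `-ε • g` lowers the inner product
  -- with the axis to first order in `ε`, but changes the norm only to second order.
  set g := Λ.axis - C • v with hg
  have hgv : dot g v = 0 := by
    have e : dot g v = dot v Λ.axis - C * dot v v := by rw [hg]; simp [dot]; ring
    rw [e, hA, dot_self, hv1]; ring
  have hga : dot g Λ.axis = 1 - C ^ 2 := by
    have e : dot g Λ.axis = dot Λ.axis Λ.axis - C * dot v Λ.axis := by rw [hg]; simp [dot]; ring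
    rw [e, hA, dot_self, Λ.norm_axis]; ring
  have hgg : ‖g‖ ^ 2 = 1 - C ^ 2 := by
    have e : dot g g = dot g Λ.axis - C * dot g v := by
      conv_lhs => rw [hg]
      simp [dot, hg]; ring
    rw [← dot_self, e, hga, hgv]; ring
  have hpos : 0 < 1 - C ^ 2 := by nlinarith
  have hcone := Λ'.gauge_axis_pos
  obtain ⟨ε, hε0, hε1, hε2⟩ : ∃ ε : ℝ, 0 < ε ∧ ε ≤ 1 ∧ 2 * (ε * ‖g‖) < Λ'.gauge v := by
    refine ⟨min 1 (Λ'.gauge v / (2 * (‖g‖ + 1))), lt_min one_pos (by positivity),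
      min_le_left _ _, ?_⟩
    have h1 : min 1 (Λ'.gauge v / (2 * (‖g‖ + 1))) ≤ Λ'.gauge v / (2 * (‖g‖ + 1)) := min_le_right _ _
    rw [le_div_iff₀ (by positivity)] at h1
    have h2 : 0 < min 1 (Λ'.gauge v / (2 * (‖g‖ + 1))) := lt_min one_pos (by positivity)
    linarith
  have h1 := Λ'.sub_le_gauge_add v (-(ε • g))
  rw [norm_neg, norm_smul, Real.norm_of_nonneg hε0.le] at h1
  have h2 := gauge_nonneg_of_subset h (y := v + -(ε • g)) (by linarith)
  have e1 : dot (v + -(ε • g)) Λ.axis = C - ε * (1 - C ^ 2) := by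
    have : dot (v + -(ε • g)) Λ.axis = dot v Λ.axis - ε * dot g Λ.axis := by simp [dot]; ring
    rw [this, hA, hga]
  have e2 : ‖v + -(ε • g)‖ ^ 2 = 1 + ε ^ 2 * (1 - C ^ 2) := by
    have : dot (v + -(ε • g)) (v + -(ε • g)) = dot v v - 2 * ε * dot g v + ε ^ 2 * dot g g := by
      simp [dot]; ring
    rw [← dot_self, this, dot_self, dot_self, hv1, hgv, hgg]; ring
  have h3 : ‖v + -(ε • g)‖ * C ≤ C - ε * (1 - C ^ 2) := by
    have : 0 ≤ dot (v + -(ε • g)) Λ.axis - ‖v + -(ε • g)‖ * C := h2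
    linarith
  set N := ‖v + -(ε • g)‖
  have hN0 : 0 ≤ N := norm_nonneg _
  have hN1 : 1 ≤ N := by nlinarith [mul_pos (pow_pos hε0 2) hpos]
  have hN2 : N ≤ 1 + ε ^ 2 * (1 - C ^ 2) / 2 := by nlinarith [sq_nonneg (N - 1)]
  have h4 : ε * (1 - C ^ 2) ≤ ε * (1 - C ^ 2) / 2 := by
    have h5 : ε * (1 - C ^ 2) ≤ (N - 1) * 1 := by nlinarith
    have h6 : N - 1 ≤ ε * (1 - C ^ 2) / 2 := by
      have : ε ^ 2 * (1 - C ^ 2) ≤ ε * (1 - C ^ 2) := by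
        have : ε ^ 2 ≤ ε := by nlinarith
        exact mul_le_mul_of_nonneg_right this hpos.le
      linarith
    linarith
  nlinarith [mul_pos hε0 hpos]

/-- Cones are star-shaped around their axis even when they are not convex. For nonnegative cosine
the triangle inequality suffices; for negative cosine the squares are compared. -/
theorem gauge_combination_pos {v : ℂ} (hv : ‖v‖ = 1) (h : 0 < Λ.gauge v) {s t : ℝ} (hs : 0 ≤ s)
    (ht : 0 ≤ t) (hst : 0 < s + t) : 0 < Λ.gauge (s • Λ.axis + t • v) := by
  have c1 := Λ.cos_lt_one
  have c2 := Λ.neg_one_lt_cos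
  have ha := Λ.norm_axis
  have e1 : dot (s • Λ.axis + t • v) Λ.axis = s + t * dot v Λ.axis := by
    have : dot (s • Λ.axis + t • v) Λ.axis = s * dot Λ.axis Λ.axis + t * dot v Λ.axis := by
      simp [dot]; ring
    rw [this, dot_self, ha]; ring
  have e2 : ‖s • Λ.axis + t • v‖ ^ 2 = s ^ 2 + 2 * s * t * dot v Λ.axis + t ^ 2 := by
    have : dot (s • Λ.axis + t • v) (s • Λ.axis + t • v) =
        s ^ 2 * dot Λ.axis Λ.axis + 2 * s * t * dot v Λ.axis + t ^ 2 * dot v v := by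
      simp [dot]; ring
    rw [← dot_self, this, dot_self, dot_self, ha, hv]; ring
  have e3 : ‖s • Λ.axis + t • v‖ ≤ s + t := by
    refine (norm_add_le _ _).trans (le_of_eq ?_)
    rw [norm_smul, norm_smul, ha, hv, Real.norm_of_nonneg hs, Real.norm_of_nonneg ht]; ring
  have hA1 : dot v Λ.axis ≤ 1 := by
    have := (le_abs_self _).trans (abs_dot_le v Λ.axis)
    rwa [hv, ha, one_mul] at this
  have hAC : Real.cos (Λ.angle / 2) < dot v Λ.axis := by
    have : 0 < dot v Λ.axis - ‖v‖ * Real.cos (Λ.angle / 2) := h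
    rw [hv] at this; linarith
  show 0 < dot (s • Λ.axis + t • v) Λ.axis - ‖s • Λ.axis + t • v‖ * Real.cos (Λ.angle / 2)
  rw [e1]
  have hN0 := norm_nonneg (s • Λ.axis + t • v)
  set N := ‖s • Λ.axis + t • v‖
  set C := Real.cos (Λ.angle / 2)
  set A := dot v Λ.axis
  rcases le_or_gt 0 C with hC | hC
  · have h1 : N * C ≤ (s + t) * C := mul_le_mul_of_nonneg_right e3 hC
    rcases hs.eq_or_lt with rfl | hs'
    · nlinarith
    · nlinarith [mul_pos hs' (show 0 < 1 - C by linarith), mul_nonneg ht (show 0 ≤ A - C by linarith)]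
  · rcases lt_or_ge 0 (s + t * A) with h0 | h0
    · nlinarith
    · have htpos : 0 < t := by
        rcases ht.eq_or_lt with rfl | h'
        · nlinarith
        · exact h'
      have hA0 : A ≤ 0 := by nlinarith
      have h1 : (-(s + t * A)) ^ 2 < (N * -C) ^ 2 := by
        have e4 : (N * -C) ^ 2 - (-(s + t * A)) ^ 2 =
            C ^ 2 * t ^ 2 * (1 - A ^ 2) - (1 - C ^ 2) * (s + t * A) ^ 2 := by
          rw [mul_pow, e2]; ring
        have h2 : (s + t * A) ^ 2 ≤ (t * A) ^ 2 := by nlinarith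
        have h3 : 0 < 1 - C ^ 2 := by nlinarith
        have h4 : 0 < t ^ 2 * (C ^ 2 - A ^ 2) :=
          mul_pos (by positivity) (by nlinarith)
        nlinarith [mul_le_mul_of_nonneg_left h2 h3.le]
      have h2 : -(s + t * A) < N * -C :=
        lt_of_pow_lt_pow_left₀ 2 (mul_nonneg hN0 (by linarith)) h1
      linarith

/-- The gauge is homogeneous, so a uniform constant is its minimum on the compact segment from the
axis to `v`. -/
theorem exists_le_gauge_combination {v : ℂ} (hv : ‖v‖ = 1) (h : 0 < Λ.gauge v) :
    ∃ κ > 0, ∀ s t : ℝ, 0 ≤ s → 0 ≤ t → κ * (s + t) ≤ Λ.gauge (s • Λ.axis + t • v) := by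
  obtain ⟨l, ⟨hl0, hl1⟩, hmin⟩ := (isCompact_Icc (a := (0 : ℝ)) (b := 1)).exists_isMinOn
    ⟨0, by simp⟩ (f := fun l : ℝ => Λ.gauge ((1 - l) • Λ.axis + l • v))
    (Λ.continuous_gauge.comp (by fun_prop)).continuousOn
  refine ⟨_, gauge_combination_pos hv h (sub_nonneg.2 hl1) hl0 (by linarith), fun s t hs ht => ?_⟩
  rcases (add_nonneg hs ht).eq_or_lt with h0 | h0
  · obtain rfl : s = 0 := by linarith
    obtain rfl : t = 0 := by linarith
    simp [gauge, dot]
  · have h1 := hmin (show t / (s + t) ∈ Set.Icc (0 : ℝ) 1 from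
      ⟨by positivity, (div_le_one h0).2 (by linarith)⟩)
    have h2 : s • Λ.axis + t • v =
        (s + t) • ((1 - t / (s + t)) • Λ.axis + (t / (s + t)) • v) := by
      rw [smul_add, smul_smul, smul_smul]
      congr 2
      · field_simp; ring
      · field_simp
    rw [h2, gauge_smul _ h0.le, mul_comm]
    exact mul_le_mul_of_nonneg_left h1 h0.le

/-- The determinant is affine in `ε` and not identically zero, since the axis and its rotation by a
right angle span the plane. -/
theorem eventually_det_ne_zero {v : ℂ} (hv : v ≠ 0) :
    ∀ᶠ ε : ℝ in 𝓝[>] 0, det (Λ.axis + ε • (Complex.I * Λ.axis)) v ≠ 0 := by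
  have e : ∀ ε : ℝ, det (Λ.axis + ε • (Complex.I * Λ.axis)) v = det Λ.axis v - ε * dot Λ.axis v := by
    intro ε; simp [det, dot]; ring
  by_cases h : det Λ.axis v = 0
  · filter_upwards [self_mem_nhdsWithin] with ε hε h0
    have hε' : (0 : ℝ) < ε := hε
    rw [e, h, zero_sub, neg_eq_zero] at h0
    have h1 : dot Λ.axis v = 0 := (mul_eq_zero.1 h0).resolve_left hε'.ne'
    have h2 : det Λ.axis v ^ 2 + dot Λ.axis v ^ 2 = ‖Λ.axis‖ ^ 2 * ‖v‖ ^ 2 := by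
      rw [← dot_self, ← dot_self]; simp only [det, dot]; ring
    rw [h, h1, Λ.norm_axis] at h2
    have h3 := norm_pos_iff.2 hv
    nlinarith
  · have hc : Continuous fun ε : ℝ => det (Λ.axis + ε • (Complex.I * Λ.axis)) v := by
      simp_rw [e]; fun_prop
    have h0 : det (Λ.axis + (0 : ℝ) • (Complex.I * Λ.axis)) v ≠ 0 := by rw [e]; simpa using h
    exact (hc.continuousAt.eventually_ne h0).filter_mono nhdsWithin_le_nhds

/-- Two directions in a cone can be joined, within the cone, to a third one which is different from
both. -/
theorem exists_common_direction {v₁ v₂ : ℂ} (hv₁ : ‖v₁‖ = 1) (hv₂ : ‖v₂‖ = 1)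
    (h₁ : 0 < Λ.gauge v₁) (h₂ : 0 < Λ.gauge v₂) :
    ∃ (b : ℂ) (κ : ℝ), 0 < κ ∧ det b v₁ ≠ 0 ∧ det b v₂ ≠ 0 ∧
      (∀ s t : ℝ, 0 ≤ s → 0 ≤ t → κ * (s + t) ≤ Λ.gauge (s • b + t • v₁)) ∧
      ∀ s t : ℝ, 0 ≤ s → 0 ≤ t → κ * (s + t) ≤ Λ.gauge (s • b + t • v₂) := by
  obtain ⟨κ₁, hκ₁, hk₁⟩ := exists_le_gauge_combination hv₁ h₁
  obtain ⟨κ₂, hκ₂, hk₂⟩ := exists_le_gauge_combination hv₂ h₂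
  set κ := min κ₁ κ₂ with hκ
  have hκpos : 0 < κ := lt_min hκ₁ hκ₂
  have hne : ∀ {v : ℂ}, ‖v‖ = 1 → v ≠ 0 := fun h => norm_pos_iff.1 (h ▸ one_pos)
  -- The common direction is the axis, slightly tilted to be independent of both given directions.
  -- Tilting loses at most `2 * s * ε` of the gauge, which is at most `κ * s / 2`.
  have hIoo : ∀ᶠ ε : ℝ in 𝓝[>] 0, 0 < ε ∧ ε < κ / 4 := Ioo_mem_nhdsGT (by linarith)
  obtain ⟨ε, ⟨⟨hε0, hε1⟩, hd₁⟩, hd₂⟩ :=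
    ((hIoo.and (eventually_det_ne_zero (Λ := Λ) (hne hv₁))).and
      (eventually_det_ne_zero (Λ := Λ) (hne hv₂))).exists
  have key : ∀ {v : ℂ} {κ' : ℝ}, κ ≤ κ' →
      (∀ s t : ℝ, 0 ≤ s → 0 ≤ t → κ' * (s + t) ≤ Λ.gauge (s • Λ.axis + t • v)) →
      ∀ s t : ℝ, 0 ≤ s → 0 ≤ t →
        κ / 2 * (s + t) ≤ Λ.gauge (s • (Λ.axis + ε • (Complex.I * Λ.axis)) + t • v) := by
    intro v κ' hle hk s t hs ht
    have h1 := Λ.sub_le_gauge_add (s • Λ.axis + t • v) ((s * ε) • (Complex.I * Λ.axis))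
    rw [norm_smul, norm_mul Complex.I, Complex.norm_I, Λ.norm_axis, one_mul, mul_one,
      Real.norm_of_nonneg (by positivity)] at h1
    have h2 : s • (Λ.axis + ε • (Complex.I * Λ.axis)) + t • v =
        s • Λ.axis + t • v + (s * ε) • (Complex.I * Λ.axis) := by
      rw [smul_add, smul_smul]; abel
    rw [h2]
    have h3 := hk s t hs ht
    nlinarith [mul_nonneg (sub_nonneg.2 hle) (add_nonneg hs ht), mul_nonneg hs (sub_nonneg.2 hε1.le),
      mul_nonneg ht hκpos.le]
  exact ⟨_, κ / 2, half_pos hκpos, hd₁, hd₂, key (min_le_left _ _) hk₁, key (min_le_right _ _) hk₂⟩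

end Cone

/-! ### Large closed paths in a cone -/

theorem inside_of_near {S : Set ℂ} {D : Set Dart}
    (h : ∀ d ∈ D, ∀ z, ‖z - d.edge.mid‖ ≤ 2 → z ∈ S) : Inside (sites S) D :=
  ⟨fun d hd => h d hd _ (by rw [sub_self, norm_zero]; norm_num),
    fun p hp _ => h p.1 hp.1 _ p.1.norm_mid_turnRight_sub_le⟩

/-- The constant is `5 = 2 + 1 + 2`: from `z` to the midpoint of the edge, from there to the centre
of an adjacent hexagon, and from the centre to a point of `K` in that hexagon. -/
theorem inside_boundary_of_near {S K : Set ℂ} (h : ∀ x ∈ K, ∀ z, ‖z - x‖ ≤ 5 → z ∈ S)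
    {T : Set Face → Set Face} (hT : T = id ∨ T = compl) :
    Inside (sites S) (boundaryDarts (T (meeting K))) := by
  refine inside_of_near fun d hd z hz => ?_
  have key : ∀ f, f ∈ meeting K → ‖d.edge.mid - center f‖ ≤ 1 → z ∈ S := by
    rintro f ⟨x, hx, hxK⟩ hf
    have h1 := norm_sub_center_le hx
    refine h x hxK z ?_
    calc ‖z - x‖ = ‖(z - d.edge.mid) + (d.edge.mid - center f) - (x - center f)‖ := by congr 1; ring
      _ ≤ ‖(z - d.edge.mid) + (d.edge.mid - center f)‖ + ‖x - center f‖ := norm_sub_le _ _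
      _ ≤ ‖z - d.edge.mid‖ + ‖d.edge.mid - center f‖ + ‖x - center f‖ := by
          gcongr; exact norm_add_le _ _
      _ ≤ 5 := by linarith
  rcases hT with rfl | rfl
  · exact key _ hd.1 d.norm_mid_sub_left_le
  · exact key _ (not_not.1 hd.2) d.norm_mid_sub_right_le

variable {u w : ℂ} {U V : Set ℝ} {a a' : ℝ}

theorem convex_wedge (hU : Convex ℝ U) (hV : Convex ℝ V) (m : ℝ) : Convex ℝ (wedge u U w V m) := by
  have e : ∀ (z x y : ℂ) (α β : ℝ), dot z (α • x + β • y) = α * dot z x + β * dot z y := by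
    intro z x y α β; rw [dot_add, dot_smul, dot_smul]
  have e' : ∀ (z x y : ℂ) (α β : ℝ), α + β = 1 → dot z (α • x + β • y) - width z =
      α • (dot z x - width z) + β • (dot z y - width z) := by
    intro z x y α β h
    rw [e, smul_eq_mul, smul_eq_mul]; linear_combination width z * h
  rintro x ⟨hx1, hx2, hx3⟩ y ⟨hy1, hy2, hy3⟩ α β hα hβ hαβ
  refine ⟨?_, ?_, ?_⟩
  · rw [e' _ _ _ _ _ hαβ]; exact hU hx1 hy1 hα hβ hαβ
  · rw [e' _ _ _ _ _ hαβ]; exact hV hx2 hy2 hα hβ hαβ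
  · rw [e]; exact convex_Ioi m hx3 hy3 hα hβ hαβ

theorem isBounded_wedge (h : det u w ≠ 0) (hU : U ⊆ Set.Ici a) (hV : V ⊆ Set.Ici a') (m N : ℝ) :
    Bornology.IsBounded (wedge u U w V m ∩ {x | dot (u + w) x < N}) := by
  have h0 := width_nonneg u
  have h0' := width_nonneg w
  set B := |a| + |a'| + |N| with hB
  refine (Metric.isBounded_iff_subset_closedBall 0).2
    ⟨(B * ‖w‖ + B * ‖u‖) / |det u w|, ?_⟩
  rintro x ⟨⟨hx1, hx2, -⟩, hx3⟩
  have h1 : a ≤ dot u x - width u := hU hx1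
  have h2 : a' ≤ dot w x - width w := hV hx2
  have h3 : dot (u + w) x < N := hx3
  rw [add_dot] at h3
  have h4 := le_abs_self N
  have h5 := neg_abs_le a
  have h6 := neg_abs_le a'
  have h7 := abs_nonneg a
  have h8 := abs_nonneg a'
  have h9 := abs_nonneg N
  rw [mem_closedBall_zero_iff, le_div_iff₀ (abs_pos.2 h), mul_comm]
  refine (abs_det_mul_norm_le u w x).trans ?_
  gcongr
  · exact abs_le.2 ⟨by linarith, by linarith⟩
  · exact abs_le.2 ⟨by linarith, by linarith⟩

/-- A wedge is exhausted by finite sets of hexagons which are bounded by a single closed path. -/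
theorem exists_closedPaths_wedge (h : det u w ≠ 0) (hU : U ⊆ Set.Ici a) (hV : V ⊆ Set.Ici a')
    (hUc : Convex ℝ U) (hVc : Convex ℝ V) {m : ℝ} (hne : (wedge u U w V m).Nonempty) {S : Set ℂ}
    (hS : ∀ x ∈ wedge u U w V m, ∀ z, ‖z - x‖ ≤ 5 → z ∈ S)
    {T : Set Face → Set Face} (hT : T = id ∨ T = compl) :
    ∃ (E : ℕ → Finset Face) (l : ℕ → List Dart),
      (∀ n, IsClosedPath (l n) ∧ (l n).Nodup ∧ (∀ d, d ∈ l n ↔ d ∈ boundaryDarts (T (E n))) ∧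
        (∀ b, closedString b (l n) = loopOp b (T (E n)) (l n)) ∧
        Inside (sites S) (boundaryDarts (T (E n)))) ∧
      ∀ d, ∀ᶠ n in atTop,
        (d ∈ boundaryDarts (T (E n)) ↔ d ∈ boundaryDarts (T (meeting (wedge u U w V m)))) := by
  obtain ⟨x₀, hx₀⟩ := hne
  obtain ⟨N₀, hN₀⟩ := exists_nat_gt (dot (u + w) x₀)
  -- The truncated wedges are convex and bounded, so the hexagons meeting them form finite connected
  -- sets without holes. Starting at `N₀` makes all of them nonempty.
  set K : ℕ → Set ℂ := fun n => wedge u U w V m ∩ {x | dot (u + w) x < ((n + N₀ : ℕ) : ℝ)} with hK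
  have hKc : ∀ n, Convex ℝ (K n) := fun n => by
    refine (convex_wedge hUc hVc m).inter ?_
    intro x hx y hy α β hα hβ hαβ
    show dot (u + w) (α • x + β • y) < _
    rw [dot_add, dot_smul, dot_smul]
    exact convex_Iio _ hx hy hα hβ hαβ
  have hfin : ∀ n, (meeting (K n)).Finite := fun n => finite_meeting (isBounded_wedge h hU hV m _)
  set E : ℕ → Finset Face := fun n => (hfin n).toFinset with hE
  have hEK : ∀ n, (E n : Set Face) = meeting (K n) := fun n => (hfin n).coe_toFinset
  have hmemE : ∀ n f, f ∈ E n ↔ f ∈ meeting (K n) := fun n f => (hfin n).mem_toFinset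
  have hpath : ∀ n, ∃ l : List Dart, IsClosedPath l ∧ l.Nodup ∧
      (∀ d, d ∈ l ↔ d ∈ boundaryDarts (T (E n))) ∧
      ∀ b, closedString b l = loopOp b (T (E n)) l := by
    intro n
    refine exists_closedPath (E := E n) ?_ ?_ ?_ ?_
    · obtain ⟨f, hf⟩ := exists_mem_closedHexagon x₀
      refine ⟨f, (hmemE n f).2 ⟨x₀, hf, hx₀, ?_⟩⟩
      show dot (u + w) x₀ < ((n + N₀ : ℕ) : ℝ)
      push_cast
      have : (0 : ℝ) ≤ n := n.cast_nonneg
      linarith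
    · intro f hf g hg
      rw [hEK]
      exact joined_of_convex (hKc n) ((hmemE n f).1 hf) ((hmemE n g).1 hg)
    · intro f hf N
      rw [hEK]
      exact joined_infinity (hKc n) (fun h => hf ((hmemE n f).2 h)) N
    · rcases hT with rfl | rfl
      · exact Or.inl rfl
      · exact Or.inr rfl
  choose l hl1 hl2 hl3 hl4 using hpath
  refine ⟨E, l, fun n => ⟨hl1 n, hl2 n, hl3 n, hl4 n, ?_⟩, fun d => ?_⟩
  · rw [hEK]
    exact inside_boundary_of_near (fun x hx => hS x hx.1) hT
  · have hf : ∀ f, ∀ᶠ n in atTop, (f ∈ (E n : Set Face) ↔ f ∈ meeting (wedge u U w V m)) := by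
      intro f
      by_cases hf : f ∈ meeting (wedge u U w V m)
      · obtain ⟨x, hx, hxK⟩ := hf
        obtain ⟨N, hN⟩ := exists_nat_gt (dot (u + w) x)
        filter_upwards [eventually_ge_atTop N] with n hn
        refine ⟨fun _ => ⟨x, hx, hxK⟩, fun _ => ?_⟩
        rw [hEK]
        refine ⟨x, hx, hxK, hN.trans_le ?_⟩
        exact_mod_cast (by omega : N ≤ n + N₀)
      · refine Eventually.of_forall fun n => ⟨fun h' => ?_, fun h' => absurd h' hf⟩
        rw [hEK] at h'
        exact meeting_mono Set.inter_subset_left h'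
    filter_upwards [hf d.left, hf d.right] with n h1 h2
    rcases hT with rfl | rfl
    · rw [mem_boundaryDarts, mem_boundaryDarts, id, id, h1, h2]
    · rw [mem_boundaryDarts, mem_boundaryDarts, Set.mem_compl_iff, Set.mem_compl_iff,
        Set.mem_compl_iff, Set.mem_compl_iff, h1, h2]

theorem eq_combination {b : ℂ} (hb : b ≠ 0) (x : ℂ) :
    x = (dot b x / ‖b‖ ^ 2) • b + (dot (Complex.I * b) x / ‖b‖ ^ 2) • (Complex.I * b) := by
  have hbn := norm_pos_iff.2 hb
  have e : ‖b‖ ^ 2 • x = dot b x • b + dot (Complex.I * b) x • (Complex.I * b) := by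
    rw [← dot_self]
    apply Complex.ext
    · simp [dot]; ring
    · simp [dot]; ring
  have h : x = (‖b‖ ^ 2)⁻¹ • (‖b‖ ^ 2 • x) := by
    rw [smul_smul, inv_mul_cancel₀ (by positivity), one_smul]
  conv_lhs => rw [h, e]
  rw [smul_add, smul_smul, smul_smul, inv_mul_eq_div, inv_mul_eq_div]

theorem ray_congr_of_pos {F : Set Face} {v w' : ℂ} {B : ℝ}
    (hF : ∀ d ∈ boundaryDarts F, |dot (Complex.I * v) d.edge.mid| ≤ B) (h : 0 < dot v w')
    (C C' : ℝ) : ∀ᶠ d in cofinite, (d ∈ ray F v C ↔ d ∈ ray F w' C') := by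
  have hv : v ≠ 0 := by
    rintro rfl; simp [dot] at h
  have hvn := norm_pos_iff.2 hv
  have hdet : det (Complex.I * v) v = -‖v‖ ^ 2 := by
    rw [← dot_self]; simp [det, dot]; ring
  refine ray_congr hF ?_ (div_pos h (by positivity)) (eq_combination hv w') C C'
  rw [hdet]
  exact (neg_neg_of_pos (by positivity)).ne

theorem wedge_nonempty {b v : ℂ} {δ : ℝ} (hδ : 0 < δ) (hub : dot u b = δ) (huv : dot u v = 0)
    (hwb : dot w b = 0) (hwv : dot w v = δ) (hU : Set.Ioi a ⊆ U) (hV : Set.Ioi a' ⊆ V) (m : ℝ) :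
    (wedge u U w V m).Nonempty := by
  have h0 := width_nonneg u
  have h0' := width_nonneg w
  set R := (|a| + |a'| + |m| + width u + width w + 1) / δ with hR
  have hRδ : R * δ = |a| + |a'| + |m| + width u + width w + 1 := by rw [hR]; field_simp
  have h1 : dot u (R • (b + v)) = R * δ := by rw [dot_smul, dot_add, hub, huv, add_zero]
  have h2 : dot w (R • (b + v)) = R * δ := by rw [dot_smul, dot_add, hwb, hwv, zero_add]
  have h3 := le_abs_self a
  have h4 := le_abs_self a'
  have h5 := le_abs_self m
  have h6 := abs_nonneg a
  have h7 := abs_nonneg a'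
  have h8 := abs_nonneg m
  refine ⟨R • (b + v), hU ?_, hV ?_, ?_⟩
  · show a < _
    rw [h1, hRδ]; linarith
  · show a' < _
    rw [h2, hRδ]; linarith
  · rw [add_dot, h1, h2, hRδ]; linarith

/-- The complement of a closed half plane is an open one. For this reason wedges are allowed with
open and with closed half lines. -/
theorem half_compl_Ici (n : ℂ) (c : ℝ) : (half (-n) (Set.Ici (-c)))ᶜ = half n (Set.Ioi c) := by
  ext f
  rw [half, half, Set.mem_compl_iff, Set.mem_ofPred_eq, Set.mem_ofPred_eq, neg_dot, Set.mem_Ici,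
    Set.mem_Ioi, neg_le_neg_iff, not_le]

namespace Cone

variable {Λ : Cone} {b v : ℂ} {κ : ℝ}

/-- Up to `δ`, the functionals `u` and `w` are dual to `b` and `v`, so points of the wedge have
coordinates along `b` and `v` bounded below. A bounded shift makes these nonnegative, and then the
gauge grows with their sum, which `m` bounds from below. -/
theorem exists_wedge_deep (hκ : 0 < κ)
    (hgauge : ∀ s t : ℝ, 0 ≤ s → 0 ≤ t → κ * (s + t) ≤ Λ.gauge (s • b + t • v))
    (h : det u w ≠ 0) {δ : ℝ} (hδ : 0 < δ) (hub : dot u b = δ) (huv : dot u v = 0)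
    (hwb : dot w b = 0) (hwv : dot w v = δ) (hU : U ⊆ Set.Ici a) (hV : V ⊆ Set.Ici a') :
    ∃ m, ∀ x ∈ wedge u U w V m, ∀ z, ‖z - x‖ ≤ 5 → z ∈ Λ.region := by
  have h0 := width_nonneg u
  have h0' := width_nonneg w
  set B := (|a| + |a'|) / δ with hB
  have hB0 : 0 ≤ B := by positivity
  have hBδ : B * δ = |a| + |a'| := by rw [hB]; field_simp
  set A := B * ‖b + v‖ + 5 + ‖Λ.apex‖ with hA
  -- `A` bounds the total displacement by the shift, by the distance `5` and by the apex. The sum of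
  -- the coordinates has to exceed `2 * A / κ` to beat the loss `2 * A` of the gauge.
  refine ⟨δ * (2 * A / κ), ?_⟩
  rintro x ⟨hx1, hx2, hx3⟩ z hz
  have h1 : a ≤ dot u x - width u := hU hx1
  have h2 : a' ≤ dot w x - width w := hV hx2
  rw [add_dot] at hx3
  set s := dot u x / δ with hs
  set t := dot w x / δ with ht
  have hsδ : s * δ = dot u x := by rw [hs]; field_simp
  have htδ : t * δ = dot w x := by rw [ht]; field_simp
  have hx : x = s • b + t • v := by
    have e1 : dot u (x - (s • b + t • v)) = 0 := by
      rw [dot_sub, dot_add, dot_smul, dot_smul, hub, huv, hsδ]; ring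
    have e2 : dot w (x - (s • b + t • v)) = 0 := by
      rw [dot_sub, dot_add, dot_smul, dot_smul, hwb, hwv, htδ]; ring
    have e3 := abs_det_mul_norm_le u w (x - (s • b + t • v))
    rw [e1, e2, abs_zero, zero_mul, zero_mul, add_zero] at e3
    have e4 : ‖x - (s • b + t • v)‖ = 0 :=
      le_antisymm (nonpos_of_mul_nonpos_right e3 (abs_pos.2 h)) (norm_nonneg _)
    exact sub_eq_zero.1 (norm_eq_zero.1 e4)
  have hs0 : 0 ≤ s + B := by
    have : 0 ≤ (s + B) * δ := by
      rw [add_mul, hsδ, hBδ]; linarith [neg_abs_le a, abs_nonneg a']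
    exact nonneg_of_mul_nonneg_left this hδ
  have ht0 : 0 ≤ t + B := by
    have : 0 ≤ (t + B) * δ := by
      rw [add_mul, htδ, hBδ]; linarith [neg_abs_le a', abs_nonneg a]
    exact nonneg_of_mul_nonneg_left this hδ
  have hst : 2 * A / κ < s + t := by
    have : δ * (2 * A / κ) < δ * (s + t) := by linarith
    exact lt_of_mul_lt_mul_left this hδ.le
  rw [div_lt_iff₀ hκ] at hst
  rw [mem_region_iff]
  have h3 := hgauge _ _ hs0 ht0
  have h4 := Λ.sub_le_gauge_add ((s + B) • b + (t + B) • v) (-(B • (b + v)) + (z - x) - Λ.apex)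
  have h5 : (s + B) • b + (t + B) • v + (-(B • (b + v)) + (z - x) - Λ.apex) = z - Λ.apex := by
    have : (s + B) • b + (t + B) • v = x + B • (b + v) := by rw [hx]; module
    rw [this]; ring
  have h6 : ‖-(B • (b + v)) + (z - x) - Λ.apex‖ ≤ A := by
    refine (norm_sub_le _ _).trans ?_
    have := norm_add_le (-(B • (b + v))) (z - x)
    rw [norm_neg, norm_smul, Real.norm_of_nonneg hB0] at this
    linarith
  rw [h5] at h4
  nlinarith [mul_nonneg hκ.le hB0]

/-- The edges of the ray stay within bounded distance of the half line along `b`, on which the gauge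
grows linearly. -/
theorem exists_ray_inside (hb : 0 < Λ.gauge b) :
    ∃ M, Inside (sites Λ.region) (ray (half (Complex.I * b) (Set.Ioi 0)) b M) := by
  have hb0 : b ≠ 0 := by
    rintro rfl; simp [gauge, dot] at hb
  have hbn := norm_pos_iff.2 hb0
  -- The displacements: `1` from the edge to the line, `2` from the midpoint to the nearby point,
  -- and the apex.
  set A := 1 + 2 + ‖Λ.apex‖ with hA
  refine ⟨2 * A / Λ.gauge b * ‖b‖ ^ 2, inside_of_near fun d hd z hz => ?_⟩
  have h1 := strip_of_boundary (a := 0) subset_rfl Set.Ioi_subset_Ici_self hd.1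
  rw [abs_zero, zero_add, norm_mul, Complex.norm_I, one_mul] at h1
  set x := d.edge.mid
  have hx := eq_combination hb0 x
  have h2 : 2 * A / Λ.gauge b < dot b x / ‖b‖ ^ 2 := (lt_div_iff₀ (by positivity)).2 hd.2
  rw [div_lt_iff₀ hb] at h2
  have hs0 : 0 < dot b x / ‖b‖ ^ 2 := by
    have : 0 < dot b x / ‖b‖ ^ 2 * Λ.gauge b := lt_trans (by positivity) h2
    exact pos_of_mul_pos_left this hb.le
  have h3 : ‖(dot (Complex.I * b) x / ‖b‖ ^ 2) • (Complex.I * b)‖ ≤ 1 := by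
    rw [norm_smul, norm_mul, Complex.norm_I, one_mul, Real.norm_eq_abs, abs_div,
      abs_of_pos (by positivity : 0 < ‖b‖ ^ 2), div_mul_eq_mul_div, div_le_one (by positivity), sq]
    gcongr
  rw [mem_region_iff]
  have h4 := Λ.sub_le_gauge_add ((dot b x / ‖b‖ ^ 2) • b)
    ((dot (Complex.I * b) x / ‖b‖ ^ 2) • (Complex.I * b) + (z - x) - Λ.apex)
  have h5 : (dot b x / ‖b‖ ^ 2) • b +
      ((dot (Complex.I * b) x / ‖b‖ ^ 2) • (Complex.I * b) + (z - x) - Λ.apex) = z - Λ.apex := by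
    have : (dot b x / ‖b‖ ^ 2) • b +
      ((dot (Complex.I * b) x / ‖b‖ ^ 2) • (Complex.I * b) + (z - x) - Λ.apex) =
      ((dot b x / ‖b‖ ^ 2) • b + (dot (Complex.I * b) x / ‖b‖ ^ 2) • (Complex.I * b)) +
        (z - x - Λ.apex) := by ring
    rw [this, ← hx]; ring
  rw [h5, gauge_smul _ hs0.le] at h4
  have h6 : ‖(dot (Complex.I * b) x / ‖b‖ ^ 2) • (Complex.I * b) + (z - x) - Λ.apex‖ ≤ A := by
    refine (norm_sub_le _ _).trans ?_
    have := norm_add_le ((dot (Complex.I * b) x / ‖b‖ ^ 2) • (Complex.I * b)) (z - x)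
    linarith
  linarith

/-- Large closed paths in a cone which converge to the union of two given rays in the cone. -/
theorem exists_closedPaths (hκ : 0 < κ)
    (hgauge : ∀ s t : ℝ, 0 ≤ s → 0 ≤ t → κ * (s + t) ≤ Λ.gauge (s • b + t • v))
    (hdet : det b v ≠ 0) (c M : ℝ) :
    ∃ (T : Set Face → Set Face) (E : ℕ → Finset Face) (l : ℕ → List Dart) (D : Set Dart),
      (T = id ∨ T = compl) ∧
      (∀ n, IsClosedPath (l n) ∧ (l n).Nodup ∧ (∀ d, d ∈ l n ↔ d ∈ boundaryDarts (T (E n))) ∧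
        (∀ a, closedString a (l n) = loopOp a (T (E n)) (l n)) ∧
        Inside (sites Λ.region) (boundaryDarts (T (E n)))) ∧
      (∀ d, ∀ᶠ n in atTop, (d ∈ boundaryDarts (T (E n)) ↔ d ∈ D)) ∧
      Inside (sites Λ.region) D ∧
      ∀ᶠ d in cofinite, (d ∈ D ↔ d ∈ ray (half (-(Complex.I * v)) (Set.Ioi c)) v 0 ∪
        ray (half (Complex.I * b) (Set.Ioi 0)) b M) := by
  have e1 : dot (-(Complex.I * v)) b = det b v := by simp [det, dot]; ring
  have e2 : dot (Complex.I * b) v = det b v := by simp [det, dot]; ring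
  have e3 : dot (-(Complex.I * v)) v = 0 := by simp [dot]; ring
  have e4 : dot (Complex.I * b) b = 0 := by simp [dot]; ring
  have hd : det (-(Complex.I * v)) (Complex.I * b) = det b v := by simp [det]; ring
  have hs₁ : ∀ d ∈ boundaryDarts (half (-(Complex.I * v)) (Set.Ioi c)),
      |dot (Complex.I * v) d.edge.mid| ≤ |c| + ‖-(Complex.I * v)‖ := fun d hd => by
    have := strip_of_boundary subset_rfl Set.Ioi_subset_Ici_self hd
    rwa [neg_dot, abs_neg] at this
  have hs₂ : ∀ d ∈ boundaryDarts (half (Complex.I * b) (Set.Ioi 0)),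
      |dot (Complex.I * b) d.edge.mid| ≤ |0| + ‖Complex.I * b‖ := fun d hd =>
    strip_of_boundary subset_rfl Set.Ioi_subset_Ici_self hd
  -- The closed paths must come in along `v` and go out along `b`. For positive `det b v` this is
  -- the counterclockwise boundary of the wedge; otherwise the wedge lies on the right of the path
  -- and its complement has to be used.
  rcases lt_or_gt_of_ne hdet with hneg | hpos
  · have n1 : dot (-(-(Complex.I * v))) b = -det b v := by rw [neg_dot, e1]
    have n2 : dot (-(Complex.I * b)) v = -det b v := by rw [neg_dot, e2]
    have n3 : dot (-(-(Complex.I * v))) v = 0 := by rw [neg_dot, e3, neg_zero]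
    have n4 : dot (-(Complex.I * b)) b = 0 := by rw [neg_dot, e4, neg_zero]
    have nd : det (-(-(Complex.I * v))) (-(Complex.I * b)) ≠ 0 := by
      rw [← hd] at hdet
      intro h0
      apply hdet
      rw [← h0]; simp [det]
    have hδ : 0 < -det b v := by linarith
    obtain ⟨m, hm⟩ := exists_wedge_deep hκ hgauge nd hδ n1 n3 n4 n2
      (U := Set.Ici (-c)) (V := Set.Ici (-0)) subset_rfl subset_rfl
    obtain ⟨E, l, h1, h2⟩ := exists_closedPaths_wedge nd (U := Set.Ici (-c)) (V := Set.Ici (-0))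
      subset_rfl subset_rfl (convex_Ici _) (convex_Ici _)
      (wedge_nonempty hδ n1 n3 n4 n2 Set.Ioi_subset_Ici_self Set.Ioi_subset_Ici_self m) hm
      (T := compl) (Or.inr rfl)
    refine ⟨compl, E, l, _, Or.inr rfl, h1, h2, inside_boundary_of_near hm (Or.inr rfl), ?_⟩
    have hb := boundary_wedge_compl nd (U := Set.Ici (-c)) (V := Set.Ici (-0))
      Set.Ioi_subset_Ici_self subset_rfl Set.Ioi_subset_Ici_self subset_rfl m 0
    rw [half_compl_Ici, half_compl_Ici] at hb
    filter_upwards [hb, ray_congr_of_pos hs₁ (w' := -(Complex.I * b)) (by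
        rw [dot_comm, n2]; exact hδ) 0 0, ray_congr_of_pos hs₂ (w' := -(-(Complex.I * v))) (by
        rw [dot_comm, n1]; exact hδ) M 0] with d h1 h2 h3
    rw [h1, Set.mem_union, Set.mem_union, h2, h3]
  · have nd : det (-(Complex.I * v)) (Complex.I * b) ≠ 0 := by rwa [hd]
    obtain ⟨m, hm⟩ := exists_wedge_deep hκ hgauge nd hpos e1 e3 e4 e2
      (U := Set.Ioi c) (V := Set.Ioi 0) Set.Ioi_subset_Ici_self Set.Ioi_subset_Ici_self
    obtain ⟨E, l, h1, h2⟩ := exists_closedPaths_wedge nd (U := Set.Ioi c) (V := Set.Ioi 0)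
      Set.Ioi_subset_Ici_self Set.Ioi_subset_Ici_self (convex_Ioi _) (convex_Ioi _)
      (wedge_nonempty hpos e1 e3 e4 e2 subset_rfl subset_rfl m) hm (T := id) (Or.inl rfl)
    refine ⟨id, E, l, _, Or.inl rfl, h1, h2, inside_boundary_of_near hm (Or.inl rfl), ?_⟩
    have hb := boundary_wedge nd (U := Set.Ioi c) (V := Set.Ioi 0)
      subset_rfl Set.Ioi_subset_Ici_self subset_rfl Set.Ioi_subset_Ici_self m 0
    filter_upwards [hb, ray_congr_of_pos hs₁ (w' := Complex.I * b) (by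
        rw [dot_comm, e2]; exact hpos) 0 0, ray_congr_of_pos hs₂ (w' := -(Complex.I * v)) (by
        rw [dot_comm, e1]; exact hpos) M 0] with d h1 h2 h3
    show d ∈ boundaryDarts (meeting _) ↔ _
    rw [h1, Set.mem_union, Set.mem_union, h2, h3]

end Cone

/-! ### String automorphisms of cones -/

theorem loopOp_mem_localObs (a : Anyon) {G : Set Face} {l : List Dart}
    (hl : ∀ d, d ∈ l ↔ d ∈ boundaryDarts G) {Y : Set Edge} (h : Inside Y (boundaryDarts G)) :
    loopOp a G l ∈ localObs Y := by
  refine mul_mem (list_prod_mem fun x hx => ?_) (list_prod_mem fun x hx => ?_)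
  · obtain ⟨d, hd, rfl⟩ := List.mem_map.1 hx
    exact mem_localUnitary.1 (edgeU_mem_localUnitary a (h.1 d ((hl d).1 hd)))
  · obtain ⟨d, hd, rfl⟩ := List.mem_map.1 hx
    have hd' := (hl d).1 hd
    exact mem_localUnitary.1 (vertexU_mem_localUnitary a h (p := (d, nextDart G d))
      ⟨hd', nextDart_mem hd', follows_nextDart G d⟩)

theorem IsConePath.mem_boundaryDarts {Λ : Cone} {P : ℕ → Dart} (h : IsConePath Λ P) (i : ℕ) :
    P i ∈ boundaryDarts (overlapping Λ.rightHalf.region) := by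
  obtain ⟨r, -, ⟨Q, -, -, -, -, -, hPQ⟩, -⟩ := h
  have : P i ∈ Set.range P ∪ Set.range Q := Or.inl ⟨i, rfl⟩
  rw [hPQ] at this
  exact this.1

theorem IsConePath.inside {Λ : Cone} {P : ℕ → Dart} (h : IsConePath Λ P) :
    Inside (sites Λ.region) (Set.range P) := by
  have hF := h.mem_boundaryDarts
  obtain ⟨r, -, ⟨Q, hP, -, hPi, -⟩, hs⟩ := h
  exact inside_of_support hP hF hPi fun O hO => hs .semion O hO

theorem IsConePath.isStringAut {Λ : Cone} {P : ℕ → Dart} (h : IsConePath Λ P) (a : Anyon) :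
    IsStringAut a P (stringAut a (Set.range P)) := by
  have hF := h.mem_boundaryDarts
  obtain ⟨r, -, ⟨Q, hP, -, hPi, -⟩, -⟩ := h
  exact fun O => (convergesTo_path a hP hF hPi O).congr fun n => (conjTruncation_eq a P n O).symm

/-- Completing the path of a cone by a ray in the direction `b` to large closed paths. -/
theorem IsConePath.exists_closedPaths {Λ Λ' : Cone} (hΛ : Λ'.region ⊆ Λ.region) {P : ℕ → Dart}
    (h : IsConePath Λ' P) (a : Anyon) {b : ℂ} {κ M : ℝ} (hκ : 0 < κ)
    (hgauge : ∀ s t : ℝ, 0 ≤ s → 0 ≤ t → κ * (s + t) ≤ Λ.gauge (s • b + t • Λ'.axis))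
    (hdet : det b Λ'.axis ≠ 0)
    (hM : Inside (sites Λ.region) (ray (half (Complex.I * b) (Set.Ioi 0)) b M)) :
    ∃ (l : ℕ → List Dart) (C : ℕ → unitary Obs) (c : ℕ → ℂ) (g : Aut) (v : unitary Obs),
      (∀ n, (C n : Obs) = closedString a (l n)) ∧
      (∀ n, IsClosedPath (l n) ∧ closedString a (l n) ∈ localObs (sites Λ.region)) ∧
      (∀ n, ‖c n‖ = 1) ∧ (∀ n, ∃ N, IsStabilizer N (C n) (c n)) ∧
      ConvergesTo atTop (fun n => Ad (C n)) g ∧ v ∈ localUnitary (sites Λ.region) ∧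
      g = Ad v * (stringAut a (Set.range P) *
        stringAut a (ray (half (Complex.I * b) (Set.Ioi 0)) b M)) := by
  obtain ⟨T, E, l, D, hT, hl, hD, hDin, hDeq⟩ := Cone.exists_closedPaths hκ hgauge hdet
    Λ'.leftOffset M
  have hP := h.mem_range_iff 0
  have hPin : Inside (sites Λ.region) (Set.range P) :=
    ⟨fun d hd => hΛ (h.inside.1 d hd), fun p hp hp' => hΛ (h.inside.2 p hp hp')⟩
  have hsplit : ∀ᶠ d in cofinite, (d ∈ D ↔
      d ∈ Set.range P ∪ ray (half (Complex.I * b) (Set.Ioi 0)) b M) := by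
    filter_upwards [hP, hDeq] with d h1 h2
    rw [h2, Set.mem_union, Set.mem_union, h1]
    rfl
  have hnd : det Λ'.leftNormal (Complex.I * b) ≠ 0 := by
    have : det Λ'.leftNormal (Complex.I * b) = det b Λ'.axis := by
      simp [det, Cone.leftNormal]; ring
    rwa [this]
  have htouch : {p : Dart × Dart | p.1 ∈ Set.range P ∧
      p.2 ∈ ray (half (Complex.I * b) (Set.Ioi 0)) b M ∧ Touch p.1 p.2}.Finite := by
    refine finite_touch hnd (B := |Λ'.leftOffset| + ‖Λ'.leftNormal‖) (B' := |0| + ‖Complex.I * b‖)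
      (hP.mono fun d h1 h2 => ?_) (Eventually.of_forall fun d hd => ?_)
    · exact strip_of_boundary subset_rfl Set.Ioi_subset_Ici_self (h1.1 h2).1
    · exact strip_of_boundary (a := 0) subset_rfl Set.Ioi_subset_Ici_self hd.1
  obtain ⟨v, hv, hveq⟩ := stringAut_eq_mul a hDin hPin hM
    (mem_cofinite.1 hsplit |>.subset fun d hd h' => hd.2 (h'.1 hd.1))
    (mem_cofinite.1 hsplit |>.subset fun d hd h' => hd.2 (h'.2 hd.1)) htouch
  refine ⟨l, fun n => loopU a (T (E n)) (l n), fun n => loopVal a (E n), stringAut a D, v,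
    fun n => ((hl n).2.2.2.1 a).symm, fun n => ⟨(hl n).1, ?_⟩, fun n => norm_loopVal a _,
    fun n => ?_, ?_, hv, hveq⟩
  · rw [(hl n).2.2.2.1 a]
    exact loopOp_mem_localObs a (hl n).2.2.1 (hl n).2.2.2.2
  · obtain ⟨N, hN⟩ := exists_subset_patch (E n)
    refine ⟨N, loopOp_mem_unitary a _ _, fun k hk => ?_⟩
    refine loopOp_approxVector a (hl n).2.1 (hl n).2.2.1 ?_ (hN k hk)
    rcases hT with rfl | rfl
    · exact Or.inl rfl
    · exact Or.inr rfl
  · exact convergesTo_loops a (fun n => (hl n).2.1) (fun n => (hl n).2.2.1) hD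

end DoubleSemion

end

/-! ### Transport of anyon strings between two cones. -/

theorem mainTheorem9
    (Λ Λ₁ Λ₂ : DoubleSemion.Cone)
    (hΛ₁ : Λ₁.region ⊆ Λ.region) (hΛ₂ : Λ₂.region ⊆ Λ.region)
    (a : DoubleSemion.Anyon) (P₁ P₂ : ℕ → DoubleSemion.Dart)
    (hP₁ : DoubleSemion.IsConePath Λ₁ P₁) (hP₂ : DoubleSemion.IsConePath Λ₂ P₂) :
    ∃ (ω : DoubleSemion.Obs →L[ℂ] ℂ)
      (w₁ w₂ : DoubleSemion.Obs ≃⋆ₐ[ℂ] DoubleSemion.Obs),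
      DoubleSemion.IsDoubleSemionState ω ∧
      DoubleSemion.IsStringAut a P₁ w₁ ∧ DoubleSemion.IsStringAut a P₂ w₂ ∧
      ∀ (H : Type*) [NormedAddCommGroup H] [InnerProductSpace ℂ H] [CompleteSpace H]
        (π : DoubleSemion.Obs →⋆ₐ[ℂ] (H →L[ℂ] H)) (Ω : H),
        DoubleSemion.IsGNSTriple ω π Ω →
        (∃ U : H →L[ℂ] H, DoubleSemion.Implements U π w₁ w₂) ∧
        ∀ U : H →L[ℂ] H, DoubleSemion.Implements U π w₁ w₂ →
          U ∈ DoubleSemion.vonNeumann π (DoubleSemion.sites Λ.region) ∧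
          DoubleSemion.IsWeakLimitOfClosedStrings π a (DoubleSemion.sites Λ.region) U := by
  obtain ⟨ω, hω⟩ := DoubleSemion.exists_isDoubleSemionState
  refine ⟨ω, DoubleSemion.stringAut a (Set.range P₁), DoubleSemion.stringAut a (Set.range P₂), hω,
    hP₁.isStringAut a, hP₂.isStringAut a, ?_⟩
  intro H _ _ _ π Ω hGNS
  -- One direction `b` and one starting point `M` of the auxiliary ray serve both cones, so that the
  -- same ray automorphism occurs in both limits.
  obtain ⟨b, κ, hκ, hd₁, hd₂, hg₁, hg₂⟩ := DoubleSemion.Cone.exists_common_direction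
    Λ₁.norm_axis Λ₂.norm_axis (DoubleSemion.Cone.gauge_axis_pos_of_subset hΛ₁)
    (DoubleSemion.Cone.gauge_axis_pos_of_subset hΛ₂)
  have hb : 0 < Λ.gauge b := by
    have := hg₁ 1 0 zero_le_one le_rfl
    rw [one_smul, zero_smul, add_zero, add_zero, mul_one] at this
    linarith
  obtain ⟨M, hM⟩ := DoubleSemion.Cone.exists_ray_inside hb
  obtain ⟨Q, C, c, g₁, v₁, hC, hQ, hc, hs, hconv, hv₁, rfl⟩ :=
    hP₁.exists_closedPaths hΛ₁ a hκ hg₁ hd₁ hM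
  obtain ⟨Q', C', c', g₂, v₂, hC', hQ', hc', hs', hconv', hv₂, rfl⟩ :=
    hP₂.exists_closedPaths hΛ₂ a hκ hg₂ hd₂ hM
  refine DoubleSemion.implements_of_closedStrings hω hGNS hv₁ hv₂ ?_ hC hC' hQ hQ' hc hc' hs hs'
    hconv hconv'
  -- In `g₂ * g₁⁻¹` the automorphism of the common ray stands in the middle together with its
  -- inverse and cancels.
  rw [map_inv]
  group
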